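/- Let $\mathbb K=\mathbb R$ or $\mathbb C$ and let $n,k\ge 0$ be integers. Work in one of the following categories at the origin $O$ of $\mathbb K^{2n}$: germs of $C^\infty$ functions (over $\mathbb C$: holomorphic functions), germs of ($\mathbb K$-)analytic functions, or formal power series; "regular" means without poles and belonging to the chosen category. A *simple log-symplectic form* on $(\mathbb K^{2n},O)$ whose divisor has $k$ components is a differential 2-form with poles $$\omega=\sum_{i=1}^k\frac{dh_i}{h_i}\wedge\beta_i+\gamma ,$$ where $h_i$, $\beta_i$, $\gamma$ are regular functions, 1-forms and a regular 2-form, such that (i) $h_1(O)=\dots=h_k(O)=0$ and $(dh_1\wedge\dots\wedge dh_k)(O)\ne 0$; (ii) $d\omega=0$; (iii) $h\,\omega^n$, with $h=h_1\cdots h_k$ and $\omega^n$ the $n$-fold wedge power, is a regular $2n$-form that does not vanish at $O$. Its divisor is $\{h=0\}$. (In the smooth and analytic categories $\omega$ is a form on the complement of $\{h=0\}$ in a neighbourhood of $O$; in the formal category its coefficients lie in the fraction field of the ring of formal power series.) **Theorem.** Let $\omega$ be a smooth, analytic or formal simple log-symplectic form on $(\mathbb K^{2n},O)$ whose divisor has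 $k$ components. Then $k\le n$, and there is a coordinate system $(x_1,y_1,\dots,x_k,y_k,z_1,\dots,z_{2(n-k)})$ at $O$ of the same category, vanishing at $O$, in which $$\omega=\sum_{i=1}^k\frac{dx_i}{x_i}\wedge dy_i+\sum_{j=1}^{n-k}dz_j\wedge dz_{j+n-k};$$ in particular, the divisor of $\omega$ is $\{x_1\cdots x_k=0\}$. Moreover, $\omega$ is non-degenerate outside of its divisor, and the bivector field $\Pi$ dual to $\omega$, that is, the one with $\Pi(\iota_v\omega,\iota_w\omega)=\omega(v,w)$ for all vectors $v,w$, is regular across the divisor, is a Poisson structure, and has the form $$\Pi=\sum_{i=1}^k x_i\,\frac{\partial}{\partial x_i}\wedge\frac{\partial}{\partial y_i}+\sum_{j=1}^{n-k}\frac{\partial}{\partial z_j}\wedge\frac{\partial}{\partial z_{j+n-k}} .$$ -/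

import Mathlib

open scoped Topology

noncomputable section

namespace LogSymplectic

/-! ## Exterior algebra of a module

`p`-forms on a module `V` are alternating maps `V [⋀^Fin p]→ₗ[R] R`. -/

section Algebra

variable {R V : Type*} [CommRing R] [AddCommGroup V] [Module R V]

/-- The wedge product `α ∧ η` of a 1-form `α` and a `p`-form `η`:
`(α ∧ η)(v₀, …, v_p) = ∑ i, (-1)^i α(v_i) η(v₀, …, v̂_i, …, v_p)`. -/
def oneWedge {p : ℕ} (α : V →ₗ[R] R) (η : V [⋀^Fin p]→ₗ[R] R) : V [⋀^Fin (p + 1)]→ₗ[R] R :=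
  AlternatingMap.alternatizeUncurryFin (α.smulRight η)

/-- The wedge product `α ∧ β` of two 1-forms. -/
def wedge₁ (α β : V →ₗ[R] R) : V [⋀^Fin 2]→ₗ[R] R :=
  oneWedge α (AlternatingMap.ofSubsingleton R V R (0 : Fin 1) β)

theorem wedge₁_apply (α β : V →ₗ[R] R) (v : Fin 2 → V) :
    wedge₁ α β v = α (v 0) * β (v 1) - α (v 1) * β (v 0) := by
  simp [wedge₁, oneWedge, AlternatingMap.alternatizeUncurryFin_apply, Fin.sum_univ_two,
    Fin.removeNth, sub_eq_add_neg]

/-- The wedge product `α₁ ∧ … ∧ α_k` of finitely many 1-forms. -/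
def wedgeFamily : (k : ℕ) → (Fin k → (V →ₗ[R] R)) → V [⋀^Fin k]→ₗ[R] R
  | 0, _ => AlternatingMap.constOfIsEmpty R V (Fin 0) 1
  | k + 1, α => oneWedge (α 0) (wedgeFamily k (fun i => α i.succ))

/-- The wedge product of a `p`-form and a `q`-form. -/
def wedge {p q : ℕ} (η : V [⋀^Fin p]→ₗ[R] R) (θ : V [⋀^Fin q]→ₗ[R] R) :
    V [⋀^Fin (p + q)]→ₗ[R] R :=
  ((LinearMap.mul' R R).compAlternatingMap (η.domCoprod θ)).domDomCongr finSumFinEquiv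

/-- The `n`-th wedge power `η ∧ … ∧ η` of a 2-form `η`. -/
def wedgePow (η : V [⋀^Fin 2]→ₗ[R] R) : (n : ℕ) → V [⋀^Fin (2 * n)]→ₗ[R] R
  | 0 => AlternatingMap.constOfIsEmpty R V (Fin 0) 1
  | n + 1 => wedge (wedgePow η n) η

/-- The contraction `ι_v η = η(v, ·)` of a 2-form with a vector. -/
def contract (η : V [⋀^Fin 2]→ₗ[R] R) (v : V) : V →ₗ[R] R :=
  (AlternatingMap.ofSubsingleton R V R (0 : Fin 1)).symm (η.curryLeft v)

theorem contract_apply (η : V [⋀^Fin 2]→ₗ[R] R) (v w : V) :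
    contract η v w = η ![v, w] := by
  have h : (fun _ : Fin 1 => w) = ![w] := by
    funext i; fin_cases i; rfl
  change η (Matrix.vecCons v (fun _ : Fin 1 => w)) = _
  rw [h]

/-- The wedge product `v ∧ w` of two vectors, a bivector, that is,
an alternating bilinear map on covectors. -/
def bivector (v w : V) : (Module.Dual R V) [⋀^Fin 2]→ₗ[R] R :=
  wedge₁ (Module.Dual.eval R V v) (Module.Dual.eval R V w)

/-- The bivector `Π` is dual to the 2-form `η`: the form `η` is non-degenerate, and `Π` is the
bivector which corresponds to `η` under the isomorphism `v ↦ ι_v η` of `V` with its dual. -/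
def IsDualBivector (P : (Module.Dual R V) [⋀^Fin 2]→ₗ[R] R) (η : V [⋀^Fin 2]→ₗ[R] R) : Prop :=
  Function.Bijective (contract η) ∧
    ∀ v w : V, P ![contract η v, contract η w] = η ![v, w]

end Algebra

/-- The names of the canonical coordinates `(x_i, y_i)_{i ≤ k}` and `(z_j, z_{j+n-k})_{j ≤ n-k}`. -/
abbrev Coord (n k : ℕ) : Type := (Fin k ⊕ Fin k) ⊕ (Fin (n - k) ⊕ Fin (n - k))

/-- The coordinate `x_i`. -/
abbrev cx {n k : ℕ} (i : Fin k) : Coord n k := Sum.inl (Sum.inl i)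
/-- The coordinate `y_i`. -/
abbrev cy {n k : ℕ} (i : Fin k) : Coord n k := Sum.inl (Sum.inr i)
/-- The coordinate `z_j`, for `1 ≤ j ≤ n - k`. -/
abbrev cz {n k : ℕ} (j : Fin (n - k)) : Coord n k := Sum.inr (Sum.inl j)
/-- The coordinate `z_{j+n-k}`, for `1 ≤ j ≤ n - k`. -/
abbrev cz' {n k : ℕ} (j : Fin (n - k)) : Coord n k := Sum.inr (Sum.inr j)

/-- `∑ i, dx_i / x_i ∧ dy_i + ∑ j, dz_j ∧ dz_{j+n-k}`, for given values `u` and differentials `du`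
of the coordinates. -/
def canonicalForm {F V : Type*} [Field F] [AddCommGroup V] [Module F V] {n k : ℕ}
    (u : Coord n k → F) (du : Coord n k → (V →ₗ[F] F)) : V [⋀^Fin 2]→ₗ[F] F :=
  ∑ i : Fin k, (u (cx i))⁻¹ • wedge₁ (du (cx i)) (du (cy i))
    + ∑ j : Fin (n - k), wedge₁ (du (cz j)) (du (cz' j))

/-- `∑ i, x_i ∂_{x_i} ∧ ∂_{y_i} + ∑ j, ∂_{z_j} ∧ ∂_{z_{j+n-k}}`, for given values `u` of the
coordinates and given coordinate vectors `X c = ∂_c`. -/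
def canonicalBivector {F V : Type*} [Field F] [AddCommGroup V] [Module F V] {n k : ℕ}
    (u : Coord n k → F) (X : Coord n k → V) : (Module.Dual F V) [⋀^Fin 2]→ₗ[F] F :=
  ∑ i : Fin k, u (cx i) • bivector (X (cx i)) (X (cy i))
    + ∑ j : Fin (n - k), bivector (X (cz j)) (X (cz' j))

/-! ## The smooth and the analytic category

Functions, forms and bivector fields of class `C^r` near the origin of `𝕜^m`. -/

section Geometric

variable {𝕜 : Type*} [RCLike 𝕜]

/-- `𝕜^m`. -/
abbrev Space (𝕜 : Type*) (m : ℕ) : Type _ := Fin m → 𝕜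

/-- The common zero locus of the `h_i`: the support of the divisor `∑ i, {h_i = 0}`. -/
def divisor {m k : ℕ} (h : Fin k → Space 𝕜 m → 𝕜) : Set (Space 𝕜 m) :=
  {p | ∃ i, h i p = 0}

/-- `ω` is a simple log-symplectic form of class `C^r` on the neighbourhood `U` of the origin
of `𝕜^{2n}`, with divisor `{h₁ = 0} ∪ … ∪ {h_k = 0}`. It is a form on the complement of
the divisor; the values of `ω` outside of `U` and on the divisor carry no meaning. -/
structure IsSimpleLogSymplectic (r : WithTop ℕ∞) (n k : ℕ) (U : Set (Space 𝕜 (2 * n)))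
    (h : Fin k → Space 𝕜 (2 * n) → 𝕜)
    (ω : Space 𝕜 (2 * n) → (Space 𝕜 (2 * n)) [⋀^Fin 2]→L[𝕜] 𝕜) : Prop where
  isOpen : IsOpen U
  zero_mem : (0 : Space 𝕜 (2 * n)) ∈ U
  contDiffOn : ∀ i, ContDiffOn 𝕜 r (h i) U
  /-- `ω = ∑ i, dh_i / h_i ∧ β_i + γ` with regular `β_i` and `γ`. -/
  exists_eq : ∃ (β : Fin k → Space 𝕜 (2 * n) → (Space 𝕜 (2 * n) →L[𝕜] 𝕜))
      (γ : Space 𝕜 (2 * n) → (Space 𝕜 (2 * n)) [⋀^Fin 2]→L[𝕜] 𝕜),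
      (∀ i, ContDiffOn 𝕜 r (β i) U) ∧ ContDiffOn 𝕜 r γ U ∧
      ∀ p ∈ U \ divisor h, (ω p).toAlternatingMap =
        ∑ i, (h i p)⁻¹ • wedge₁ (fderiv 𝕜 (h i) p : Space 𝕜 (2 * n) →ₗ[𝕜] 𝕜) (β i p)
          + (γ p).toAlternatingMap
  /-- The `h_i` vanish at the origin. -/
  map_zero : ∀ i, h i 0 = 0
  /-- `dh₁ ∧ … ∧ dh_k` does not vanish at the origin. -/
  wedge_ne_zero :
    wedgeFamily k (fun i => (fderiv 𝕜 (h i) 0 : Space 𝕜 (2 * n) →ₗ[𝕜] 𝕜)) ≠ 0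
  /-- `dω = 0`. -/
  closed : ∀ p ∈ U \ divisor h, extDeriv ω p = 0
  /-- `h₁ ⋯ h_k ω^n = f dx₁ ∧ … ∧ dx_{2n}` with `f` regular and `f(0) ≠ 0`. -/
  volume : ∃ f : Space 𝕜 (2 * n) → 𝕜, ContDiffOn 𝕜 r f U ∧ f 0 ≠ 0 ∧
    ∀ p ∈ U \ divisor h, (∏ i, h i p) • wedgePow (ω p).toAlternatingMap n =
      f p • (Pi.basisFun 𝕜 (Fin (2 * n))).det

/-- `Φ` is a local coordinate system of class `C^r` at the origin of `𝕜^{2n}`, on the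
neighbourhood `Φ.source`. -/
structure IsCoordinateSystem (r : WithTop ℕ∞) {n k : ℕ}
    (Φ : OpenPartialHomeomorph (Space 𝕜 (2 * n)) (Coord n k → 𝕜)) : Prop where
  zero_mem : (0 : Space 𝕜 (2 * n)) ∈ Φ.source
  map_zero : Φ 0 = 0
  contDiffOn : ContDiffOn 𝕜 r Φ Φ.source
  contDiffOn_symm : ContDiffOn 𝕜 r Φ.symm Φ.target

/-- The differential `du_c` of the coordinate `u_c` of `Φ` at `p`. -/
def coordDiff {n k : ℕ} (Φ : OpenPartialHomeomorph (Space 𝕜 (2 * n)) (Coord n k → 𝕜))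
    (c : Coord n k) (p : Space 𝕜 (2 * n)) : Space 𝕜 (2 * n) →L[𝕜] 𝕜 :=
  fderiv 𝕜 (fun q => Φ q c) p

/-- The coordinate vector field `∂/∂u_c` of `Φ` at `p`. -/
def coordVec {n k : ℕ} (Φ : OpenPartialHomeomorph (Space 𝕜 (2 * n)) (Coord n k → 𝕜))
    (c : Coord n k) (p : Space 𝕜 (2 * n)) : Space 𝕜 (2 * n) :=
  fderiv 𝕜 Φ.symm (Φ p) (Pi.single c 1)

/-- The bivector at a point, as an alternating map on all covectors (in finite dimension
all covectors are continuous). -/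
def toDualBivector {m : ℕ} (P : (Space 𝕜 m →L[𝕜] 𝕜) [⋀^Fin 2]→L[𝕜] 𝕜) :
    (Module.Dual 𝕜 (Space 𝕜 m)) [⋀^Fin 2]→ₗ[𝕜] 𝕜 :=
  P.toAlternatingMap.compLinearMap LinearMap.toContinuousLinearMap.toLinearMap

/-- `P` is a Poisson structure of class `C^r` on `V`, that is, a `C^r` bivector field whose
bracket `{f, g} = P(df, dg)` satisfies the Jacobi identity. The Jacobiator is a tensor,
so that it is enough to test it on linear functions. -/
def IsPoisson (r : WithTop ℕ∞) {m : ℕ} (V : Set (Space 𝕜 m))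
    (P : Space 𝕜 m → (Space 𝕜 m →L[𝕜] 𝕜) [⋀^Fin 2]→L[𝕜] 𝕜) : Prop :=
  ContDiffOn 𝕜 r P V ∧ ∀ p ∈ V, ∀ f g l : Space 𝕜 m →L[𝕜] 𝕜,
    P p ![f, fderiv 𝕜 (fun q => P q ![g, l]) p] + P p ![g, fderiv 𝕜 (fun q => P q ![l, f]) p]
      + P p ![l, fderiv 𝕜 (fun q => P q ![f, g]) p] = 0

end Geometric

/-! ## The formal category

Regular functions are formal power series; functions with poles are elements of the
fraction field of the ring of power series. -/

section Formal

/-- Formal functions at the origin of `𝕜^m`. -/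
abbrev FFun (𝕜 : Type*) [RCLike 𝕜] (m : ℕ) : Type _ := MvPowerSeries (Fin m) 𝕜

/-- Formal meromorphic functions at the origin of `𝕜^m`. -/
abbrev FMer (𝕜 : Type*) [RCLike 𝕜] (m : ℕ) : Type _ := FractionRing (FFun 𝕜 m)

variable {𝕜 : Type*} [RCLike 𝕜] {m : ℕ}

/-- A formal function as a formal meromorphic function. -/
abbrev toMer (f : FFun 𝕜 m) : FMer 𝕜 m := algebraMap (FFun 𝕜 m) (FMer 𝕜 m) f

/-- The partial derivative `∂_a (p / q) = (q ∂_a p - p ∂_a q) / q²` of a formal meromorphic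
function. -/
def merDeriv (a : Fin m) (f : FMer 𝕜 m) : FMer 𝕜 m :=
  let p : FFun 𝕜 m := (IsLocalization.sec (nonZeroDivisors (FFun 𝕜 m)) f).1
  let q : FFun 𝕜 m := (IsLocalization.sec (nonZeroDivisors (FFun 𝕜 m)) f).2
  (toMer q * toMer (MvPowerSeries.pderiv 𝕜 a p) - toMer p * toMer (MvPowerSeries.pderiv 𝕜 a q))
    / toMer q ^ 2

theorem merDeriv_div (a : Fin m) (p q : FFun 𝕜 m) (hq : q ≠ 0) :
    merDeriv a (toMer p / toMer q) =
      (toMer q * toMer (MvPowerSeries.pderiv 𝕜 a p)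
        - toMer p * toMer (MvPowerSeries.pderiv 𝕜 a q)) / toMer q ^ 2 := by
  have inj : Function.Injective (algebraMap (FFun 𝕜 m) (FMer 𝕜 m)) :=
    IsFractionRing.injective (FFun 𝕜 m) (FMer 𝕜 m)
  have hspec := IsLocalization.sec_spec (nonZeroDivisors (FFun 𝕜 m)) (toMer p / toMer q)
  unfold merDeriv
  generalize (IsLocalization.sec (nonZeroDivisors (FFun 𝕜 m)) (toMer p / toMer q)) = s at hspec
  obtain ⟨p', q', hq'⟩ := s
  have hq0 : q' ≠ 0 := nonZeroDivisors.ne_zero hq'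
  have e1 : toMer q ≠ 0 := fun e => hq (inj (by rw [map_zero]; exact e))
  have e2 : toMer q' ≠ 0 := fun e => hq0 (inj (by rw [map_zero]; exact e))
  have h1 : toMer p * toMer q' = toMer p' * toMer q := by
    have h2 : toMer p / toMer q * toMer q' = toMer p' := hspec
    rw [← h2]
    field_simp
  have h3 : p * q' = p' * q := inj (by simpa only [map_mul] using h1)
  have h4 := congrArg (MvPowerSeries.pderiv 𝕜 a) h3
  rw [Derivation.leibniz, Derivation.leibniz] at h4
  have h5 := congrArg (algebraMap (FFun 𝕜 m) (FMer 𝕜 m)) h4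
  simp only [map_add, smul_eq_mul, map_mul] at h5
  dsimp only
  rw [div_eq_div_iff (pow_ne_zero 2 e2) (pow_ne_zero 2 e1)]
  change toMer p * toMer (MvPowerSeries.pderiv 𝕜 a q') + toMer q' * toMer (MvPowerSeries.pderiv 𝕜 a p)
    = toMer p' * toMer (MvPowerSeries.pderiv 𝕜 a q) + toMer q * toMer (MvPowerSeries.pderiv 𝕜 a p') at h5
  linear_combination (-toMer q * toMer q') * h5
    + (toMer q * toMer (MvPowerSeries.pderiv 𝕜 a q') + toMer q' * toMer (MvPowerSeries.pderiv 𝕜 a q)) * h1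

theorem merDeriv_toMer (a : Fin m) (p : FFun 𝕜 m) :
    merDeriv a (toMer p) = toMer (MvPowerSeries.pderiv 𝕜 a p) := by
  have h := merDeriv_div a p 1 one_ne_zero
  simpa using h

/-- Formal meromorphic vectors fields `∑ a, v_a ∂_a`. -/
abbrev FVec (𝕜 : Type*) [RCLike 𝕜] (m : ℕ) : Type _ := Fin m → FMer 𝕜 m

/-- The constant vector field `∂_a`. -/
abbrev basisVec (a : Fin m) : FVec 𝕜 m := Pi.single a 1

/-- The 1-form `dx_a`. -/
abbrev basisForm (a : Fin m) : Module.Dual (FMer 𝕜 m) (FVec 𝕜 m) :=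
  LinearMap.proj (R := FMer 𝕜 m) (φ := fun _ : Fin m => FMer 𝕜 m) a

/-- The differential `df = ∑ a, ∂_a f dx_a`. -/
def merDiff (f : FMer 𝕜 m) : FVec 𝕜 m →ₗ[FMer 𝕜 m] FMer 𝕜 m :=
  ∑ a, merDeriv a f • basisForm a

/-- The differential of a formal function at the origin. -/
def diffAtZero (f : FFun 𝕜 m) : (Fin m → 𝕜) →ₗ[𝕜] 𝕜 :=
  ∑ a, MvPowerSeries.constantCoeff (MvPowerSeries.pderiv 𝕜 a f) •
    LinearMap.proj (R := 𝕜) (φ := fun _ : Fin m => 𝕜) a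

/-- A formal meromorphic function without poles. -/
def IsReg (f : FMer 𝕜 m) : Prop := f ∈ Set.range (algebraMap (FFun 𝕜 m) (FMer 𝕜 m))

/-- `dω = 0` for a formal meromorphic 2-form: the left-hand side is `dω(∂_a, ∂_b, ∂_c)`. -/
def IsFormallyClosed (ω : (FVec 𝕜 m) [⋀^Fin 2]→ₗ[FMer 𝕜 m] FMer 𝕜 m) : Prop :=
  ∀ a b c : Fin m, merDeriv a (ω ![basisVec b, basisVec c])
    - merDeriv b (ω ![basisVec a, basisVec c]) + merDeriv c (ω ![basisVec a, basisVec b]) = 0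

/-- `ω` is a formal simple log-symplectic form at the origin of `𝕜^{2n}`, with
divisor `{h₁ = 0} ∪ … ∪ {h_k = 0}`. -/
structure IsFormalSimpleLogSymplectic (n k : ℕ) (h : Fin k → FFun 𝕜 (2 * n))
    (ω : (FVec 𝕜 (2 * n)) [⋀^Fin 2]→ₗ[FMer 𝕜 (2 * n)] FMer 𝕜 (2 * n)) : Prop where
  /-- `ω = ∑ i, dh_i / h_i ∧ β_i + γ` with regular `β_i` and `γ`. -/
  exists_eq : ∃ (β : Fin k → (FVec 𝕜 (2 * n) →ₗ[FMer 𝕜 (2 * n)] FMer 𝕜 (2 * n)))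
      (γ : (FVec 𝕜 (2 * n)) [⋀^Fin 2]→ₗ[FMer 𝕜 (2 * n)] FMer 𝕜 (2 * n)),
      (∀ i a, IsReg (β i (basisVec a))) ∧ (∀ a b, IsReg (γ ![basisVec a, basisVec b])) ∧
      ω = ∑ i, (toMer (h i))⁻¹ • wedge₁ (merDiff (toMer (h i))) (β i) + γ
  /-- The `h_i` vanish at the origin. -/
  map_zero : ∀ i, MvPowerSeries.constantCoeff (h i) = 0
  /-- `dh₁ ∧ … ∧ dh_k` does not vanish at the origin. -/
  wedge_ne_zero : wedgeFamily k (fun i => diffAtZero (h i)) ≠ 0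
  /-- `dω = 0`. -/
  closed : IsFormallyClosed ω
  /-- `h₁ ⋯ h_k ω^n = f dx₁ ∧ … ∧ dx_{2n}` with `f` regular and `f(0) ≠ 0`. -/
  volume : ∃ f : FFun 𝕜 (2 * n), MvPowerSeries.constantCoeff f ≠ 0 ∧
    (∏ i, toMer (h i)) • wedgePow ω n =
      toMer f • (Pi.basisFun (FMer 𝕜 (2 * n)) (Fin (2 * n))).det

/-- `u` is a formal coordinate system at the origin of `𝕜^{2n}`: a family of formal functions
which vanish at the origin and whose differentials at the origin form a basis of the
cotangent space. -/
structure IsFormalCoordinateSystem {n k : ℕ} (u : Coord n k → FFun 𝕜 (2 * n)) : Prop where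
  map_zero : ∀ c, MvPowerSeries.constantCoeff (u c) = 0
  linearIndependent : LinearIndependent 𝕜 (fun c => diffAtZero (u c))
  span_eq_top : Submodule.span 𝕜 (Set.range (fun c => diffAtZero (u c))) = ⊤

/-- `X c` is the coordinate vector field `∂/∂u_c` of the formal coordinate system `u`. -/
def IsFormalCoordVec {n k : ℕ} (u : Coord n k → FFun 𝕜 (2 * n))
    (X : Coord n k → FVec 𝕜 (2 * n)) : Prop :=
  ∀ c d, merDiff (toMer (u c)) (X d) = if c = d then 1 else 0

/-- `P` is a formal Poisson structure: a bivector field without poles whose bracket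
`{f, g} = P(df, dg)` satisfies the Jacobi identity (tested on the ambient coordinates). -/
def IsFormalPoisson
    (P : (Module.Dual (FMer 𝕜 m) (FVec 𝕜 m)) [⋀^Fin 2]→ₗ[FMer 𝕜 m] FMer 𝕜 m) : Prop :=
  (∀ a b, IsReg (P ![basisForm a, basisForm b])) ∧
  ∀ a b c : Fin m,
    P ![basisForm a, merDiff (P ![basisForm b, basisForm c])]
      + P ![basisForm b, merDiff (P ![basisForm c, basisForm a])]
      + P ![basisForm c, merDiff (P ![basisForm a, basisForm b])] = 0

end Formal

end LogSymplectic

end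
open LogSymplectic

/-! A closed form with logarithmic poles is governed by its residues. The part of `dω = 0` that has
a pole along `h_i = 0` says that `β_i` is closed on this hypersurface. It is therefore exact there,
so that `β_i = dy_i + s_i dh_i + h_i η_i`, and `ω = ∑ dh_i/h_i ∧ dy_i + τ₀` with `τ₀` regular and
closed (`residue_closed`, `exists_primitive_on_hypersurface`, `exists_residue_primitives`).

In a frame of logarithmic vector fields, where `h_i ∂_{h_i}` takes the place of `∂_{h_i}`, the
coefficients of `ω` are regular. The condition on `h ωⁿ` then says that their matrix is
nondegenerate at the origin (`nondegenerate_at_zero`). By linear algebra the `dh_i` and `dy_i` are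
independent at the origin and `τ₀` is nondegenerate on their common kernel. This gives `k ≤ n`, and
it gives `τ₀ = ∑ b_i ∧ dy_i + ∑ z_j ∧ z'_j + ∑ dh_i ∧ a_i` at the origin for suitable covectors
(`exists_linear_normal_form`). The substitutions `x_i = h_i (1 + b_i)` and `y_i ↦ y_i + x_i a_i`
absorb the first and the last sum, and the linear functions `z_j`, `z'_j` the middle one. Hence `ω =
ω₀ + τ`, where `ω₀` is canonical and `τ` is regular, closed and zero at the origin
(`LocalCalculus.normal_form`). All of this uses only partial derivatives, radial integration and
retractions onto smooth hypersurfaces. It is carried out once, for a `LocalCalculus`, of which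
formal power series and germs are two instances.

It remains to remove `τ`. Its radial primitive `θ` vanishes to second order. For formal series, one
writes `θ = ∑ θ_c du_c` in the current coordinates and corrects these by the `θ_c`. The new error is
quadratic in `θ`, so its order grows, and the iteration converges in the power series ring
(`IsNormalUpTo.step`, `IsNormalUpTo.exists_limit`). For germs, Moser's method applies. The equation
`ι_X (ω₀ + (1 - t) τ) = θ` has a regular solution `X_t`, which is logarithmic, so that its flow
preserves every `x_i = 0`. Its time-one map `φ` satisfies `φ^* ω₀ = ω₀ + τ`, and the coordinates of
`ω₀` composed with `φ` are the required ones (`exists_moser`). The flow comes from the inverse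
function theorem in a Banach space of curves. This treats smooth and analytic dependence on the
initial value, over both fields, by the same argument (`exists_flow`).

Finally, inverting `ω₀` gives `∑ x_i ∂_{x_i} ∧ ∂_{y_i} + ∑ ∂_{z_j} ∧ ∂_{z'_j}`, which has no poles.
The fields `x_i ∂_{x_i}`, `∂_{y_i}`, `∂_{z_j}`, `∂_{z'_j}` commute, and a sum of wedge products of
commuting fields satisfies the Jacobi identity (`jacobi_of_commuting`). -/

namespace LogSymplectic

/-! ### Wedge powers of a 2-form as universal polynomials -/

section WedgePow

variable {R V : Type*} [CommRing R] [AddCommGroup V] [Module R V]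

theorem alternatingMap_sum_apply {ι κ : Type*} (s : Finset ι) (f : ι → V [⋀^κ]→ₗ[R] R)
    (v : κ → V) : (∑ i ∈ s, f i) v = ∑ i ∈ s, f i v :=
  map_sum (AddMonoidHom.mk' (fun g : V [⋀^κ]→ₗ[R] R => g v) fun _ _ => rfl) f s

theorem wedge_apply {p q : ℕ} (η : V [⋀^Fin p]→ₗ[R] R) (θ : V [⋀^Fin q]→ₗ[R] R)
    (w : Fin (p + q) → V) :
    wedge η θ w = ∑ σ : Equiv.Perm.ModSumCongr (Fin p) (Fin q),
      (Equiv.Perm.sign σ.out : ℤ) •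
        (η (fun i => w (finSumFinEquiv (σ.out (Sum.inl i)))) *
          θ (fun j => w (finSumFinEquiv (σ.out (Sum.inr j))))) := by
  simp only [wedge, AlternatingMap.domDomCongr_apply, LinearMap.compAlternatingMap_apply,
    AlternatingMap.domCoprod_apply, sum_apply, map_sum]
  refine Finset.sum_congr rfl fun σ _ => ?_
  conv_lhs => rw [← Quotient.out_eq' σ]
  rw [AlternatingMap.domCoprod.summand_mk'']
  rw [smul_apply, Units.smul_def, map_zsmul]
  rfl

/-- The value of the `n`-th wedge power of a 2-form as a polynomial in the values of the
2-form. -/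
noncomputable def wedgePowPoly {ι : Type*} : (n : ℕ) → (Fin (2 * n) → ι) → MvPolynomial (ι × ι) ℤ
  | 0, _ => 1
  | n + 1, f => ∑ σ : Equiv.Perm.ModSumCongr (Fin (2 * n)) (Fin 2),
      (Equiv.Perm.sign σ.out : ℤ) •
        (wedgePowPoly n (fun i => f (finSumFinEquiv (σ.out (Sum.inl i)))) *
          MvPolynomial.X (f (finSumFinEquiv (σ.out (Sum.inr 0))),
            f (finSumFinEquiv (σ.out (Sum.inr 1)))))

/-- An integral polynomial in the values of `η` can be moved between a ring and its fraction field
and can be evaluated at the origin. This is how the volume condition reaches the origin, where `ω`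
itself has no value. -/
theorem wedgePow_apply {ι : Type*} (η : V [⋀^Fin 2]→ₗ[R] R) (w : ι → V) (n : ℕ)
    (f : Fin (2 * n) → ι) :
    wedgePow η n (w ∘ f) =
      MvPolynomial.aeval (fun c : ι × ι => η ![w c.1, w c.2]) (wedgePowPoly n f) := by
  induction n with
  | zero => simp [wedgePow, wedgePowPoly]
  | succ n ih =>
    change wedge (wedgePow η n) η (w ∘ f) = _
    rw [wedge_apply, wedgePowPoly, map_sum]
    refine Finset.sum_congr rfl fun σ _ => ?_
    rw [map_zsmul, map_mul, MvPolynomial.aeval_X, ← ih]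
    congr 3
    funext j
    fin_cases j <;> rfl

/-- In every shuffle the kernel vector `w a` enters either the lower power, which vanishes by
induction, or the last factor `η`. -/
theorem wedgePow_eq_zero (η : V [⋀^Fin 2]→ₗ[R] R) (n : ℕ) (w : Fin (2 * n) → V)
    (a : Fin (2 * n)) (h : ∀ v, η ![w a, v] = 0) : wedgePow η n w = 0 := by
  induction n with
  | zero => exact a.elim0
  | succ n ih =>
    change wedge (wedgePow η n) η w = _
    rw [wedge_apply]
    refine Finset.sum_eq_zero fun σ _ => ?_
    obtain ⟨x, hx⟩ : ∃ x, finSumFinEquiv (σ.out x) = a :=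
      ⟨σ.out.symm (finSumFinEquiv.symm a), by simp⟩
    rcases x with i | j
    · rw [ih _ i (by simpa only [hx] using h), zero_mul, smul_zero]
    · have key : ∀ u : Fin 2 → V, u j = w a → η u = 0 := by
        intro u hu
        have h2 : u = ![u 0, u 1] := by funext j; fin_cases j <;> rfl
        fin_cases j
        · rw [h2]; simp only [Fin.zero_eta] at hu; rw [hu]; exact h _
        · have h3 := η.map_swap ![u 1, u 0] (i := 0) (j := 1) (by decide)
          have h4 : (![u 1, u 0] ∘ Equiv.swap (0 : Fin 2) 1) = u := by
            funext j; fin_cases j <;> rfl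
          rw [h4] at h3
          simp only [Fin.mk_one] at hu
          rw [h3, hu, h, neg_zero]
      rw [key _ (by rw [← hx]), mul_zero, smul_zero]

end WedgePow

/-! ### Determinants, and nondegeneracy from the top wedge power -/

section Det

variable {R V : Type*} [CommRing R] [AddCommGroup V] [Module R V]

theorem wedgeFamily_apply (k : ℕ) (α : Fin k → (V →ₗ[R] R)) (v : Fin k → V) :
    wedgeFamily k α v = Matrix.det (Matrix.of fun i j => α i (v j)) := by
  induction k with
  | zero => simp [wedgeFamily]
  | succ k ih =>
    rw [wedgeFamily, oneWedge, AlternatingMap.alternatizeUncurryFin_apply,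
      Matrix.det_succ_row_zero]
    refine Finset.sum_congr rfl fun i _ => ?_
    simp only [LinearMap.smulRight_apply, AlternatingMap.smul_apply, ih, smul_eq_mul,
      Matrix.of_apply]
    rw [zsmul_eq_mul, mul_assoc]
    push_cast
    rfl

/-- A linear relation between the `α i` is a left null vector of the matrix `α i (v j)`, whose
determinant is the value of the wedge product on `v`. -/
theorem linearIndependent_of_wedgeFamily_ne_zero {F W : Type*} [Field F] [AddCommGroup W]
    [Module F W] {k : ℕ} {α : Fin k → (W →ₗ[F] F)} (h : wedgeFamily k α ≠ 0) :
    LinearIndependent F α := by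
  obtain ⟨v, hv⟩ : ∃ v, wedgeFamily k α v ≠ 0 := by
    by_contra! h'
    exact h (AlternatingMap.ext h')
  rw [wedgeFamily_apply] at hv
  rw [Fintype.linearIndependent_iff]
  intro g hg
  have h1 : Matrix.vecMul g (Matrix.of fun i j => α i (v j)) = 0 := by
    funext j
    have := LinearMap.congr_fun hg (v j)
    simpa [Matrix.vecMul, dotProduct] using this
  exact congrFun (Matrix.eq_zero_of_vecMul_eq_zero hv h1)

/-- An antisymmetric matrix with a kernel has vanishing Pfaffian. -/
theorem eq_zero_of_wedgePowPoly_ne_zero {F C : Type*} [Field F] [CharZero F] [Fintype C]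
    [DecidableEq C] {n : ℕ} (e : Fin (2 * n) ≃ C) (B : C → C → F) (hB : ∀ c d, B c d = -B d c)
    (h : MvPolynomial.aeval (fun c : C × C => B c.1 c.2) (wedgePowPoly n e) ≠ 0)
    (ζ : C → F) (hζ : ∀ d, ∑ c, ζ c * B c d = 0) : ζ = 0 := by
  -- The sum runs over ordered pairs, so every wedge product occurs twice; the factor `2⁻¹` makes
  -- `B` the matrix of `η`.
  let η : (C → F) [⋀^Fin 2]→ₗ[F] F :=
    ∑ c, ∑ d, (2⁻¹ * B c d) • wedge₁ (LinearMap.proj (R := F) (φ := fun _ : C => F) c)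
      (LinearMap.proj (R := F) (φ := fun _ : C => F) d)
  have hη : ∀ u v : C → F, η ![u, v] = ∑ d, (∑ c, u c * B c d) * v d := by
    intro u v
    simp only [η, alternatingMap_sum_apply, AlternatingMap.smul_apply, wedge₁_apply, smul_eq_mul,
      LinearMap.proj_apply, Matrix.cons_val_zero, Matrix.cons_val_one, mul_sub,
      Finset.sum_sub_distrib]
    rw [Finset.sum_comm (f := fun c d => 2⁻¹ * B c d * (v c * u d)),
      ← Finset.sum_sub_distrib]
    simp only [← Finset.sum_sub_distrib, Finset.sum_mul]
    rw [Finset.sum_comm]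
    refine Finset.sum_congr rfl fun c _ => Finset.sum_congr rfl fun d _ => ?_
    rw [hB c d]; ring
  have hpow : wedgePow η n ((fun c => Pi.single c (1 : F)) ∘ e) ≠ 0 := by
    rw [wedgePow_apply]
    have h1 : (fun c : C × C => η ![(Pi.single c.1 (1 : F) : C → F), Pi.single c.2 1]) =
        fun c => B c.1 c.2 := by
      funext c
      rw [hη]
      simp [Pi.single_apply]
    rw [h1]
    exact h
  funext c
  by_contra hc
  apply hpow
  set b : Fin (2 * n) → (C → F) := (fun c => Pi.single c (1 : F)) ∘ e with hb
  -- Replacing the basis vector `e_c` by `ζ` multiplies the top power by `ζ c ≠ 0`. The result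
  -- vanishes because `ζ` lies in the kernel of `η`.
  have h1 : wedgePow η n (Function.update b (e.symm c) ζ) = 0 := by
    refine wedgePow_eq_zero η n _ (e.symm c) fun v => ?_
    rw [Function.update_self, hη]
    simp [hζ]
  have h2 : ζ = ∑ i, ζ (e i) • b i := by
    funext d
    rw [Finset.sum_apply, ← Equiv.sum_comp e.symm]
    simp [hb, Pi.single_apply]
  rw [h2, AlternatingMap.map_update_sum, Finset.sum_eq_single (e.symm c)] at h1
  · rw [AlternatingMap.map_update_smul, Function.update_eq_self] at h1
    exact (mul_eq_zero.mp h1).resolve_left (by simpa using hc)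
  · intro i _ hi
    rw [AlternatingMap.map_update_smul, AlternatingMap.map_update_self _ _ hi.symm, smul_zero]
  · simp

end Det

end LogSymplectic

namespace LogSymplectic

/-! ### Linear algebra of a log-symplectic form at one point -/

section Symplectic

universe u

/-- Every nondegenerate alternating form has a symplectic basis. -/
theorem exists_symplectic_basis {F : Type*} [Field F] (d : ℕ) :
    ∀ (W : Type u) [AddCommGroup W] [Module F W] [FiniteDimensional F W]
      (γ : W →ₗ[F] W →ₗ[F] F), (∀ v, γ v v = 0) → (∀ v, (∀ w, γ v w = 0) → v = 0) →
      Module.finrank F W = d →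
      ∃ r, 2 * r = d ∧ ∃ p q : Fin r → W,
        ∀ v, v = ∑ j, (γ v (q j) • p j + γ (p j) v • q j) := by
  induction d using Nat.strong_induction_on with
  | _ d ih =>
    intro W _ _ _ γ hγ hnd hd
    have hneg : ∀ v w, γ v w = -γ w v := by
      intro v w
      have := hγ (v + w)
      simp only [map_add, LinearMap.add_apply, hγ] at this
      linear_combination this
    by_cases h0 : d = 0
    · refine ⟨0, by omega, Fin.elim0, Fin.elim0, fun v => ?_⟩
      rw [h0] at hd
      have := Module.finrank_zero_iff.mp hd
      exact Subsingleton.elim _ _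
    · have : Nontrivial W := Module.nontrivial_of_finrank_pos (R := F) (by omega)
      obtain ⟨v, hv⟩ := exists_ne (0 : W)
      obtain ⟨w', hw'⟩ : ∃ w, γ v w ≠ 0 := by
        by_contra! h
        exact hv (hnd v h)
      obtain ⟨w, hw⟩ : ∃ w, γ v w = 1 := ⟨(γ v w')⁻¹ • w', by simp [hw']⟩
      -- The kernel of `f` is the orthogonal complement of the hyperbolic plane spanned by `v` and
      -- `w`. The vector `x - γ x w • v - γ v x • w` is the projection of `x` to it, and the
      -- induction continues there.
      let f : W →ₗ[F] F × F := (γ v).prod (γ w)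
      have hsurj : LinearMap.range f = ⊤ := by
        rw [LinearMap.range_eq_top]
        rintro ⟨a, b⟩
        refine ⟨a • w - b • v, ?_⟩
        simp [f, hw, hγ, hneg w v]
      have hrank := LinearMap.finrank_range_add_finrank_ker f
      rw [hsurj, finrank_top, Module.finrank_prod, Module.finrank_self, hd] at hrank
      have hmem : ∀ x, x - γ x w • v - γ v x • w ∈ LinearMap.ker f := by
        intro x
        have hfx : ∀ y, f y = (γ v y, γ w y) := fun _ => rfl
        rw [LinearMap.mem_ker, hfx]
        simp only [map_sub, map_smul, hγ, hw, hneg w v, hneg w x, smul_eq_mul]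
        simp
      have hker : ∀ x ∈ LinearMap.ker f, γ v x = 0 ∧ γ w x = 0 := by
        intro x hx
        simpa [f] using hx
      obtain ⟨r, hr, p, q, hpq⟩ := ih (Module.finrank F (LinearMap.ker f)) (by omega)
        (LinearMap.ker f) (γ.domRestrict₁₂ (LinearMap.ker f) (LinearMap.ker f))
        (fun x => hγ x) (by
          intro x hx
          refine Subtype.ext (hnd x fun y => ?_)
          have h1 := hx ⟨_, hmem y⟩
          simp only [LinearMap.domRestrict₁₂_apply, map_sub, map_smul, smul_eq_mul] at h1
          rw [hneg x v, hneg x w, (hker x x.2).1, (hker x x.2).2] at h1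
          simpa using h1) rfl
      refine ⟨r + 1, by omega, Fin.cons v (fun j => p j), Fin.cons w (fun j => q j), fun x => ?_⟩
      have h1 := congrArg Subtype.val (hpq ⟨_, hmem x⟩)
      simp only [LinearMap.domRestrict₁₂_apply, map_sub, map_smul, smul_eq_mul, LinearMap.sub_apply,
        LinearMap.smul_apply] at h1
      rw [Fin.sum_univ_succ]
      simp only [Fin.cons_zero, Fin.cons_succ]
      have h2 : ∀ j, γ v (q j) = 0 ∧ γ w (q j) = 0 ∧ γ (p j) v = 0 ∧ γ (p j) w = 0 := fun j =>
        ⟨(hker _ (q j).2).1, (hker _ (q j).2).2, by rw [hneg, (hker _ (p j).2).1, neg_zero],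
          by rw [hneg, (hker _ (p j).2).2, neg_zero]⟩
      rw [Submodule.coe_sum] at h1
      simp only [Submodule.coe_add, Submodule.coe_smul, h2, mul_zero, sub_zero] at h1
      rw [← h1]
      abel

/-- A proper range would be killed by a nonzero functional on `ι → F`, whose coordinates form a
relation between the `f i`. -/
theorem pi_surjective_of_linearIndependent {F W ι : Type*} [Field F] [AddCommGroup W]
    [Module F W] [Fintype ι] [DecidableEq ι] (f : ι → Module.Dual F W)
    (hf : LinearIndependent F f) : Function.Surjective (LinearMap.pi f) := by
  rw [← LinearMap.range_eq_top]
  by_contra hne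
  obtain ⟨g, hg0, hg⟩ := Submodule.exists_le_ker_of_lt_top _ (lt_top_iff_ne_top.mpr hne)
  apply hg0
  have h1 : ∑ i, g (Pi.single i 1) • f i = 0 := by
    ext v
    have h2 : g (LinearMap.pi f v) = 0 := hg ⟨v, rfl⟩
    rw [← LinearMap.sum_single_apply (v := LinearMap.pi f v), map_sum] at h2
    rw [LinearMap.sum_apply, LinearMap.zero_apply, ← h2]
    refine Finset.sum_congr rfl fun i _ => ?_
    rw [LinearMap.smul_apply, smul_eq_mul, mul_comm, ← smul_eq_mul, ← map_smul]
    congr 1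
    funext j
    simp [Pi.single_apply]
  have h3 := Fintype.linearIndependent_iff.mp hf _ h1
  refine LinearMap.pi_ext' fun i => LinearMap.ext_ring ?_
  simpa using h3 i

/-- An alternating form that vanishes on the common kernel of independent functionals `f i` is
`∑ i, f i ∧ c i` for some functionals `c i`. -/
theorem exists_sum_wedge_of_vanish {F W ι : Type*} [Field F] [CharZero F] [AddCommGroup W]
    [Module F W] [FiniteDimensional F W] [Fintype ι] [DecidableEq ι] (f : ι → Module.Dual F W)
    (hf : LinearIndependent F f) (δ : W →ₗ[F] W →ₗ[F] F) (hδ : ∀ v w, δ v w = -δ w v)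
    (h0 : ∀ v w, (∀ i, f i v = 0) → (∀ i, f i w = 0) → δ v w = 0) :
    ∃ c : ι → Module.Dual F W, ∀ v w, δ v w = ∑ i, (f i v * c i w - f i w * c i v) := by
  obtain ⟨e, he⟩ : ∃ e : ι → W, ∀ i j, f i (e j) = if i = j then 1 else 0 := by
    have hsurj := pi_surjective_of_linearIndependent f hf
    choose e he using fun j : ι => hsurj (Pi.single j 1)
    refine ⟨e, fun i j => ?_⟩
    have := congrFun (he j) i
    simpa [Pi.single_apply] using this
  -- Contracting `δ` with the dual vectors `e i` counts the block `δ (e i) (e j)` twice, once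
  -- through each index; subtracting half of it corrects this. The identity then follows by
  -- projecting `v` and `w` to the common kernel along the `e i`.
  refine ⟨fun i => δ (e i) - (2⁻¹ : F) • ∑ j, δ (e i) (e j) • f j, fun v w => ?_⟩
  have hk : ∀ v, ∀ i, f i (v - ∑ j, f j v • e j) = 0 := by
    intro v i
    simp [he]
  have h1 := h0 _ _ (hk v) (hk w)
  simp only [map_sub, map_sum, map_smul, LinearMap.sub_apply, LinearMap.sum_apply,
    LinearMap.smul_apply, smul_eq_mul, mul_sub, Finset.sum_sub_distrib] at h1 ⊢
  have h2 : ∑ j, f j w * δ v (e j) = -∑ j, f j w * δ (e j) v := by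
    rw [← Finset.sum_neg_distrib]
    exact Finset.sum_congr rfl fun j _ => by rw [hδ v]; ring
  have h3 : ∑ i, f i v * ∑ j, δ (e i) (e j) * f j w = ∑ j, f j w * ∑ i, f i v * δ (e i) (e j) := by
    simp only [Finset.mul_sum]
    rw [Finset.sum_comm]
    exact Finset.sum_congr rfl fun j _ => Finset.sum_congr rfl fun i _ => by ring
  have h4 : ∑ i, f i w * ∑ j, δ (e i) (e j) * f j v =
      -∑ j, f j w * ∑ i, f i v * δ (e i) (e j) := by
    simp only [Finset.mul_sum]
    rw [← Finset.sum_neg_distrib]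
    refine Finset.sum_congr rfl fun j _ => ?_
    rw [← Finset.sum_neg_distrib]
    exact Finset.sum_congr rfl fun i _ => by rw [hδ (e i)]; ring
  rw [h2] at h1
  simp only [mul_left_comm _ (2⁻¹ : F), ← Finset.mul_sum]
  rw [h3, h4]
  linear_combination h1

/-- The linear normal form of a simple log-symplectic form at a point of its divisor. -/
theorem exists_linear_normal_form {F : Type*} [Field F] [CharZero F] {V : Type u} [AddCommGroup V]
    [Module F V] [FiniteDimensional F V] (n k : ℕ) (hdim : Module.finrank F V = 2 * n)
    (α β : Fin k → Module.Dual F V) (γ : V →ₗ[F] V →ₗ[F] F) (hγ : ∀ v, γ v v = 0)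
    (hα : LinearIndependent F α)
    (hnd : ∀ (s : Fin k → F) (v : V), (∀ i, α i v = 0) → (∀ i, β i v = 0) →
      (∀ w, (∀ i, α i w = 0) → ∑ i, s i * β i w + γ v w = 0) → s = 0 ∧ v = 0) :
    k ≤ n ∧ ∃ (a b : Fin k → Module.Dual F V) (z z' : Fin (n - k) → Module.Dual F V),
      (∀ v w, γ v w = ∑ i, (b i v * β i w - b i w * β i v) + ∑ j, (z j v * z' j w - z j w * z' j v)
        + ∑ i, (α i v * a i w - α i w * a i v)) ∧
      ∀ v, (∀ i, α i v = 0) → (∀ i, β i v = 0) → (∀ j, z j v = 0) → (∀ j, z' j v = 0) → v = 0 := by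
  have hneg : ∀ v w, γ v w = -γ w v := by
    intro v w
    have := hγ (v + w)
    simp only [map_add, LinearMap.add_apply, hγ] at this
    linear_combination this
  let f : Fin k ⊕ Fin k → Module.Dual F V := Sum.elim α β
  -- Restricted to the common kernel of the `α i`, a relation involves the `β i` only, and its
  -- coefficients violate `hnd` with `v = 0` unless they vanish.
  have hf : LinearIndependent F f := by
    rw [Fintype.linearIndependent_iff]
    intro g hg
    rw [Fintype.sum_sum_type] at hg
    simp only [f, Sum.elim_inl, Sum.elim_inr] at hg
    have h1 := (hnd (fun i => g (Sum.inr i)) 0 (by simp) (by simp) (by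
      intro w hw
      have := LinearMap.congr_fun hg w
      simpa [hw] using this)).1
    have h2 : ∀ i, g (Sum.inr i) = 0 := fun i => congrFun h1 i
    simp only [h2, zero_smul, Finset.sum_const_zero, add_zero] at hg
    have h3 := Fintype.linearIndependent_iff.mp hα _ hg
    rintro (i | i)
    · exact h3 i
    · exact h2 i
  let K : Submodule F V := LinearMap.ker (LinearMap.pi f)
  have hK : ∀ v, v ∈ K ↔ (∀ i, α i v = 0) ∧ ∀ i, β i v = 0 := by
    intro v
    simp only [K, LinearMap.mem_ker, funext_iff, LinearMap.pi_apply, Sum.forall, f, Sum.elim_inl,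
      Sum.elim_inr, Pi.zero_apply]
  have hspan : ∀ g : Module.Dual F V, (∀ v ∈ K, g v = 0) → g ∈ Submodule.span F (Set.range f) := by
    intro g hg
    refine mem_span_of_iInf_ker_le_ker fun v hv => hg v ?_
    simpa [K, funext_iff, LinearMap.mem_ker] using hv
  have hKdim : Module.finrank F K + 2 * k = 2 * n := by
    have h1 := LinearMap.finrank_range_add_finrank_ker (LinearMap.pi f)
    have h2 : LinearMap.range (LinearMap.pi f) = ⊤ :=
      LinearMap.range_eq_top.mpr (pi_surjective_of_linearIndependent f hf)
    rw [h2, finrank_top, Module.finrank_fintype_fun_eq_card, hdim] at h1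
    simp only [Fintype.card_sum, Fintype.card_fin] at h1
    change _ + Module.finrank F K = _ at h1
    omega
  -- The restriction of `γ` to `K` is nondegenerate: if `γ x` vanishes on `K`, it is a combination
  -- of the `α i` and `β i`. On the common kernel of the `α i` only the `β i` remain, and `hnd`
  -- applies with minus their coefficients as `s`.
  obtain ⟨r, hr, p, q, hpq⟩ := exists_symplectic_basis (Module.finrank F K) K
    (γ.domRestrict₁₂ K K) (fun x => hγ x) (by
      intro x hx
      have h1 : γ x ∈ Submodule.span F (Set.range f) := hspan _ fun v hv => hx ⟨v, hv⟩
      obtain ⟨c, hc⟩ := (Submodule.mem_span_range_iff_exists_fun F).mp h1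
      rw [Fintype.sum_sum_type] at hc
      simp only [f, Sum.elim_inl, Sum.elim_inr] at hc
      have h2 := hnd (fun i => -c (Sum.inr i)) x ((hK x).mp x.2).1 ((hK x).mp x.2).2 (by
        intro w hw
        rw [← hc]
        simp [hw])
      exact Subtype.ext h2.2) rfl
  have hkn : k ≤ n := by omega
  obtain rfl : r = n - k := by omega
  refine ⟨hkn, ?_⟩
  let z : Fin (n - k) → Module.Dual F V := fun j => γ.flip (q j)
  let z' : Fin (n - k) → Module.Dual F V := fun j => γ (p j)
  have hrep : ∀ v ∈ K, v = ∑ j, (z j v • (p j : V) + z' j v • (q j : V)) := by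
    intro v hv
    have := congrArg Subtype.val (hpq ⟨v, hv⟩)
    simp only [Submodule.coe_sum, Submodule.coe_add, Submodule.coe_smul] at this
    exact this
  -- What is left of `γ` after the symplectic part vanishes on `K`, hence every term of it contains
  -- some `α i` or `β i`. The terms with `β i` change sign below, since `b` is wanted in front of
  -- `β`.
  let δ : V →ₗ[F] V →ₗ[F] F :=
    γ - ∑ j, ((z j).smulRight (z' j) - (z' j).smulRight (z j))
  have hδ : ∀ v w, δ v w = γ v w - ∑ j, (z j v * z' j w - z j w * z' j v) := by
    intro v w
    simp only [δ, LinearMap.sub_apply, LinearMap.sum_apply, LinearMap.smulRight_apply,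
      LinearMap.smul_apply, smul_eq_mul]
    congr 1
    exact Finset.sum_congr rfl fun j _ => by ring
  obtain ⟨c, hc⟩ := exists_sum_wedge_of_vanish f hf δ (by
      intro v w
      rw [hδ, hδ, hneg v w]
      simp only [Finset.sum_sub_distrib]
      ring) (by
      intro v w hv hw
      have hv' : v ∈ K := (hK v).mpr ⟨fun i => hv (Sum.inl i), fun i => hv (Sum.inr i)⟩
      rw [hδ, sub_eq_zero]
      conv_lhs => rw [hrep v hv']
      simp only [map_sum, map_add, map_smul, LinearMap.sum_apply, LinearMap.add_apply,
        LinearMap.smul_apply, smul_eq_mul]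
      refine Finset.sum_congr rfl fun j _ => ?_
      rw [hneg (q j) w]
      change z j v * z' j w + z' j v * -(z j w) = _
      ring)
  refine ⟨fun i => c (Sum.inl i), fun i => -c (Sum.inr i), z, z', fun v w => ?_, ?_⟩
  · have h1 := hc v w
    rw [hδ, Fintype.sum_sum_type] at h1
    simp only [f, Sum.elim_inl, Sum.elim_inr] at h1
    have h2 : ∑ i, ((-c (Sum.inr i)) v * β i w - (-c (Sum.inr i)) w * β i v) =
        ∑ i, (β i v * c (Sum.inr i) w - β i w * c (Sum.inr i) v) :=
      Finset.sum_congr rfl fun i _ => by simp only [LinearMap.neg_apply]; ring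
    rw [h2]
    linear_combination h1
  · intro v h1 h2 h3 h4
    rw [hrep v ((hK v).mpr ⟨h1, h2⟩)]
    simp [h3, h4]

end Symplectic

end LogSymplectic

namespace LogSymplectic

/-! ### The dual bivector and the Jacobi identity, pointwise -/

section Dual

theorem canonicalForm_apply {F V : Type*} [Field F] [AddCommGroup V] [Module F V] {n k : ℕ}
    (u : Coord n k → F) (du : Coord n k → (V →ₗ[F] F)) (v w : V) :
    canonicalForm u du ![v, w] =
      ∑ i, (u (cx i))⁻¹ * (du (cx i) v * du (cy i) w - du (cx i) w * du (cy i) v)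
        + ∑ j, (du (cz j) v * du (cz' j) w - du (cz j) w * du (cz' j) v) := by
  simp [canonicalForm, alternatingMap_sum_apply, AlternatingMap.add_apply, wedge₁_apply]

theorem canonicalBivector_apply {F V : Type*} [Field F] [AddCommGroup V] [Module F V] {n k : ℕ}
    (u : Coord n k → F) (X : Coord n k → V) (f g : Module.Dual F V) :
    canonicalBivector u X ![f, g] =
      ∑ i, u (cx i) * (f (X (cx i)) * g (X (cy i)) - g (X (cx i)) * f (X (cy i)))
        + ∑ j, (f (X (cz j)) * g (X (cz' j)) - g (X (cz j)) * f (X (cz' j))) := by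
  simp [canonicalBivector, bivector, alternatingMap_sum_apply, AlternatingMap.add_apply,
    wedge₁_apply]

/-- In dual frames the contraction exchanges the indices of `x_i` and `y_i`, and those of `z_j` and
`z'_j`, up to nonzero factors. It is thus injective, and bijective by equality of dimensions;
duality is then a substitution of the values `hval`. -/
theorem isDualBivector_canonical {F V : Type*} [Field F] [AddCommGroup V] [Module F V]
    [FiniteDimensional F V] {n k : ℕ} (u : Coord n k → F) (du : Coord n k → (V →ₗ[F] F))
    (X : Coord n k → V) (hX : ∀ c d, du c (X d) = if c = d then 1 else 0)
    (hker : ∀ v, (∀ c, du c v = 0) → v = 0) (hu : ∀ i, u (cx i) ≠ 0) :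
    IsDualBivector (canonicalBivector u X) (canonicalForm u du) := by
  have hval : ∀ v,
      (∀ i, contract (canonicalForm u du) v (X (cx i)) = -((u (cx i))⁻¹ * du (cy i) v)) ∧
      (∀ i, contract (canonicalForm u du) v (X (cy i)) = (u (cx i))⁻¹ * du (cx i) v) ∧
      (∀ j, contract (canonicalForm u du) v (X (cz j)) = -du (cz' j) v) ∧
      (∀ j, contract (canonicalForm u du) v (X (cz' j)) = du (cz j) v) := by
    intro v
    refine ⟨fun i => ?_, fun i => ?_, fun j => ?_, fun j => ?_⟩ <;>
      rw [contract_apply, canonicalForm_apply] <;> simp [hX]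
  constructor
  · have hlin : ∃ f : V →ₗ[F] Module.Dual F V, ∀ v, f v = contract (canonicalForm u du) v := by
      refine ⟨⟨⟨contract (canonicalForm u du), fun v w => ?_⟩, fun a v => ?_⟩, fun v => rfl⟩
      · ext x
        rw [LinearMap.add_apply, contract_apply, contract_apply, contract_apply]
        simp only [canonicalForm_apply, map_add]
        rw [add_add_add_comm, ← Finset.sum_add_distrib, ← Finset.sum_add_distrib]
        congr 1 <;> exact Finset.sum_congr rfl fun i _ => by ring
      · ext x
        simp only [RingHom.id_apply, LinearMap.smul_apply]
        rw [contract_apply, contract_apply]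
        simp only [canonicalForm_apply, map_smul, smul_eq_mul, mul_add, Finset.mul_sum]
        congr 1 <;> exact Finset.sum_congr rfl fun i _ => by ring
    obtain ⟨f, hf⟩ := hlin
    have hinj : Function.Injective f := by
      rw [← LinearMap.ker_eq_bot, LinearMap.ker_eq_bot']
      intro v hv
      refine hker v ?_
      obtain ⟨h1, h2, h3, h4⟩ := hval v
      rw [← hf, hv] at h1 h2 h3 h4
      rintro ((i | i) | (j | j))
      · simpa [hu i] using h2 i
      · simpa [hu i] using h1 i
      · simpa using (h4 j).symm
      · simpa using h3 j
    have h1 : contract (canonicalForm u du) = f := funext fun v => (hf v).symm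
    rw [h1]
    exact ⟨hinj, (LinearMap.injective_iff_surjective_of_finrank_eq_finrank
      (Subspace.dual_finrank_eq).symm).mp hinj⟩
  · intro v w
    rw [canonicalBivector_apply, canonicalForm_apply]
    obtain ⟨h1, h2, h3, h4⟩ := hval v
    obtain ⟨g1, g2, g3, g4⟩ := hval w
    simp only [h1, h2, h3, h4, g1, g2, g3, g4]
    congr 1
    · refine Finset.sum_congr rfl fun i _ => ?_
      have := hu i
      field_simp
      ring
    · exact Finset.sum_congr rfl fun i _ => by ring

/-- The Jacobi identity for the bracket `∑ a, A_a ∧ B_a` of commuting derivations, in terms of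
the values of the first derivatives `A`, `B` and of the second derivatives `AA`, `AB`, `BB`
of three functions. -/
theorem jacobi_sum {S ι : Type*} [Field S] [CharZero S] [Fintype ι] (A B : ι → Fin 3 → S)
    (AA AB BB : ι → ι → Fin 3 → S) (hAA : ∀ a b, AA a b = AA b a) (hBB : ∀ a b, BB a b = BB b a)
    (dA dB : ι → Fin 3 → Fin 3 → S)
    (hdA : ∀ a g l, dA a g l = ∑ b, (AA a b g * B b l + A b g * AB a b l
      - AA a b l * B b g - A b l * AB a b g))
    (hdB : ∀ a g l, dB a g l = ∑ b, (AB b a g * B b l + A b g * BB a b l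
      - AB b a l * B b g - A b l * BB a b g)) :
    ∑ a, (A a 0 * dB a 1 2 - dA a 1 2 * B a 0) + ∑ a, (A a 1 * dB a 2 0 - dA a 2 0 * B a 1)
      + ∑ a, (A a 2 * dB a 0 1 - dA a 0 1 * B a 2) = 0 := by
  let T : ι → ι → S := fun a b =>
    A a 0 * (AB b a 1 * B b 2 + A b 1 * BB a b 2 - AB b a 2 * B b 1 - A b 2 * BB a b 1)
      - (AA a b 1 * B b 2 + A b 1 * AB a b 2 - AA a b 2 * B b 1 - A b 2 * AB a b 1) * B a 0
    + (A a 1 * (AB b a 2 * B b 0 + A b 2 * BB a b 0 - AB b a 0 * B b 2 - A b 0 * BB a b 2)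
      - (AA a b 2 * B b 0 + A b 2 * AB a b 0 - AA a b 0 * B b 2 - A b 0 * AB a b 2) * B a 1)
    + (A a 2 * (AB b a 0 * B b 1 + A b 0 * BB a b 1 - AB b a 1 * B b 0 - A b 1 * BB a b 0)
      - (AA a b 0 * B b 1 + A b 0 * AB a b 1 - AA a b 1 * B b 0 - A b 1 * AB a b 0) * B a 2)
  -- Symmetry of the second derivatives makes the term of the pair `(a, b)` antisymmetric. The
  -- double sum is therefore its own negative.
  have hT : ∀ a b, T a b + T b a = 0 := by
    intro a b
    simp only [T]
    rw [hAA b a, hBB b a]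
    ring
  have h1 : ∑ a, (A a 0 * dB a 1 2 - dA a 1 2 * B a 0)
      + ∑ a, (A a 1 * dB a 2 0 - dA a 2 0 * B a 1)
      + ∑ a, (A a 2 * dB a 0 1 - dA a 0 1 * B a 2) = ∑ a, ∑ b, T a b := by
    rw [← Finset.sum_add_distrib, ← Finset.sum_add_distrib]
    refine Finset.sum_congr rfl fun a _ => ?_
    simp only [hdA, hdB, Finset.mul_sum, Finset.sum_mul, ← Finset.sum_sub_distrib,
      ← Finset.sum_add_distrib, T]
  rw [h1]
  have h2 : ∑ a, ∑ b, T a b + ∑ a, ∑ b, T a b = 0 := by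
    nth_rewrite 2 [Finset.sum_comm]
    simp only [← Finset.sum_add_distrib, hT, Finset.sum_const_zero]
  exact add_self_eq_zero.mp h2

/-- A log-symplectic form whose top power does not vanish is nondegenerate at the origin. Here
`E` is a frame adapted to the divisor and `G` its logarithmic version. -/
theorem nondegenerate_of_wedgePowPoly {F V S : Type*} [Field F] [CharZero F] [AddCommGroup V]
    [Module F V] [Fintype S] [DecidableEq S] {n k : ℕ} (e : Fin (2 * n) ≃ Fin k ⊕ S)
    (α β : Fin k → Module.Dual F V) (γ : V →ₗ[F] V →ₗ[F] F) (hγ : ∀ v w, γ v w = -γ w v)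
    (E : S → V) (hE : ∀ i t, α i (E t) = 0)
    (hspan : ∀ v, (∀ i, α i v = 0) → ∃ ζ : S → F, v = ∑ t, ζ t • E t)
    (G : Fin k ⊕ S → V) (hGl : ∀ i, G (Sum.inl i) = 0) (hGr : ∀ t, G (Sum.inr t) = E t)
    (h : MvPolynomial.aeval (fun c : (Fin k ⊕ S) × (Fin k ⊕ S) =>
      ∑ i, ((if c.1 = Sum.inl i then 1 else 0) * β i (G c.2)
        - (if c.2 = Sum.inl i then 1 else 0) * β i (G c.1)) + γ (G c.1) (G c.2))
      (wedgePowPoly n e) ≠ 0) (s : Fin k → F) (v : V) (hαv : ∀ i, α i v = 0)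
    (hβv : ∀ i, β i v = 0) (hv : ∀ w, (∀ i, α i w = 0) → ∑ i, s i * β i w + γ v w = 0) :
    s = 0 ∧ v = 0 := by
  obtain ⟨ζ, rfl⟩ := hspan v hαv
  -- The pair `(s, ζ)` lists the coordinates of the logarithmic vector `∑ s_i h_i ∂_{h_i} + v`. The
  -- field `h_i ∂_{h_i}` vanishes at the origin as a vector, whence `G (Sum.inl i) = 0`, but `dh_i /
  -- h_i` takes the value 1 on it. This accounts for the `if` terms. The hypotheses on `v` say that
  -- this vector lies in the kernel.
  have h1 := eq_zero_of_wedgePowPoly_ne_zero e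
    (fun c d => ∑ i, ((if c = Sum.inl i then 1 else 0) * β i (G d)
        - (if d = Sum.inl i then 1 else 0) * β i (G c)) + γ (G c) (G d))
    (fun c d => by
      rw [hγ (G c), neg_add, ← Finset.sum_neg_distrib]
      simp only [neg_sub]) h (Sum.elim s ζ) (by
      rintro (i | t)
      · simp only [Fintype.sum_sum_type, Sum.elim_inl, Sum.elim_inr, hGl, hGr, Sum.inl.injEq, reduceCtorEq,
          if_false, zero_mul, sub_zero, map_zero, Pi.zero_apply, mul_zero, add_zero,
          Finset.sum_const_zero, zero_sub, Finset.sum_neg_distrib, mul_neg, zero_add]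
        have := hβv i
        simp only [map_sum, map_smul, smul_eq_mul] at this
        simp [this]
      · have := hv (E t) (fun i => hE i t)
        simp only [map_sum, map_smul, LinearMap.sum_apply, LinearMap.smul_apply,
          smul_eq_mul] at this
        simp only [Fintype.sum_sum_type, Sum.elim_inl, Sum.elim_inr, hGl, hGr, Sum.inl.injEq, reduceCtorEq,
          if_false, zero_mul, sub_zero, map_zero, Pi.zero_apply, add_zero, LinearMap.zero_apply,
          Finset.sum_const_zero, zero_add]
        simpa using this)
  have h2 : s = 0 := funext fun i => congrFun h1 (Sum.inl i)
  have h3 : ∀ t, ζ t = 0 := fun t => congrFun h1 (Sum.inr t)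
  exact ⟨h2, by simp [h3]⟩

end Dual

end LogSymplectic

/-! ### Differential calculus in an abstract local ring: Poincaré lemmas -/

namespace LogSymplectic

/-- A local ring `R` of functions at the origin of `𝕜^m`, with its partial derivatives `D a`, the
value `ev` at the origin, the coordinates `X a`, the operators `I s f = ∫₀¹ t^s f(t x) dt`, and
a retraction onto every smooth hypersurface `h = 0`. -/
structure LocalCalculus (𝕜 R : Type*) [Field 𝕜] [CommRing R] [Algebra 𝕜 R] (m : ℕ) where
  D : Fin m → Derivation 𝕜 R R
  D_comm : ∀ a b f, D a (D b f) = D b (D a f)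
  ev : R →ₐ[𝕜] 𝕜
  isUnit : ∀ f, ev f ≠ 0 → IsUnit f
  X : Fin m → R
  ev_X : ∀ a, ev (X a) = 0
  D_X : ∀ a b, D a (X b) = if a = b then 1 else 0
  I : ℕ → R →+ R
  D_I : ∀ s a f, D a (I s f) = I (s + 1) (D a f)
  euler : ∀ (s : ℕ) f, ∑ a, X a * D a (I s f) + ((s : R) + 1) * I s f = f
  nzd : ∀ f, ev f = 0 → ∀ a, ev (D a f) ≠ 0 → ∀ g, f * g = 0 → g = 0
  retract : ∀ h, ev h = 0 → ∀ a, ev (D a h) ≠ 0 → ∃ π : R →+* R, π h = 0 ∧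
    (∀ f, ∃ e, π f = f + h * e) ∧ ∀ b f, D b (π f) = ∑ c, π (D c f) * D b (π (X c))

section FormsInCoordinates

variable {R : Type*} [CommRing R] {m : ℕ}

/-- The coefficients of the wedge product of two 1-forms. -/
def w2 (α β : Fin m → R) (a b : Fin m) : R := α a * β b - α b * β a

/-- The coefficients of the wedge product of a 1-form and a 2-form. -/
def w12 (α : Fin m → R) (τ : Fin m → Fin m → R) (a b c : Fin m) : R :=
  α a * τ b c + α b * τ c a + α c * τ a b

end FormsInCoordinates

namespace LocalCalculus

variable {𝕜 R : Type*} [Field 𝕜] [CommRing R] [Algebra 𝕜 R] {m : ℕ} (L : LocalCalculus 𝕜 R m)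

/-- The differential of a function. -/
def grad (f : R) (a : Fin m) : R := L.D a f

/-- The exterior derivative of a 1-form. -/
def dd (θ : Fin m → R) (a b : Fin m) : R := L.D a (θ b) - L.D b (θ a)

/-- The exterior derivative of a 2-form. -/
def d2 (τ : Fin m → Fin m → R) (a b c : Fin m) : R :=
  L.D a (τ b c) + L.D b (τ c a) + L.D c (τ a b)

theorem D_mul (a : Fin m) (f g : R) : L.D a (f * g) = f * L.D a g + g * L.D a f := by
  simp [Derivation.leibniz]

theorem d2_add (τ σ : Fin m → Fin m → R) (a b c : Fin m) :
    L.d2 (fun a b => τ a b + σ a b) a b c = L.d2 τ a b c + L.d2 σ a b c := by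
  simp only [d2, map_add]; ring

theorem d2_sub (τ σ : Fin m → Fin m → R) (a b c : Fin m) :
    L.d2 (fun a b => τ a b - σ a b) a b c = L.d2 τ a b c - L.d2 σ a b c := by
  simp only [d2, map_sub]; ring

theorem d2_sum {ι : Type*} (s : Finset ι) (τ : ι → Fin m → Fin m → R) (a b c : Fin m) :
    L.d2 (fun a b => ∑ i ∈ s, τ i a b) a b c = ∑ i ∈ s, L.d2 (τ i) a b c := by
  simp only [d2, map_sum, Finset.sum_add_distrib]

theorem d2_w2_grad (f : R) (β : Fin m → R) (a b c : Fin m) :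
    L.d2 (w2 (L.grad f) β) a b c = -w12 (L.grad f) (L.dd β) a b c := by
  simp only [d2, w2, w12, grad, dd, map_sub, D_mul]
  rw [L.D_comm b a f, L.D_comm c a f, L.D_comm c b f]
  ring

theorem dd_grad (f : R) (a b : Fin m) : L.dd (L.grad f) a b = 0 := by
  simp only [dd, grad]
  rw [L.D_comm, sub_self]

theorem d2_w2_grad_grad (f g : R) (a b c : Fin m) :
    L.d2 (w2 (L.grad f) (L.grad g)) a b c = 0 := by
  rw [d2_w2_grad]
  simp [w12, dd_grad]

theorem d2_mul (q : R) (τ : Fin m → Fin m → R) (a b c : Fin m) :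
    L.d2 (fun a b => q * τ a b) a b c = q * L.d2 τ a b c + w12 (L.grad q) τ a b c := by
  simp only [d2, w12, grad, D_mul]; ring

theorem D_of_mul_eq_one {f g : R} (h : f * g = 1) (a : Fin m) :
    L.D a g = -g ^ 2 * L.D a f := by
  have h1 := congrArg (L.D a) h
  rw [D_mul, Derivation.map_one_eq_zero] at h1
  linear_combination g * h1 - (L.D a g) * h

/-- The form is `d log f ∧ dy`: since `dg = -g² df`, its derivative contains `df ∧ df`. -/
theorem d2_dlog_w2 {f g : R} (h : f * g = 1) (y : R) (a b c : Fin m) :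
    L.d2 (fun a b => g * w2 (L.grad f) (L.grad y) a b) a b c = 0 := by
  rw [d2_mul, d2_w2_grad_grad]
  simp only [w12, w2, grad, L.D_of_mul_eq_one h]
  ring

/-- The primitive of a closed 1-form. -/
theorem exists_grad_eq (β : Fin m → R) (hβ : ∀ a b, L.D a (β b) = L.D b (β a)) :
    ∃ y, L.ev y = 0 ∧ ∀ a, L.D a y = β a := by
  -- The primitive is the integral of `β` along the segment from the origin. Closedness turns its
  -- derivative into the left-hand side of the Euler identity with `s = 0`.
  refine ⟨∑ a, L.X a * L.I 0 (β a), by simp [L.ev_X], fun b => ?_⟩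
  simp only [map_sum, D_mul, L.D_X, L.D_I, mul_ite, mul_one, mul_zero, Finset.sum_add_distrib,
    Finset.sum_ite_eq, Finset.mem_univ, if_true]
  have h := L.euler 0 (β b)
  simp only [L.D_I, Nat.cast_zero, zero_add, one_mul] at h
  rw [← h, h]
  conv_rhs => rw [← h]
  congr 1
  exact Finset.sum_congr rfl fun a _ => by rw [hβ]

/-- The radial primitive of a 2-form. -/
def prim (τ : Fin m → Fin m → R) (b : Fin m) : R := ∑ a, L.X a * L.I 1 (τ a b)

theorem D_prim (τ : Fin m → Fin m → R) (c b : Fin m) :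
    L.D c (L.prim τ b) = ∑ a, L.X a * L.I 2 (L.D c (τ a b)) + L.I 1 (τ c b) := by
  simp [prim, L.D_X, L.D_I, Finset.sum_add_distrib]

/-- Closedness rewrites the radial derivative of `τ a b` as the difference of the first terms in
`D_prim`. Together with the two undifferentiated terms this is the Euler identity with `s = 1`. -/
theorem dd_prim (τ : Fin m → Fin m → R) (hτ : ∀ a b, τ a b = -τ b a)
    (hcl : ∀ a b c, L.d2 τ a b c = 0) (a b : Fin m) : L.dd (L.prim τ) a b = τ a b := by
  have h := L.euler 1 (τ a b)
  simp only [L.D_I] at h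
  rw [dd, D_prim, D_prim, hτ b a, map_neg]
  conv_rhs => rw [← h]
  have h2 : ∀ e, L.X e * L.I 2 (L.D e (τ a b)) =
      L.X e * L.I 2 (L.D a (τ e b)) - L.X e * L.I 2 (L.D b (τ e a)) := by
    intro e
    have h3 := hcl a b e
    simp only [d2] at h3
    rw [← mul_sub, ← map_sub]
    congr 2
    rw [hτ e b, map_neg]
    linear_combination h3
  simp only [h2, Finset.sum_sub_distrib]
  push_cast
  ring

theorem ev_prim (τ : Fin m → Fin m → R) (b : Fin m) : L.ev (L.prim τ b) = 0 := by
  simp [prim, L.ev_X]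

theorem ev_I_eq_zero [CharZero 𝕜] (s : ℕ) (f : R) (hf : L.ev f = 0) : L.ev (L.I s f) = 0 := by
  have h := congrArg L.ev (L.euler s f)
  simp only [map_add, map_sum, map_mul, L.ev_X, zero_mul, Finset.sum_const_zero, zero_add,
    map_natCast, map_one, hf] at h
  exact (mul_eq_zero.mp h).resolve_left (by exact_mod_cast Nat.succ_ne_zero s)

/-- Thus the radial primitive of a form that vanishes at the origin vanishes there to second order.
This makes the linear part of the Moser field at the origin zero. -/
theorem ev_D_prim [CharZero 𝕜] (τ : Fin m → Fin m → R) (h0 : ∀ a b, L.ev (τ a b) = 0)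
    (c b : Fin m) : L.ev (L.D c (L.prim τ b)) = 0 := by
  rw [D_prim]
  simp [L.ev_X, L.ev_I_eq_zero 1 _ (h0 c b)]

/-- A 1-form that is closed along the hypersurface `h = 0` is exact there. -/
theorem exists_primitive_on_hypersurface (h : R) (h0 : L.ev h = 0) (a₀ : Fin m)
    (ha₀ : L.ev (L.D a₀ h) ≠ 0) (β : Fin m → R)
    (hβ : ∀ a b c, ∃ e, w12 (L.grad h) (L.dd β) a b c = h * e) :
    ∃ (y s : R) (η : Fin m → R), L.ev y = 0 ∧
      ∀ a, β a = L.D a y + s * L.D a h + h * η a := by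
  obtain ⟨π, hπ, hπf, hchain⟩ := L.retract h h0 a₀ ha₀
  let P : Fin m → Fin m → R := fun a c => L.D a (π (L.X c))
  let T : Fin m → Fin m → R := fun e c => π (L.dd β e c)
  have hunit : IsUnit (π (L.D a₀ h)) := (L.isUnit _ ha₀).map π
  obtain ⟨g, hg⟩ := hunit.exists_right_inv
  -- Under `π` the hypothesis becomes `π(dh) ∧ T = 0`, where `T` is `dβ` with coefficients
  -- restricted to the hypersurface. Since one coefficient of `π(dh)` is a unit with inverse `g`,
  -- the form `T` is divisible by `π(dh)`.
  have hT : ∀ b c, T b c = -g * (π (L.D b h) * T c a₀ + π (L.D c h) * T a₀ b) := by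
    intro b c
    obtain ⟨e, he⟩ := hβ a₀ b c
    have h1 := congrArg π he
    simp only [w12, grad, map_add, map_mul, hπ, zero_mul] at h1
    change _ * T b c + _ * T c a₀ + _ * T a₀ b = 0 at h1
    linear_combination g * h1 - T b c * hg
  have hP : ∀ a, ∑ c, π (L.D c h) * P a c = 0 := by
    intro a
    have := hchain a h
    rw [hπ, map_zero] at this
    exact this.symm
  -- The pull-back of `β` by the retraction is closed: its derivative is the pull-back of `T`, which
  -- is divisible by `dh`, and `dh` pulls back to zero by `hP`.
  have hclosed : ∀ a b, L.D a (∑ c, π (β c) * P b c) = L.D b (∑ c, π (β c) * P a c) := by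
    intro a b
    have h1 : ∀ a b, L.D a (∑ c, π (β c) * P b c) =
        ∑ c, π (β c) * L.D a (P b c) + ∑ c, ∑ e, π (L.D e (β c)) * P a e * P b c := by
      intro a b
      simp only [map_sum, D_mul, Finset.sum_add_distrib]
      congr 1
      refine Finset.sum_congr rfl fun c _ => ?_
      rw [hchain, Finset.mul_sum]
      exact Finset.sum_congr rfl fun e _ => by simp only [P]; ring
    have h2 : ∀ c, L.D a (P b c) = L.D b (P a c) := fun c => L.D_comm _ _ _
    rw [h1, h1]
    simp only [h2]
    congr 1
    rw [← sub_eq_zero]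
    nth_rewrite 2 [Finset.sum_comm]
    rw [← Finset.sum_sub_distrib]
    simp only [← Finset.sum_sub_distrib]
    have h3 : ∀ c e, π (L.D e (β c)) * P a e * P b c - π (L.D c (β e)) * P b c * P a e =
        -g * ((π (L.D e h) * P a e) * (T c a₀ * P b c)) -
          g * ((π (L.D c h) * P b c) * (T a₀ e * P a e)) := by
      intro c e
      have h4 := hT e c
      simp only [T, dd, map_sub] at h4 ⊢
      linear_combination P a e * P b c * h4
    simp only [h3, Finset.sum_sub_distrib, ← Finset.mul_sum]
    have h5 : ∑ c, ∑ e, π (L.D c h) * P b c * (T a₀ e * P a e) = 0 := by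
      simp only [← Finset.mul_sum]
      rw [← Finset.sum_mul, hP, zero_mul]
    have h6 : ∑ c, ∑ e, π (L.D e h) * P a e * (T c a₀ * P b c) = 0 := by
      simp only [← Finset.sum_mul, hP, zero_mul, Finset.sum_const_zero]
    simp only [← Finset.mul_sum] at h5
    rw [h5]
    simp only [← Finset.sum_mul, hP, zero_mul, Finset.sum_const_zero]
    ring
  obtain ⟨y, hy0, hy⟩ := L.exists_grad_eq _ hclosed
  choose e he using fun f => hπf f
  refine ⟨y, -∑ c, β c * e (L.X c),
    fun a => -∑ c, (β c * L.D a (e (L.X c)) + e (β c) * P a c), hy0, fun a => ?_⟩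
  rw [hy]
  -- Writing `π f = f + h e(f)` for the coefficients and the coordinates shows that the pull-back
  -- differs from `β` by a multiple of `dh` and a multiple of `h`. These are the terms with `s` and
  -- `η`.
  have h1 : ∀ c, π (β c) * P a c = (β c * if a = c then 1 else 0) + L.D a h * (β c * e (L.X c))
      + h * (β c * L.D a (e (L.X c)) + e (β c) * P a c) := by
    intro c
    have h2 : P a c = (if a = c then 1 else 0) + h * L.D a (e (L.X c)) + e (L.X c) * L.D a h := by
      simp only [P]
      rw [he (L.X c), map_add, L.D_X, D_mul, add_assoc]
    rw [he (β c)]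
    linear_combination (β c) * h2
  simp only [h1, Finset.sum_add_distrib, ← Finset.mul_sum]
  simp
  ring

end LocalCalculus

end LogSymplectic

/-! ### Covectors and bilinear forms from coefficients, and frames dual to coordinates -/

namespace LogSymplectic

theorem wedgePowPoly_comp {ι κ : Type*} (g : ι → κ) (n : ℕ) (f : Fin (2 * n) → ι) :
    wedgePowPoly n (g ∘ f) = MvPolynomial.rename (Prod.map g g) (wedgePowPoly n f) := by
  induction n with
  | zero => simp [wedgePowPoly]
  | succ n ih =>
    rw [wedgePowPoly, wedgePowPoly, map_sum]
    refine Finset.sum_congr rfl fun σ _ => ?_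
    rw [map_zsmul, map_mul, MvPolynomial.rename_X, ← ih]
    rfl

theorem aeval_wedgePowPoly_comp {S ι : Type*} [CommRing S] {n : ℕ} (e : Fin (2 * n) → ι)
    (B : ι → ι → S) :
    MvPolynomial.aeval (fun c : Fin (2 * n) × Fin (2 * n) => B (e c.1) (e c.2))
      (wedgePowPoly n id) = MvPolynomial.aeval (fun c : ι × ι => B c.1 c.2) (wedgePowPoly n e) := by
  have h := wedgePowPoly_comp e n id
  rw [Function.comp_id] at h
  rw [h, MvPolynomial.aeval_rename]
  rfl

theorem map_aeval_int {S T σ : Type*} [CommRing S] [CommRing T] (φ : S →+* T) (f : σ → S)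
    (p : MvPolynomial σ ℤ) :
    φ (MvPolynomial.aeval f p) = MvPolynomial.aeval (fun i => φ (f i)) p :=
  AlgHom.congr_fun (MvPolynomial.comp_aeval f φ.toIntAlgHom) p

/-- The covector with given coefficients. -/
def covector {F : Type*} [Field F] {m : ℕ} (α : Fin m → F) : Module.Dual F (Fin m → F) :=
  ∑ a, α a • LinearMap.proj (R := F) (φ := fun _ : Fin m => F) a

theorem covector_apply {F : Type*} [Field F] {m : ℕ} (α : Fin m → F) (v : Fin m → F) :
    covector α v = ∑ a, α a * v a := by
  simp [covector]

theorem covector_single {F : Type*} [Field F] {m : ℕ} (α : Fin m → F) (a : Fin m) :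
    covector α (Pi.single a 1) = α a := by
  simp [covector_apply, Pi.single_apply]

/-- The bilinear form with given coefficients. -/
def bilinear {F : Type*} [Field F] {m : ℕ} (τ : Fin m → Fin m → F) :
    (Fin m → F) →ₗ[F] (Fin m → F) →ₗ[F] F :=
  ∑ a, (LinearMap.proj (R := F) (φ := fun _ : Fin m => F) a).smulRight (covector (τ a))

theorem bilinear_apply {F : Type*} [Field F] {m : ℕ} (τ : Fin m → Fin m → F) (v w : Fin m → F) :
    bilinear τ v w = ∑ a, ∑ b, τ a b * v a * w b := by
  simp only [bilinear, LinearMap.sum_apply, LinearMap.smulRight_apply, LinearMap.smul_apply,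
    covector_apply, smul_eq_mul, LinearMap.proj_apply, Finset.mul_sum]
  exact Finset.sum_congr rfl fun a _ => Finset.sum_congr rfl fun b _ => by ring

theorem bilinear_single {F : Type*} [Field F] {m : ℕ} (τ : Fin m → Fin m → F) (a b : Fin m) :
    bilinear τ (Pi.single a 1) (Pi.single b 1) = τ a b := by
  simp [bilinear_apply, Pi.single_apply]

theorem bilinear_neg {F : Type*} [Field F] {m : ℕ} {τ : Fin m → Fin m → F}
    (hτ : ∀ a b, τ a b = -τ b a) (v w : Fin m → F) : bilinear τ v w = -bilinear τ w v := by
  rw [bilinear_apply, bilinear_apply, Finset.sum_comm, ← Finset.sum_neg_distrib]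
  refine Finset.sum_congr rfl fun a _ => ?_
  rw [← Finset.sum_neg_distrib]
  exact Finset.sum_congr rfl fun b _ => by rw [hτ b a]; ring

theorem bilinear_self {F : Type*} [Field F] [CharZero F] {m : ℕ} {τ : Fin m → Fin m → F}
    (hτ : ∀ a b, τ a b = -τ b a) (v : Fin m → F) : bilinear τ v v = 0 :=
  self_eq_neg.mp (bilinear_neg hτ v v)

namespace LocalCalculus

variable {𝕜 R : Type*} [Field 𝕜] [CommRing R] [Algebra 𝕜 R] {m : ℕ} (L : LocalCalculus 𝕜 R m)

/-- The differential at the origin. -/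
def diff₀ (f : R) : Module.Dual 𝕜 (Fin m → 𝕜) := covector fun a => L.ev (L.D a f)

/-- Functions whose differentials at the origin are independent have a dual frame. -/
theorem exists_frame {C : Type*} [Fintype C] [DecidableEq C] (e : Fin m ≃ C) (u : C → R)
    (hu : ∀ v, (∀ c, L.diff₀ (u c) v = 0) → v = 0) :
    ∃ E : Fin m → C → R, (∀ c d, ∑ a, L.D a (u c) * E a d = if c = d then 1 else 0) ∧
      (∀ a b, ∑ c, E a c * L.D b (u c) = if a = b then 1 else 0) ∧
      ∃ g, g * Matrix.det (Matrix.of fun a i => E a (e i)) = 1 := by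
  let J : Matrix (Fin m) (Fin m) R := Matrix.of fun i a => L.D a (u (e i))
  -- If the Jacobian were singular at the origin, it would have a null vector there, on which all
  -- differentials of the `u c` vanish.
  have hdet : IsUnit J.det := by
    refine L.isUnit _ fun h => ?_
    have h1 : (J.map L.ev).det = 0 := by
      rw [← h]
      exact (RingHom.map_det (L.ev : R →+* 𝕜) J).symm
    obtain ⟨v, hv, hv'⟩ := Matrix.exists_mulVec_eq_zero_iff.mpr h1
    refine hv (hu v fun c => ?_)
    have := congrFun hv' (e.symm c)
    simpa [Matrix.mulVec, dotProduct, J, diff₀, covector_apply] using this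
  refine ⟨fun a c => J⁻¹ a (e.symm c), fun c d => ?_, fun a b => ?_, J.det, ?_⟩
  · have := congrFun (congrFun (Matrix.mul_nonsing_inv J hdet) (e.symm c)) (e.symm d)
    simpa [Matrix.mul_apply, J, Matrix.one_apply] using this
  · have := congrFun (congrFun (Matrix.nonsing_inv_mul J hdet) a) b
    rw [Matrix.mul_apply, ← e.symm.sum_comp] at this
    simpa [J, Matrix.one_apply] using this
  · have : (Matrix.of fun a i => J⁻¹ a (e.symm (e i))) = J⁻¹ := by ext; simp
    rw [this, ← Matrix.det_mul, Matrix.mul_nonsing_inv J hdet, Matrix.det_one]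

/-- The linear function with a given differential. -/
def lin (φ : Module.Dual 𝕜 (Fin m → 𝕜)) : R := ∑ a, φ (Pi.single a 1) • L.X a

theorem D_lin (φ : Module.Dual 𝕜 (Fin m → 𝕜)) (a : Fin m) :
    L.D a (L.lin φ) = algebraMap 𝕜 R (φ (Pi.single a 1)) := by
  simp [lin, L.D_X, Algebra.algebraMap_eq_smul_one]

theorem ev_lin (φ : Module.Dual 𝕜 (Fin m → 𝕜)) : L.ev (L.lin φ) = 0 := by
  simp [lin, L.ev_X]

theorem ev_D_lin (φ : Module.Dual 𝕜 (Fin m → 𝕜)) (a : Fin m) :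
    L.ev (L.D a (L.lin φ)) = φ (Pi.single a 1) := by
  rw [D_lin, AlgHom.commutes]; rfl

theorem diff₀_lin (φ : Module.Dual 𝕜 (Fin m → 𝕜)) : L.diff₀ (L.lin φ) = φ := by
  refine LinearMap.pi_ext' fun a => LinearMap.ext_ring ?_
  simp [diff₀, covector_single, ev_D_lin]

end LocalCalculus

end LogSymplectic

/-! ### Nondegeneracy at the origin in a logarithmic frame -/

namespace LogSymplectic

theorem exists_basis_extension {F W : Type*} [Field F] [AddCommGroup W] [Module F W]
    [FiniteDimensional F W] {ι : Type*} {f : ι → W} (hf : LinearIndependent F f) :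
    ∃ (S : Set W) (_ : Fintype S) (bs : Module.Basis (ι ⊕ S) F W), ∀ i, bs (Sum.inl i) = f i := by
  let bs := Module.Basis.sumExtend hf
  have : Finite (ι ⊕ Module.Basis.sumExtendIndex hf) := Module.Finite.finite_basis bs
  have : Finite (Module.Basis.sumExtendIndex hf) := Finite.sum_right ι
  refine ⟨_, Fintype.ofFinite _, bs, fun i => ?_⟩
  simp only [bs, Module.Basis.sumExtend]
  simp
  rfl

namespace LocalCalculus

variable {𝕜 R : Type*} [Field 𝕜] [CommRing R] [Algebra 𝕜 R]

/-- The coefficients of the regular form `h₁ ⋯ h_k ω`, for `ω = ∑ i, dh_i / h_i ∧ β_i + γ`. -/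
def logForm {m : ℕ} (L : LocalCalculus 𝕜 R m) {k : ℕ} (h : Fin k → R) (β : Fin k → Fin m → R)
    (γ : Fin m → Fin m → R) (a b : Fin m) : R :=
  ∑ i, (∏ j ∈ Finset.univ.erase i, h j) * w2 (L.grad (h i)) (β i) a b + (∏ j, h j) * γ a b

/-- In a logarithmic frame `ω` has regular coefficients `B`, while the determinant of the frame is
`h` times a unit. The volume condition becomes `h P(B) = f h g` with `g` a unit, so `h` cancels and
`P(B)` is nonzero at the origin. The hypothesis `hvol` is the volume condition on an arbitrary frame
`G`, phrased without poles. -/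
theorem nondegenerate_at_zero [CharZero 𝕜] {n : ℕ} (L : LocalCalculus 𝕜 R (2 * n)) {k : ℕ}
    (h : Fin k → R) (β : Fin k → Fin (2 * n) → R) (γ : Fin (2 * n) → Fin (2 * n) → R)
    (hγ : ∀ a b, γ a b = -γ b a) (h0 : ∀ i, L.ev (h i) = 0)
    (hind : LinearIndependent 𝕜 fun i => L.diff₀ (h i))
    (hvol : ∃ f, L.ev f ≠ 0 ∧ ∀ G B : Fin (2 * n) → Fin (2 * n) → R,
      (∀ c d, (∏ j, h j) * B c d = ∑ a, ∑ b, L.logForm h β γ a b * G a c * G b d) →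
      (∏ j, h j) * MvPolynomial.aeval (fun c : Fin (2 * n) × Fin (2 * n) => B c.1 c.2)
        (wedgePowPoly n id) = f * Matrix.det (Matrix.of G))
    (hnzd : ∀ g, (∏ j, h j) * g = 0 → g = 0)
    (s : Fin k → 𝕜) (v : Fin (2 * n) → 𝕜) (hαv : ∀ i, L.diff₀ (h i) v = 0)
    (hβv : ∀ i, covector (fun a => L.ev (β i a)) v = 0)
    (hv : ∀ w, (∀ i, L.diff₀ (h i) w = 0) → ∑ i, s i * covector (fun a => L.ev (β i a)) w
      + bilinear (fun a b => L.ev (γ a b)) v w = 0) :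
    s = 0 ∧ v = 0 := by
  classical
  obtain ⟨S, _, bs, hbsl⟩ := exists_basis_extension hind
  have hcard : Fintype.card (Fin (2 * n)) = Fintype.card (Fin k ⊕ S) := by
    rw [← Module.finrank_eq_card_basis bs, Subspace.dual_finrank_eq,
      Module.finrank_fintype_fun_eq_card]
  let e : Fin (2 * n) ≃ Fin k ⊕ S := Fintype.equivOfCardEq hcard
  let u : Fin k ⊕ S → R := Sum.elim h fun t => L.lin (bs (Sum.inr t))
  have hu : ∀ c, L.diff₀ (u c) = bs c := by
    rintro (i | t)
    · exact (hbsl i).symm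
    · exact L.diff₀_lin _
  obtain ⟨E, hE1, hE2, g, hg⟩ := L.exists_frame e u (by
    intro v hv
    refine (Module.forall_dual_apply_eq_zero_iff 𝕜 v).mp fun φ => ?_
    rw [← bs.sum_repr φ]
    simp [← hu, hv])
  -- The first `k` vectors of the frame dual to `u` are multiplied by `h_i`. This cancels the poles
  -- of `ω`, since `dh_i / h_i` takes the value 1 on `h_i ∂_{h_i}`.
  let lam : Fin k ⊕ S → R := Sum.elim h fun _ => 1
  let G : Fin k ⊕ S → Fin (2 * n) → R := fun c a => lam c * E a c
  let B : Fin k ⊕ S → Fin k ⊕ S → R := fun c d =>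
    ∑ i, ((if c = Sum.inl i then 1 else 0) * ∑ a, β i a * G d a
      - (if d = Sum.inl i then 1 else 0) * ∑ a, β i a * G c a) + ∑ a, ∑ b, γ a b * G c a * G d b
  have hdh : ∀ i c, ∑ a, L.D a (h i) * G c a = h i * if c = Sum.inl i then 1 else 0 := by
    intro i c
    have h1 := hE1 (Sum.inl i) c
    simp only [u, Sum.elim_inl] at h1
    simp only [G, mul_left_comm _ (lam c), ← Finset.mul_sum]
    rw [h1]
    by_cases hc : c = Sum.inl i
    · subst hc; simp [lam]
    · rw [if_neg hc, if_neg (Ne.symm hc)]; simp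
  have hprod : ∀ i, (∏ j ∈ Finset.univ.erase i, h j) * h i = ∏ j, h j := fun i =>
    Finset.prod_erase_mul _ _ (Finset.mem_univ i)
  obtain ⟨f, hf, hvol⟩ := hvol
  have hBG : ∀ c d, (∏ j, h j) * B c d = ∑ a, ∑ b, L.logForm h β γ a b * G c a * G d b := by
    intro c d
    have h1 : ∑ a, ∑ b, L.logForm h β γ a b * G c a * G d b =
        ∑ i, (∏ j ∈ Finset.univ.erase i, h j) *
          ((∑ a, L.D a (h i) * G c a) * (∑ b, β i b * G d b)
            - (∑ b, L.D b (h i) * G d b) * (∑ a, β i a * G c a))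
          + (∏ j, h j) * ∑ a, ∑ b, γ a b * G c a * G d b := by
      simp only [logForm, add_mul, Finset.sum_add_distrib, Finset.mul_sum, Finset.sum_mul]
      congr 1
      · have : ∀ a b, ∑ i, (∏ j ∈ Finset.univ.erase i, h j) * w2 (L.grad (h i)) (β i) a b
            * G c a * G d b = ∑ i, (∏ j ∈ Finset.univ.erase i, h j) *
              ((L.D a (h i) * G c a) * (β i b * G d b)
                - (L.D b (h i) * G d b) * (β i a * G c a)) := fun a b =>
          Finset.sum_congr rfl fun i _ => by simp only [w2, grad]; ring
        simp only [this]
        rw [Finset.sum_comm' (t' := Finset.univ) (s' := fun _ => Finset.univ) (by simp)]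
        have h2 : ∀ b, ∑ a, ∑ i, (∏ j ∈ Finset.univ.erase i, h j) *
              ((L.D a (h i) * G c a) * (β i b * G d b)
                - (L.D b (h i) * G d b) * (β i a * G c a)) = ∑ i, ∑ a,
              (∏ j ∈ Finset.univ.erase i, h j) *
              ((L.D a (h i) * G c a) * (β i b * G d b)
                - (L.D b (h i) * G d b) * (β i a * G c a)) := fun b => Finset.sum_comm
        simp only [h2]
        rw [Finset.sum_comm]
        refine Finset.sum_congr rfl fun i _ => ?_
        simp only [← Finset.mul_sum]
        congr 1
        simp only [Finset.sum_sub_distrib]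
        congr 1
        rw [Finset.sum_comm]
      · exact Finset.sum_congr rfl fun a _ => Finset.sum_congr rfl fun b _ => by ring
    rw [h1]
    simp only [B, mul_add, Finset.mul_sum, hdh]
    congr 1
    refine Finset.sum_congr rfl fun i _ => ?_
    rw [← hprod i]
    simp only [← Finset.mul_sum]
    ring
  have h1 := hvol (fun a c => G (e c) a) (fun c d => B (e c) (e d)) fun c d => hBG _ _
  have h2 : Matrix.det (Matrix.of fun a c => G (e c) a) =
      (∏ j, h j) * Matrix.det (Matrix.of fun a i => E a (e i)) := by
    have h3 : (Matrix.of fun a c => G (e c) a) =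
        (Matrix.of fun a i => E a (e i)) * Matrix.diagonal fun c => lam (e c) := by
      ext a c
      simp [Matrix.mul_diagonal, G, mul_comm]
    rw [h3, Matrix.det_mul, Matrix.det_diagonal, mul_comm, Equiv.prod_comp e lam,
      Fintype.prod_sum_type]
    simp [lam]
  rw [h2] at h1
  -- Both sides carry the factor `h`, the right one through the determinant of the rescaled frame;
  -- it cancels because `h` is not a zero divisor.
  have h3 := sub_eq_zero.mp (hnzd (MvPolynomial.aeval (fun c : Fin (2 * n) × Fin (2 * n) =>
    B (e c.1) (e c.2)) (wedgePowPoly n id) - f * Matrix.det (Matrix.of fun a i => E a (e i))) (by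
      rw [mul_sub, h1]; ring))
  rw [aeval_wedgePowPoly_comp] at h3
  have h4 := congrArg (L.ev : R →+* 𝕜) h3
  rw [map_aeval_int, map_mul] at h4
  have hGl : ∀ i, (fun a => L.ev (G (Sum.inl i) a)) = 0 := fun i => by
    funext a
    simp [G, lam, h0]
  have hGr : ∀ t, (fun a => L.ev (G (Sum.inr t) a)) = fun a => L.ev (E a (Sum.inr t)) := fun t => by
    funext a
    simp [G, lam]
  clear_value G
  refine nondegenerate_of_wedgePowPoly e (fun i => L.diff₀ (h i))
    (fun i => covector fun a => L.ev (β i a)) (bilinear fun a b => L.ev (γ a b))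
    (bilinear_neg fun a b => by rw [hγ a b, map_neg]) (fun t a => L.ev (E a (Sum.inr t)))
    (fun i t => ?_) (fun v hv => ⟨fun t => bs (Sum.inr t) v, ?_⟩) (fun c a => L.ev (G c a))
    hGl hGr ?_ s v hαv hβv hv
  · have := congrArg L.ev (hE1 (Sum.inl i) (Sum.inr t))
    simpa [u, diff₀, covector_apply] using this
  · funext a
    have h5 : ∑ b, (∑ c, L.ev (E a c) * L.ev (L.D b (u c))) * v b = v a := by
      have h6 : ∀ b, ∑ c, L.ev (E a c) * L.ev (L.D b (u c)) = if a = b then 1 else 0 := by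
        intro b
        have := congrArg L.ev (hE2 a b)
        simpa [apply_ite L.ev] using this
      simp [h6]
    rw [← h5]
    simp only [Finset.sum_mul]
    rw [Finset.sum_comm]
    have h7 : ∀ c, ∑ b, L.ev (E a c) * L.ev (L.D b (u c)) * v b = bs c v * L.ev (E a c) := by
      intro c
      rw [← hu c, diff₀, covector_apply, Finset.sum_mul]
      exact Finset.sum_congr rfl fun b _ => by ring
    simp only [h7, Fintype.sum_sum_type, hbsl, hv, zero_mul, Finset.sum_const_zero, zero_add]
    simp
  · have h5 : (fun c : (Fin k ⊕ S) × (Fin k ⊕ S) => (L.ev : R →+* 𝕜) (B c.1 c.2)) =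
        fun c => ∑ i, ((if c.1 = Sum.inl i then 1 else 0) *
          covector (fun a => L.ev (β i a)) (fun a => L.ev (G c.2 a))
          - (if c.2 = Sum.inl i then 1 else 0) *
            covector (fun a => L.ev (β i a)) (fun a => L.ev (G c.1 a)))
          + bilinear (fun a b => L.ev (γ a b)) (fun a => L.ev (G c.1 a))
            (fun a => L.ev (G c.2 a)) := by
      funext c
      simp only [B, covector_apply, bilinear_apply, RingHom.coe_coe, map_add, map_sum, map_sub,
        map_mul, apply_ite L.ev, map_one, map_zero]
    rw [h5] at h4
    rw [h4]
    refine mul_ne_zero hf ?_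
    have h6 := congrArg (L.ev : R →+* 𝕜) hg
    rw [map_mul, map_one] at h6
    exact right_ne_zero_of_mul_eq_one h6

end LocalCalculus

end LogSymplectic

/-! ### Residues, and the normal form up to a closed form vanishing at the origin -/

namespace LogSymplectic

namespace LocalCalculus

variable {𝕜 R : Type*} [Field 𝕜] [CommRing R] [Algebra 𝕜 R]

theorem exists_ev_D_ne_zero {m : ℕ} (L : LocalCalculus 𝕜 R m) {f : R} (hf : L.diff₀ f ≠ 0) :
    ∃ a, L.ev (L.D a f) ≠ 0 := by
  by_contra! h
  exact hf (by simp [diff₀, covector, h])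

theorem diff₀_add_mul {m : ℕ} (L : LocalCalculus 𝕜 R m) {h : R} (h0 : L.ev h = 0) (f e : R) :
    L.diff₀ (f + h * e) = L.diff₀ f + L.ev e • L.diff₀ h := by
  refine LinearMap.pi_ext' fun a => LinearMap.ext_ring ?_
  simp [diff₀, covector_single, h0]

/-- Each factor is either a unit or a function vanishing at the origin with nonzero differential,
and neither is a zero divisor. -/
theorem prod_nzd {m : ℕ} (L : LocalCalculus 𝕜 R m) {ι : Type*} (s : Finset ι) (h : ι → R)
    (hs : ∀ i ∈ s, L.ev (h i) = 0 → L.diff₀ (h i) ≠ 0) (g : R) (hg : (∏ j ∈ s, h j) * g = 0) :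
    g = 0 := by
  classical
  induction s using Finset.induction_on generalizing g with
  | empty => simpa using hg
  | insert i s hi ih =>
    rw [Finset.prod_insert hi, mul_assoc] at hg
    refine ih (fun j hj => hs j (Finset.mem_insert_of_mem hj)) g ?_
    by_cases h0 : L.ev (h i) = 0
    · obtain ⟨a, ha⟩ := L.exists_ev_D_ne_zero (hs i (Finset.mem_insert_self i s) h0)
      exact L.nzd _ h0 a ha _ hg
    · exact ((L.isUnit _ h0).mul_right_eq_zero).mp hg

/-- The residues of a closed logarithmic form are closed. -/
theorem residue_closed {m : ℕ} (L : LocalCalculus 𝕜 R m) {k : ℕ} (h : Fin k → R)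
    (h0 : ∀ i, L.ev (h i) = 0) (hind : LinearIndependent 𝕜 fun i => L.diff₀ (h i))
    (ψ : Fin k → R) (χ : R)
    (hψ : ∑ i, (∏ j ∈ Finset.univ.erase i, h j) * ψ i = (∏ j, h j) * χ) (i : Fin k) :
    ∃ e, ψ i = h i * e := by
  obtain ⟨a, ha⟩ := L.exists_ev_D_ne_zero (hind.ne_zero i)
  obtain ⟨π, hπ, hπf, -⟩ := L.retract (h i) (h0 i) a ha
  -- On `h_i = 0` every other summand and the right-hand side contain the factor `h_i`; only `∏_{j ≠
  -- i} π(h_j) · π(ψ_i) = 0` survives.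
  have h1 := congrArg π hψ
  rw [map_sum, Finset.sum_eq_single i, map_mul, map_mul, map_prod, map_prod,
    Finset.prod_eq_zero (Finset.mem_univ i) hπ, zero_mul] at h1
  -- The differential of `π(h_j) = h_j + h_i e` at the origin is `dh_j + e(0) dh_i`, which is
  -- nonzero by independence. So the product over `j ≠ i` can be cancelled.
  · have h2 := L.prod_nzd (Finset.univ.erase i) (fun j => π (h j)) (fun j hj _ hd => by
      obtain ⟨e, he⟩ := hπf (h j)
      rw [he, L.diff₀_add_mul (h0 i)] at hd
      have h3 : LinearIndependent 𝕜 ![L.diff₀ (h j), L.diff₀ (h i)] := by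
        have h5 : Function.Injective ![j, i] := by
          intro x y hxy
          have := Finset.ne_of_mem_erase hj
          fin_cases x <;> fin_cases y <;> simp_all
        convert hind.comp _ h5 using 1
        funext x
        fin_cases x <;> rfl
      have h4 := LinearIndependent.pair_iff.mp h3 1 (L.ev e) (by simpa using hd)
      exact one_ne_zero h4.1) _ h1
    obtain ⟨e, he⟩ := hπf (ψ i)
    exact ⟨-e, by rw [h2] at he; linear_combination -he⟩
  · intro j _ hj
    rw [map_mul, map_prod, Finset.prod_eq_zero (Finset.mem_erase.mpr ⟨hj.symm, Finset.mem_univ i⟩) hπ,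
      zero_mul]
  · simp

/-- A closed logarithmic form is `∑ i, dh_i / h_i ∧ dy_i + τ` with `τ` regular and closed. -/
theorem exists_residue_primitives {m : ℕ} (L : LocalCalculus 𝕜 R m) {k : ℕ} (h : Fin k → R)
    (β : Fin k → Fin m → R) (γ : Fin m → Fin m → R)
    (h0 : ∀ i, L.ev (h i) = 0) (hind : LinearIndependent 𝕜 fun i => L.diff₀ (h i))
    (hclosed : ∀ a b c, ∑ i, (∏ j ∈ Finset.univ.erase i, h j) *
      w12 (L.grad (h i)) (L.dd (β i)) a b c = (∏ j, h j) * L.d2 γ a b c) :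
    ∃ (y s : Fin k → R) (η : Fin k → Fin m → R), (∀ i, L.ev (y i) = 0) ∧
      (∀ i a, β i a = L.D a (y i) + s i * L.D a (h i) + h i * η i a) ∧
      (∀ a b c, L.d2 (fun a b => γ a b + ∑ i, w2 (L.grad (h i)) (η i) a b) a b c = 0) := by
  have h1 : ∀ i, ∃ (y s : R) (η : Fin m → R), L.ev y = 0 ∧
      ∀ a, β i a = L.D a y + s * L.D a (h i) + h i * η a := by
    intro i
    obtain ⟨a, ha⟩ := L.exists_ev_D_ne_zero (hind.ne_zero i)
    exact L.exists_primitive_on_hypersurface (h i) (h0 i) a ha (β i) fun a b c =>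
      L.residue_closed h h0 hind _ _ (hclosed a b c) i
  choose y s η hy hβ using h1
  refine ⟨y, s, η, hy, hβ, fun a b c => ?_⟩
  -- In `dβ_i` the contributions of `s_i` and of `dh_i ∧ η_i` contain `dh_i` and disappear after
  -- wedging with it; only `h_i dη_i` remains.
  have h2 : ∀ i, w12 (L.grad (h i)) (L.dd (β i)) a b c =
      h i * w12 (L.grad (h i)) (L.dd (η i)) a b c := by
    intro i
    simp only [w12, dd, hβ, grad, map_add, D_mul]
    rw [L.D_comm b a, L.D_comm c a, L.D_comm c b, L.D_comm b a (h i), L.D_comm c a (h i),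
      L.D_comm c b (h i)]
    ring
  have h3 := hclosed a b c
  have h4 : ∀ i, (∏ j ∈ Finset.univ.erase i, h j) * h i = ∏ j, h j := fun i =>
    Finset.prod_erase_mul _ _ (Finset.mem_univ i)
  simp only [h2, ← mul_assoc, h4, ← Finset.mul_sum] at h3
  rw [d2_add, d2_sum]
  simp only [d2_w2_grad, Finset.sum_neg_distrib]
  -- Now the common factor is `h`, and cancelling it gives `∑ dh_i ∧ dη_i = dγ`, which is the
  -- closedness of `γ + ∑ dh_i ∧ η_i`.
  have h5 := L.prod_nzd Finset.univ h (fun i _ _ => hind.ne_zero i)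
    (L.d2 γ a b c - ∑ i, w12 (L.grad (h i)) (L.dd (η i)) a b c) (by rw [mul_sub, h3, sub_self])
  linear_combination h5

/-- With `x_i = h_i ε_i`, one has `dx_i/x_i ∧ d(y_i + x_i a_i) = dh_i/h_i ∧ dy_i + dε_i/ε_i ∧ dy_i +
dx_i ∧ da_i`. At the origin the last two terms are `b_i ∧ dy_i` and `dh_i ∧ a_i` when `ε_i = 1 +
b_i`. They and the `dz_j ∧ dz'_j` thus match the linear normal form of the regular part, and what
remains is closed and zero at the origin. -/
theorem normal_form [CharZero 𝕜] {n : ℕ} (L : LocalCalculus 𝕜 R (2 * n)) {k : ℕ}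
    (h : Fin k → R) (β : Fin k → Fin (2 * n) → R) (γ : Fin (2 * n) → Fin (2 * n) → R)
    (hγ : ∀ a b, γ a b = -γ b a) (h0 : ∀ i, L.ev (h i) = 0)
    (hind : LinearIndependent 𝕜 fun i => L.diff₀ (h i))
    (hclosed : ∀ a b c, ∑ i, (∏ j ∈ Finset.univ.erase i, h j) *
      w12 (L.grad (h i)) (L.dd (β i)) a b c = (∏ j, h j) * L.d2 γ a b c)
    (hvol : ∃ f, L.ev f ≠ 0 ∧ ∀ G B : Fin (2 * n) → Fin (2 * n) → R,
      (∀ c d, (∏ j, h j) * B c d = ∑ a, ∑ b, L.logForm h β γ a b * G a c * G b d) →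
      (∏ j, h j) * MvPolynomial.aeval (fun c : Fin (2 * n) × Fin (2 * n) => B c.1 c.2)
        (wedgePowPoly n id) = f * Matrix.det (Matrix.of G)) :
    k ≤ n ∧ ∃ (u : Coord n k → R) (ε ε' : Fin k → R) (τ : Fin (2 * n) → Fin (2 * n) → R),
      (∀ i, u (cx i) = h i * ε i) ∧ (∀ i, ε i * ε' i = 1) ∧ (∀ c, L.ev (u c) = 0) ∧
      (∀ v, (∀ c, L.diff₀ (u c) v = 0) → v = 0) ∧
      (∀ a b, τ a b = -τ b a) ∧ (∀ a b c, L.d2 τ a b c = 0) ∧ (∀ a b, L.ev (τ a b) = 0) ∧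
      ∀ a b, L.logForm h β γ a b =
        ∑ i, (∏ j ∈ Finset.univ.erase i, h j) *
          (ε' i * w2 (L.grad (u (cx i))) (L.grad (u (cy i))) a b)
        + (∏ j, h j) * (∑ j, w2 (L.grad (u (cz j))) (L.grad (u (cz' j))) a b + τ a b) := by
  have hnzd := L.prod_nzd Finset.univ h (fun i _ _ => hind.ne_zero i)
  have hnd := L.nondegenerate_at_zero h β γ hγ h0 hind hvol hnzd
  obtain ⟨y, s, η, hy, hβ, hτ0⟩ := L.exists_residue_primitives h β γ h0 hind hclosed
  set τ0 : Fin (2 * n) → Fin (2 * n) → R :=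
    fun a b => γ a b + ∑ i, w2 (L.grad (h i)) (η i) a b with hτ0def
  have hτ0neg : ∀ a b, τ0 a b = -τ0 b a := by
    intro a b
    simp only [hτ0def, hγ a b, neg_add, ← Finset.sum_neg_distrib]
    congr 1
    exact Finset.sum_congr rfl fun i _ => by simp only [w2]; ring
  have hevneg : ∀ a b, L.ev (τ0 a b) = -L.ev (τ0 b a) := fun a b => by rw [hτ0neg a b, map_neg]
  -- On the common kernel of the `dh_i` at the origin, `β_i` agrees with `dy_i`, and by `hγτ` below
  -- `γ` agrees with `τ0`. The nondegeneracy of `ω` therefore passes to `dy_i` and `τ0`.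
  have hβy : ∀ i v, (∀ i, L.diff₀ (h i) v = 0) →
      covector (fun a => L.ev (β i a)) v = L.diff₀ (y i) v := by
    intro i v hv
    have h1 := hv i
    rw [diff₀, covector_apply] at h1 ⊢
    rw [covector_apply, ← sub_eq_zero, ← Finset.sum_sub_distrib,
      ← mul_zero (L.ev (s i)), ← h1, Finset.mul_sum]
    refine Finset.sum_congr rfl fun a _ => ?_
    simp only [hβ, map_add, map_mul, h0]
    ring
  have hγτ : ∀ v w, (∀ i, L.diff₀ (h i) v = 0) → (∀ i, L.diff₀ (h i) w = 0) →
      bilinear (fun a b => L.ev (γ a b)) v w = bilinear (fun a b => L.ev (τ0 a b)) v w := by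
    intro v w hv hw
    have h1 : bilinear (fun a b => L.ev (τ0 a b)) v w = bilinear (fun a b => L.ev (γ a b)) v w +
        ∑ i, (L.diff₀ (h i) v * covector (fun a => L.ev (η i a)) w
          - L.diff₀ (h i) w * covector (fun a => L.ev (η i a)) v) := by
      simp only [bilinear_apply, hτ0def, map_add, map_sum, add_mul, Finset.sum_add_distrib,
        diff₀, covector_apply, Finset.sum_mul]
      congr 1
      have h2 : ∀ a, ∑ b, ∑ i, L.ev (w2 (L.grad (h i)) (η i) a b) * v a * w b =
          ∑ i, ∑ b, L.ev (w2 (L.grad (h i)) (η i) a b) * v a * w b := fun a => Finset.sum_comm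
      simp only [h2]
      rw [Finset.sum_comm]
      refine Finset.sum_congr rfl fun i _ => ?_
      simp only [Finset.mul_sum]
      rw [Finset.sum_comm (f := fun a b => L.ev (L.D a (h i)) * w a * (L.ev (η i b) * v b)),
        ← Finset.sum_sub_distrib]
      refine Finset.sum_congr rfl fun a _ => ?_
      rw [← Finset.sum_sub_distrib]
      refine Finset.sum_congr rfl fun b _ => ?_
      simp only [w2, grad, map_sub, map_mul]
      ring
    rw [h1]
    simp [hv, hw]
  obtain ⟨hkn, a, b, z, z', hnf, hker⟩ := exists_linear_normal_form n k (by simp)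
    (fun i => L.diff₀ (h i)) (fun i => L.diff₀ (y i)) (bilinear fun a b => L.ev (τ0 a b))
    (bilinear_self hevneg) hind (by
      intro s v h1 h2 h3
      refine hnd s v h1 (fun i => by rw [hβy i v h1, h2 i]) fun w hw => ?_
      rw [← h3 w hw, hγτ v w h1 hw]
      congr 1
      exact Finset.sum_congr rfl fun i _ => by rw [hβy i w hw])
  refine ⟨hkn, ?_⟩
  let ε : Fin k → R := fun i => 1 + L.lin (b i)
  have hε : ∀ i, L.ev (ε i) = 1 := fun i => by simp [ε, ev_lin]
  choose ε' hε' using fun i => (L.isUnit (ε i) (by rw [hε]; exact one_ne_zero)).exists_right_inv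
  have hDε : ∀ i c, L.D c (ε i) = L.D c (L.lin (b i)) := fun i c => by simp [ε]
  have hevε' : ∀ i, L.ev (ε' i) = 1 := fun i => by
    have := congrArg L.ev (hε' i)
    simpa [hε] using this
  let x : Fin k → R := fun i => h i * ε i
  have hevx : ∀ i, L.ev (x i) = 0 := fun i => by simp [x, h0]
  have hevDx : ∀ i c, L.ev (L.D c (x i)) = L.ev (L.D c (h i)) := fun i c => by
    simp [x, h0, hε]
  let u : Coord n k → R := Sum.elim (Sum.elim x fun i => y i + x i * L.lin (a i))
    (Sum.elim (fun j => L.lin (z j)) fun j => L.lin (z' j))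
  -- The error consists of `τ0` minus the regular terms produced by the new coordinates. Each of
  -- these is closed: two are wedge products of exact forms, and the first one is `d log ε_i ∧
  -- dy_i`.
  let τ : Fin (2 * n) → Fin (2 * n) → R := fun c d => τ0 c d
    - ∑ i, ε' i * w2 (L.grad (ε i)) (L.grad (y i)) c d
    - ∑ i, w2 (L.grad (x i)) (L.grad (L.lin (a i))) c d
    - ∑ j, w2 (L.grad (L.lin (z j))) (L.grad (L.lin (z' j))) c d
  have hdx : ∀ i, L.diff₀ (x i) = L.diff₀ (h i) := fun i => by
    simp only [diff₀, hevDx]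
  have hdy : ∀ i, L.diff₀ (y i + x i * L.lin (a i)) = L.diff₀ (y i) := fun i => by
    rw [L.diff₀_add_mul (hevx i), ev_lin, zero_smul, add_zero]
  refine ⟨u, ε, ε', τ, fun i => rfl, hε', ?_, fun v hv => ?_, fun c d => ?_, fun c d e => ?_,
    fun c d => ?_, fun c d => ?_⟩
  · rintro ((i | i) | (j | j))
    · exact hevx i
    · simp [u, hy, hevx]
    · exact L.ev_lin _
    · exact L.ev_lin _
  · refine hker v (fun i => ?_) (fun i => ?_) (fun j => ?_) fun j => ?_
    · rw [← hdx]; exact hv (cx i)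
    · rw [← hdy]; exact hv (cy i)
    · rw [← L.diff₀_lin (z j)]; exact hv (cz j)
    · rw [← L.diff₀_lin (z' j)]; exact hv (cz' j)
  · simp only [τ, hτ0neg c d, neg_sub]
    have h1 : ∀ (f g : Fin (2 * n) → R), w2 f g d c = -w2 f g c d := fun f g => by
      simp only [w2]; ring
    simp only [h1, mul_neg, Finset.sum_neg_distrib]
    ring
  · simp only [τ]
    rw [d2_sub, d2_sub, d2_sub, hτ0, d2_sum, d2_sum, d2_sum]
    simp only [d2_w2_grad_grad, L.d2_dlog_w2 (hε' _), Finset.sum_const_zero, sub_zero]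
  · have h1 := hnf (Pi.single c 1) (Pi.single d 1)
    simp only [bilinear_single] at h1
    simp only [τ, map_sub, map_sum, map_mul, hevε', one_mul, w2, grad, hDε, ev_D_lin, hevDx]
    rw [h1]
    simp only [diff₀, covector_single]
    ring
  · have h1 : ∀ i, (∏ j ∈ Finset.univ.erase i, h j) * h i = ∏ j, h j := fun i =>
      Finset.prod_erase_mul _ _ (Finset.mem_univ i)
    have h2 : ∀ i, (∏ j ∈ Finset.univ.erase i, h j) * w2 (L.grad (h i)) (β i) c d =
        (∏ j ∈ Finset.univ.erase i, h j) *
          (ε' i * w2 (L.grad (u (cx i))) (L.grad (u (cy i))) c d)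
        + (∏ j, h j) * (w2 (L.grad (h i)) (η i) c d - ε' i * w2 (L.grad (ε i)) (L.grad (y i)) c d
          - w2 (L.grad (x i)) (L.grad (L.lin (a i))) c d) := by
      intro i
      rw [← h1 i, mul_assoc, ← mul_add]
      congr 1
      simp only [u, Sum.elim_inl, Sum.elim_inr, w2, grad, hβ, x, map_add, D_mul]
      have h3 := hε' i
      generalize ε i = p at *
      generalize ε' i = q at *
      linear_combination (-(L.D c (h i) * L.D d (y i) - L.D d (h i) * L.D c (y i))
        - h i * ((h i * L.D c p + p * L.D c (h i)) * L.D d (L.lin (a i))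
          - (h i * L.D d p + p * L.D d (h i)) * L.D c (L.lin (a i)))) * h3
    simp only [logForm, h2, Finset.sum_add_distrib, ← Finset.mul_sum, Finset.sum_sub_distrib]
    simp only [u, τ, hτ0def, Sum.elim_inl, Sum.elim_inr]
    ring

end LocalCalculus

end LogSymplectic

/-! ### Formal power series: the order filtration and radial integration -/

namespace LogSymplectic

namespace Formal

open MvPowerSeries

variable {𝕜 : Type*} [Field 𝕜] {m : ℕ}

/-- The ideal of formal power series without terms of degree `< N`. -/
def orderIdeal (𝕜 : Type*) [Field 𝕜] (m N : ℕ) : Ideal (MvPowerSeries (Fin m) 𝕜) where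
  carrier := {f | (N : ℕ∞) ≤ f.order}
  add_mem' hf hg := (le_min hf hg).trans min_order_le_add
  zero_mem' := by simp
  smul_mem' c f hf := (le_trans hf le_add_self).trans le_order_mul

theorem mem_orderIdeal {N : ℕ} {f : MvPowerSeries (Fin m) 𝕜} :
    f ∈ orderIdeal 𝕜 m N ↔ (N : ℕ∞) ≤ f.order := Iff.rfl

theorem mem_orderIdeal_iff {N : ℕ} {f : MvPowerSeries (Fin m) 𝕜} :
    f ∈ orderIdeal 𝕜 m N ↔ ∀ d, Finsupp.degree d < N → coeff d f = 0 :=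
  ⟨fun h _ hd => coeff_of_lt_order (lt_of_lt_of_le (by exact_mod_cast hd) h),
    fun h => nat_le_order h⟩

theorem mul_mem_orderIdeal {p q : ℕ} {f g : MvPowerSeries (Fin m) 𝕜}
    (hf : f ∈ orderIdeal 𝕜 m p) (hg : g ∈ orderIdeal 𝕜 m q) : f * g ∈ orderIdeal 𝕜 m (p + q) := by
  rw [mem_orderIdeal] at *
  push_cast
  exact (add_le_add hf hg).trans le_order_mul

theorem orderIdeal_mono {p q : ℕ} (h : p ≤ q) : orderIdeal 𝕜 m q ≤ orderIdeal 𝕜 m p :=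
  fun _ hf => le_trans (by exact_mod_cast h) (mem_orderIdeal.mp hf)

theorem mem_orderIdeal_one {f : MvPowerSeries (Fin m) 𝕜} :
    f ∈ orderIdeal 𝕜 m 1 ↔ constantCoeff f = 0 := by
  rw [mem_orderIdeal, Nat.cast_one, one_le_order_iff_constCoeff_eq_zero]

theorem mem_orderIdeal_zero (f : MvPowerSeries (Fin m) 𝕜) : f ∈ orderIdeal 𝕜 m 0 := by
  rw [mem_orderIdeal]; simp

theorem eq_zero_of_mem_orderIdeal {f : MvPowerSeries (Fin m) 𝕜}
    (h : ∀ N, f ∈ orderIdeal 𝕜 m N) : f = 0 := by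
  ext d
  exact mem_orderIdeal_iff.mp (h (Finsupp.degree d + 1)) d (Nat.lt_succ_self _)

theorem pderiv_mem_orderIdeal {N : ℕ} {f : MvPowerSeries (Fin m) 𝕜}
    (hf : f ∈ orderIdeal 𝕜 m (N + 1)) (a : Fin m) : pderiv 𝕜 a f ∈ orderIdeal 𝕜 m N := by
  rw [mem_orderIdeal_iff] at *
  intro d hd
  rw [coeff_pderiv, hf, zero_mul]
  rw [map_add, Finsupp.degree_single]
  omega

/-- The ring of formal power series is complete. -/
theorem exists_series_sum (t : ℕ → MvPowerSeries (Fin m) 𝕜) (ht : ∀ j, t j ∈ orderIdeal 𝕜 m j) :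
    ∃ S, ∀ N, S - ∑ j ∈ Finset.range N, t j ∈ orderIdeal 𝕜 m N := by
  -- Only `t 0, …, t (degree d)` can contribute to the coefficient at `d`, because `t j` has order
  -- at least `j`.
  let S : MvPowerSeries (Fin m) 𝕜 :=
    fun d => ∑ j ∈ Finset.range (Finsupp.degree d + 1), coeff d (t j)
  have hS : ∀ d, coeff d S = ∑ j ∈ Finset.range (Finsupp.degree d + 1), coeff d (t j) :=
    fun d => rfl
  refine ⟨S, fun N => ?_⟩
  rw [mem_orderIdeal_iff]
  intro d hd
  rw [map_sub, hS, map_sum, sub_eq_zero]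
  refine Finset.sum_subset (Finset.range_mono hd) fun j _ hj => ?_
  refine mem_orderIdeal_iff.mp (ht j) d ?_
  simp at hj
  omega

theorem pderiv_comm (a b : Fin m) (f : MvPowerSeries (Fin m) 𝕜) :
    pderiv 𝕜 a (pderiv 𝕜 b f) = pderiv 𝕜 b (pderiv 𝕜 a f) := by
  ext d
  simp only [coeff_pderiv]
  by_cases h : a = b
  · subst h; rfl
  · rw [add_right_comm]
    simp only [Finsupp.add_apply, Finsupp.single_apply, h, Ne.symm h, if_false, add_zero]
    ring

/-- The operator `f ↦ ∫₀¹ t^s f(t x) dt`. -/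
noncomputable def radialIntegral (s : ℕ) : MvPowerSeries (Fin m) 𝕜 →+ MvPowerSeries (Fin m) 𝕜 where
  toFun f := fun d => coeff d f / (((Finsupp.degree d : ℕ) : 𝕜) + s + 1)
  map_zero' := by
    funext d
    change coeff d 0 / _ = (0 : 𝕜)
    rw [map_zero, zero_div]
  map_add' f g := by
    funext d
    change coeff d (f + g) / _ = coeff d f / _ + coeff d g / _
    rw [map_add, add_div]

theorem coeff_radialIntegral (s : ℕ) (f : MvPowerSeries (Fin m) 𝕜) (d : Fin m →₀ ℕ) :
    coeff d (radialIntegral s f) = coeff d f / (((Finsupp.degree d : ℕ) : 𝕜) + s + 1) := rfl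

theorem radialIntegral_mem_orderIdeal {N : ℕ} {f : MvPowerSeries (Fin m) 𝕜}
    (hf : f ∈ orderIdeal 𝕜 m N) (s : ℕ) : radialIntegral s f ∈ orderIdeal 𝕜 m N := by
  rw [mem_orderIdeal_iff] at *
  intro d hd
  rw [coeff_radialIntegral, hf d hd, zero_div]

theorem pderiv_radialIntegral (s : ℕ) (a : Fin m) (f : MvPowerSeries (Fin m) 𝕜) :
    pderiv 𝕜 a (radialIntegral s f) = radialIntegral (s + 1) (pderiv 𝕜 a f) := by
  ext d
  rw [coeff_pderiv, coeff_radialIntegral, coeff_radialIntegral, coeff_pderiv, map_add,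
    Finsupp.degree_single]
  push_cast
  rw [div_mul_eq_mul_div]
  congr 1
  ring

theorem coeff_X_mul_pderiv (a : Fin m) (f : MvPowerSeries (Fin m) 𝕜) (d : Fin m →₀ ℕ) :
    coeff d (X a * pderiv 𝕜 a f) = d a * coeff d f := by
  rw [X_def, coeff_monomial_mul]
  split_ifs with h
  · rw [coeff_pderiv, tsub_add_cancel_of_le h, one_mul, mul_comm]
    congr 1
    have h1 : 1 ≤ d a := by simpa using h a
    rw [Finsupp.tsub_apply, Finsupp.single_eq_same, Nat.cast_sub h1]
    simp
  · have h1 : d a = 0 := by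
      by_contra h1
      exact h (Finsupp.single_le_iff.mpr (Nat.one_le_iff_ne_zero.mpr h1))
    simp [h1]

/-- On monomials of degree `e` the Euler field is multiplication by `e`, and the radial integral
divides by `e + s + 1`. -/
theorem euler_radialIntegral [CharZero 𝕜] (s : ℕ) (f : MvPowerSeries (Fin m) 𝕜) :
    ∑ a, X a * pderiv 𝕜 a (radialIntegral s f) +
      ((s : MvPowerSeries (Fin m) 𝕜) + 1) * radialIntegral s f = f := by
  ext d
  have h1 : ((s : MvPowerSeries (Fin m) 𝕜) + 1) = C ((s : 𝕜) + 1) := by simp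
  rw [map_add, map_sum, h1, coeff_C_mul]
  simp only [coeff_X_mul_pderiv, ← Finset.sum_mul]
  rw [← add_mul, coeff_radialIntegral]
  have h2 : ∑ a, (d a : 𝕜) = ((Finsupp.degree d : ℕ) : 𝕜) := by
    rw [Finsupp.degree_eq_sum]
    push_cast
    rfl
  rw [h2, ← add_assoc]
  have h3 : (((Finsupp.degree d : ℕ) : 𝕜) + s + 1) ≠ 0 := by
    exact_mod_cast Nat.succ_ne_zero (Finsupp.degree d + s)
  field_simp

/-! ### Formal power series: retractions onto a smooth hypersurface -/

section Retraction

variable [CharZero 𝕜] {A : Type*} [CommRing A] [Algebra 𝕜 A] (D : Derivation 𝕜 A A)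

/-- The divided powers of a derivation. -/
def dividedPower (j : ℕ) (f : A) : A := ((j.factorial : 𝕜)⁻¹) • (D^[j] f)

theorem dividedPower_succ (j : ℕ) (f : A) :
    ((j : A) + 1) * dividedPower D (j + 1) f = D (dividedPower D j f) := by
  rw [dividedPower, dividedPower, Function.iterate_succ_apply', Derivation.map_smul,
    Nat.factorial_succ]
  have h1 : ((j : A) + 1) = algebraMap 𝕜 A ((j : 𝕜) + 1) := by simp
  rw [h1, ← Algebra.smul_def, smul_smul]
  congr 1
  have : ((j : 𝕜) + 1) ≠ 0 := by exact_mod_cast Nat.succ_ne_zero j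
  push_cast
  rw [mul_inv, mul_inv_cancel_left₀ this]

theorem dividedPower_zero (f : A) : dividedPower D 0 f = f := by simp [dividedPower]

theorem iterate_map_add (j : ℕ) (f g : A) : D^[j] (f + g) = D^[j] f + D^[j] g := by
  induction j generalizing f g with
  | zero => rfl
  | succ j ih => rw [Function.iterate_succ_apply, map_add, ih]; rfl

theorem dividedPower_add (j : ℕ) (f g : A) :
    dividedPower D j (f + g) = dividedPower D j f + dividedPower D j g := by
  rw [dividedPower, iterate_map_add, smul_add]; rfl

/-- This Leibniz rule makes `f ↦ ∑ (-h)^j D^{[j]} f` multiplicative. In the induction both sides are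
multiplied by the unit `n + 1`, which is split as `p.1 + p.2` on the antidiagonal. -/
theorem dividedPower_mul (n : ℕ) (f g : A) : dividedPower D n (f * g) =
    ∑ p ∈ Finset.HasAntidiagonal.antidiagonal n, dividedPower D p.1 f * dividedPower D p.2 g := by
  induction n with
  | zero => simp [dividedPower]
  | succ n ih =>
    have hunit : IsUnit ((n : A) + 1) := by
      have h1 : ((n : A) + 1) = algebraMap 𝕜 A ((n : 𝕜) + 1) := by simp
      rw [h1]
      exact (IsUnit.mk0 _ (by exact_mod_cast Nat.succ_ne_zero n)).map _
    refine hunit.mul_left_cancel ?_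
    rw [dividedPower_succ, ih, map_sum]
    have h1 : ∀ p : ℕ × ℕ, D (dividedPower D p.1 f * dividedPower D p.2 g) =
        ((p.1 + 1 : ℕ) : A) * (dividedPower D (p.1 + 1) f * dividedPower D p.2 g) +
        ((p.2 + 1 : ℕ) : A) * (dividedPower D p.1 f * dividedPower D (p.2 + 1) g) := by
      intro p
      rw [Derivation.leibniz, ← dividedPower_succ, ← dividedPower_succ]
      push_cast
      simp only [smul_eq_mul]
      ring
    have h2 : ((n : A) + 1) * ∑ p ∈ Finset.HasAntidiagonal.antidiagonal (n + 1),
        dividedPower D p.1 f * dividedPower D p.2 g =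
        ∑ p ∈ Finset.HasAntidiagonal.antidiagonal (n + 1),
          (p.1 : A) * (dividedPower D p.1 f * dividedPower D p.2 g) +
        ∑ p ∈ Finset.HasAntidiagonal.antidiagonal (n + 1),
          (p.2 : A) * (dividedPower D p.1 f * dividedPower D p.2 g) := by
      rw [Finset.mul_sum, ← Finset.sum_add_distrib]
      refine Finset.sum_congr rfl fun p hp => ?_
      rw [← add_mul, ← Nat.cast_add, Finset.HasAntidiagonal.mem_antidiagonal.mp hp]
      push_cast
      rfl
    rw [h2]
    simp only [h1, Finset.sum_add_distrib]
    congr 1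
    · rw [Finset.Nat.sum_antidiagonal_succ]
      simp
    · rw [Finset.Nat.sum_antidiagonal_succ']
      simp

theorem dividedPower_eq_zero {f : A} {n : ℕ} (h : D^[n] f = 0) {j : ℕ} (hj : n ≤ j) :
    dividedPower D j f = 0 := by
  obtain ⟨i, rfl⟩ := Nat.exists_eq_add_of_le hj
  rw [dividedPower, add_comm, Function.iterate_add_apply, h]
  have : D^[i] 0 = 0 := by
    induction i with
    | zero => rfl
    | succ i ih => rw [Function.iterate_succ_apply, map_zero, ih (by omega)]
  rw [this, smul_zero]

theorem dividedPower_comm (D' : Derivation 𝕜 A A) (h : ∀ f, D' (D f) = D (D' f)) (j : ℕ) (f : A) :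
    D' (dividedPower D j f) = dividedPower D j (D' f) := by
  rw [dividedPower, dividedPower, Derivation.map_smul]
  congr 1
  induction j generalizing f with
  | zero => rfl
  | succ j ih => rw [Function.iterate_succ_apply, ih, h]; rfl

theorem sum_range_mul_sum_range (N : ℕ) (F : ℕ × ℕ → A) :
    ∑ n ∈ Finset.range N, ∑ p ∈ Finset.HasAntidiagonal.antidiagonal n, F p =
      ∑ p ∈ (Finset.range N ×ˢ Finset.range N).filter (fun p => p.1 + p.2 < N), F p := by
  rw [Finset.sum_sigma']
  refine Finset.sum_bij' (fun x _ => x.2) (fun p _ => ⟨p.1 + p.2, p⟩) ?_ ?_ ?_ ?_ ?_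
  · rintro ⟨n, p⟩ h
    simp only [Finset.mem_sigma, Finset.mem_range, Finset.HasAntidiagonal.mem_antidiagonal] at h
    simp only [Finset.mem_filter, Finset.mem_product, Finset.mem_range]
    omega
  · rintro p h
    simp only [Finset.mem_filter, Finset.mem_product, Finset.mem_range] at h
    simp [h]
  · rintro ⟨n, p⟩ h
    simp only [Finset.mem_sigma, Finset.mem_range, Finset.HasAntidiagonal.mem_antidiagonal] at h
    simp [h]
  · intros; rfl
  · intros; rfl

end Retraction

end Formal

end LogSymplectic

namespace LogSymplectic

namespace Formal

open MvPowerSeries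

variable {𝕜 : Type*} [Field 𝕜] [CharZero 𝕜] {m : ℕ}

/-- The sum telescopes: since `D h = 1`, the derivative of `(-h)^j` cancels the derivative of the
preceding divided power. In the limit, the retraction takes values in the kernel of `D`. -/
theorem iterate_dividedPower_series (D : Derivation 𝕜 (MvPowerSeries (Fin m) 𝕜)
    (MvPowerSeries (Fin m) 𝕜)) (h : MvPowerSeries (Fin m) 𝕜) (hD : D h = 1) (f : MvPowerSeries (Fin m) 𝕜)
    (N : ℕ) : D (∑ j ∈ Finset.range (N + 1), (-h) ^ j * dividedPower D j f) =
      (-h) ^ N * D (dividedPower D N f) := by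
  induction N with
  | zero => simp
  | succ N ih =>
    rw [Finset.sum_range_succ, map_add, ih, Derivation.leibniz, Derivation.leibniz_pow, map_neg, hD]
    rw [← dividedPower_succ D N]
    simp only [smul_eq_mul, Nat.add_sub_cancel, nsmul_eq_mul]
    push_cast
    ring

/-- The retraction onto the hypersurface `h = 0` along the flow of `D`, where `D h = 1`:
`f ↦ ∑ j, (-h)^j / j! D^j f`. -/
theorem exists_retraction (h : MvPowerSeries (Fin m) 𝕜) (h0 : constantCoeff h = 0)
    (D : Derivation 𝕜 (MvPowerSeries (Fin m) 𝕜) (MvPowerSeries (Fin m) 𝕜)) (hD : D h = 1)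
    (hord : ∀ N f, f ∈ orderIdeal 𝕜 m (N + 1) → D f ∈ orderIdeal 𝕜 m N) :
    ∃ π : MvPowerSeries (Fin m) 𝕜 →+* MvPowerSeries (Fin m) 𝕜, π h = 0 ∧
      (∀ f, ∃ e, π f = f + h * e) ∧ (∀ f, D (π f) = 0) ∧
      ∀ D' : Derivation 𝕜 (MvPowerSeries (Fin m) 𝕜) (MvPowerSeries (Fin m) 𝕜),
        D' h = 0 → (∀ f, D' (D f) = D (D' f)) →
        (∀ N f, f ∈ orderIdeal 𝕜 m (N + 1) → D' f ∈ orderIdeal 𝕜 m N) →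
        ∀ f, D' (π f) = π (D' f) := by
  have hpow : ∀ j (g : MvPowerSeries (Fin m) 𝕜), (-h) ^ j * g ∈ orderIdeal 𝕜 m j := by
    intro j g
    refine Ideal.mul_mem_right _ _ ?_
    induction j with
    | zero => exact mem_orderIdeal_zero _
    | succ j ih =>
      rw [pow_succ]
      exact mul_mem_orderIdeal ih (Ideal.neg_mem_iff _ |>.mpr (mem_orderIdeal_one.mpr h0))
  let P : ℕ → MvPowerSeries (Fin m) 𝕜 → MvPowerSeries (Fin m) 𝕜 :=
    fun N f => ∑ j ∈ Finset.range N, (-h) ^ j * dividedPower D j f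
  choose π hπ using fun f : MvPowerSeries (Fin m) 𝕜 =>
    exists_series_sum (fun j => (-h) ^ j * dividedPower D j f) (fun j => hpow j _)
  change ∀ f N, π f - P N f ∈ orderIdeal 𝕜 m N at hπ
  have huniq : ∀ f g, (∀ N, g - P N f ∈ orderIdeal 𝕜 m N) → π f = g := by
    intro f g hg
    refine sub_eq_zero.mp (eq_zero_of_mem_orderIdeal fun N => ?_)
    have := (orderIdeal 𝕜 m N).sub_mem (hπ f N) (hg N)
    simpa using this
  have hP0 : ∀ f (N : ℕ), D f = 0 → f - P N f ∈ orderIdeal 𝕜 m N := by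
    intro f N hf
    rcases N with _ | N
    · exact mem_orderIdeal_zero _
    · simp only [P]
      rw [Finset.sum_range_succ', Finset.sum_eq_zero]
      · simp [dividedPower_zero]
      · intro j _
        rw [dividedPower_eq_zero D (n := 1) (by simpa using hf) (by omega), mul_zero]
  have hadd : ∀ N f g, P N (f + g) = P N f + P N g := by
    intro N f g
    simp only [P, dividedPower_add, mul_add, Finset.sum_add_distrib]
  let ρ : MvPowerSeries (Fin m) 𝕜 →+* MvPowerSeries (Fin m) 𝕜 :=
    { toFun := π
      map_one' := huniq _ _ fun N => hP0 _ _ (Derivation.map_one_eq_zero D)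
      map_zero' := huniq _ _ fun N => hP0 _ _ (map_zero D)
      map_add' := fun f g => huniq _ _ fun N => by
        rw [hadd]
        have := (orderIdeal 𝕜 m N).add_mem (hπ f N) (hπ g N)
        convert this using 1
        ring
      map_mul' := fun f g => huniq _ _ fun N => by
        -- The products with `p.1 + p.2 < N` form the partial sum for `f * g`; the others contain
        -- `h^N`.
        have h1 : P N f * P N g - P N (f * g) ∈ orderIdeal 𝕜 m N := by
          have h2 : P N (f * g) = ∑ n ∈ Finset.range N, ∑ p ∈ Finset.HasAntidiagonal.antidiagonal n,
              ((-h) ^ p.1 * dividedPower D p.1 f) * ((-h) ^ p.2 * dividedPower D p.2 g) := by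
            refine Finset.sum_congr rfl fun n _ => ?_
            rw [dividedPower_mul, Finset.mul_sum]
            refine Finset.sum_congr rfl fun p hp => ?_
            rw [← Finset.HasAntidiagonal.mem_antidiagonal.mp hp, pow_add]
            ring
          rw [h2, sum_range_mul_sum_range]
          simp only [P]
          rw [Finset.sum_mul_sum, ← Finset.sum_product',
            ← Finset.sum_filter_add_sum_filter_not (Finset.range N ×ˢ Finset.range N)
              (fun p => p.1 + p.2 < N), add_sub_cancel_left]
          refine Ideal.sum_mem _ fun p hp => ?_
          rw [Finset.mem_filter] at hp
          exact orderIdeal_mono (not_lt.mp hp.2) (mul_mem_orderIdeal (hpow _ _) (hpow _ _))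
        have h2 := (orderIdeal 𝕜 m N).mul_mem_right (π g) (hπ f N)
        have h3 := (orderIdeal 𝕜 m N).mul_mem_left (P N f) (hπ g N)
        have h4 := (orderIdeal 𝕜 m N).add_mem ((orderIdeal 𝕜 m N).add_mem h2 h3) h1
        convert h4 using 1
        ring }
  have hρ : ∀ f, ρ f = π f := fun f => rfl
  refine ⟨ρ, ?_, fun f => ?_, fun f => ?_, fun D' hD'h hcomm hord' f => ?_⟩
  · refine huniq _ _ fun N => ?_
    rcases N with _ | _ | N
    · exact mem_orderIdeal_zero _
    · simp [P, dividedPower_zero, mem_orderIdeal_one, h0]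
    -- Since `D h = 1` and `D² h = 0`, the series for `h` is `h - h`. The orders `N ≤ 1`, where the
    -- partial sum is not yet complete, are treated separately.
    · have h1 : P (N + 2) h = 0 := by
        simp only [P]
        rw [Finset.sum_range_succ', Finset.sum_range_succ', Finset.sum_eq_zero]
        · simp [dividedPower, hD]
        · intro j _
          rw [dividedPower_eq_zero D (n := 2) (by simp [hD]) (by omega), mul_zero]
      rw [h1, sub_zero]
      exact zero_mem _
  · obtain ⟨e, he⟩ := exists_series_sum (fun j => (-h) ^ j * (-dividedPower D (j + 1) f))
      (fun j => hpow j _)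
    refine ⟨e, huniq _ _ fun N => ?_⟩
    rcases N with _ | N
    · exact mem_orderIdeal_zero _
    · have h1 : P (N + 1) f =
          f + h * ∑ j ∈ Finset.range N, (-h) ^ j * (-dividedPower D (j + 1) f) := by
        simp only [P]
        rw [Finset.sum_range_succ', Finset.mul_sum, add_comm]
        congr 1
        · simp [dividedPower_zero]
        · exact Finset.sum_congr rfl fun j _ => by rw [pow_succ]; ring
      rw [h1, add_sub_add_left_eq_sub, ← mul_sub, add_comm N 1]
      exact mul_mem_orderIdeal (mem_orderIdeal_one.mpr h0) (he N)
  · refine eq_zero_of_mem_orderIdeal fun N => ?_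
    have h1 := hord N _ (hπ f (N + 1))
    rw [map_sub] at h1
    have h2 : D (P (N + 1) f) ∈ orderIdeal 𝕜 m N := by
      simp only [P]
      rw [iterate_dividedPower_series D h hD]
      exact hpow _ _
    have := (orderIdeal 𝕜 m N).add_mem h1 h2
    simpa [hρ] using this
  -- A derivation `D'` that kills `h` and commutes with `D` passes through every term of the series.
  · refine (huniq _ _ fun N => ?_).symm
    have h1 := hord' N _ (hπ f (N + 1))
    rw [map_sub] at h1
    have h2 : D' (P (N + 1) f) = P (N + 1) (D' f) := by
      simp only [P, map_sum]
      refine Finset.sum_congr rfl fun j _ => ?_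
      rw [Derivation.leibniz, Derivation.leibniz_pow, map_neg, hD'h, dividedPower_comm D D' hcomm]
      simp
    rw [h2] at h1
    have h3 : P (N + 1) (D' f) - P N (D' f) ∈ orderIdeal 𝕜 m N := by
      simp only [P]
      rw [Finset.sum_range_succ, add_sub_cancel_left]
      exact hpow _ _
    have := (orderIdeal 𝕜 m N).add_mem h1 h3
    simpa [hρ] using this

/-- The derivation `D = (∂_a h)⁻¹ ∂_a` satisfies `D h = 1`. For every `b` the derivation `∂_b - (∂_b
h) D` kills `h` and commutes with `D`, hence with the retraction. Since `D` vanishes on the image,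
this expresses `∂_b (π f)` by `π(∂_b f)` and `π(∂_a f)`. Comparison with the case of the coordinates
is the chain rule. -/
theorem exists_retraction_of_pderiv (h : MvPowerSeries (Fin m) 𝕜) (h0 : constantCoeff h = 0)
    (a : Fin m) (ha : constantCoeff (pderiv 𝕜 a h) ≠ 0) :
    ∃ π : MvPowerSeries (Fin m) 𝕜 →+* MvPowerSeries (Fin m) 𝕜, π h = 0 ∧
      (∀ f, ∃ e, π f = f + h * e) ∧
      ∀ b f, pderiv 𝕜 b (π f) = ∑ c, π (pderiv 𝕜 c f) * pderiv 𝕜 b (π (X c)) := by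
  obtain ⟨q, hq⟩ : ∃ q, pderiv 𝕜 a h * q = 1 := ⟨_, MvPowerSeries.mul_inv_cancel _ ha⟩
  let D : Derivation 𝕜 (MvPowerSeries (Fin m) 𝕜) (MvPowerSeries (Fin m) 𝕜) := q • pderiv 𝕜 a
  have hDa : ∀ f, D f = q * pderiv 𝕜 a f := fun f => rfl
  obtain ⟨π, hπ, hπf, hDπ, hcomm⟩ := exists_retraction h h0 D (by rw [hDa, mul_comm, hq])
    (fun N f hf => Ideal.mul_mem_left _ _ (pderiv_mem_orderIdeal hf a))
  refine ⟨π, hπ, hπf, ?_⟩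
  have hq' : ∀ b, pderiv 𝕜 b q = -q ^ 2 * pderiv 𝕜 b (pderiv 𝕜 a h) := by
    intro b
    have h1 := congrArg (pderiv 𝕜 b) hq
    rw [Derivation.leibniz, Derivation.map_one_eq_zero, smul_eq_mul, smul_eq_mul] at h1
    linear_combination q * h1 - pderiv 𝕜 b q * hq
  have key : ∀ b f, pderiv 𝕜 b (π f) = π (pderiv 𝕜 b f) - π (pderiv 𝕜 b h) * π q * π (pderiv 𝕜 a f) := by
    intro b f
    let D' : Derivation 𝕜 (MvPowerSeries (Fin m) 𝕜) (MvPowerSeries (Fin m) 𝕜) :=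
      pderiv 𝕜 b - (pderiv 𝕜 b h) • D
    have hD' : ∀ f, D' f = pderiv 𝕜 b f - pderiv 𝕜 b h * D f := fun f => rfl
    have h1 := hcomm D' (by rw [hD', hDa, mul_comm q, hq, mul_one, sub_self]) (fun f => by
        simp only [hD', hDa, map_sub, Derivation.leibniz, smul_eq_mul]
        rw [hq' b, pderiv_comm b a f, pderiv_comm b a h]
        ring)
      (fun N f hf => Ideal.sub_mem _ (pderiv_mem_orderIdeal hf b)
        (Ideal.mul_mem_left _ _ (Ideal.mul_mem_left _ _ (pderiv_mem_orderIdeal hf a)))) f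
    rw [hD', hDπ, hD', hDa, map_sub, map_mul, map_mul] at h1
    linear_combination h1
  intro b f
  have hX : ∀ a c : Fin m, pderiv 𝕜 a (X c : MvPowerSeries (Fin m) 𝕜) = if a = c then 1 else 0 := by
    intro a c
    rw [pderiv_X]
    simp [Pi.single_apply, eq_comm]
  rw [key]
  simp only [key b (X _), hX, apply_ite π, map_one, map_zero, mul_sub, mul_ite, mul_one, mul_zero,
    Finset.sum_sub_distrib, Finset.sum_ite_eq, Finset.mem_univ, if_true]
  ring

/-- The local calculus of formal power series. -/
noncomputable def formalCalculus (𝕜 : Type*) [Field 𝕜] [CharZero 𝕜] (m : ℕ) :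
    LocalCalculus 𝕜 (MvPowerSeries (Fin m) 𝕜) m where
  D := pderiv 𝕜
  D_comm := pderiv_comm
  ev := { (constantCoeff : MvPowerSeries (Fin m) 𝕜 →+* 𝕜) with
    commutes' := fun r => by
      change constantCoeff (algebraMap 𝕜 (MvPowerSeries (Fin m) 𝕜) r) = r
      rw [MvPowerSeries.algebraMap_apply]
      simp }
  isUnit f hf := isUnit_iff_constantCoeff.mpr (IsUnit.mk0 _ hf)
  X := X
  ev_X a := constantCoeff_X a
  D_X a b := by rw [pderiv_X]; simp [Pi.single_apply, eq_comm]
  I := radialIntegral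
  D_I s a f := pderiv_radialIntegral s a f
  euler := euler_radialIntegral
  nzd f _ a ha g hg := by
    refine (mul_eq_zero.mp hg).resolve_left ?_
    rintro rfl
    exact ha (by simp)
  retract h h0 a ha := exists_retraction_of_pderiv h h0 a ha

end Formal

end LogSymplectic

/-! ### Formal removal of the error by iteration -/

namespace LogSymplectic

theorem card_coord {n k : ℕ} (hkn : k ≤ n) : Fintype.card (Coord n k) = 2 * n := by
  simp only [Coord, Fintype.card_sum, Fintype.card_fin]
  omega

theorem w2_swap {R : Type*} [CommRing R] {m : ℕ} (α β : Fin m → R) (a b : Fin m) :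
    w2 α β a b = -w2 α β b a := by
  simp only [w2]; ring

namespace Formal

open MvPowerSeries

variable {𝕜 : Type*} [Field 𝕜] [CharZero 𝕜]

local notation "ℒ" => formalCalculus

theorem formalCalculus_D {m : ℕ} (a : Fin m) : (ℒ 𝕜 m).D a = pderiv 𝕜 a := rfl

theorem formalCalculus_ev {m : ℕ} (f : MvPowerSeries (Fin m) 𝕜) :
    (ℒ 𝕜 m).ev f = constantCoeff f := rfl

theorem grad_mem {m N : ℕ} {f : MvPowerSeries (Fin m) 𝕜} (hf : f ∈ orderIdeal 𝕜 m (N + 1))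
    (a : Fin m) : (ℒ 𝕜 m).grad f a ∈ orderIdeal 𝕜 m N :=
  pderiv_mem_orderIdeal hf a

theorem w2_mem {m p q : ℕ} {α β : Fin m → MvPowerSeries (Fin m) 𝕜}
    (hα : ∀ a, α a ∈ orderIdeal 𝕜 m p) (hβ : ∀ a, β a ∈ orderIdeal 𝕜 m q) (a b : Fin m) :
    w2 α β a b ∈ orderIdeal 𝕜 m (p + q) :=
  Ideal.sub_mem _ (mul_mem_orderIdeal (hα a) (hβ b)) (mul_mem_orderIdeal (hα b) (hβ a))

/-- Formal coordinates in which `h₁ ⋯ h_k ω = Ω` is canonical up to the closed regular form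
`τ` of order `N`. -/
structure IsNormalUpTo {n k : ℕ} (h : Fin k → MvPowerSeries (Fin (2 * n)) 𝕜)
    (Ω : Fin (2 * n) → Fin (2 * n) → MvPowerSeries (Fin (2 * n)) 𝕜) (N : ℕ)
    (u : Coord n k → MvPowerSeries (Fin (2 * n)) 𝕜) (ε ε' : Fin k → MvPowerSeries (Fin (2 * n)) 𝕜)
    (τ : Fin (2 * n) → Fin (2 * n) → MvPowerSeries (Fin (2 * n)) 𝕜) : Prop where
  eq_mul : ∀ i, u (cx i) = h i * ε i
  mul_eq_one : ∀ i, ε i * ε' i = 1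
  ev_eq_zero : ∀ c, constantCoeff (u c) = 0
  ker : ∀ v, (∀ c, (ℒ 𝕜 (2 * n)).diff₀ (u c) v = 0) → v = 0
  antisymm : ∀ a b, τ a b = -τ b a
  closed : ∀ a b c, (ℒ 𝕜 (2 * n)).d2 τ a b c = 0
  mem : ∀ a b, τ a b ∈ orderIdeal 𝕜 (2 * n) N
  eq : ∀ a b, Ω a b =
        ∑ i, (∏ j ∈ Finset.univ.erase i, h j) *
          (ε' i * w2 ((ℒ 𝕜 (2 * n)).grad (u (cx i))) ((ℒ 𝕜 (2 * n)).grad (u (cy i))) a b)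
        + (∏ j, h j) * (∑ j, w2 ((ℒ 𝕜 (2 * n)).grad (u (cz j)))
          ((ℒ 𝕜 (2 * n)).grad (u (cz' j))) a b + τ a b)

theorem diff₀_eq_of_sub_mem {m : ℕ} {f g : MvPowerSeries (Fin m) 𝕜}
    (h : f - g ∈ orderIdeal 𝕜 m 2) : (ℒ 𝕜 m).diff₀ f = (ℒ 𝕜 m).diff₀ g := by
  simp only [LocalCalculus.diff₀]
  congr 1
  funext a
  have h1 := mem_orderIdeal_one.mp (pderiv_mem_orderIdeal (N := 1) h a)
  rw [map_sub, map_sub, sub_eq_zero] at h1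
  exact h1

/-- One step of the Newton iteration. -/
theorem IsNormalUpTo.step {n k : ℕ} (hkn : k ≤ n) {h : Fin k → MvPowerSeries (Fin (2 * n)) 𝕜}
    {Ω : Fin (2 * n) → Fin (2 * n) → MvPowerSeries (Fin (2 * n)) 𝕜} {N : ℕ} (hN : 1 ≤ N)
    {u : Coord n k → MvPowerSeries (Fin (2 * n)) 𝕜} {ε ε' : Fin k → MvPowerSeries (Fin (2 * n)) 𝕜}
    {τ : Fin (2 * n) → Fin (2 * n) → MvPowerSeries (Fin (2 * n)) 𝕜}
    (H : IsNormalUpTo h Ω N u ε ε' τ) :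
    ∃ u₁ ε₁ ε₁' τ₁, IsNormalUpTo h Ω (N + 1) u₁ ε₁ ε₁' τ₁ ∧
      (∀ c, u₁ c - u c ∈ orderIdeal 𝕜 (2 * n) (N + 1)) ∧
      (∀ i, ε₁ i - ε i ∈ orderIdeal 𝕜 (2 * n) (N + 1)) ∧
      (∀ i, ε₁' i - ε' i ∈ orderIdeal 𝕜 (2 * n) (N + 1)) := by
  set L := ℒ 𝕜 (2 * n) with hL
  let e : Fin (2 * n) ≃ Coord n k := (Fintype.equivFinOfCardEq (card_coord hkn)).symm
  obtain ⟨E, hE1, hE2, -⟩ := L.exists_frame e u H.ker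
  -- These are the coefficients of the radial primitive in the coframe `du_c`, so that `τ = ∑ dθ_c ∧
  -- du_c`. Integration gains one order.
  let θ : Coord n k → MvPowerSeries (Fin (2 * n)) 𝕜 := fun c => ∑ a, L.prim τ a * E a c
  have hprim : ∀ a, L.prim τ a ∈ orderIdeal 𝕜 (2 * n) (N + 1) := fun a =>
    Ideal.sum_mem _ fun b _ => by
      rw [add_comm]
      exact mul_mem_orderIdeal (mem_orderIdeal_one.mpr (constantCoeff_X b))
        (radialIntegral_mem_orderIdeal (H.mem b a) 1)
  have hθ : ∀ c, θ c ∈ orderIdeal 𝕜 (2 * n) (N + 1) := fun c =>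
    Ideal.sum_mem _ fun a _ => Ideal.mul_mem_right _ _ (hprim a)
  have hθu : ∀ b, L.prim τ b = ∑ c, θ c * L.D b (u c) := by
    intro b
    simp only [θ, Finset.sum_mul]
    rw [Finset.sum_comm]
    simp only [mul_assoc, ← Finset.mul_sum, hE2]
    simp
  have hτ : ∀ a b, τ a b = ∑ c, w2 (L.grad (θ c)) (L.grad (u c)) a b := by
    intro a b
    rw [← L.dd_prim τ H.antisymm H.closed a b, LocalCalculus.dd, hθu, hθu, map_sum, map_sum,
      ← Finset.sum_sub_distrib]
    refine Finset.sum_congr rfl fun c _ => ?_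
    rw [L.D_mul, L.D_mul, L.D_comm b a]
    simp only [w2, LocalCalculus.grad]
    ring
  -- The corrections are read off from `τ = ∑ dθ_c ∧ du_c`. Multiplying `x` by `1 + θ_y` adds `dθ_y
  -- ∧ dy` to first order. Subtracting `x θ_x` from `y` adds `-dx ∧ dθ_x = dθ_x ∧ dx`. Replacing `z,
  -- z'` by `z + θ_{z'}, z' - θ_z` adds `dθ_{z'} ∧ dz' + dθ_z ∧ dz`, again up to quadratic terms.
  let p : Fin k → MvPowerSeries (Fin (2 * n)) 𝕜 := fun i => θ (cy i)
  have hp0 : ∀ i, constantCoeff (1 + p i) = 1 := fun i => by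
    have := mem_orderIdeal_one.mp (orderIdeal_mono (Nat.le_add_left 1 N) (hθ (cy i)))
    rw [map_add, map_one, this, add_zero]
  choose q hq using fun i => (L.isUnit (1 + p i) (by
    rw [hL, formalCalculus_ev, hp0]; exact one_ne_zero)).exists_right_inv
  have hq1 : ∀ i, q i - 1 ∈ orderIdeal 𝕜 (2 * n) (N + 1) := fun i => by
    have : q i - 1 = -(p i * q i) := by linear_combination hq i
    rw [this]
    exact neg_mem (Ideal.mul_mem_right _ _ (hθ _))
  let Y : Fin k → MvPowerSeries (Fin (2 * n)) 𝕜 := fun i => -(u (cx i) * θ (cx i))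
  have hY : ∀ i, Y i ∈ orderIdeal 𝕜 (2 * n) (N + 1 + 1) := fun i => by
    rw [add_comm (N + 1)]
    exact neg_mem (mul_mem_orderIdeal (mem_orderIdeal_one.mpr (H.ev_eq_zero _)) (hθ _))
  let u₁ : Coord n k → MvPowerSeries (Fin (2 * n)) 𝕜 :=
    Sum.elim (Sum.elim (fun i => u (cx i) * (1 + p i)) fun i => u (cy i) + Y i)
      (Sum.elim (fun j => u (cz j) + θ (cz' j)) fun j => u (cz' j) - θ (cz j))
  have hu₁ : ∀ c, u₁ c - u c ∈ orderIdeal 𝕜 (2 * n) (N + 1) := by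
    rintro ((i | i) | (j | j))
    · have : u₁ (cx i) - u (cx i) = u (cx i) * p i := by simp only [u₁, Sum.elim_inl]; ring
      exact this ▸ Ideal.mul_mem_left _ _ (hθ _)
    · have : u₁ (cy i) - u (cy i) = Y i := by simp only [u₁, Sum.elim_inl, Sum.elim_inr]; ring
      exact this ▸ orderIdeal_mono (Nat.le_succ _) (hY i)
    · have : u₁ (cz j) - u (cz j) = θ (cz' j) := by
        simp only [u₁, Sum.elim_inl, Sum.elim_inr]; ring
      exact this ▸ hθ _
    · have : u₁ (cz' j) - u (cz' j) = -θ (cz j) := by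
        simp only [u₁, Sum.elim_inr]; ring
      exact this ▸ neg_mem (hθ _)
  -- The error of the first-order computation. Every term contains a product of two corrections or
  -- of their derivatives, whose orders are at least `N`; this improves the order because `N ≥ 1`.
  let τ₁ : Fin (2 * n) → Fin (2 * n) → MvPowerSeries (Fin (2 * n)) 𝕜 := fun a b =>
    ∑ i, (w2 (L.grad (p i)) (L.grad (u (cy i))) a b
        - q i * w2 (L.grad (1 + p i)) (L.grad (u (cy i) + Y i)) a b)
      + ∑ j, w2 (L.grad (θ (cz' j))) (L.grad (θ (cz j))) a b
  have hgradp : ∀ i, L.grad (1 + p i) = L.grad (p i) := fun i => by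
    funext a
    simp [LocalCalculus.grad]
  have hgradY : ∀ i, L.grad (u (cy i) + Y i) = fun a => L.grad (u (cy i)) a + L.grad (Y i) a :=
    fun i => by
      funext a
      simp [LocalCalculus.grad]
  refine ⟨u₁, fun i => ε i * (1 + p i), fun i => ε' i * q i, τ₁, ⟨fun i => ?_, fun i => ?_,
    fun c => ?_, fun v hv => H.ker v fun c => ?_, fun a b => ?_, fun a b c => ?_, fun a b => ?_,
    fun a b => ?_⟩, hu₁, fun i => ?_, fun i => ?_⟩
  · simp only [u₁, Sum.elim_inl, H.eq_mul i]; ring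
  · linear_combination (1 + p i) * q i * H.mul_eq_one i + hq i
  · have h1 := mem_orderIdeal_one.mp (orderIdeal_mono (Nat.le_add_left 1 N) (hu₁ c))
    rw [map_sub, H.ev_eq_zero, sub_zero] at h1
    exact h1
  · rw [← hv c, diff₀_eq_of_sub_mem (orderIdeal_mono (by omega) (hu₁ c))]
  · simp only [τ₁, neg_add, ← Finset.sum_neg_distrib]
    congr 1
    · refine Finset.sum_congr rfl fun i _ => ?_
      rw [w2_swap, w2_swap (L.grad (1 + p i))]; ring
    · exact Finset.sum_congr rfl fun j _ => w2_swap _ _ _ _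
  · simp only [τ₁]
    rw [L.d2_add, L.d2_sum, L.d2_sum]
    simp only [L.d2_sub, L.d2_w2_grad_grad, L.d2_dlog_w2 (hq _), Finset.sum_const_zero, sub_zero,
      add_zero]
  · refine Ideal.add_mem _ (Ideal.sum_mem _ fun i _ => ?_) (Ideal.sum_mem _ fun j _ => ?_)
    · have h1 : w2 (L.grad (p i)) (L.grad (u (cy i))) a b
          - q i * w2 (L.grad (1 + p i)) (L.grad (u (cy i) + Y i)) a b
          = -(q i - 1) * w2 (L.grad (p i)) (L.grad (u (cy i))) a b
            - q i * w2 (L.grad (p i)) (L.grad (Y i)) a b := by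
        rw [hgradp, hgradY]
        simp only [w2]
        ring
      rw [h1]
      refine Ideal.sub_mem _ (Ideal.mul_mem_right _ _ (neg_mem (hq1 i))) ?_
      refine Ideal.mul_mem_left _ _ (orderIdeal_mono (by omega : N + 1 ≤ N + (N + 1)) ?_)
      exact w2_mem (fun a => grad_mem (hθ _) a) (fun a => grad_mem (hY i) a) a b
    · exact orderIdeal_mono (by omega : N + 1 ≤ N + N)
        (w2_mem (fun a => grad_mem (hθ _) a) (fun a => grad_mem (hθ _) a) a b)
  · have h1 : ∀ i, (∏ j ∈ Finset.univ.erase i, h j) * h i = ∏ j, h j := fun i =>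
      Finset.prod_erase_mul _ _ (Finset.mem_univ i)
    have h2 : ∀ i, (∏ j ∈ Finset.univ.erase i, h j) *
        (ε' i * q i * w2 (L.grad (u₁ (cx i))) (L.grad (u₁ (cy i))) a b) =
        (∏ j ∈ Finset.univ.erase i, h j) *
          (ε' i * w2 (L.grad (u (cx i))) (L.grad (u (cy i))) a b)
        + (∏ j, h j) * (w2 (L.grad (θ (cx i))) (L.grad (u (cx i))) a b
          + q i * w2 (L.grad (1 + p i)) (L.grad (u (cy i) + Y i)) a b) := by
      intro i
      rw [← h1 i, mul_assoc _ (h i), ← mul_add]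
      congr 1
      simp only [u₁, Sum.elim_inl, Sum.elim_inr]
      rw [hgradp]
      simp only [w2, LocalCalculus.grad, Y, map_add, map_neg, L.D_mul, Derivation.map_one_eq_zero,
        zero_add]
      have hx := H.eq_mul i
      have hε := H.mul_eq_one i
      have hqi := hq i
      have hxε : u (cx i) * ε' i = h i := by linear_combination ε' i * hx + h i * hε
      generalize u (cx i) = x at *
      generalize ε' i = r at *
      generalize q i = Q at *
      generalize L.D a x = xa at *
      generalize L.D b x = xb at *
      generalize L.D a (u (cy i)) = ya at *
      generalize L.D b (u (cy i)) = yb at *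
      generalize θ (cx i) = t at *
      generalize L.D a t = ta at *
      generalize L.D b t = tb at *
      generalize L.D a (p i) = pa at *
      generalize L.D b (p i) = pb at *
      generalize p i = P at *
      linear_combination (ta * xb - tb * xa
        + Q * (pa * (yb - x * tb - t * xb) - pb * (ya - x * ta - t * xa))) * hxε
        + r * (xa * (yb - x * tb - t * xb) - xb * (ya - x * ta - t * xa)) * hqi
    have h3 : ∀ j, w2 (L.grad (u₁ (cz j))) (L.grad (u₁ (cz' j))) a b
        = w2 (L.grad (u (cz j))) (L.grad (u (cz' j))) a b
          + w2 (L.grad (θ (cz j))) (L.grad (u (cz j))) a b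
          + w2 (L.grad (θ (cz' j))) (L.grad (u (cz' j))) a b
          - w2 (L.grad (θ (cz' j))) (L.grad (θ (cz j))) a b := by
      intro j
      simp only [u₁, Sum.elim_inl, Sum.elim_inr, w2, LocalCalculus.grad, map_add, map_sub]
      ring
    have heq := H.eq a b
    rw [hτ a b] at heq
    rw [heq]
    simp only [← hL, h2, h3, τ₁, p, mul_add, Fintype.sum_sum_type, Finset.sum_add_distrib, Finset.sum_sub_distrib,
      ← Finset.mul_sum]
    ring
  · have : ε i * (1 + p i) - ε i = ε i * p i := by ring
    exact this ▸ Ideal.mul_mem_left _ _ (hθ _)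
  · have : ε' i * q i - ε' i = ε' i * (q i - 1) := by ring
    exact this ▸ Ideal.mul_mem_left _ _ (hq1 i)

end Formal

end LogSymplectic

namespace LogSymplectic

namespace Formal

open MvPowerSeries

variable {𝕜 : Type*} [Field 𝕜] [CharZero 𝕜]

local notation "ℒ" => formalCalculus

theorem exists_limit {m : ℕ} (f : ℕ → MvPowerSeries (Fin m) 𝕜)
    (hf : ∀ N, f (N + 1) - f N ∈ orderIdeal 𝕜 m (N + 2)) :
    ∃ F, ∀ N, F - f N ∈ orderIdeal 𝕜 m (N + 1) := by
  obtain ⟨F, hF⟩ := exists_series_sum (fun j => Nat.casesOn j (f 0) fun j => f (j + 1) - f j)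
    (fun j => by
      cases j with
      | zero => exact mem_orderIdeal_zero _
      | succ j => exact orderIdeal_mono (Nat.le_succ _) (hf j))
  refine ⟨F, fun N => ?_⟩
  have := hF (N + 1)
  rw [Finset.sum_range_succ'] at this
  simp only [Finset.sum_range_sub] at this
  simpa using this

/-- The `N`-th correction has order at least `N + 2`, so the iterates converge. All the equations of
the normal form are polynomial in the data and their first derivatives and hence hold for the limit
modulo every power of the filtration, while the error terms tend to zero. -/
theorem IsNormalUpTo.exists_limit {n k : ℕ} (hkn : k ≤ n)
    {h : Fin k → MvPowerSeries (Fin (2 * n)) 𝕜}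
    {Ω : Fin (2 * n) → Fin (2 * n) → MvPowerSeries (Fin (2 * n)) 𝕜}
    {u : Coord n k → MvPowerSeries (Fin (2 * n)) 𝕜} {ε ε' : Fin k → MvPowerSeries (Fin (2 * n)) 𝕜}
    {τ : Fin (2 * n) → Fin (2 * n) → MvPowerSeries (Fin (2 * n)) 𝕜}
    (H : IsNormalUpTo h Ω 1 u ε ε' τ) :
    ∃ u ε ε', IsNormalUpTo h Ω 1 u ε ε' fun _ _ => 0 := by
  let T := (Coord n k → MvPowerSeries (Fin (2 * n)) 𝕜) × (Fin k → MvPowerSeries (Fin (2 * n)) 𝕜) ×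
    (Fin k → MvPowerSeries (Fin (2 * n)) 𝕜) ×
    (Fin (2 * n) → Fin (2 * n) → MvPowerSeries (Fin (2 * n)) 𝕜)
  let P : ℕ → T → Prop := fun N t => IsNormalUpTo h Ω (N + 1) t.1 t.2.1 t.2.2.1 t.2.2.2
  have hstep : ∀ N (t : {t // P N t}), ∃ t' : {t // P (N + 1) t},
      (∀ c, t'.1.1 c - t.1.1 c ∈ orderIdeal 𝕜 (2 * n) (N + 2)) ∧
      (∀ i, t'.1.2.1 i - t.1.2.1 i ∈ orderIdeal 𝕜 (2 * n) (N + 2)) ∧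
      (∀ i, t'.1.2.2.1 i - t.1.2.2.1 i ∈ orderIdeal 𝕜 (2 * n) (N + 2)) := by
    rintro N ⟨t, ht⟩
    obtain ⟨u₁, ε₁, ε₁', τ₁, h1, h2⟩ := IsNormalUpTo.step hkn (Nat.le_add_left 1 N) ht
    exact ⟨⟨(u₁, ε₁, ε₁', τ₁), h1⟩, h2⟩
  choose F hF using hstep
  let s : ∀ N, {t // P N t} := fun N => Nat.rec ⟨(u, ε, ε', τ), H⟩ F N
  have hs : ∀ N, s (N + 1) = F N (s N) := fun _ => rfl
  choose u' hu' using fun c => Formal.exists_limit (fun N => (s N).1.1 c) fun N => (hF N (s N)).1 c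
  choose δ hδ using fun i =>
    Formal.exists_limit (fun N => (s N).1.2.1 i) fun N => (hF N (s N)).2.1 i
  choose δ' hδ' using fun i =>
    Formal.exists_limit (fun N => (s N).1.2.2.1 i) fun N => (hF N (s N)).2.2 i
  have hlim : ∀ f g : MvPowerSeries (Fin (2 * n)) 𝕜,
      (∀ N, Ideal.Quotient.mk (orderIdeal 𝕜 (2 * n) (N + 1)) f = Ideal.Quotient.mk _ g) → f = g :=
    fun f g hfg => sub_eq_zero.mp <| eq_zero_of_mem_orderIdeal fun N =>
      orderIdeal_mono (Nat.le_succ N) (Ideal.Quotient.eq.mp (hfg N))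
  have mu := fun N c => Ideal.Quotient.eq.mpr (hu' c N)
  have mδ := fun N i => Ideal.Quotient.eq.mpr (hδ i N)
  have mδ' := fun N i => Ideal.Quotient.eq.mpr (hδ' i N)
  refine ⟨u', δ, δ', fun i => hlim _ _ fun N => ?_, fun i => hlim _ _ fun N => ?_, fun c => ?_,
    fun v hv => (s 1).2.ker v fun c => ?_, fun a b => neg_zero.symm, fun a b c => ?_,
    fun a b => zero_mem _, fun a b => sub_eq_zero.mp <| eq_zero_of_mem_orderIdeal fun N => ?_⟩
  · rw [map_mul, mu, mδ, (s N).2.eq_mul i, map_mul]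
  · rw [map_mul, mδ, mδ', ← map_mul, (s N).2.mul_eq_one i]
  · have h1 := mem_orderIdeal_one.mp (hu' c 0)
    rw [map_sub, (s 0).2.ev_eq_zero, sub_zero] at h1
    exact h1
  -- The limit is compared with the iterate of index 1, from which it differs by terms of order two;
  -- these do not change the differential.
  · rw [← hv c, diff₀_eq_of_sub_mem (hu' c 1)]
  · simp [LocalCalculus.d2]
  · have mg : ∀ c a, Ideal.Quotient.mk (orderIdeal 𝕜 (2 * n) N) ((ℒ 𝕜 (2 * n)).grad (u' c) a) =
        Ideal.Quotient.mk _ ((ℒ 𝕜 (2 * n)).grad ((s N).1.1 c) a) := fun c a => by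
      refine Ideal.Quotient.eq.mpr ?_
      have := grad_mem (hu' c N) a
      rwa [LocalCalculus.grad, map_sub] at this
    have mδ'' : ∀ i, Ideal.Quotient.mk (orderIdeal 𝕜 (2 * n) N) (δ' i) =
        Ideal.Quotient.mk _ ((s N).1.2.2.1 i) := fun i =>
      Ideal.Quotient.eq.mpr (orderIdeal_mono (Nat.le_succ N) (hδ' i N))
    have mτ : Ideal.Quotient.mk (orderIdeal 𝕜 (2 * n) N) ((s N).1.2.2.2 a b) = 0 :=
      Ideal.Quotient.eq_zero_iff_mem.mpr (orderIdeal_mono (Nat.le_succ N) ((s N).2.mem a b))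
    rw [← Ideal.Quotient.eq, (s N).2.eq a b]
    simp only [map_add, map_mul, map_sum, w2, map_sub, mg, mδ'', mτ, map_zero]

end Formal

end LogSymplectic

/-! ### Closedness without poles, and commuting frames -/

namespace LogSymplectic

namespace LocalCalculus

variable {𝕜 R : Type*} [Field 𝕜] [CommRing R] [Algebra 𝕜 R] {m : ℕ} (L : LocalCalculus 𝕜 R m)

/-- If `Ω / (h₁ ⋯ h_k)` is closed, where `Ω = L.logForm h β γ`, then
`∑ i, dh_i / h_i ∧ dβ_i = dγ`. -/
theorem closed_of_logForm {k : ℕ} (h : Fin k → R) (β : Fin k → Fin m → R)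
    (γ : Fin m → Fin m → R) (hnzd : ∀ g, (∏ j, h j) * g = 0 → g = 0)
    (hcl : ∀ a b c, (∏ j, h j) * L.d2 (L.logForm h β γ) a b c =
      w12 (L.grad (∏ j, h j)) (L.logForm h β γ) a b c) (a b c : Fin m) :
    ∑ i, (∏ j ∈ Finset.univ.erase i, h j) * w12 (L.grad (h i)) (L.dd (β i)) a b c =
      (∏ j, h j) * L.d2 γ a b c := by
  have h1 : ∀ i, (∏ j ∈ Finset.univ.erase i, h j) * h i = ∏ j, h j := fun i =>
    Finset.prod_erase_mul _ _ (Finset.mem_univ i)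
  have h2 : L.d2 (L.logForm h β γ) a b c =
      ∑ i, ((∏ j ∈ Finset.univ.erase i, h j) * -w12 (L.grad (h i)) (L.dd (β i)) a b c
        + w12 (L.grad (∏ j ∈ Finset.univ.erase i, h j)) (w2 (L.grad (h i)) (β i)) a b c)
      + ((∏ j, h j) * L.d2 γ a b c + w12 (L.grad (∏ j, h j)) γ a b c) := by
    have : L.logForm h β γ = fun a b => (∑ i, (∏ j ∈ Finset.univ.erase i, h j) *
      w2 (L.grad (h i)) (β i) a b) + (∏ j, h j) * γ a b := rfl
    rw [this, L.d2_add, L.d2_sum, L.d2_mul]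
    simp only [L.d2_mul, L.d2_w2_grad]
  have h3 : w12 (L.grad (∏ j, h j)) (L.logForm h β γ) a b c =
      ∑ i, (∏ j ∈ Finset.univ.erase i, h j) *
        w12 (L.grad (∏ j, h j)) (w2 (L.grad (h i)) (β i)) a b c
      + (∏ j, h j) * w12 (L.grad (∏ j, h j)) γ a b c := by
    simp only [w12, logForm, mul_add, Finset.sum_add_distrib, Finset.mul_sum]
    have : ∀ x i y z, L.grad (∏ j, h j) x * ((∏ j ∈ Finset.univ.erase i, h j) *
        w2 (L.grad (h i)) (β i) y z) = (∏ j ∈ Finset.univ.erase i, h j) *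
        (L.grad (∏ j, h j) x * w2 (L.grad (h i)) (β i) y z) := fun _ _ _ _ => by ring
    simp only [this]
    ring
  -- The product rule gives `dh = h_i d(∏_{j ≠ i} h_j) + (∏_{j ≠ i} h_j) dh_i`, and the second term
  -- dies against `dh_i`.
  have h4 : ∀ i, (∏ j, h j) *
      w12 (L.grad (∏ j ∈ Finset.univ.erase i, h j)) (w2 (L.grad (h i)) (β i)) a b c =
      (∏ j ∈ Finset.univ.erase i, h j) *
        w12 (L.grad (∏ j, h j)) (w2 (L.grad (h i)) (β i)) a b c := by
    intro i
    rw [← h1 i]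
    simp only [w12, w2, grad, D_mul]
    ring
  have h5 := hcl a b c
  rw [h2, h3, mul_add, Finset.mul_sum] at h5
  simp only [mul_add, h4, Finset.sum_add_distrib] at h5
  have h6 := hnzd (∑ i, (∏ j ∈ Finset.univ.erase i, h j) * w12 (L.grad (h i)) (L.dd (β i)) a b c
    - (∏ j, h j) * L.d2 γ a b c) (by
      rw [mul_sub, Finset.mul_sum]
      simp only [mul_neg, Finset.sum_neg_distrib] at h5
      linear_combination -h5)
  exact sub_eq_zero.mp h6

variable {C : Type*} [Fintype C] [DecidableEq C]

/-- The vector fields of a frame. -/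
noncomputable def vec (E : Fin m → C → R) (c : C) : Derivation 𝕜 R R := ∑ a, E a c • L.D a

theorem vec_apply (E : Fin m → C → R) (c : C) (f : R) :
    L.vec E c f = ∑ a, E a c * L.D a f := by
  have h := congrFun (map_sum Derivation.coeFnAddMonoidHom (fun a => E a c • L.D a) Finset.univ) f
  rw [Finset.sum_apply] at h
  exact h

/-- The vector fields of the frame dual to a coordinate system commute. -/
theorem vec_comm {u : C → R} {E : Fin m → C → R}
    (hE : ∀ c d, ∑ a, L.D a (u c) * E a d = if c = d then 1 else 0)
    (hE' : ∀ a b, ∑ c, E a c * L.D b (u c) = if a = b then 1 else 0) (c d : C) (f : R) :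
    L.vec E c (L.vec E d f) = L.vec E d (L.vec E c f) := by
  have hvu : ∀ c d, L.vec E d (u c) = if c = d then 1 else 0 := fun c d => by
    rw [vec_apply, ← hE]
    exact Finset.sum_congr rfl fun _ _ => mul_comm _ _
  -- The commutator is again a vector field, since the second derivatives cancel. It kills every
  -- coordinate `u e`, because the frame fields have constant values on these; as the differentials
  -- `du_e` span, its components vanish.
  have hW : ∀ f, L.vec E c (L.vec E d f) - L.vec E d (L.vec E c f) =
      ∑ a, (L.vec E c (E a d) - L.vec E d (E a c)) * L.D a f := by
    intro f
    have h1 : ∀ c d, L.vec E c (L.vec E d f) =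
        ∑ a, L.vec E c (E a d) * L.D a f + ∑ a, ∑ b, E a d * (E b c * L.D b (L.D a f)) := by
      intro c d
      conv_lhs => rw [vec_apply _ _ d, map_sum]
      rw [← Finset.sum_add_distrib]
      refine Finset.sum_congr rfl fun a _ => ?_
      rw [Derivation.leibniz, smul_eq_mul, smul_eq_mul, vec_apply _ _ c (L.D a f),
        Finset.mul_sum]
      ring
    rw [h1, h1, Finset.sum_comm (f := fun a b => E a c * (E b d * L.D b (L.D a f)))]
    have h2 : ∀ a b, E b c * (E a d * L.D a (L.D b f)) = E a d * (E b c * L.D b (L.D a f)) :=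
      fun a b => by rw [L.D_comm a b]; ring
    simp only [h2, sub_mul, Finset.sum_sub_distrib]
    ring
  have hW0 : ∀ b, L.vec E c (E b d) - L.vec E d (E b c) = 0 := by
    intro b
    have h1 : ∀ e, ∑ a, (L.vec E c (E a d) - L.vec E d (E a c)) * L.D a (u e) = 0 := fun e => by
      rw [← hW, hvu, hvu]
      split_ifs <;> simp
    calc L.vec E c (E b d) - L.vec E d (E b c)
        = ∑ a, (L.vec E c (E a d) - L.vec E d (E a c)) * (if b = a then 1 else 0) := by simp
      _ = ∑ e, E b e * ∑ a, (L.vec E c (E a d) - L.vec E d (E a c)) * L.D a (u e) := by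
        simp only [← hE', Finset.mul_sum]
        rw [Finset.sum_comm]
        exact Finset.sum_congr rfl fun _ _ => Finset.sum_congr rfl fun _ _ => by ring
      _ = 0 := by simp [h1]
  have := hW f
  simp only [hW0, zero_mul, Finset.sum_const_zero] at this
  exact sub_eq_zero.mp this

end LocalCalculus

/-- The Jacobi identity for the bracket `∑ a, A_a ∧ B_a` of commuting derivations. -/
theorem jacobi_of_commuting {𝕜 R S ι : Type*} [CommRing 𝕜] [CommRing R] [Algebra 𝕜 R] [Field S]
    [CharZero S] [Fintype ι] (φ : R →+* S) (A B : ι → Derivation 𝕜 R R)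
    (hAA : ∀ a b f, A a (A b f) = A b (A a f)) (hAB : ∀ a b f, A a (B b f) = B b (A a f))
    (hBB : ∀ a b f, B a (B b f) = B b (B a f)) (f : Fin 3 → R) (br : R → R → R)
    (hbr : ∀ g l, br g l = ∑ a, (A a g * B a l - A a l * B a g)) :
    φ (br (f 0) (br (f 1) (f 2))) + φ (br (f 1) (br (f 2) (f 0)))
      + φ (br (f 2) (br (f 0) (f 1))) = 0 := by
  have key := jacobi_sum (S := S) (fun a s => φ (A a (f s))) (fun a s => φ (B a (f s)))
    (fun a b s => φ (A a (A b (f s)))) (fun a b s => φ (A a (B b (f s))))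
    (fun a b s => φ (B a (B b (f s)))) (fun a b => by simp only [hAA a b])
    (fun a b => by simp only [hBB a b]) (fun a s t => φ (A a (br (f s) (f t))))
    (fun a s t => φ (B a (br (f s) (f t))))
    (fun a g l => by
      rw [hbr, map_sum, map_sum]
      refine Finset.sum_congr rfl fun b _ => ?_
      simp only [map_sub, Derivation.leibniz, smul_eq_mul, map_add, map_mul]
      ring)
    (fun a g l => by
      rw [hbr, map_sum, map_sum]
      refine Finset.sum_congr rfl fun b _ => ?_
      simp only [map_sub, Derivation.leibniz, smul_eq_mul, map_add, map_mul, hAB]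
      ring)
  simp only [hbr _ (br _ _), map_sum, map_sub, map_mul]
  exact key

end LogSymplectic

/-! ### The canonical bracket, and forms over a field in coefficients -/

namespace LogSymplectic

/-- The Jacobi identity for the canonical bracket. -/
theorem LocalCalculus.jacobi_canonical {𝕜 R S : Type*} [Field 𝕜] [CommRing R] [Algebra 𝕜 R]
    [Field S] [CharZero S] {m n k : ℕ} (L : LocalCalculus 𝕜 R m) {u : Coord n k → R}
    {E : Fin m → Coord n k → R}
    (hE : ∀ c d, ∑ a, L.D a (u c) * E a d = if c = d then 1 else 0)
    (hE' : ∀ a b, ∑ c, E a c * L.D b (u c) = if a = b then 1 else 0) (φ : R →+* S)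
    (br : R → R → R)
    (hbr : ∀ g l, br g l = ∑ i, u (cx i) * (L.vec E (cx i) g * L.vec E (cy i) l
        - L.vec E (cx i) l * L.vec E (cy i) g)
      + ∑ j, (L.vec E (cz j) g * L.vec E (cz' j) l - L.vec E (cz j) l * L.vec E (cz' j) g))
    (f : Fin 3 → R) :
    φ (br (f 0) (br (f 1) (f 2))) + φ (br (f 1) (br (f 2) (f 0)))
      + φ (br (f 2) (br (f 0) (f 1))) = 0 := by
  have hvu : ∀ c d, L.vec E d (u c) = if c = d then 1 else 0 := fun c d => by
    rw [L.vec_apply, ← hE]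
    exact Finset.sum_congr rfl fun _ _ => mul_comm _ _
  have hc := fun c d => L.vec_comm hE hE' c d
  -- The factor `x_i` is moved into the first field: `x_i ∂_{x_i}` commutes with all the others,
  -- because `x_i` depends on no other coordinate.
  refine jacobi_of_commuting φ
    (Sum.elim (fun i => u (cx i) • L.vec E (cx i)) fun j => L.vec E (cz j))
    (Sum.elim (fun i => L.vec E (cy i)) fun j => L.vec E (cz' j)) ?_ ?_ ?_ f br ?_
  · rintro (i | j) (i' | j') g <;>
      simp only [Sum.elim_inl, Sum.elim_inr, Derivation.smul_apply, smul_eq_mul,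
        Derivation.leibniz, hvu]
    · by_cases h : i = i'
      · subst h; ring
      · rw [if_neg (by simpa using Ne.symm h), if_neg (by simpa using h), hc (cx i)]; ring
    · rw [if_neg (by simp), hc]; ring
    · rw [if_neg (by simp), hc]; ring
    · exact hc _ _ _
  · rintro (i | j) (i' | j') g <;>
      simp only [Sum.elim_inl, Sum.elim_inr, Derivation.smul_apply, smul_eq_mul,
        Derivation.leibniz, hvu]
    · rw [if_neg (by simp), hc]; ring
    · rw [if_neg (by simp), hc]; ring
    · exact hc _ _ _
    · exact hc _ _ _
  · rintro (i | j) (i' | j') g <;> exact hc _ _ _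
  · intro g l
    rw [hbr, Fintype.sum_sum_type]
    simp only [Sum.elim_inl, Sum.elim_inr, Derivation.smul_apply, smul_eq_mul]
    congr 1
    exact Finset.sum_congr rfl fun _ _ => by ring

section Forms

variable {F : Type*} [Field F] {m : ℕ}

theorem form_ext {ω η : (Fin m → F) [⋀^Fin 2]→ₗ[F] F}
    (h : ∀ a b, ω ![Pi.single a 1, Pi.single b 1] = η ![Pi.single a 1, Pi.single b 1]) : ω = η := by
  refine (Pi.basisFun (F) (Fin m)).ext_alternating fun v _ => ?_
  have : (fun i => (Pi.basisFun (F) (Fin m)) (v i)) =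
      ![Pi.single (v 0) 1, Pi.single (v 1) 1] := by
    funext i
    fin_cases i <;> simp
  rw [this]
  exact h _ _

theorem form_swap (γ : (Fin m → F) [⋀^Fin 2]→ₗ[F] F) (v w : Fin m → F) :
    γ ![v, w] = -γ ![w, v] := by
  have h := γ.map_swap ![w, v] (show (0 : Fin 2) ≠ 1 by decide)
  rw [← h]
  congr 1
  funext i
  fin_cases i <;> rfl

theorem form_sum_apply (γ : (Fin m → F) [⋀^Fin 2]→ₗ[F] F) (v w : Fin m → F) :
    γ ![v, w] = ∑ a, ∑ b, γ ![Pi.single a 1, Pi.single b 1] * v a * w b := by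
  have hv : v = ∑ a, v a • Pi.single a 1 := by
    simpa using (pi_eq_sum_univ' v)
  have hw : w = ∑ a, w a • Pi.single a 1 := by
    simpa using (pi_eq_sum_univ' w)
  conv_lhs => rw [← contract_apply, hw, map_sum]
  rw [Finset.sum_comm]
  refine Finset.sum_congr rfl fun b _ => ?_
  rw [map_smul, contract_apply, form_swap, ← contract_apply]
  conv_lhs => rw [hv, map_sum]
  rw [← Finset.sum_neg_distrib, Finset.smul_sum]
  refine Finset.sum_congr rfl fun a _ => ?_
  rw [map_smul, contract_apply, form_swap]
  simp only [smul_eq_mul]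
  ring

/-- The volume condition, in terms of coefficients. -/
theorem volume_coefficients {R : Type*} [CommRing R] {φ : R →+* F} (hφ : Function.Injective φ)
    {n : ℕ} {H f : R} (hH : H ≠ 0) {ω : (Fin (2 * n) → F) [⋀^Fin 2]→ₗ[F] F}
    (hvol : φ H • wedgePow ω n = φ f • (Pi.basisFun F (Fin (2 * n))).det)
    {Ω : Fin (2 * n) → Fin (2 * n) → R}
    (hΩ : ∀ a b, φ H * ω ![Pi.single a 1, Pi.single b 1] = φ (Ω a b))
    (G B : Fin (2 * n) → Fin (2 * n) → R)
    (hB : ∀ c d, H * B c d = ∑ a, ∑ b, Ω a b * G a c * G b d) :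
    H * MvPolynomial.aeval (fun c : Fin (2 * n) × Fin (2 * n) => B c.1 c.2)
      (wedgePowPoly n id) = f * Matrix.det (Matrix.of G) := by
  have hH' : φ H ≠ 0 := fun h0 => hH (hφ (h0.trans (map_zero _).symm))
  let w : Fin (2 * n) → (Fin (2 * n) → F) := fun c a => φ (G a c)
  have hw : ∀ c d, ω ![w c, w d] = φ (B c d) := by
    intro c d
    refine mul_left_cancel₀ hH' ?_
    rw [form_sum_apply, ← map_mul, hB, Finset.mul_sum]
    simp only [map_sum, map_mul, Finset.mul_sum, ← hΩ, mul_assoc]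
    rfl
  have h1 := congrArg (fun η => η (w ∘ id)) hvol
  simp only [AlternatingMap.smul_apply, wedgePow_apply, hw, smul_eq_mul] at h1
  refine hφ ?_
  rw [map_mul, map_mul, map_aeval_int, h1, Module.Basis.det_apply, RingHom.map_det]
  rfl

end Forms

/-! ### The formal case of the theorem -/

namespace Formal

variable {𝕜 : Type*} [RCLike 𝕜] {m : ℕ}

local notation "ℒ" => formalCalculus

theorem toMer_injective : Function.Injective (algebraMap (FFun 𝕜 m) (FMer 𝕜 m)) :=
  IsFractionRing.injective (FFun 𝕜 m) (FMer 𝕜 m)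

theorem toMer_mul (f g : FFun 𝕜 m) : toMer (f * g) = toMer f * toMer g := map_mul _ f g

theorem toMer_sum {ι : Type*} (s : Finset ι) (f : ι → FFun 𝕜 m) :
    toMer (∑ i ∈ s, f i) = ∑ i ∈ s, toMer (f i) := map_sum _ f s

instance : CharZero (FMer 𝕜 m) :=
  charZero_of_injective_ringHom
    ((algebraMap (FFun 𝕜 m) (FMer 𝕜 m)).comp MvPowerSeries.C).injective

theorem merDiff_toMer_apply (f : FFun 𝕜 m) (v : FVec 𝕜 m) :
    merDiff (toMer f) v = ∑ a, toMer ((ℒ 𝕜 m).D a f) * v a := by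
  simp only [merDiff, merDeriv_toMer, LinearMap.sum_apply, LinearMap.smul_apply, smul_eq_mul,
    LinearMap.proj_apply]
  rfl

theorem diffAtZero_eq (f : FFun 𝕜 m) : diffAtZero f = (ℒ 𝕜 m).diff₀ f := rfl

end Formal

end LogSymplectic

namespace LogSymplectic

namespace Formal

variable {𝕜 : Type*} [RCLike 𝕜]

local notation "ℒ" => formalCalculus

/-- The hypotheses on a formal simple log-symplectic form, in terms of coefficients. -/
theorem exists_coefficients {n k : ℕ} {h : Fin k → FFun 𝕜 (2 * n)}
    {ω : (FVec 𝕜 (2 * n)) [⋀^Fin 2]→ₗ[FMer 𝕜 (2 * n)] FMer 𝕜 (2 * n)}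
    (H : IsFormalSimpleLogSymplectic n k h ω) :
    ∃ (β : Fin k → Fin (2 * n) → FFun 𝕜 (2 * n))
      (γ : Fin (2 * n) → Fin (2 * n) → FFun 𝕜 (2 * n)),
      (∀ a b, γ a b = -γ b a) ∧
      ∀ a b, (∏ j, toMer (h j)) * ω ![basisVec a, basisVec b] =
        toMer ((ℒ 𝕜 (2 * n)).logForm h β γ a b) := by
  obtain ⟨β, γ, hβ, hγ, hω⟩ := H.exists_eq
  choose β' hβ' using hβ
  choose γ' hγ' using hγ
  have hne : ∀ i, toMer (h i) ≠ 0 := fun i h0 =>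
    (linearIndependent_of_wedgeFamily_ne_zero H.wedge_ne_zero).ne_zero i (by
      rw [diffAtZero_eq, toMer_injective (h0.trans (map_zero _).symm)]
      simp [LocalCalculus.diff₀, covector])
  refine ⟨β', γ', fun a b => toMer_injective ?_, fun a b => ?_⟩
  · rw [map_neg, hγ', hγ', form_swap]
  · rw [hω]
    simp only [LocalCalculus.logForm, map_add, map_sum, map_mul, map_prod, hγ',
      AlternatingMap.add_apply, alternatingMap_sum_apply, AlternatingMap.smul_apply, mul_add,
      Finset.mul_sum, smul_eq_mul, wedge₁_apply, w2, map_sub, hβ']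
    congr 1
    refine Finset.sum_congr rfl fun i _ => ?_
    rw [← Finset.prod_erase_mul _ _ (Finset.mem_univ i), mul_assoc, mul_inv_cancel_left₀ (hne i)]
    simp [merDiff_toMer_apply, LocalCalculus.grad, Pi.single_apply]

/-- Multiplying `d(Ω / H) = 0` by `H²` gives `H dΩ = dH ∧ Ω`, an identity between power series to
which `closed_of_logForm` applies. -/
theorem closed_coefficients {n : ℕ} {H : FFun 𝕜 (2 * n)} (hH : H ≠ 0)
    {ω : (FVec 𝕜 (2 * n)) [⋀^Fin 2]→ₗ[FMer 𝕜 (2 * n)] FMer 𝕜 (2 * n)}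
    (hcl : IsFormallyClosed ω) {Ω : Fin (2 * n) → Fin (2 * n) → FFun 𝕜 (2 * n)}
    (hΩ : ∀ a b, toMer H * ω ![basisVec a, basisVec b] = toMer (Ω a b)) (a b c : Fin (2 * n)) :
    H * (ℒ 𝕜 (2 * n)).d2 Ω a b c = w12 ((ℒ 𝕜 (2 * n)).grad H) Ω a b c := by
  have hH' : toMer H ≠ 0 := fun h0 => hH (toMer_injective (h0.trans (map_zero _).symm))
  have hω : ∀ a b, ω ![basisVec a, basisVec b] = toMer (Ω a b) / toMer H := fun a b => by
    exact (eq_div_iff hH').mpr ((mul_comm _ _).trans (hΩ a b))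
  have hanti : Ω c a = -Ω a c := toMer_injective (by
    rw [map_neg]
    change toMer _ = -toMer _
    rw [← hΩ, ← hΩ, form_swap]; ring)
  have h1 := hcl a b c
  simp only [hω, merDeriv_div _ _ _ hH] at h1
  field_simp at h1
  have h2 := toMer_injective (𝕜 := 𝕜) (m := 2 * n) (a₁ :=
    (H * MvPowerSeries.pderiv 𝕜 a (Ω b c) - Ω b c * MvPowerSeries.pderiv 𝕜 a H)
    - (H * MvPowerSeries.pderiv 𝕜 b (Ω a c) - Ω a c * MvPowerSeries.pderiv 𝕜 b H)
    + (H * MvPowerSeries.pderiv 𝕜 c (Ω a b) - Ω a b * MvPowerSeries.pderiv 𝕜 c H)) (a₂ := 0) (by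
      simp only [map_add, map_sub, map_mul, map_zero]
      linear_combination h1)
  simp only [LocalCalculus.d2, w12, LocalCalculus.grad, hanti, map_neg, formalCalculus_D]
  linear_combination h2

theorem prod_ne_zero {n k : ℕ} {h : Fin k → FFun 𝕜 (2 * n)}
    (hind : LinearIndependent 𝕜 fun i => (ℒ 𝕜 (2 * n)).diff₀ (h i)) : ∏ j, h j ≠ 0 := fun h0 =>
  one_ne_zero ((ℒ 𝕜 (2 * n)).prod_nzd Finset.univ h (fun i _ _ => hind.ne_zero i) 1
    (by rw [h0, zero_mul]))

theorem exists_isNormalUpTo {n k : ℕ} {h : Fin k → FFun 𝕜 (2 * n)}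
    {ω : (FVec 𝕜 (2 * n)) [⋀^Fin 2]→ₗ[FMer 𝕜 (2 * n)] FMer 𝕜 (2 * n)}
    (H : IsFormalSimpleLogSymplectic n k h ω) :
    k ≤ n ∧ ∏ j, h j ≠ 0 ∧ ∃ Ω u ε ε',
      (∀ a b, toMer (∏ j, h j) * ω ![basisVec a, basisVec b] = toMer (Ω a b)) ∧
      IsNormalUpTo h Ω 1 u ε ε' fun _ _ => 0 := by
  set L := formalCalculus 𝕜 (2 * n) with hL
  obtain ⟨β, γ, hγ, hΩ⟩ := exists_coefficients H
  obtain ⟨f, hf, hvol⟩ := H.volume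
  have hind : LinearIndependent 𝕜 fun i => L.diff₀ (h i) :=
    linearIndependent_of_wedgeFamily_ne_zero H.wedge_ne_zero
  have hnzd : ∀ g, (∏ j, h j) * g = 0 → g = 0 :=
    L.prod_nzd Finset.univ h fun i _ _ => hind.ne_zero i
  have hne := prod_ne_zero hind
  rw [← map_prod] at hvol
  simp only [← map_prod] at hΩ
  obtain ⟨hkn, u, ε, ε', τ, hu1, hu2, hu3, hu4, hτ1, hτ2, hτ3, hu5⟩ :=
    L.normal_form h β γ hγ H.map_zero hind
      (L.closed_of_logForm h β γ hnzd (closed_coefficients hne H.closed hΩ))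
      ⟨f, hf, volume_coefficients toMer_injective hne hvol hΩ⟩
  exact ⟨hkn, hne, L.logForm h β γ, (IsNormalUpTo.exists_limit hkn (Ω := L.logForm h β γ)
    ⟨hu1, hu2, hu3, hu4, hτ1, hτ2, fun a b => mem_orderIdeal_one.mpr (hτ3 a b), hu5⟩).imp fun _ => .imp fun _ => .imp fun _ N => ⟨hΩ, N⟩⟩

/-- Because `x_i = h_i ε_i`, the quotient `h / x_i` is `∏_{j ≠ i} h_j` times the inverse of `ε_i`.
Without error term the identity for `h ω` is thus `h` times the canonical form, and `h` can be
cancelled. -/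
theorem IsNormalUpTo.eq_canonicalForm {n k : ℕ} {h : Fin k → FFun 𝕜 (2 * n)}
    {ω : (FVec 𝕜 (2 * n)) [⋀^Fin 2]→ₗ[FMer 𝕜 (2 * n)] FMer 𝕜 (2 * n)}
    {Ω : Fin (2 * n) → Fin (2 * n) → FFun 𝕜 (2 * n)} {u : Coord n k → FFun 𝕜 (2 * n)}
    {ε ε' : Fin k → FFun 𝕜 (2 * n)} {N : ℕ} (hne : ∏ j, h j ≠ 0)
    (hΩ : ∀ a b, toMer (∏ j, h j) * ω ![basisVec a, basisVec b] = toMer (Ω a b))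
    (N : IsNormalUpTo h Ω N u ε ε' fun _ _ => 0) :
    (∀ i, toMer (u (cx i)) ≠ 0) ∧
      ω = canonicalForm (fun c => toMer (u c)) (fun c => merDiff (toMer (u c))) := by
  set L := formalCalculus 𝕜 (2 * n) with hL
  have hHne : toMer (∏ j, h j) ≠ 0 := fun h0 => hne (toMer_injective (h0.trans (map_zero _).symm))
  have hx : ∀ i, (toMer (u (cx i)))⁻¹ * toMer (∏ j, h j) =
      toMer ((∏ j ∈ Finset.univ.erase i, h j) * ε' i) := by
    intro i
    have h1 : u (cx i) * ((∏ j ∈ Finset.univ.erase i, h j) * ε' i) = ∏ j, h j := by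
      rw [N.eq_mul i, ← Finset.prod_erase_mul _ _ (Finset.mem_univ i)]
      linear_combination (∏ j ∈ Finset.univ.erase i, h j) * h i * N.mul_eq_one i
    have h2 : toMer (u (cx i)) ≠ 0 := fun h0 => hne (by
      rw [← h1, toMer_injective (h0.trans (map_zero _).symm), zero_mul])
    rw [← h1, toMer_mul, inv_mul_cancel_left₀ h2]
  have hxne : ∀ i, toMer (u (cx i)) ≠ 0 := fun i h0 => by
    have h1 := hx i
    have h2 : u (cx i) = 0 := toMer_injective (h0.trans (map_zero _).symm)
    rw [N.eq_mul] at h2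
    have h3 : h i = 0 := by linear_combination ε' i * h2 - h i * N.mul_eq_one i
    exact hne (Finset.prod_eq_zero (Finset.mem_univ i) h3)
  refine ⟨hxne, ?_⟩
  · refine form_ext fun a b => mul_left_cancel₀ hHne ?_
    have hd : ∀ c a, merDiff (toMer (u c)) (basisVec a) = toMer (L.D a (u c)) := fun c a => by
      simp [merDiff_toMer_apply, Pi.single_apply, hL]
    rw [hΩ, N.eq, canonicalForm_apply]
    simp only [hd, mul_add, Finset.mul_sum, map_add, map_sum, add_zero]
    congr 1
    · refine Finset.sum_congr rfl fun i _ => ?_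
      have := hx i
      rw [toMer_mul] at this
      simp only [w2, map_mul, map_sub, LocalCalculus.grad, ← hL]
      linear_combination -(toMer (L.D a (u (cx i))) * toMer (L.D b (u (cy i))) -
        toMer (L.D b (u (cx i))) * toMer (L.D a (u (cy i)))) * this
    · simp only [w2, map_mul, map_sub, LocalCalculus.grad, ← hL]

/-- The formal case of the theorem. -/
theorem exists_canonical_coordinates {n k : ℕ} {h : Fin k → FFun 𝕜 (2 * n)}
    {ω : (FVec 𝕜 (2 * n)) [⋀^Fin 2]→ₗ[FMer 𝕜 (2 * n)] FMer 𝕜 (2 * n)}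
    (H : IsFormalSimpleLogSymplectic n k h ω) :
    k ≤ n ∧ ∃ u : Coord n k → FFun 𝕜 (2 * n), IsFormalCoordinateSystem u ∧
      ω = canonicalForm (fun c => toMer (u c)) (fun c => merDiff (toMer (u c))) ∧
      ∃ (P : (Module.Dual (FMer 𝕜 (2 * n)) (FVec 𝕜 (2 * n))) [⋀^Fin 2]→ₗ[FMer 𝕜 (2 * n)]
          FMer 𝕜 (2 * n)) (X : Coord n k → FVec 𝕜 (2 * n)),
        IsFormalPoisson P ∧ IsDualBivector P ω ∧ IsFormalCoordVec u X ∧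
        P = canonicalBivector (fun c => toMer (u c)) X := by
  set L := formalCalculus 𝕜 (2 * n) with hL
  obtain ⟨hkn, hne, Ω, u, ε, ε', hΩ, N⟩ := exists_isNormalUpTo H
  obtain ⟨hxne, hω⟩ := N.eq_canonicalForm hne hΩ
  let e : Fin (2 * n) ≃ Coord n k := (Fintype.equivFinOfCardEq (card_coord hkn)).symm
  obtain ⟨E, hE1, hE2, -⟩ := L.exists_frame e u N.ker
  let X : Coord n k → FVec 𝕜 (2 * n) := fun c a => toMer (E a c)
  have hX : ∀ c d, merDiff (toMer (u c)) (X d) = if c = d then 1 else 0 := by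
    intro c d
    simp only [merDiff_toMer_apply, X, ← hL, ← map_mul, ← map_sum, hE1]
    split_ifs <;> simp
  have hker : ∀ v : FVec 𝕜 (2 * n), (∀ c, merDiff (toMer (u c)) v = 0) → v = 0 := by
    intro v hv
    funext a
    calc v a = ∑ b, toMer (if a = b then 1 else 0) * v b := by simp [apply_ite]
      _ = ∑ c, toMer (E a c) * merDiff (toMer (u c)) v := by
        simp only [merDiff_toMer_apply, ← hL, Finset.mul_sum, ← hE2, map_sum, Finset.sum_mul,
          map_mul]
        rw [Finset.sum_comm]
        exact Finset.sum_congr rfl fun _ _ => Finset.sum_congr rfl fun _ _ => by ring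
      _ = 0 := by simp [hv]
  let P := canonicalBivector (fun c => toMer (u c)) X
  -- The bracket on power series. The ambient forms `dx_a` are differentials of power series, so the
  -- values of `P` on them are brackets of power series and have no poles. The Jacobi identity is
  -- then checked in the power series ring.
  let br : FFun 𝕜 (2 * n) → FFun 𝕜 (2 * n) → FFun 𝕜 (2 * n) := fun g l =>
    ∑ i, u (cx i) * (L.vec E (cx i) g * L.vec E (cy i) l - L.vec E (cx i) l * L.vec E (cy i) g)
      + ∑ j, (L.vec E (cz j) g * L.vec E (cz' j) l - L.vec E (cz j) l * L.vec E (cz' j) g)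
  have hb : ∀ a, basisForm a = merDiff (𝕜 := 𝕜) (toMer (L.X a)) := fun a => by
    refine LinearMap.pi_ext' fun b => LinearMap.ext_ring ?_
    simp [merDiff_toMer_apply, ← hL, L.D_X, Pi.single_apply, apply_ite, eq_comm]
  have hP : ∀ g l, P ![merDiff (toMer g), merDiff (toMer l)] = toMer (br g l) := by
    intro g l
    have hv : ∀ g c, merDiff (toMer g) (X c) = toMer (L.vec E c g) := fun g c => by
      rw [merDiff_toMer_apply, L.vec_apply, toMer_sum]
      exact Finset.sum_congr rfl fun a _ => by rw [toMer_mul]; exact mul_comm _ _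
    rw [canonicalBivector_apply]
    simp only [hv, br, map_add, map_sum, map_mul, map_sub]
  have hPX : ∀ a b, P ![basisForm a, basisForm b] = toMer (br (L.X a) (L.X b)) := fun a b => by
    rw [hb, hb, hP]
  have hind : LinearIndependent 𝕜 fun c => diffAtZero (u c) := by
    refine Fintype.linearIndependent_iff.mpr fun g hg d => ?_
    have h1 := LinearMap.congr_fun hg fun a => L.ev (E a d)
    have h2 : ∀ c, L.diff₀ (u c) (fun a => L.ev (E a d)) = if c = d then 1 else 0 := fun c => by
      simp only [LocalCalculus.diff₀, covector_apply, ← map_mul, ← map_sum, hE1]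
      split_ifs <;> simp
    simpa only [diffAtZero_eq, ← hL, LinearMap.sum_apply, LinearMap.smul_apply, h2, smul_eq_mul,
      mul_ite, mul_one, mul_zero, Finset.sum_ite_eq', Finset.mem_univ, if_true,
      LinearMap.zero_apply] using h1
  refine ⟨hkn, u, ⟨N.ev_eq_zero, hind, hind.span_eq_top_of_card_eq_finrank' ?_⟩, hω, P, X, ⟨fun a b => ⟨_, (hPX a b).symm⟩,
    fun a b c => ?_⟩, hω ▸ isDualBivector_canonical _ _ X hX hker hxne, hX, rfl⟩
  · rw [card_coord hkn]
    simp
  · simp only [hPX]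
    rw [hb a, hb b, hb c, hP, hP, hP]
    exact L.jacobi_canonical hE1 hE2 (algebraMap _ (FMer 𝕜 (2 * n))) br (fun _ _ => rfl)
      ![L.X a, L.X b, L.X c]

end Formal

end LogSymplectic

/-! ### Functions of class `C^r` near a point -/

namespace LogSymplectic

/-- `f` is of class `C^r` on a neighbourhood of `x`. -/
def ContDiffNear {𝕜 E F : Type*} [NontriviallyNormedField 𝕜] [NormedAddCommGroup E]
    [NormedSpace 𝕜 E] [NormedAddCommGroup F] [NormedSpace 𝕜 F] (r : WithTop ℕ∞) (f : E → F)
    (x : E) : Prop :=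
  ∀ᶠ y in 𝓝 x, ContDiffAt 𝕜 r f y

/-- Smooth or analytic. -/
class IsSmoothOrAnalytic (r : WithTop ℕ∞) : Prop where
  out : r = ((⊤ : ℕ∞) : WithTop ℕ∞) ∨ r = (⊤ : WithTop ℕ∞)

namespace IsSmoothOrAnalytic

variable (r : WithTop ℕ∞) [IsSmoothOrAnalytic r]

theorem natCast_le (n : ℕ) : (n : WithTop ℕ∞) ≤ r := by
  rcases IsSmoothOrAnalytic.out (r := r) with rfl | rfl
  · exact mod_cast le_top
  · exact le_top

theorem one_le : 1 ≤ r := mod_cast natCast_le r 1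

theorem ne_zero : r ≠ 0 := fun h => by
  have := one_le r
  rw [h] at this
  exact absurd this (by simp)

/-- No regularity is lost by differentiation in either class, which makes the germs closed under
partial derivatives. -/
theorem add_one_le : r + 1 ≤ r := by
  rcases IsSmoothOrAnalytic.out (r := r) with rfl | rfl
  · exact le_rfl
  · exact le_top

end IsSmoothOrAnalytic

namespace ContDiffNear

open IsSmoothOrAnalytic

variable {𝕜 E F G : Type*} [RCLike 𝕜] [NormedAddCommGroup E] [NormedSpace 𝕜 E]
  [NormedAddCommGroup F] [NormedSpace 𝕜 F] [NormedAddCommGroup G] [NormedSpace 𝕜 G]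
  {r : WithTop ℕ∞} {f g : E → F} {x : E}

theorem contDiffAt (h : ContDiffNear (𝕜 := 𝕜) r f x) : ContDiffAt 𝕜 r f x := h.self_of_nhds

theorem continuousAt (h : ContDiffNear (𝕜 := 𝕜) r f x) : ContinuousAt f x := h.contDiffAt.continuousAt

theorem eventually (h : ContDiffNear (𝕜 := 𝕜) r f x) :
    ∀ᶠ y in 𝓝 x, ContDiffNear (𝕜 := 𝕜) r f y := eventually_eventually_nhds.mpr h

theorem comp {g : F → G} {f : E → F} (hg : ContDiffNear (𝕜 := 𝕜) r g (f x))
    (hf : ContDiffNear (𝕜 := 𝕜) r f x) : ContDiffNear (𝕜 := 𝕜) r (fun y => g (f y)) x := by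
  filter_upwards [hf, hf.continuousAt.eventually hg] with y hy hgy
  exact hgy.comp y hy

theorem of_contDiff (h : ContDiff 𝕜 r f) : ContDiffNear (𝕜 := 𝕜) r f x :=
  .of_forall fun _ => h.contDiffAt

theorem of_contDiffOn {s : Set E} (h : ContDiffOn 𝕜 r f s) (hs : IsOpen s) (hx : x ∈ s) :
    ContDiffNear (𝕜 := 𝕜) r f x :=
  Filter.mem_of_superset (hs.mem_nhds hx) fun _ hy => h.contDiffAt (hs.mem_nhds hy)

theorem const (c : F) : ContDiffNear (𝕜 := 𝕜) r (fun _ : E => c) x := of_contDiff contDiff_const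

theorem clm (A : E →L[𝕜] F) : ContDiffNear (𝕜 := 𝕜) r (fun y => A y) x := of_contDiff A.contDiff

theorem add (hf : ContDiffNear (𝕜 := 𝕜) r f x) (hg : ContDiffNear (𝕜 := 𝕜) r g x) :
    ContDiffNear (𝕜 := 𝕜) r (fun y => f y + g y) x := by
  filter_upwards [hf, hg] with y h1 h2 using h1.add h2

theorem sub (hf : ContDiffNear (𝕜 := 𝕜) r f x) (hg : ContDiffNear (𝕜 := 𝕜) r g x) :
    ContDiffNear (𝕜 := 𝕜) r (fun y => f y - g y) x := by
  filter_upwards [hf, hg] with y h1 h2 using h1.sub h2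

theorem prodMk {g : E → G} (hf : ContDiffNear (𝕜 := 𝕜) r f x)
    (hg : ContDiffNear (𝕜 := 𝕜) r g x) : ContDiffNear (𝕜 := 𝕜) r (fun y => (f y, g y)) x := by
  filter_upwards [hf, hg] with y h1 h2 using h1.prodMk h2

theorem smul {f : E → 𝕜} (hf : ContDiffNear (𝕜 := 𝕜) r f x) (hg : ContDiffNear (𝕜 := 𝕜) r g x) :
    ContDiffNear (𝕜 := 𝕜) r (fun y => f y • g y) x := by
  filter_upwards [hf, hg] with y h1 h2 using h1.smul h2

theorem mul {f g : E → 𝕜} (hf : ContDiffNear (𝕜 := 𝕜) r f x) (hg : ContDiffNear (𝕜 := 𝕜) r g x) :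
    ContDiffNear (𝕜 := 𝕜) r (fun y => f y * g y) x := hf.smul hg

theorem inv {f : E → 𝕜} (hf : ContDiffNear (𝕜 := 𝕜) r f x) (h0 : f x ≠ 0) :
    ContDiffNear (𝕜 := 𝕜) r (fun y => (f y)⁻¹) x := by
  filter_upwards [hf, hf.continuousAt.eventually_ne h0] with y h1 h2 using h1.inv h2

theorem sum {ι : Type*} {s : Finset ι} {f : ι → E → F}
    (hf : ∀ i ∈ s, ContDiffNear (𝕜 := 𝕜) r (f i) x) :
    ContDiffNear (𝕜 := 𝕜) r (fun y => ∑ i ∈ s, f i y) x := by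
  have := (Filter.eventually_all_finset s).mpr hf
  filter_upwards [this] with y hy using ContDiffAt.sum hy

theorem pi {ι : Type*} [Fintype ι] {F : ι → Type*} [∀ i, NormedAddCommGroup (F i)]
    [∀ i, NormedSpace 𝕜 (F i)] {f : E → ∀ i, F i}
    (hf : ∀ i, ContDiffNear (𝕜 := 𝕜) r (fun y => f y i) x) : ContDiffNear (𝕜 := 𝕜) r f x := by
  filter_upwards [Filter.eventually_all.mpr hf] with y hy using contDiffAt_pi.mpr hy

theorem clm_apply {f : E → F →L[𝕜] G} {g : E → F} (hf : ContDiffNear (𝕜 := 𝕜) r f x)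
    (hg : ContDiffNear (𝕜 := 𝕜) r g x) : ContDiffNear (𝕜 := 𝕜) r (fun y => f y (g y)) x := by
  filter_upwards [hf, hg] with y h1 h2 using h1.clm_apply h2

variable [IsSmoothOrAnalytic r]

protected theorem fderiv (hf : ContDiffNear (𝕜 := 𝕜) r f x) :
    ContDiffNear (𝕜 := 𝕜) r (fderiv 𝕜 f) x := by
  filter_upwards [hf] with y hy using hy.fderiv_right (add_one_le r)

theorem differentiableAt (hf : ContDiffNear (𝕜 := 𝕜) r f x) : DifferentiableAt 𝕜 f x :=
  hf.contDiffAt.differentiableAt (ne_zero r)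

theorem hasFDerivAt (hf : ContDiffNear (𝕜 := 𝕜) r f x) : HasFDerivAt f (_root_.fderiv 𝕜 f x) x :=
  hf.differentiableAt.hasFDerivAt

theorem fderiv_comm (hf : ContDiffNear (𝕜 := 𝕜) r f x) (v w : E) :
    _root_.fderiv 𝕜 (fun y => _root_.fderiv 𝕜 f y w) x v =
      _root_.fderiv 𝕜 (fun y => _root_.fderiv 𝕜 f y v) x w := by
  have h := (hf.contDiffAt.isSymmSndFDerivAt (by
    rw [minSmoothness_of_isRCLikeNormedField]; exact mod_cast natCast_le r 2)).eq v w
  rw [fderiv_clm_apply hf.fderiv.differentiableAt (by fun_prop),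
    fderiv_clm_apply hf.fderiv.differentiableAt (by fun_prop)]
  simpa using h

end ContDiffNear

end LogSymplectic

/-! ### Superposition operators on spaces of continuous curves -/

namespace LogSymplectic

section Nemytskii

variable {T : Type*} [TopologicalSpace T] [CompactSpace T]

open Classical in
/-- The superposition operator `u ↦ f ∘ u`, with value `0` where `f ∘ u` is not continuous. -/
noncomputable def nemytskii {E F : Type*} [TopologicalSpace E] [TopologicalSpace F] [Zero F]
    (f : E → F) (u : C(T, E)) : C(T, F) :=
  if h : Continuous fun t => f (u t) then ⟨fun t => f (u t), h⟩ else 0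

theorem nemytskii_apply {E F : Type*} [TopologicalSpace E] [TopologicalSpace F] [Zero F]
    {f : E → F} {u : C(T, E)} (h : ∀ t, ContinuousAt f (u t)) (t : T) :
    nemytskii f u t = f (u t) := by
  have : Continuous fun t => f (u t) := continuous_iff_continuousAt.mpr fun t =>
    ContinuousAt.comp (f := u) (h t) u.continuous.continuousAt
  rw [nemytskii, dif_pos this]
  rfl

variable {𝕜 E F : Type*} [RCLike 𝕜] [NormedAddCommGroup E] [NormedSpace 𝕜 E]
  [NormedAddCommGroup F] [NormedSpace 𝕜 F]

/-- Pointwise application of a family of operators to a family of vectors. -/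
noncomputable def pointwiseApply :
    C(T, E →L[𝕜] F) →L[𝕜] C(T, E) →L[𝕜] C(T, F) :=
  LinearMap.mkContinuous₂
    (LinearMap.mk₂ 𝕜 (fun (A : C(T, E →L[𝕜] F)) (v : C(T, E)) =>
      (⟨fun t => A t (v t), by fun_prop⟩ : C(T, F)))
      (fun A B v => by ext t; simp) (fun c A v => by ext t; simp)
      (fun A v w => by ext t; simp) (fun c A v => by ext t; simp)) 1 (fun A v => by
      rw [one_mul]
      refine (ContinuousMap.norm_le _ (by positivity)).mpr fun t => ?_
      exact (ContinuousLinearMap.le_opNorm _ _).trans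
        (mul_le_mul (A.norm_coe_le_norm t) (v.norm_coe_le_norm t) (norm_nonneg _)
          (norm_nonneg (E := C(T, E →L[𝕜] F)) _)))

theorem pointwiseApply_apply (A : C(T, E →L[𝕜] F)) (v : C(T, E)) (t : T) :
    pointwiseApply A v t = A t (v t) := rfl

theorem isOpen_range_subset {B : Set E} (hB : IsOpen B) : IsOpen {u : C(T, E) | ∀ t, u t ∈ B} := by
  have := ContinuousMap.isOpen_setOf_mapsTo (X := T) isCompact_univ hB
  simpa [Set.MapsTo] using this

/-- Uniform continuity of `f` along the range of `u`. -/
theorem exists_dist_lt {f : E → F} (u : C(T, E)) (hf : ∀ t, ContinuousAt f (u t)) {ε : ℝ}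
    (hε : 0 < ε) : ∃ δ > 0, ∀ t y, dist y (u t) < δ → dist (f y) (f (u t)) < ε := by
  have h := IsCompact.uniformContinuousAt_of_continuousAt (isCompact_range u.continuous) f
    (by rintro _ ⟨t, rfl⟩; exact hf t) (Metric.dist_mem_uniformity hε)
  obtain ⟨δ, hδ, h⟩ := Metric.mem_uniformity_dist.mp h
  refine ⟨δ, hδ, fun t y hy => ?_⟩
  have := h (a := u t) (b := y) (by rwa [dist_comm])
  simp only [Set.mem_setOf_eq] at this
  rw [dist_comm]
  exact this ⟨t, rfl⟩

theorem continuousAt_nemytskii {f : E → F} {B : Set E} (hB : IsOpen B) (hf : ContinuousOn f B)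
    (u : C(T, E)) (hu : ∀ t, u t ∈ B) : ContinuousAt (nemytskii f) u := by
  rw [Metric.continuousAt_iff]
  intro ε hε
  have hc : ∀ y ∈ B, ContinuousAt f y := fun y hy => hf.continuousAt (hB.mem_nhds hy)
  obtain ⟨δ, hδ, h⟩ := exists_dist_lt u (fun t => hc _ (hu t)) (half_pos hε)
  obtain ⟨δ', hδ', h'⟩ := Metric.isOpen_iff.mp (isOpen_range_subset (T := T) hB) u hu
  refine ⟨min δ δ', lt_min hδ hδ', fun v hv => ?_⟩
  have hvB : ∀ t, v t ∈ B := h' (Metric.mem_ball.mpr (hv.trans_le (min_le_right _ _)))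
  refine lt_of_le_of_lt ((ContinuousMap.dist_le (half_pos hε).le).mpr fun t => ?_) (half_lt_self hε)
  rw [nemytskii_apply (fun t => hc _ (hvB t)), nemytskii_apply fun t => hc _ (hu t)]
  exact (h t (v t) (lt_of_le_of_lt (ContinuousMap.dist_apply_le_dist t)
    (hv.trans_le (min_le_left _ _)))).le

/-- The mean value inequality on a ball around each `u t` estimates the remainder by the oscillation
of the derivative of `f`. By compactness of `T` the radius of the ball can be chosen independently
of `t`. -/
theorem hasFDerivAt_nemytskii {f : E → F} {B : Set E} (hB : IsOpen B) (hf : ContDiffOn 𝕜 1 f B)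
    (u : C(T, E)) (hu : ∀ t, u t ∈ B) :
    HasFDerivAt (nemytskii f) (pointwiseApply (nemytskii (fderiv 𝕜 f) u)) u := by
  have hc : ∀ y ∈ B, ContinuousAt f y := fun y hy => hf.continuousOn.continuousAt (hB.mem_nhds hy)
  have hf' : ContinuousOn (fderiv 𝕜 f) B := hf.continuousOn_fderiv_of_isOpen hB le_rfl
  have hc' : ∀ y ∈ B, ContinuousAt (fderiv 𝕜 f) y := fun y hy => hf'.continuousAt (hB.mem_nhds hy)
  have hd : ∀ y ∈ B, HasFDerivAt f (fderiv 𝕜 f y) y := fun y hy =>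
    ((hf.differentiableOn one_ne_zero).differentiableAt (hB.mem_nhds hy)).hasFDerivAt
  rw [hasFDerivAt_iff_isLittleO, Asymptotics.isLittleO_iff]
  intro ε hε
  obtain ⟨δ, hδ, h⟩ := exists_dist_lt u (fun t => hc' _ (hu t)) hε
  obtain ⟨δ', hδ', h'⟩ : ∃ δ' > 0, ∀ t y, dist y (u t) < δ' → y ∈ B := by
    obtain ⟨δ', hδ', h'⟩ := (isCompact_range u.continuous).exists_thickening_subset_open hB
      (by rintro _ ⟨t, rfl⟩; exact hu t)
    exact ⟨δ', hδ', fun t y hy => h' (Metric.mem_thickening_iff.mpr ⟨u t, ⟨t, rfl⟩, hy⟩)⟩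
  filter_upwards [Metric.ball_mem_nhds u (lt_min hδ hδ')] with v hv
  have hvt : ∀ t, dist (v t) (u t) < min δ δ' := fun t =>
    lt_of_le_of_lt (ContinuousMap.dist_apply_le_dist t) hv
  refine (ContinuousMap.norm_le _ (by positivity)).mpr fun t => ?_
  simp only [ContinuousMap.sub_apply, pointwiseApply_apply]
  rw [nemytskii_apply (fun t => hc _ (h' t _ ((hvt t).trans_le (min_le_right _ _)))),
    nemytskii_apply fun t => hc _ (hu t), nemytskii_apply fun t => hc' _ (hu t)]
  letI := NormedSpace.restrictScalars ℝ 𝕜 E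
  refine ((convex_ball (u t) (min δ δ')).norm_image_sub_le_of_norm_hasFDerivWithin_le'
    (f := f) (f' := fderiv 𝕜 f) (φ := fderiv 𝕜 f (u t)) (C := ε)
    (fun y hy => (hd y (h' t y (hy.trans_le (min_le_right _ _)))).hasFDerivWithinAt)
    (fun y hy => ?_) (Metric.mem_ball_self (lt_min hδ hδ')) (hvt t)).trans ?_
  · rw [← dist_eq_norm]
    exact (h t y (hy.trans_le (min_le_left _ _))).le
  · exact mul_le_mul_of_nonneg_left ((v - u).norm_coe_le_norm t) hε.le

end Nemytskii

/-- The derivative of the superposition with `f` is a continuous linear map applied to the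
superposition with the derivative of `f`, which is one class lower. `E` and `F` share a universe so
that the induction may replace `F` by `E →L[𝕜] F`. -/
theorem contDiffOn_nemytskii_nat.{u} {T : Type*} [TopologicalSpace T] [CompactSpace T] {𝕜 : Type*}
    [RCLike 𝕜] {E F : Type u} [NormedAddCommGroup E] [NormedSpace 𝕜 E]
    [NormedAddCommGroup F] [NormedSpace 𝕜 F] {f : E → F} {B : Set E} (hB : IsOpen B) (n : ℕ)
    (hf : ContDiffOn 𝕜 n f B) :
    ContDiffOn 𝕜 n (nemytskii (T := T) f) {u | ∀ t, u t ∈ B} := by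
  induction n generalizing F with
  | zero =>
    rw [Nat.cast_zero, contDiffOn_zero] at hf ⊢
    exact fun u hu => (continuousAt_nemytskii hB hf u hu).continuousWithinAt
  | succ n ih =>
    have h1 : ContDiffOn 𝕜 1 f B := hf.of_le (by simp)
    have hd := hasFDerivAt_nemytskii (T := T) hB h1
    have hf' : ContDiffOn 𝕜 n (fderiv 𝕜 f) B := hf.fderiv_of_isOpen hB le_rfl
    refine (contDiffOn_succ_iff_fderiv_of_isOpen (isOpen_range_subset hB)).mpr
      ⟨fun u hu => (hd u hu).differentiableAt.differentiableWithinAt,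
        fun h => absurd h (WithTop.natCast_ne_top (α := ℕ∞) n), ?_⟩
    have h2 := (pointwiseApply (T := T) (𝕜 := 𝕜) (E := E) (F := F)).contDiff.comp_contDiffOn (ih hf')
    exact h2.congr fun u hu => (hd u hu).fderiv

theorem contDiffNear_nemytskii_infty.{u} {T : Type*} [TopologicalSpace T] [CompactSpace T]
    {𝕜 : Type*} [RCLike 𝕜] {E F : Type u} [NormedAddCommGroup E] [NormedSpace 𝕜 E]
    [NormedAddCommGroup F] [NormedSpace 𝕜 F] {f : E → F} {x : E}
    (hf : ContDiffNear (𝕜 := 𝕜) ((⊤ : ℕ∞) : WithTop ℕ∞) f x) :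
    ContDiffNear (𝕜 := 𝕜) ((⊤ : ℕ∞) : WithTop ℕ∞) (nemytskii (T := T) f)
      (ContinuousMap.const T x) := by
  obtain ⟨B, hBf, hB, hx⟩ := eventually_nhds_iff.mp hf
  refine .of_contDiffOn (s := {u | ∀ t, u t ∈ B}) ?_ (isOpen_range_subset hB) fun t => hx
  exact contDiffOn_infty.mpr fun n => contDiffOn_nemytskii_nat hB n fun y hy =>
    ((hBf y hy).of_le (mod_cast le_top)).contDiffWithinAt

section Analytic

variable {T : Type*} [TopologicalSpace T] [CompactSpace T] {𝕜 E F : Type*} [RCLike 𝕜]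
  [NormedAddCommGroup E] [NormedSpace 𝕜 E] [NormedAddCommGroup F] [NormedSpace 𝕜 F]

/-- Pointwise application of a multilinear map. -/
noncomputable def pointwiseMultilinear {n : ℕ} (p : E [×n]→L[𝕜] F) :
    C(T, E) [×n]→L[𝕜] C(T, F) :=
  MultilinearMap.mkContinuous
    { toFun := fun v => ⟨fun t => p fun i => v i t, by fun_prop⟩
      map_update_add' := fun v i a b => by
        ext t
        have : ∀ c : C(T, E), (fun j => Function.update v i c j t) =
          Function.update (fun j => v j t) i (c t) := fun c => by
            funext j; by_cases h : j = i
            · subst h; simp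
            · simp [h]
        simp [this]
      map_update_smul' := fun v i c a => by
        ext t
        have : ∀ c : C(T, E), (fun j => Function.update v i c j t) =
          Function.update (fun j => v j t) i (c t) := fun c => by
            funext j; by_cases h : j = i
            · subst h; simp
            · simp [h]
        simp [this] } ‖p‖ fun v => by
      refine (ContinuousMap.norm_le _ (by positivity)).mpr fun t => ?_
      exact (p.le_opNorm _).trans (mul_le_mul_of_nonneg_left
        (Finset.prod_le_prod (fun i _ => norm_nonneg _) fun i _ => (v i).norm_coe_le_norm t)
        (norm_nonneg _))

theorem norm_pointwiseMultilinear_le {n : ℕ} (p : E [×n]→L[𝕜] F) :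
    ‖pointwiseMultilinear (T := T) p‖ ≤ ‖p‖ :=
  MultilinearMap.mkContinuous_norm_le _ (norm_nonneg _) _

/-- Applied pointwise, the power series of `f` at `x` is a power series between the spaces of
curves. The norms of its terms do not increase, so that it converges at least on the same ball. -/
theorem contDiffNear_nemytskii_omega [CompleteSpace F] {f : E → F} {x : E}
    (hf : ContDiffNear (𝕜 := 𝕜) (⊤ : WithTop ℕ∞) f x) :
    ContDiffNear (𝕜 := 𝕜) (⊤ : WithTop ℕ∞) (nemytskii (T := T) f) (ContinuousMap.const T x) := by
  have ha : AnalyticAt 𝕜 f x := hf.contDiffAt.analyticAt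
  obtain ⟨p, R, hp⟩ := ha
  have hcont : ∀ y ∈ Metric.eball x R, ContinuousAt f y := fun y hy =>
    (hp.analyticAt_of_mem hy).continuousAt
  have hP : HasFPowerSeriesOnBall (nemytskii (T := T) f)
      (fun n => pointwiseMultilinear (p n)) (ContinuousMap.const T x) R := by
    refine ⟨hp.r_le.trans (ENNReal.le_of_forall_nnreal_lt fun s hs => ?_), hp.r_pos,
      fun {v} hv => ?_⟩
    · obtain ⟨C, -, hC⟩ := p.norm_mul_pow_le_of_lt_radius hs
      exact FormalMultilinearSeries.le_radius_of_bound _ C fun n =>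
        (mul_le_mul_of_nonneg_right (norm_pointwiseMultilinear_le (p n)) (by positivity)).trans
          (hC n)
    · have hv' : (‖v‖₊ : ENNReal) < R := by
        simpa [edist_eq_enorm_sub, enorm_eq_nnnorm] using hv
      have hvt : ∀ t, v t ∈ Metric.eball (0 : E) R := fun t => by
        have h1 : ‖v t‖₊ ≤ ‖v‖₊ := v.norm_coe_le_norm t
        have h2 : (‖v t‖₊ : ENNReal) < R := lt_of_le_of_lt (ENNReal.coe_le_coe.mpr h1) hv'
        simpa [edist_eq_enorm_sub, enorm_eq_nnnorm] using h2
      have hsum : Summable fun n => pointwiseMultilinear (T := T) (p n) fun _ => v := by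
        refine Summable.of_norm_bounded (p.summable_norm_mul_pow (hv'.trans_le hp.r_le)) fun n => ?_
        refine (ContinuousMultilinearMap.le_opNorm _ _).trans ?_
        rw [Finset.prod_const, Finset.card_univ, Fintype.card_fin]
        exact mul_le_mul_of_nonneg_right (norm_pointwiseMultilinear_le (p n)) (by positivity)
      refine hsum.hasSum_iff.mpr (ContinuousMap.ext fun t => ?_)
      have h1 : HasSum (fun n => p n fun _ => v t)
          ((∑' n, pointwiseMultilinear (T := T) (p n) fun _ => v) t) :=
        hsum.hasSum.map (ContinuousMap.evalCLM 𝕜 t) (ContinuousMap.evalCLM 𝕜 t).continuous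
      rw [h1.unique (hp.hasSum (hvt t)), nemytskii_apply]
      · rfl
      · exact fun t => hcont _ (by simpa [edist_eq_enorm_sub] using hvt t)
  have : ∀ᶠ u in 𝓝 (ContinuousMap.const T x), AnalyticAt 𝕜 (nemytskii (T := T) f) u :=
    hP.analyticAt.eventually_analyticAt
  exact this.mono fun u hu => hu.contDiffAt

end Analytic

theorem contDiffNear_nemytskii.{u} {T : Type*} [TopologicalSpace T] [CompactSpace T]
    {𝕜 : Type*} [RCLike 𝕜] {E F : Type u} [NormedAddCommGroup E] [NormedSpace 𝕜 E]
    [NormedAddCommGroup F] [NormedSpace 𝕜 F] [CompleteSpace F] {r : WithTop ℕ∞}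
    [IsSmoothOrAnalytic r] {f : E → F} {x : E} (hf : ContDiffNear (𝕜 := 𝕜) r f x) :
    ContDiffNear (𝕜 := 𝕜) r (nemytskii (T := T) f) (ContinuousMap.const T x) := by
  rcases IsSmoothOrAnalytic.out (r := r) with rfl | rfl
  · exact contDiffNear_nemytskii_infty hf
  · exact contDiffNear_nemytskii_omega hf

end LogSymplectic

/-! ### Integrals along curves and their dependence on parameters -/

namespace LogSymplectic

open unitInterval

section Integrals

variable {𝕜 F : Type*} [RCLike 𝕜] [NormedAddCommGroup F] [NormedSpace 𝕜 F] [NormedSpace ℝ F]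

/-- The constant extension of a curve to the real line. -/
noncomputable def extendCurve {F : Type*} [TopologicalSpace F] (w : C(I, F)) (t : ℝ) : F :=
  w (Set.projIcc 0 1 zero_le_one t)

theorem continuous_extendCurve {F : Type*} [TopologicalSpace F] (w : C(I, F)) :
    Continuous (extendCurve w) :=
  w.continuous.comp continuous_projIcc

theorem extendCurve_coe {F : Type*} [TopologicalSpace F] (w : C(I, F)) (t : I) :
    extendCurve w t = w t := by
  rw [extendCurve, Set.projIcc_val]

theorem norm_extendCurve_le (w : C(I, F)) (t : ℝ) : ‖extendCurve w t‖ ≤ ‖w‖ :=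
  w.norm_coe_le_norm _

variable [SMulCommClass ℝ 𝕜 F]

/-- `w ↦ ∫₀ᵗ w`. -/
noncomputable def primitive : C(I, F) →L[𝕜] C(I, F) :=
  LinearMap.mkContinuous
    { toFun := fun w => ⟨fun t => ∫ s in (0 : ℝ)..t, extendCurve w s,
        (intervalIntegral.continuous_primitive
          (fun a b => (continuous_extendCurve w).intervalIntegrable a b) 0).comp
          continuous_subtype_val⟩
      map_add' := fun v w => by
        ext t
        exact intervalIntegral.integral_add ((continuous_extendCurve v).intervalIntegrable _ _)
          ((continuous_extendCurve w).intervalIntegrable _ _)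
      map_smul' := fun c w => by
        ext t
        exact intervalIntegral.integral_smul c _ } 1 fun w => by
      refine (ContinuousMap.norm_le _ (by positivity)).mpr fun t => ?_
      refine (intervalIntegral.norm_integral_le_of_norm_le_const
        fun s _ => norm_extendCurve_le w s).trans ?_
      rw [sub_zero, abs_of_nonneg t.2.1, mul_comm]
      exact mul_le_mul_of_nonneg_right t.2.2 (norm_nonneg (E := C(I, F)) _)

/-- `w ↦ ∫₀¹ tˢ w(t) dt`. -/
noncomputable def moment (s : ℕ) : C(I, 𝕜) →L[𝕜] 𝕜 :=
  (ContinuousMap.evalCLM 𝕜 (1 : I)).comp ((primitive (𝕜 := 𝕜) (F := 𝕜)).comp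
    (ContinuousLinearMap.mul 𝕜 C(I, 𝕜) ⟨fun t => ((t : ℝ) : 𝕜) ^ s, by fun_prop⟩))

theorem moment_apply (s : ℕ) (w : C(I, 𝕜)) :
    moment s w = ∫ t in (0 : ℝ)..1, (t : 𝕜) ^ s * extendCurve w t := by
  change ∫ t in (0 : ℝ)..((1 : I) : ℝ), _ = _
  refine intervalIntegral.integral_congr fun t ht => ?_
  rw [Set.Icc.coe_one, Set.uIcc_of_le zero_le_one] at ht
  simp [extendCurve, Set.projIcc_of_mem _ ht]

end Integrals

section Parametric

variable {𝕜 : Type*} [RCLike 𝕜] {r : WithTop ℕ∞} [IsSmoothOrAnalytic r]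

universe u

variable {E E' : Type u} [NormedAddCommGroup E] [NormedAddCommGroup E']

theorem eventually_forall_curve [NormedSpace 𝕜 E] [NormedSpace 𝕜 E'] {p : E' → Prop}
    (L : E →L[𝕜] C(I, E')) (hp : ∀ᶠ y in 𝓝 0, p y) : ∀ᶠ q in 𝓝 0, ∀ t, p (L q t) := by
  obtain ⟨B, hBp, hB, h0⟩ := eventually_nhds_iff.mp hp
  have h1 : {u : C(I, E') | ∀ t, u t ∈ B} ∈ 𝓝 (L 0) :=
    (isOpen_range_subset hB).mem_nhds fun t => by simpa using h0
  filter_upwards [L.continuous.continuousAt h1] with q hq t using hBp _ (hq t)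

variable {𝕜 : Type u} [RCLike 𝕜] [NormedSpace 𝕜 E] [NormedSpace 𝕜 E']

/-- The integral is a composition of two continuous linear maps with a superposition operator, so it
inherits both smoothness and analyticity in the parameter. -/
theorem contDiffNear_moment {f : E' → 𝕜} (hf : ContDiffNear (𝕜 := 𝕜) r f 0)
    (L : E →L[𝕜] C(I, E')) (s : ℕ) :
    ContDiffNear (𝕜 := 𝕜) r (fun q => moment s (nemytskii f (L q))) 0 :=
  ContDiffNear.comp (.clm _) (ContDiffNear.comp (g := nemytskii f)
    (by rw [map_zero]; exact contDiffNear_nemytskii hf) (.clm L))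

theorem eventually_fderiv_moment {f : E' → 𝕜} (hf : ContDiffNear (𝕜 := 𝕜) r f 0)
    (L : E →L[𝕜] C(I, E')) (s : ℕ) : ∀ᶠ q in 𝓝 0, ∀ v,
      fderiv 𝕜 (fun q => moment s (nemytskii f (L q))) q v =
        moment s (pointwiseApply (nemytskii (fderiv 𝕜 f) (L q)) (L v)) := by
  obtain ⟨B, hBf, hB, hx⟩ := eventually_nhds_iff.mp hf
  filter_upwards [eventually_forall_curve L (hB.mem_nhds hx)] with q hq v
  have h1 := hasFDerivAt_nemytskii (𝕜 := 𝕜) hB (fun y hy => ((hBf y hy).of_le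
    (IsSmoothOrAnalytic.one_le r)).contDiffWithinAt) (L q) hq
  have h2 := (moment (𝕜 := 𝕜) s).hasFDerivAt.comp q (h1.comp q L.hasFDerivAt)
  exact congrArg (fun A => A v) h2.fderiv

end Parametric

end LogSymplectic

/-! ### The ring of germs and its partial derivatives -/

namespace LogSymplectic

section GermRing

variable (𝕜 : Type*) [RCLike 𝕜] (r : WithTop ℕ∞) {ι : Type*} [Fintype ι] (x : ι → 𝕜)

/-- The functions of class `C^r` near `x`. -/
def nearAlgebra : Subalgebra 𝕜 ((ι → 𝕜) → 𝕜) where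
  carrier := {f | ContDiffNear (𝕜 := 𝕜) r f x}
  mul_mem' := ContDiffNear.mul
  add_mem' := ContDiffNear.add
  algebraMap_mem' c := ContDiffNear.const c

/-- The functions which vanish near `x`. -/
def nearIdeal : Ideal (nearAlgebra 𝕜 r x) where
  carrier := {f | ∀ᶠ y in 𝓝 x, (f : (ι → 𝕜) → 𝕜) y = 0}
  add_mem' := fun hf hg => by
    filter_upwards [hf, hg] with y h1 h2
    exact (congrArg₂ (· + ·) h1 h2).trans (add_zero _)
  zero_mem' := .of_forall fun _ => rfl
  smul_mem' := fun c f hf => by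
    filter_upwards [hf] with y h1
    exact (congrArg ((c : (ι → 𝕜) → 𝕜) y * ·) h1).trans (mul_zero _)

/-- The ring of germs of functions of class `C^r` at `x`. -/
def GermRing : Type _ := nearAlgebra 𝕜 r x ⧸ nearIdeal 𝕜 r x

noncomputable instance : CommRing (GermRing 𝕜 r x) :=
  inferInstanceAs (CommRing (nearAlgebra 𝕜 r x ⧸ nearIdeal 𝕜 r x))

noncomputable instance : Algebra 𝕜 (GermRing 𝕜 r x) :=
  inferInstanceAs (Algebra 𝕜 (nearAlgebra 𝕜 r x ⧸ nearIdeal 𝕜 r x))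

variable {𝕜 r x} in
/-- The germ of a function. -/
noncomputable def toGerm : nearAlgebra 𝕜 r x →ₐ[𝕜] GermRing 𝕜 r x := Ideal.Quotient.mkₐ 𝕜 (nearIdeal 𝕜 r x)

variable {𝕜 r x}

/-- `f` represents the germ `a`. -/
def Represents (f : (ι → 𝕜) → 𝕜) (a : GermRing 𝕜 r x) : Prop :=
  ∃ hf : ContDiffNear (𝕜 := 𝕜) r f x, toGerm ⟨f, hf⟩ = a

theorem exists_represents (a : GermRing 𝕜 r x) : ∃ f, Represents f a := by
  obtain ⟨⟨f, hf⟩, h⟩ := Ideal.Quotient.mk_surjective a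
  exact ⟨f, hf, h⟩

theorem ContDiffNear.exists_germ {f : (ι → 𝕜) → 𝕜} (hf : ContDiffNear (𝕜 := 𝕜) r f x) :
    ∃ a : GermRing 𝕜 r x, Represents f a := ⟨_, hf, rfl⟩

namespace Represents

variable {f g : (ι → 𝕜) → 𝕜} {a b : GermRing 𝕜 r x}

theorem contDiffNear (h : Represents f a) : ContDiffNear (𝕜 := 𝕜) r f x := h.1

theorem eq_iff (hf : Represents f a) (hg : Represents g b) : a = b ↔ f =ᶠ[𝓝 x] g := by
  obtain ⟨hf, rfl⟩ := hf
  obtain ⟨hg, rfl⟩ := hg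
  refine Ideal.Quotient.eq.trans ?_
  change (∀ᶠ y in 𝓝 x, f y - g y = 0) ↔ _
  simp only [sub_eq_zero]
  rfl

theorem add (hf : Represents f a) (hg : Represents g b) :
    Represents (fun y => f y + g y) (a + b) := by
  obtain ⟨hf, rfl⟩ := hf
  obtain ⟨hg, rfl⟩ := hg
  exact ⟨hf.add hg, rfl⟩

theorem sub (hf : Represents f a) (hg : Represents g b) :
    Represents (fun y => f y - g y) (a - b) := by
  obtain ⟨hf, rfl⟩ := hf
  obtain ⟨hg, rfl⟩ := hg
  exact ⟨hf.sub hg, rfl⟩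

theorem mul (hf : Represents f a) (hg : Represents g b) :
    Represents (fun y => f y * g y) (a * b) := by
  obtain ⟨hf, rfl⟩ := hf
  obtain ⟨hg, rfl⟩ := hg
  exact ⟨hf.mul hg, rfl⟩

theorem const (c : 𝕜) : Represents (fun _ => c) (algebraMap 𝕜 (GermRing 𝕜 r x) c) :=
  ⟨.const c, rfl⟩

theorem zero : Represents (fun _ => (0 : 𝕜)) (0 : GermRing 𝕜 r x) := ⟨.const 0, rfl⟩

theorem one : Represents (fun _ => (1 : 𝕜)) (1 : GermRing 𝕜 r x) := ⟨.const 1, rfl⟩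

theorem neg (hf : Represents f a) : Represents (fun y => -f y) (-a) := by
  have := zero.sub hf
  simpa using this

theorem natCast (n : ℕ) : Represents (fun _ => (n : 𝕜)) (n : GermRing 𝕜 r x) := by
  have := const (r := r) (x := x) (n : 𝕜)
  rwa [map_natCast] at this

theorem smul (c : 𝕜) (hf : Represents f a) : Represents (fun y => c * f y) (c • a) := by
  obtain ⟨hf, rfl⟩ := hf
  exact ⟨(ContDiffNear.const c).mul hf, rfl⟩

theorem sum {κ : Type*} {s : Finset κ} {f : κ → (ι → 𝕜) → 𝕜} {a : κ → GermRing 𝕜 r x}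
    (h : ∀ i ∈ s, Represents (f i) (a i)) :
    Represents (fun y => ∑ i ∈ s, f i y) (∑ i ∈ s, a i) := by
  classical
  induction s using Finset.induction_on with
  | empty => simpa using zero
  | insert i s hi ih =>
    simp only [Finset.sum_insert hi]
    exact (h i (Finset.mem_insert_self i s)).add (ih fun j hj => h j (Finset.mem_insert_of_mem hj))

theorem prod {κ : Type*} {s : Finset κ} {f : κ → (ι → 𝕜) → 𝕜} {a : κ → GermRing 𝕜 r x}
    (h : ∀ i ∈ s, Represents (f i) (a i)) :
    Represents (fun y => ∏ i ∈ s, f i y) (∏ i ∈ s, a i) := by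
  classical
  induction s using Finset.induction_on with
  | empty => simpa using one
  | insert i s hi ih =>
    simp only [Finset.prod_insert hi]
    exact (h i (Finset.mem_insert_self i s)).mul (ih fun j hj => h j (Finset.mem_insert_of_mem hj))

end Represents

variable (𝕜 r x) in
/-- The value of a germ at `x`. -/
noncomputable def germEval : GermRing 𝕜 r x →ₐ[𝕜] 𝕜 :=
  Ideal.Quotient.liftₐ (nearIdeal 𝕜 r x)
    ((Pi.evalAlgHom 𝕜 (fun _ : ι → 𝕜 => 𝕜) x).comp (nearAlgebra 𝕜 r x).val)
    fun f hf => by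
      have : ∀ᶠ y in 𝓝 x, (f : (ι → 𝕜) → 𝕜) y = 0 := hf
      exact this.self_of_nhds

theorem Represents.germEval {f : (ι → 𝕜) → 𝕜} {a : GermRing 𝕜 r x} (h : Represents f a) :
    germEval 𝕜 r x a = f x := by
  obtain ⟨hf, rfl⟩ := h
  rfl

variable [DecidableEq ι] [IsSmoothOrAnalytic r]

theorem ContDiffNear.partial {f : (ι → 𝕜) → 𝕜} (hf : ContDiffNear (𝕜 := 𝕜) r f x) (v : ι → 𝕜) :
    ContDiffNear (𝕜 := 𝕜) r (fun y => _root_.fderiv 𝕜 f y v) x :=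
  hf.fderiv.clm_apply (.const v)

theorem exists_partial (i : ι) (a : GermRing 𝕜 r x) : ∃ b : GermRing 𝕜 r x, ∀ f,
    Represents f a → Represents (fun y => fderiv 𝕜 f y (Pi.single i 1)) b := by
  obtain ⟨g, hg⟩ := exists_represents a
  obtain ⟨b, hb⟩ := (hg.contDiffNear.partial (Pi.single i 1)).exists_germ
  refine ⟨b, fun f hf => ?_⟩
  obtain ⟨c, hc⟩ := (hf.contDiffNear.partial (Pi.single i 1)).exists_germ
  rwa [(hb.eq_iff hc).mpr]
  filter_upwards [((hg.eq_iff hf).mp rfl).eventuallyEq_nhds] with y hy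
  rw [hy.fderiv_eq]

variable (𝕜 r x) in
/-- The partial derivatives of germs. -/
noncomputable def germDeriv (i : ι) : Derivation 𝕜 (GermRing 𝕜 r x) (GermRing 𝕜 r x) :=
  Derivation.mk'
    { toFun := fun a => (exists_partial i a).choose
      map_add' := fun a b => by
        obtain ⟨f, hf⟩ := exists_represents a
        obtain ⟨g, hg⟩ := exists_represents b
        refine (((exists_partial i (a + b)).choose_spec _ (hf.add hg)).eq_iff
          (((exists_partial i a).choose_spec _ hf).add
            ((exists_partial i b).choose_spec _ hg))).mpr ?_
        filter_upwards [hf.contDiffNear, hg.contDiffNear] with y h1 h2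
        have := IsSmoothOrAnalytic.ne_zero r
        rw [fderiv_fun_add (h1.differentiableAt this) (h2.differentiableAt this)]
        rfl
      map_smul' := fun c a => by
        obtain ⟨f, hf⟩ := exists_represents a
        refine (((exists_partial i (c • a)).choose_spec _ (hf.smul c)).eq_iff
          (((exists_partial i a).choose_spec _ hf).smul c)).mpr ?_
        filter_upwards [hf.contDiffNear] with y h1
        rw [fderiv_const_mul (h1.differentiableAt (IsSmoothOrAnalytic.ne_zero r))]
        rfl } fun a b => by
    obtain ⟨f, hf⟩ := exists_represents a
    obtain ⟨g, hg⟩ := exists_represents b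
    refine (((exists_partial i (a * b)).choose_spec _ (hf.mul hg)).eq_iff
      ((hf.mul ((exists_partial i b).choose_spec _ hg)).add
        (hg.mul ((exists_partial i a).choose_spec _ hf)))).mpr ?_
    filter_upwards [hf.contDiffNear, hg.contDiffNear] with y h1 h2
    have := IsSmoothOrAnalytic.ne_zero r
    rw [fderiv_fun_mul (h1.differentiableAt this) (h2.differentiableAt this)]
    rfl

theorem Represents.germDeriv {f : (ι → 𝕜) → 𝕜} {a : GermRing 𝕜 r x} (h : Represents f a) (i : ι) :
    Represents (fun y => fderiv 𝕜 f y (Pi.single i 1)) (germDeriv 𝕜 r x i a) :=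
  (exists_partial i a).choose_spec f h

theorem germDeriv_comm (i j : ι) (a : GermRing 𝕜 r x) :
    germDeriv 𝕜 r x i (germDeriv 𝕜 r x j a) = germDeriv 𝕜 r x j (germDeriv 𝕜 r x i a) := by
  obtain ⟨f, hf⟩ := exists_represents a
  refine (((hf.germDeriv j).germDeriv i).eq_iff ((hf.germDeriv i).germDeriv j)).mpr ?_
  filter_upwards [hf.contDiffNear.eventually] with y hy
  exact hy.fderiv_comm _ _

end GermRing

end LogSymplectic

/-! ### The inverse function theorem, and integration along segments -/

namespace LogSymplectic

open unitInterval

/-- The inverse function theorem in class `C^r`. -/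
theorem ContDiffNear.exists_openPartialHomeomorph {𝕜 E F : Type*} [RCLike 𝕜]
    [NormedAddCommGroup E] [NormedSpace 𝕜 E] [CompleteSpace E] [NormedAddCommGroup F]
    [NormedSpace 𝕜 F] {r : WithTop ℕ∞} [IsSmoothOrAnalytic r] {f : E → F} {x : E}
    (hf : ContDiffNear (𝕜 := 𝕜) r f x) {f' : E ≃L[𝕜] F}
    (hf' : HasFDerivAt f (f' : E →L[𝕜] F) x) {U : Set E} (hU : U ∈ 𝓝 x) :
    ∃ Φ : OpenPartialHomeomorph E F, (Φ : E → F) = f ∧ x ∈ Φ.source ∧ Φ.source ⊆ U ∧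
      (∀ y ∈ Φ.source, ContDiffAt 𝕜 r f y) ∧ ∀ z ∈ Φ.target, ContDiffAt 𝕜 r Φ.symm z := by
  have h1 := IsSmoothOrAnalytic.ne_zero r
  let Φ₀ := hf.contDiffAt.toOpenPartialHomeomorph f hf' h1
  have hΦ₀ : (Φ₀ : E → F) = f := hf.contDiffAt.toOpenPartialHomeomorph_coe hf' h1
  -- The source is shrunk to a set where the derivative is invertible everywhere, so that the
  -- inverse is of class `C^r` on the whole target.
  have h2 : ∀ᶠ y in 𝓝 x, _root_.fderiv 𝕜 f y ∈ Set.range ((↑) : (E ≃L[𝕜] F) → E →L[𝕜] F) := by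
    refine hf.fderiv.continuousAt ?_
    rw [hf'.fderiv]
    exact ContinuousLinearEquiv.nhds f'
  obtain ⟨B, hB, hBo, hx⟩ := eventually_nhds_iff.mp (hf.eventually.and (h2.and hU))
  refine ⟨Φ₀.restrOpen B hBo, hΦ₀,
    ⟨hf.contDiffAt.mem_toOpenPartialHomeomorph_source hf' h1, hx⟩,
    fun y hy => (hB y hy.2).2.2, fun y hy => (hB y hy.2).1.contDiffAt, fun z hz => ?_⟩
  have hy := (Φ₀.restrOpen B hBo).map_target hz
  obtain ⟨g', hg'⟩ := (hB _ hy.2).2.1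
  refine (Φ₀.restrOpen B hBo).contDiffAt_symm (f₀' := g') hz ?_ ?_
  · rw [hg']
    change HasFDerivAt Φ₀ _ _
    rw [hΦ₀]
    exact (hB _ hy.2).1.hasFDerivAt
  · change ContDiffAt 𝕜 r Φ₀ _
    rw [hΦ₀]
    exact (hB _ hy.2).1.contDiffAt

section Segments

universe u

variable {𝕜 : Type u} [RCLike 𝕜] {E E' : Type u} [NormedAddCommGroup E] [NormedSpace 𝕜 E]
  [NormedAddCommGroup E'] [NormedSpace 𝕜 E']

/-- The segments `t ↦ A q + t B q`. -/
noncomputable def segment (A B : E →L[𝕜] E') : E →L[𝕜] C(I, E') :=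
  LinearMap.mkContinuous
    { toFun := fun q => ⟨fun t => A q + ((t : ℝ) : 𝕜) • B q, by fun_prop⟩
      map_add' := fun p q => by ext t; simp; abel
      map_smul' := fun c q => by
        ext t
        change A (c • q) + ((t : ℝ) : 𝕜) • B (c • q) = c • (A q + ((t : ℝ) : 𝕜) • B q)
        rw [map_smul, map_smul, smul_add, smul_comm _ c] } (‖A‖ + ‖B‖) fun q => by
    refine (ContinuousMap.norm_le _ (by positivity)).mpr fun t => ?_
    refine (norm_add_le _ _).trans ?_
    rw [add_mul, norm_smul]
    refine add_le_add (A.le_opNorm q) ((mul_le_of_le_one_left (norm_nonneg _) ?_).trans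
      (B.le_opNorm q))
    rw [RCLike.norm_ofReal, abs_of_nonneg t.2.1]
    exact t.2.2

theorem segment_apply (A B : E →L[𝕜] E') (q : E) (t : I) :
    segment A B q t = A q + ((t : ℝ) : 𝕜) • B q := rfl

theorem moment_congr {s s' : ℕ} {w w' : C(I, 𝕜)}
    (h : ∀ t : I, ((t : ℝ) : 𝕜) ^ s * w t = ((t : ℝ) : 𝕜) ^ s' * w' t) :
    moment s w = moment s' w' := by
  rw [moment_apply, moment_apply]
  refine intervalIntegral.integral_congr fun t ht => ?_
  rw [Set.uIcc_of_le zero_le_one] at ht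
  simpa [extendCurve, Set.projIcc_of_mem _ ht] using h ⟨t, ht⟩

variable {r : WithTop ℕ∞} [IsSmoothOrAnalytic r] {f : E' → 𝕜}

theorem moment_zero_fderiv (A B : E →L[𝕜] E') {q : E}
    (hf : ∀ t, ContDiffNear (𝕜 := 𝕜) r f (segment A B q t)) :
    moment 0 (nemytskii (fun y => fderiv 𝕜 f y (B q)) (segment A B q)) =
      f (A q + B q) - f (A q) := by
  letI := NormedSpace.restrictScalars ℝ 𝕜 E'
  have hc : ∀ t : ℝ, HasDerivAt (fun t : ℝ => A q + (t : 𝕜) • B q) (B q) t := fun t => by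
    have := (RCLike.ofRealCLM (K := 𝕜)).hasDerivAt (x := t)
    simpa using (this.smul_const (B q)).const_add (A q)
  have hg : ∀ t ∈ Set.Icc (0 : ℝ) 1, HasDerivAt (fun t : ℝ => f (A q + (t : 𝕜) • B q))
      (extendCurve (nemytskii (fun y => fderiv 𝕜 f y (B q)) (segment A B q)) t) t := by
    intro t ht
    have h1 := ((hf ⟨t, ht⟩).hasFDerivAt.restrictScalars ℝ).comp_hasDerivAt t (hc t)
    rw [extendCurve, Set.projIcc_of_mem _ ht, nemytskii_apply fun t =>
      ((hf t).fderiv.clm_apply (.const (B q))).continuousAt]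
    exact h1
  rw [moment_apply]
  simp only [pow_zero, one_mul]
  rw [intervalIntegral.integral_eq_sub_of_hasDerivAt (fun t ht => hg t (by
    rwa [Set.uIcc_of_le zero_le_one] at ht))
    ((continuous_extendCurve _).intervalIntegrable _ _)]
  simp

/-- This is the fundamental theorem of calculus for `t^(s+1) f(A q + t B q)` on `[0, 1]`; the lower
boundary term vanishes because of the factor `t^(s+1)`. -/
theorem moment_euler (A B : E →L[𝕜] E') {q : E} (s : ℕ)
    (hf : ∀ t, ContDiffNear (𝕜 := 𝕜) r f (segment A B q t)) :
    moment (s + 1) (nemytskii (fun y => fderiv 𝕜 f y (B q)) (segment A B q))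
      + (s + 1) * moment s (nemytskii f (segment A B q)) = f (A q + B q) := by
  letI := NormedSpace.restrictScalars ℝ 𝕜 E'
  have hc : ∀ t : ℝ, HasDerivAt (fun t : ℝ => A q + (t : 𝕜) • B q) (B q) t := fun t => by
    have := (RCLike.ofRealCLM (K := 𝕜)).hasDerivAt (x := t)
    simpa using (this.smul_const (B q)).const_add (A q)
  have hp : ∀ t : ℝ, HasDerivAt (fun t : ℝ => (t : 𝕜) ^ (s + 1)) ((s + 1) * (t : 𝕜) ^ s) t :=
    fun t => by
      have := ((RCLike.ofRealCLM (K := 𝕜)).hasDerivAt (x := t)).pow (s + 1)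
      exact this.congr_deriv (by simp)
  have hg : ∀ t ∈ Set.Icc (0 : ℝ) 1, HasDerivAt
      (fun t : ℝ => (t : 𝕜) ^ (s + 1) * f (A q + (t : 𝕜) • B q))
      ((t : 𝕜) ^ (s + 1) *
        extendCurve (nemytskii (fun y => fderiv 𝕜 f y (B q)) (segment A B q)) t
        + (s + 1) * ((t : 𝕜) ^ s * extendCurve (nemytskii f (segment A B q)) t)) t := by
    intro t ht
    have h1 := ((hf ⟨t, ht⟩).hasFDerivAt.restrictScalars ℝ).comp_hasDerivAt t (hc t)
    rw [extendCurve, extendCurve, Set.projIcc_of_mem _ ht, nemytskii_apply fun t =>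
      ((hf t).fderiv.clm_apply (.const (B q))).continuousAt,
      nemytskii_apply fun t => (hf t).continuousAt]
    have h2 := (hp t).mul h1
    refine h2.congr_deriv ?_
    rw [add_comm, ← mul_assoc]
    rfl
  have hi : ∀ (s : ℕ) (w : C(I, 𝕜)), IntervalIntegrable
      (fun t : ℝ => (t : 𝕜) ^ s * extendCurve w t) MeasureTheory.volume 0 1 := fun s w =>
    Continuous.intervalIntegrable (by
      have := continuous_extendCurve w
      fun_prop) _ _
  rw [moment_apply, moment_apply, ← intervalIntegral.integral_const_mul,
    ← intervalIntegral.integral_add (hi _ _) ((hi _ _).const_mul _)]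
  rw [intervalIntegral.integral_eq_sub_of_hasDerivAt (fun t ht => hg t (by
    rwa [Set.uIcc_of_le zero_le_one] at ht)) ((hi _ _).add ((hi _ _).const_mul _))]
  simp

end Segments

end LogSymplectic

/-! ### Hadamard's lemma and retractions onto a smooth hypersurface -/

namespace LogSymplectic

open unitInterval

universe u

variable {𝕜 : Type u} [RCLike 𝕜] {r : WithTop ℕ∞} [IsSmoothOrAnalytic r] {m : ℕ}

theorem eventually_segment {E E' : Type u} [NormedAddCommGroup E] [NormedSpace 𝕜 E]
    [NormedAddCommGroup E'] [NormedSpace 𝕜 E'] {f : E' → 𝕜} (hf : ContDiffNear (𝕜 := 𝕜) r f 0)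
    (A B : E →L[𝕜] E') : ∀ᶠ q in 𝓝 0, ∀ t, ContDiffNear (𝕜 := 𝕜) r f (segment A B q t) :=
  eventually_forall_curve (segment A B) hf.eventually

theorem fderiv_eq_sum (f : (Fin m → 𝕜) → 𝕜) (q v : Fin m → 𝕜) :
    fderiv 𝕜 f q v = ∑ a, v a * fderiv 𝕜 f q (Pi.single a 1) := by
  conv_lhs => rw [pi_eq_sum_univ' v, map_sum]
  simp

theorem exists_equiv_of_injective {E F : Type*} [NormedAddCommGroup E] [NormedSpace 𝕜 E]
    [NormedAddCommGroup F] [NormedSpace 𝕜 F] [FiniteDimensional 𝕜 E] [FiniteDimensional 𝕜 F]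
    (hdim : Module.finrank 𝕜 E = Module.finrank 𝕜 F) (A : E →L[𝕜] F)
    (hA : ∀ v, A v = 0 → v = 0) : ∃ e : E ≃L[𝕜] F, (e : E →L[𝕜] F) = A := by
  have hinj : Function.Injective (A : E →ₗ[𝕜] F) := (injective_iff_map_eq_zero A).mpr hA
  refine ⟨(LinearEquiv.ofInjectiveOfFinrankEq (A : E →ₗ[𝕜] F) hinj hdim).toContinuousLinearEquiv,
    ?_⟩
  ext v
  rfl

/-- Hadamard's lemma for a hyperplane. -/
theorem ContDiffNear.exists_hadamard {F : (Fin m → 𝕜) → 𝕜} (hF : ContDiffNear (𝕜 := 𝕜) r F 0)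
    (a : Fin m) : ∃ e, ContDiffNear (𝕜 := 𝕜) r e 0 ∧
      ∀ᶠ q in 𝓝 0, F (q - Pi.single a (q a)) = F q + q a * e q := by
  -- The segment `A q + t B q` runs from the projection of `q` to the hyperplane `q a = 0` to `q`
  -- itself. Its direction is `q a` times the basis vector, and this produces the factor `q a`.
  let B : (Fin m → 𝕜) →L[𝕜] (Fin m → 𝕜) :=
    (ContinuousLinearMap.single 𝕜 (fun _ : Fin m => 𝕜) a).comp (ContinuousLinearMap.proj a)
  let A : (Fin m → 𝕜) →L[𝕜] (Fin m → 𝕜) := ContinuousLinearMap.id 𝕜 _ - B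
  have hB : ∀ q, B q = Pi.single a (q a) := fun q => rfl
  have hA : ∀ q, A q = q - Pi.single a (q a) := fun q => rfl
  refine ⟨fun q => -moment 0 (nemytskii (fun y => fderiv 𝕜 F y (Pi.single a 1)) (segment A B q)),
    ?_, ?_⟩
  · have := contDiffNear_moment (hF.partial (Pi.single a 1)) (segment A B) 0
    simpa using (ContDiffNear.const (0 : 𝕜)).sub this
  · filter_upwards [eventually_segment hF A B] with q hq
    have h := moment_zero_fderiv A B hq
    have h2 : moment 0 (nemytskii (fun y => fderiv 𝕜 F y (B q)) (segment A B q)) =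
        q a * moment 0 (nemytskii (fun y => fderiv 𝕜 F y (Pi.single a 1)) (segment A B q)) := by
      rw [← smul_eq_mul, ← map_smul]
      congr 1
      ext t
      rw [ContinuousMap.smul_apply, nemytskii_apply fun t =>
        ((hq t).partial (Pi.single a 1)).continuousAt, nemytskii_apply fun t =>
        ((hq t).partial (B q)).continuousAt, hB, ← map_smul, ← Pi.single_smul, smul_eq_mul, mul_one]
    rw [h2] at h
    rw [mul_neg, h, hA, hB]
    simp

/-- A retraction onto a smooth hypersurface, with Hadamard's lemma. -/
theorem ContDiffNear.exists_retraction {h : (Fin m → 𝕜) → 𝕜} (hh : ContDiffNear (𝕜 := 𝕜) r h 0)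
    (h0 : h 0 = 0) {a : Fin m} (ha : fderiv 𝕜 h 0 (Pi.single a 1) ≠ 0) :
    ∃ K : (Fin m → 𝕜) → (Fin m → 𝕜), ContDiffNear (𝕜 := 𝕜) r K 0 ∧ K 0 = 0 ∧
      (∀ᶠ q in 𝓝 0, h (K q) = 0) ∧ ∀ f, ContDiffNear (𝕜 := 𝕜) r f 0 →
        ∃ e, ContDiffNear (𝕜 := 𝕜) r e 0 ∧ ∀ᶠ q in 𝓝 0, f (K q) = f q + h q * e q := by
  let S : 𝕜 →L[𝕜] (Fin m → 𝕜) := ContinuousLinearMap.single 𝕜 (fun _ : Fin m => 𝕜) a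
  let pr : (Fin m → 𝕜) →L[𝕜] 𝕜 := ContinuousLinearMap.proj a
  -- The map `ψ` replaces the coordinate `a` by `h` and thus straightens the hypersurface; as `∂_a h
  -- ≠ 0`, it is a local coordinate system.
  let ψ : (Fin m → 𝕜) → (Fin m → 𝕜) := fun q => q + S (h q - pr q)
  have hψa : ∀ q, ψ q a = h q := fun q => by simp [ψ, S, pr]
  have hψ0 : ψ 0 = 0 := by simp [ψ, h0]
  have hψ : ContDiffNear (𝕜 := 𝕜) r ψ 0 :=
    (ContDiffNear.clm (ContinuousLinearMap.id 𝕜 _)).add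
      (ContDiffNear.comp (.clm S) (hh.sub (.clm pr)))
  let ψ' : (Fin m → 𝕜) →L[𝕜] (Fin m → 𝕜) :=
    ContinuousLinearMap.id 𝕜 _ + S.comp (fderiv 𝕜 h 0 - pr)
  have hψ' : HasFDerivAt ψ ψ' 0 :=
    (hasFDerivAt_id 0).add (S.hasFDerivAt.comp 0 (hh.hasFDerivAt.sub pr.hasFDerivAt))
  have hinj : ∀ v, ψ' v = 0 → v = 0 := by
    intro v hv
    have h1 : v = (v a - fderiv 𝕜 h 0 v) • Pi.single a 1 := by
      have h2 : v + S (fderiv 𝕜 h 0 v - v a) = 0 := hv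
      have h3 : S (fderiv 𝕜 h 0 v - v a) = (fderiv 𝕜 h 0 v - v a) • Pi.single a 1 := by
        rw [← Pi.single_smul, smul_eq_mul, mul_one]; rfl
      rw [h3] at h2
      have h4 := eq_neg_of_add_eq_zero_left h2
      rwa [← neg_smul, neg_sub] at h4
    have h2 : fderiv 𝕜 h 0 v = 0 := by
      have := congrFun hv a
      simpa [ψ', S, pr] using this
    rw [h2, sub_zero] at h1
    rw [h1, map_smul, smul_eq_mul] at h2
    rw [h1, (mul_eq_zero.mp h2).resolve_right ha, zero_smul]
  obtain ⟨e', he'⟩ := exists_equiv_of_injective rfl ψ' hinj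
  rw [← he'] at hψ'
  obtain ⟨Φ, hΦ, h0Φ, -, -, hsymm⟩ := hψ.exists_openPartialHomeomorph hψ' Filter.univ_mem
  have h0t : (0 : Fin m → 𝕜) ∈ Φ.target := by
    have := Φ.map_source h0Φ
    rwa [hΦ, hψ0] at this
  have hs0 : Φ.symm 0 = 0 := by
    have := Φ.left_inv h0Φ
    rwa [hΦ, hψ0] at this
  have hsn : ContDiffNear (𝕜 := 𝕜) r Φ.symm 0 :=
    Filter.mem_of_superset (Φ.open_target.mem_nhds h0t) hsymm
  -- The retraction is the projection `Q` to the coordinate hyperplane, conjugated by `ψ`; the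
  -- Hadamard quotient is transported by `ψ` as well.
  let Q : (Fin m → 𝕜) →L[𝕜] (Fin m → 𝕜) := ContinuousLinearMap.id 𝕜 _ - S.comp pr
  have hQ : ∀ q, Q q = q - Pi.single a (q a) := fun q => rfl
  have hQψ : ContDiffNear (𝕜 := 𝕜) r (fun q => Q (ψ q)) 0 := ContDiffNear.comp (.clm Q) hψ
  have hQ0 : Q (ψ 0) = 0 := by rw [hψ0, map_zero]
  refine ⟨fun q => Φ.symm (Q (ψ q)), ContDiffNear.comp (by rwa [hQ0]) hQψ, ?_, ?_, fun f hf => ?_⟩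
  · simp only [hQ0, hs0]
  · have : ∀ᶠ q in 𝓝 0, Q (ψ q) ∈ Φ.target :=
      hQψ.continuousAt (by rw [hQ0]; exact Φ.open_target.mem_nhds h0t)
    filter_upwards [this] with q hq
    rw [← hψa, ← congrFun hΦ, Φ.right_inv hq, hQ]
    simp
  · obtain ⟨e, he, hfe⟩ := ContDiffNear.exists_hadamard (F := fun y => f (Φ.symm y))
      (ContDiffNear.comp (by rwa [hs0]) hsn) a
    refine ⟨fun q => e (ψ q), ContDiffNear.comp (by rwa [hψ0]) hψ, ?_⟩
    filter_upwards [hψ.continuousAt (by rw [hψ0]; exact hfe), Φ.open_source.mem_nhds h0Φ]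
      with q hq hqs
    have h1 : f (Φ.symm (ψ q - Pi.single a (ψ q a))) =
      f (Φ.symm (ψ q)) + ψ q a * e (ψ q) := hq
    rw [hψa, ← hΦ, Φ.left_inv hqs] at h1
    rw [hQ, hψa, ← hΦ]
    exact h1

end LogSymplectic

/-! ### The local calculus of germs -/

namespace LogSymplectic

universe u

variable {𝕜 : Type u} [RCLike 𝕜] {r : WithTop ℕ∞} [IsSmoothOrAnalytic r] {m : ℕ}

variable (𝕜 m) in
/-- The segments `t ↦ t q`. -/
noncomputable def ray : (Fin m → 𝕜) →L[𝕜] C(unitInterval, Fin m → 𝕜) :=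
  segment 0 (ContinuousLinearMap.id 𝕜 _)

theorem ray_apply (q : Fin m → 𝕜) (t : unitInterval) : ray 𝕜 m q t = ((t : ℝ) : 𝕜) • q := by
  simp [ray, segment_apply]

theorem exists_radial (s : ℕ) (a : GermRing 𝕜 r (0 : Fin m → 𝕜)) :
    ∃ b : GermRing 𝕜 r (0 : Fin m → 𝕜), ∀ f, Represents f a →
      Represents (fun q => moment s (nemytskii f (ray 𝕜 m q))) b := by
  obtain ⟨g, hg⟩ := exists_represents a
  obtain ⟨b, hb⟩ := (contDiffNear_moment hg.contDiffNear (ray 𝕜 m) s).exists_germ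
  refine ⟨b, fun f hf => ?_⟩
  obtain ⟨c, hc⟩ := (contDiffNear_moment hf.contDiffNear (ray 𝕜 m) s).exists_germ
  rwa [(hb.eq_iff hc).mpr]
  filter_upwards [eventually_forall_curve (ray 𝕜 m)
    ((hf.contDiffNear.eventually.and hg.contDiffNear.eventually).and ((hg.eq_iff hf).mp rfl))]
    with q hq
  congr 1
  ext t
  rw [nemytskii_apply fun t => (hq t).1.2.continuousAt,
    nemytskii_apply fun t => (hq t).1.1.continuousAt, (hq t).2]

variable (𝕜 r m) in
/-- The radial integrals of germs. -/
noncomputable def germRadial (s : ℕ) :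
    GermRing 𝕜 r (0 : Fin m → 𝕜) →+ GermRing 𝕜 r (0 : Fin m → 𝕜) :=
  AddMonoidHom.mk' (fun a => (exists_radial s a).choose) fun a b => by
    obtain ⟨f, hf⟩ := exists_represents a
    obtain ⟨g, hg⟩ := exists_represents b
    refine (((exists_radial s (a + b)).choose_spec _ (hf.add hg)).eq_iff
      (((exists_radial s a).choose_spec _ hf).add ((exists_radial s b).choose_spec _ hg))).mpr ?_
    filter_upwards [eventually_forall_curve (ray 𝕜 m)
      (hf.contDiffNear.eventually.and hg.contDiffNear.eventually)] with q hq
    rw [← map_add]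
    congr 1
    ext t
    rw [ContinuousMap.add_apply, nemytskii_apply fun t => (hq t).2.continuousAt,
      nemytskii_apply fun t => (hq t).1.continuousAt,
      nemytskii_apply fun t => ((hq t).1.add (hq t).2).continuousAt]

theorem Represents.germRadial {f : (Fin m → 𝕜) → 𝕜} {a : GermRing 𝕜 r (0 : Fin m → 𝕜)}
    (h : Represents f a) (s : ℕ) :
    Represents (fun q => moment s (nemytskii f (ray 𝕜 m q))) (germRadial 𝕜 r m s a) :=
  (exists_radial s a).choose_spec f h

/-- Differentiating `f(t q)` in `q` produces one further factor `t`, which raises the exponent. -/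
theorem eventually_partial_radial {f : (Fin m → 𝕜) → 𝕜} (hf : ContDiffNear (𝕜 := 𝕜) r f 0)
    (s : ℕ) : ∀ᶠ q in 𝓝 (0 : Fin m → 𝕜), ∀ v,
      fderiv 𝕜 (fun q => moment s (nemytskii f (ray 𝕜 m q))) q v =
        moment (s + 1) (nemytskii (fun y => fderiv 𝕜 f y v) (ray 𝕜 m q)) := by
  filter_upwards [eventually_fderiv_moment hf (ray 𝕜 m) s,
    eventually_forall_curve (ray 𝕜 m) hf.eventually] with q hq hq' v
  rw [hq]
  refine moment_congr fun t => ?_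
  rw [pointwiseApply_apply, nemytskii_apply fun t => (hq' t).fderiv.continuousAt,
    nemytskii_apply fun t => ((hq' t).partial v).continuousAt, ray_apply v t, map_smul,
    smul_eq_mul]
  ring

variable (𝕜 r m) in
theorem exists_germ_coord (a : Fin m) : ∃ b : GermRing 𝕜 r (0 : Fin m → 𝕜),
    Represents (fun q => q a) b :=
  (ContDiffNear.clm (ContinuousLinearMap.proj a)).exists_germ

/-- Pulling back germs. -/
theorem exists_pullback {K : (Fin m → 𝕜) → (Fin m → 𝕜)} (hK : ContDiffNear (𝕜 := 𝕜) r K 0)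
    (hK0 : K 0 = 0) : ∃ π : GermRing 𝕜 r (0 : Fin m → 𝕜) →+* GermRing 𝕜 r (0 : Fin m → 𝕜),
      ∀ f a, Represents f a → Represents (fun q => f (K q)) (π a) := by
  have hc : Filter.Tendsto K (𝓝 0) (𝓝 0) := by
    have := hK.continuousAt
    rwa [ContinuousAt, hK0] at this
  have h1 : ∀ a : GermRing 𝕜 r (0 : Fin m → 𝕜), ∃ b : GermRing 𝕜 r (0 : Fin m → 𝕜),
      ∀ f, Represents f a → Represents (fun q => f (K q)) b := by
    intro a
    have hs : ∀ f, Represents f a → ContDiffNear (𝕜 := 𝕜) r (fun q => f (K q)) 0 := fun f hf =>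
      ContDiffNear.comp (by rw [hK0]; exact hf.contDiffNear) hK
    obtain ⟨g, hg⟩ := exists_represents a
    obtain ⟨b, hb⟩ := (hs g hg).exists_germ
    refine ⟨b, fun f hf => ?_⟩
    obtain ⟨c, hc'⟩ := (hs f hf).exists_germ
    rwa [(hb.eq_iff hc').mpr]
    exact hc.eventually ((hg.eq_iff hf).mp rfl)
  choose π hπ using h1
  refine ⟨{ toFun := π, map_one' := ?_, map_mul' := fun a b => ?_, map_zero' := ?_,
            map_add' := fun a b => ?_ }, fun f a hf => hπ a f hf⟩
  · exact ((hπ 1 _ .one).eq_iff .one).mpr .rfl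
  · obtain ⟨f, hf⟩ := exists_represents a
    obtain ⟨g, hg⟩ := exists_represents b
    exact ((hπ _ _ (hf.mul hg)).eq_iff ((hπ _ _ hf).mul (hπ _ _ hg))).mpr .rfl
  · exact ((hπ 0 _ .zero).eq_iff .zero).mpr .rfl
  · obtain ⟨f, hf⟩ := exists_represents a
    obtain ⟨g, hg⟩ := exists_represents b
    exact ((hπ _ _ (hf.add hg)).eq_iff ((hπ _ _ hf).add (hπ _ _ hg))).mpr .rfl

/-- The ring of smooth germs is not a domain, so the derivative is needed: where `g` is nonzero, the
other factor vanishes on an open set, and this contradicts `∂_a f ≠ 0` near the origin. -/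
theorem germ_nzd (h : GermRing 𝕜 r (0 : Fin m → 𝕜)) (a : Fin m)
    (ha : germEval 𝕜 r 0 (germDeriv 𝕜 r 0 a h) ≠ 0) (g : GermRing 𝕜 r (0 : Fin m → 𝕜))
    (hg : h * g = 0) : g = 0 := by
  obtain ⟨f, hf⟩ := exists_represents h
  obtain ⟨l, hl⟩ := exists_represents g
  rw [(hf.germDeriv a).germEval] at ha
  have h1 := ((hf.mul hl).eq_iff .zero).mp hg
  refine (hl.eq_iff .zero).mpr ?_
  have h2 := (hf.contDiffNear.partial (Pi.single a 1)).continuousAt.eventually_ne ha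
  filter_upwards [h2, hf.contDiffNear.eventually, hl.contDiffNear.eventually,
    h1.eventuallyEq_nhds] with q hq hfq hlq hprod
  by_contra hne
  have h3 : f =ᶠ[𝓝 q] fun _ => 0 := by
    filter_upwards [hprod, hlq.continuousAt.eventually_ne hne] with y hy hy'
    exact (mul_eq_zero.mp hy).resolve_right hy'
  apply hq
  rw [h3.fderiv_eq]
  simp

theorem germ_retract (h : GermRing 𝕜 r (0 : Fin m → 𝕜)) (h0 : germEval 𝕜 r 0 h = 0) (a : Fin m)
    (ha : germEval 𝕜 r 0 (germDeriv 𝕜 r 0 a h) ≠ 0)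
    (X : Fin m → GermRing 𝕜 r (0 : Fin m → 𝕜)) (hX : ∀ a, Represents (fun q => q a) (X a)) :
    ∃ π : GermRing 𝕜 r (0 : Fin m → 𝕜) →+* GermRing 𝕜 r (0 : Fin m → 𝕜), π h = 0 ∧
      (∀ f, ∃ e, π f = f + h * e) ∧ ∀ b f, germDeriv 𝕜 r 0 b (π f) =
        ∑ c, π (germDeriv 𝕜 r 0 c f) * germDeriv 𝕜 r 0 b (π (X c)) := by
  obtain ⟨η, hη⟩ := exists_represents h
  rw [hη.germEval] at h0
  rw [(hη.germDeriv a).germEval] at ha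
  obtain ⟨K, hK, hK0, hηK, hhad⟩ := hη.contDiffNear.exists_retraction h0 ha
  obtain ⟨π, hπ⟩ := exists_pullback hK hK0
  refine ⟨π, ((hπ _ _ hη).eq_iff .zero).mpr hηK, fun f => ?_, fun b f => ?_⟩
  · obtain ⟨g, hg⟩ := exists_represents f
    obtain ⟨e, he, hge⟩ := hhad g hg.contDiffNear
    obtain ⟨e', he'⟩ := he.exists_germ
    exact ⟨e', ((hπ _ _ hg).eq_iff (hg.add (hη.mul he'))).mpr hge⟩
  · obtain ⟨g, hg⟩ := exists_represents f
    refine (((hπ _ _ hg).germDeriv b).eq_iff (.sum fun c _ =>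
      (hπ _ _ (hg.germDeriv c)).mul ((hπ _ _ (hX c)).germDeriv b))).mpr ?_
    have hgK : ∀ᶠ q in 𝓝 0, ContDiffNear (𝕜 := 𝕜) r g (K q) :=
      hK.continuousAt (by rw [hK0]; exact hg.contDiffNear.eventually)
    filter_upwards [hgK, hK.eventually] with q hgq hKq
    have h1 : HasFDerivAt (fun q => g (K q)) _ q := hgq.hasFDerivAt.comp q hKq.hasFDerivAt
    rw [h1.fderiv, ContinuousLinearMap.comp_apply, fderiv_eq_sum]
    refine Finset.sum_congr rfl fun c _ => ?_
    have h2 : HasFDerivAt (fun q => K q c) _ q :=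
      (hasFDerivAt_pi'.mp hKq.hasFDerivAt) c
    rw [h2.fderiv, mul_comm]
    rfl

variable (𝕜 r m) in
/-- The calculus of germs of smooth or analytic functions at the origin. -/
noncomputable def germCalculus : LocalCalculus 𝕜 (GermRing 𝕜 r (0 : Fin m → 𝕜)) m where
  D := germDeriv 𝕜 r 0
  D_comm := germDeriv_comm
  ev := germEval 𝕜 r 0
  isUnit a ha := by
    obtain ⟨f, hf⟩ := exists_represents a
    rw [hf.germEval] at ha
    obtain ⟨b, hb⟩ := (hf.contDiffNear.inv ha).exists_germ
    refine IsUnit.of_mul_eq_one b (((hf.mul hb).eq_iff .one).mpr ?_)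
    filter_upwards [hf.contDiffNear.continuousAt.eventually_ne ha] with q hq
    exact mul_inv_cancel₀ hq
  X a := (exists_germ_coord 𝕜 r m a).choose
  ev_X a := (exists_germ_coord 𝕜 r m a).choose_spec.germEval
  D_X a b := by
    have h1 := ((exists_germ_coord 𝕜 r m b).choose_spec.germDeriv a)
    have h2 : ∀ q : Fin m → 𝕜, fderiv 𝕜 (fun q : Fin m → 𝕜 => q b) q (Pi.single a 1) =
        if a = b then 1 else 0 := fun q => by
      have : HasFDerivAt (fun q : Fin m → 𝕜 => q b) (ContinuousLinearMap.proj (R := 𝕜) b) q :=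
        (ContinuousLinearMap.proj (R := 𝕜) (φ := fun _ : Fin m => 𝕜) b).hasFDerivAt
      rw [this.fderiv]
      simp [Pi.single_apply, eq_comm]
    split_ifs with h
    · exact (h1.eq_iff .one).mpr (.of_forall fun q => (h2 q).trans (if_pos h))
    · exact (h1.eq_iff .zero).mpr (.of_forall fun q => (h2 q).trans (if_neg h))
  I := germRadial 𝕜 r m
  D_I s a f := by
    obtain ⟨g, hg⟩ := exists_represents f
    refine (((hg.germRadial s).germDeriv a).eq_iff ((hg.germDeriv a).germRadial (s + 1))).mpr ?_
    filter_upwards [eventually_partial_radial hg.contDiffNear s] with q hq using hq _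
  euler s f := by
    obtain ⟨g, hg⟩ := exists_represents f
    refine (((Represents.sum fun a _ => (exists_germ_coord 𝕜 r m a).choose_spec.mul
      ((hg.germRadial s).germDeriv a)).add
      (((Represents.natCast s).add .one).mul (hg.germRadial s))).eq_iff hg).mpr ?_
    filter_upwards [eventually_partial_radial hg.contDiffNear s,
      eventually_segment hg.contDiffNear 0 (ContinuousLinearMap.id 𝕜 _)] with q hq hq'
    rw [← fderiv_eq_sum, hq]
    have := moment_euler 0 (ContinuousLinearMap.id 𝕜 _) s hq'
    simpa [ray] using this
  nzd f _ a ha g hg := germ_nzd f a ha g hg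
  retract h h0 a ha := germ_retract h h0 a ha _ fun a => (exists_germ_coord 𝕜 r m a).choose_spec

end LogSymplectic

/-! ### Flows from the inverse function theorem in a space of curves -/

namespace LogSymplectic

section Flow

open unitInterval

universe u

variable {𝕜 : Type u} [RCLike 𝕜] {r : WithTop ℕ∞} [IsSmoothOrAnalytic r] {A E : Type u}
  [NormedAddCommGroup A] [NormedSpace 𝕜 A] [NormedAddCommGroup E] [NormedSpace 𝕜 E]

variable (𝕜 A E) in
/-- `(w, u) ↦ ((1 - t) w(t), u(t))`. -/
noncomputable def slopePair : C(I, A) × C(I, E) →L[𝕜] C(I, A × E) :=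
  LinearMap.mkContinuous
    { toFun := fun p => ⟨fun t => (((1 - (t : ℝ) : ℝ) : 𝕜) • p.1 t, p.2 t), by fun_prop⟩
      map_add' := fun p q => by
        ext t
        · change _ • (p.1 t + q.1 t) = _
          rw [smul_add]; rfl
        · rfl
      map_smul' := fun c p => by
        ext t
        · change _ • (c • p.1 t) = _
          rw [smul_comm]; rfl
        · rfl } 1 fun p => by
    refine (ContinuousMap.norm_le _ (by positivity)).mpr fun t => ?_
    rw [one_mul]
    refine max_le ?_ ((p.2.norm_coe_le_norm t).trans (le_max_right _ _))
    refine le_trans ?_ ((p.1.norm_coe_le_norm t).trans (le_max_left _ _))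
    change ‖((1 - (t : ℝ) : ℝ) : 𝕜) • p.1 t‖ ≤ _
    rw [norm_smul]
    refine mul_le_of_le_one_left (norm_nonneg _) ?_
    rw [RCLike.norm_ofReal, abs_of_nonneg (sub_nonneg.mpr t.2.2)]
    linarith [t.2.1]

theorem slopePair_apply (p : C(I, A) × C(I, E)) (t : I) :
    slopePair 𝕜 A E p t = (((1 - (t : ℝ) : ℝ) : 𝕜) • p.1 t, p.2 t) := rfl

variable (𝕜) in
/-- The curve `t ↦ ((1 - t) S(u(t)), u(t))`. -/
noncomputable def slopeCurve (S : E → A) (u : C(I, E)) : C(I, A × E) :=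
  slopePair 𝕜 A E (nemytskii S u, u)

theorem slopeCurve_apply {S : E → A} {u : C(I, E)} (hS : ∀ t, ContinuousAt S (u t)) (t : I) :
    slopeCurve 𝕜 S u t = (((1 - (t : ℝ) : ℝ) : 𝕜) • S (u t), u t) := by
  rw [slopeCurve, slopePair_apply, nemytskii_apply hS]

/-- Time enters only through the linear operator `slopePair`. The regularity of superpositions with
maps that do not depend on `t` therefore suffices, also in the analytic class. -/
theorem contDiffNear_slopeCurve [CompleteSpace A] {S : E → A}
    (hS : ContDiffNear (𝕜 := 𝕜) r S 0) : ContDiffNear (𝕜 := 𝕜) r (slopeCurve 𝕜 S) 0 :=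
  ContDiffNear.comp (g := slopePair 𝕜 A E) (.clm _)
    (ContDiffNear.prodMk (x := (0 : C(I, E))) (contDiffNear_nemytskii hS)
      (ContDiffNear.clm (ContinuousLinearMap.id 𝕜 _)))

theorem slopeCurve_zero {S : E → A} (hS : ContinuousAt S 0) (hS0 : S 0 = 0) :
    slopeCurve 𝕜 S 0 = 0 := by
  ext t : 1
  rw [slopeCurve_apply (fun _ => hS)]
  simp [hS0]

theorem hasFDerivAt_nemytskii_of_forall {E' F : Type*} [NormedAddCommGroup E'] [NormedSpace 𝕜 E']
    [NormedAddCommGroup F] [NormedSpace 𝕜 F] {f : E' → F} {u : C(I, E')}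
    (h : ∀ t, ContDiffNear (𝕜 := 𝕜) r f (u t)) :
    HasFDerivAt (nemytskii f) (pointwiseApply (nemytskii (fderiv 𝕜 f) u)) u := by
  refine hasFDerivAt_nemytskii (𝕜 := 𝕜) (B := {y | ContDiffNear (𝕜 := 𝕜) r f y}) ?_
    (fun y hy => (hy.contDiffAt.of_le (IsSmoothOrAnalytic.one_le r)).contDiffWithinAt) u h
  exact isOpen_iff_mem_nhds.mpr fun y hy => ContDiffNear.eventually hy

/-- The derivative of the superposition with the vector field `X(t, q) = Y((1 - t) S(q), q)`. -/
theorem hasFDerivAt_nemytskii_slopeCurve {S : E → A} {Y : A × E → E} {u : C(I, E)}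
    (hS : ∀ t, ContDiffNear (𝕜 := 𝕜) r S (u t))
    (hY : ∀ t, ContDiffNear (𝕜 := 𝕜) r Y (slopeCurve 𝕜 S u t)) :
    ∃ N' : C(I, E) →L[𝕜] C(I, E), HasFDerivAt (fun u => nemytskii Y (slopeCurve 𝕜 S u)) N' u ∧
      (∀ v t, N' v t =
        fderiv 𝕜 (fun q => Y (((1 - (t : ℝ) : ℝ) : 𝕜) • S q, q)) (u t) (v t)) ∧
      ∀ v t, N' v t = fderiv 𝕜 Y (slopeCurve 𝕜 S u t)
        (((1 - (t : ℝ) : ℝ) : 𝕜) • fderiv 𝕜 S (u t) (v t), v t) := by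
  have h1 : HasFDerivAt (slopeCurve 𝕜 S) _ u := (slopePair 𝕜 A E).hasFDerivAt.comp u
    ((hasFDerivAt_nemytskii_of_forall hS).prodMk (hasFDerivAt_id u))
  have h3 : ∀ v t, ((pointwiseApply (nemytskii (fderiv 𝕜 Y) (slopeCurve 𝕜 S u))).comp
      ((slopePair 𝕜 A E).comp ((pointwiseApply (nemytskii (fderiv 𝕜 S) u)).prod
        (ContinuousLinearMap.id 𝕜 _)))) v t = fderiv 𝕜 Y (slopeCurve 𝕜 S u t)
        (((1 - (t : ℝ) : ℝ) : 𝕜) • fderiv 𝕜 S (u t) (v t), v t) := by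
    intro v t
    rw [ContinuousLinearMap.comp_apply, pointwiseApply_apply,
      nemytskii_apply fun t => (hY t).fderiv.continuousAt, ContinuousLinearMap.comp_apply,
      slopePair_apply, ContinuousLinearMap.prod_apply, pointwiseApply_apply,
      nemytskii_apply fun t => (hS t).fderiv.continuousAt]
    rfl
  refine ⟨_, (hasFDerivAt_nemytskii_of_forall hY).comp u h1, fun v t => ?_, h3⟩
  refine (h3 v t).trans ?_
  have h4 := (hY t).hasFDerivAt
  rw [slopeCurve_apply fun t => (hS t).continuousAt] at h4 ⊢
  have h5 := HasFDerivAt.comp (g := Y) (f := fun q => (((1 - (t : ℝ) : ℝ) : 𝕜) • S q, q)) (u t) h4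
    (((hS t).hasFDerivAt.const_smul (((1 - (t : ℝ) : ℝ) : 𝕜))).prodMk (hasFDerivAt_id (u t)))
  have h6 : fderiv 𝕜 (fun q => Y (((1 - (t : ℝ) : ℝ) : 𝕜) • S q, q)) (u t) = _ := h5.fderiv
  rw [h6]
  rfl

end Flow

end LogSymplectic

namespace LogSymplectic

section Flow

open unitInterval

universe u

variable {𝕜 : Type u} [RCLike 𝕜] {r : WithTop ℕ∞} [IsSmoothOrAnalytic r] {A E : Type u}
  [NormedAddCommGroup A] [NormedSpace 𝕜 A] [NormedAddCommGroup E] [NormedSpace 𝕜 E]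
  [NormedSpace ℝ E]

/-- Integral curves extend to solutions of a differential equation on the real line. -/
theorem exists_hasDerivAt_of_eq_primitive [CompleteSpace E] [SMulCommClass ℝ 𝕜 E] {u w : C(I, E)}
    {p : E} (h : ∀ t, u t = p + primitive (𝕜 := 𝕜) w t) :
    ∃ c : ℝ → E, c 0 = p ∧ (∀ t : I, c t = u t) ∧ ∀ t : I, HasDerivAt c (w t) t := by
  refine ⟨fun t => p + ∫ s in (0 : ℝ)..t, extendCurve w s, by simp, fun t => (h t).symm,
    fun t => ?_⟩
  have h1 := (intervalIntegral.integral_hasDerivAt_right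
    ((continuous_extendCurve w).intervalIntegrable 0 t)
    ((continuous_extendCurve w).stronglyMeasurableAtFilter _ _)
    (continuous_extendCurve w).continuousAt).const_add p
  rwa [extendCurve_coe] at h1

/-- The flow of the time-dependent vector field `X(t, q) = Y((1 - t) S(q), q)`, and its
derivative. -/
theorem exists_flow [CompleteSpace A] [CompleteSpace E] [SMulCommClass ℝ 𝕜 E] {S : E → A}
    {Y : A × E → E} (hS : ContDiffNear (𝕜 := 𝕜) r S 0) (hS0 : S 0 = 0)
    (hY : ContDiffNear (𝕜 := 𝕜) r Y 0) (hY0 : Y 0 = 0) (hY' : HasFDerivAt (𝕜 := 𝕜) Y 0 0) :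
    ∃ φ : E → C(I, E), ContDiffNear (𝕜 := 𝕜) r φ 0 ∧ φ 0 = 0 ∧
      HasFDerivAt φ (segment (ContinuousLinearMap.id 𝕜 E) 0) 0 ∧ ∀ᶠ p in 𝓝 0,
        (∃ c : ℝ → E, c 0 = p ∧ (∀ t : I, c t = φ p t) ∧
          ∀ t : I, HasDerivAt c (Y (((1 - (t : ℝ) : ℝ) : 𝕜) • S (c t), c t)) t) ∧
        ∀ v, ∃ V : ℝ → E, V 0 = v ∧ (∀ t : I, V t = fderiv 𝕜 φ p v t) ∧
          ∀ t : I, HasDerivAt V (fderiv 𝕜 (fun q => Y (((1 - (t : ℝ) : ℝ) : 𝕜) • S q, q))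
            (φ p t) (V t)) t := by
  let N : C(I, E) → C(I, E) := fun u => nemytskii Y (slopeCurve 𝕜 S u)
  have hc0 := slopeCurve_zero (𝕜 := 𝕜) hS.continuousAt hS0
  have hcn := contDiffNear_slopeCurve hS
  have hN : ContDiffNear (𝕜 := 𝕜) r N 0 :=
    ContDiffNear.comp (g := nemytskii Y) (by rw [hc0]; exact contDiffNear_nemytskii hY) hcn
  -- where the operator is smooth
  have hgood : ∀ᶠ u : C(I, E) in 𝓝 0, (∀ t, ContDiffNear (𝕜 := 𝕜) r S (u t)) ∧
      ∀ t, ContDiffNear (𝕜 := 𝕜) r Y (slopeCurve 𝕜 S u t) := by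
    have h1 : ∀ {E' F : Type u} [NormedAddCommGroup E'] [NormedSpace 𝕜 E'] [NormedAddCommGroup F]
        [NormedSpace 𝕜 F] {f : E' → F}, ContDiffNear (𝕜 := 𝕜) r f 0 →
        {u : C(I, E') | ∀ t, u t ∈ {y | ContDiffNear (𝕜 := 𝕜) r f y}} ∈ 𝓝 0 := fun hf =>
      (isOpen_range_subset (isOpen_iff_mem_nhds.mpr fun y hy =>
        ContDiffNear.eventually hy)).mem_nhds fun _ => hf
    exact (Filter.Eventually.and (h1 hS) (hcn.continuousAt (by rw [hc0]; exact h1 hY)))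
  have hN' : HasFDerivAt N (0 : C(I, E) →L[𝕜] C(I, E)) 0 := by
    obtain ⟨N', h1, -, h2⟩ := hasFDerivAt_nemytskii_slopeCurve hgood.self_of_nhds.1
      hgood.self_of_nhds.2
    have : N' = 0 := by
      ext v t
      rw [h2, hc0]
      change fderiv 𝕜 Y 0 _ = 0
      rw [hY'.fderiv]
      rfl
    rwa [this] at h1
  -- A curve `u` is an integral curve starting at `p` exactly when `F u` is the constant curve `p`.
  -- Since `Y` has zero derivative at the origin, the derivative of `F` at the zero curve is the
  -- identity, so `F` is invertible up to time 1, and the flow is its inverse on constant curves.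
  let F : C(I, E) → C(I, E) := fun u => u - primitive (𝕜 := 𝕜) (N u)
  have hF : ContDiffNear (𝕜 := 𝕜) r F 0 :=
    (ContDiffNear.clm (ContinuousLinearMap.id 𝕜 _)).sub (ContDiffNear.comp (.clm _) hN)
  have hF' : HasFDerivAt F ((ContinuousLinearEquiv.refl 𝕜 C(I, E) : C(I, E) ≃L[𝕜] C(I, E)) :
      C(I, E) →L[𝕜] C(I, E)) 0 := by
    have h1 := (hasFDerivAt_id (𝕜 := 𝕜) (0 : C(I, E))).sub
      ((primitive (𝕜 := 𝕜) (F := E)).hasFDerivAt.comp 0 hN')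
    refine h1.congr_fderiv ?_
    ext v t
    simp
  obtain ⟨Ψ, hΨ, h0Ψ, -, -, hsymm⟩ := hF.exists_openPartialHomeomorph hF' hgood
  have hF0 : F 0 = 0 := by
    have : N 0 = 0 := by
      ext t
      change nemytskii Y (slopeCurve 𝕜 S 0) t = 0
      rw [nemytskii_apply fun t => (hgood.self_of_nhds.2 t).continuousAt, hc0]
      exact hY0
    simp [F, this]
  have h0t : (0 : C(I, E)) ∈ Ψ.target := by
    have := Ψ.map_source h0Ψ
    rwa [hΨ, hF0] at this
  have hs0 : Ψ.symm 0 = 0 := by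
    have := Ψ.left_inv h0Ψ
    rwa [hΨ, hF0] at this
  let κ : E →L[𝕜] C(I, E) := segment (ContinuousLinearMap.id 𝕜 E) 0
  have hκ : ∀ p t, κ p t = p := fun p t => by simp [κ, segment_apply]
  have hκ0 : κ 0 = 0 := map_zero κ
  have hsn : ContDiffNear (𝕜 := 𝕜) r Ψ.symm (κ 0) := by
    rw [hκ0]
    exact Filter.mem_of_superset (Ψ.open_target.mem_nhds h0t) hsymm
  let φ : E → C(I, E) := fun p => Ψ.symm (κ p)
  have hφ : ContDiffNear (𝕜 := 𝕜) r φ 0 := ContDiffNear.comp hsn (.clm κ)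
  have hφ0 : φ 0 = 0 := by simp only [φ, hκ0, hs0]
  have hφ' : HasFDerivAt φ κ 0 := by
    have h1 : HasFDerivAt Ψ.symm
        ((ContinuousLinearEquiv.refl 𝕜 C(I, E) : C(I, E) ≃L[𝕜] C(I, E)).symm :
          C(I, E) →L[𝕜] C(I, E)) (κ 0) := by
      rw [hκ0]
      refine Ψ.hasFDerivAt_symm h0t ?_
      rw [hs0, hΨ]
      exact hF'
    exact h1.comp 0 κ.hasFDerivAt
  have hev : ∀ᶠ p in 𝓝 0, φ p = κ p + primitive (𝕜 := 𝕜) (N (φ p)) := by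
    have h1 : ∀ᶠ p in 𝓝 0, κ p ∈ Ψ.target :=
      κ.continuous.continuousAt (by rw [hκ0]; exact Ψ.open_target.mem_nhds h0t)
    filter_upwards [h1] with p hp
    have h2 : F (φ p) = κ p := by rw [← hΨ]; exact Ψ.right_inv hp
    rw [← h2]
    exact (sub_add_cancel _ _).symm
  refine ⟨φ, hφ, hφ0, hφ', ?_⟩
  have hgood' : ∀ᶠ p in 𝓝 0, (∀ t, ContDiffNear (𝕜 := 𝕜) r S (φ p t)) ∧
      ∀ t, ContDiffNear (𝕜 := 𝕜) r Y (slopeCurve 𝕜 S (φ p) t) :=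
    hφ.continuousAt (by rw [hφ0]; exact hgood)
  filter_upwards [eventually_eventually_nhds.mpr hev, hφ.eventually, hgood']
    with p hp hφp ⟨hSp, hYp⟩
  refine ⟨?_, fun v => ?_⟩
  · obtain ⟨c, hc1, hc2, hc3⟩ := exists_hasDerivAt_of_eq_primitive (𝕜 := 𝕜) (u := φ p)
      (w := N (φ p)) (p := p) fun t => by
        conv_lhs => rw [hp.self_of_nhds]
        rw [ContinuousMap.add_apply, hκ]
    refine ⟨c, hc1, hc2, fun t => ?_⟩
    have := hc3 t
    rw [show N (φ p) t = _ from nemytskii_apply (fun t => (hYp t).continuousAt) t,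
      slopeCurve_apply fun t => (hSp t).continuousAt] at this
    rwa [hc2]
  -- Differentiating `φ p = p + ∫ N(φ p)` in `p` gives the integral form of the variational
  -- equation.
  · obtain ⟨N', h1, h2, -⟩ := hasFDerivAt_nemytskii_slopeCurve hSp hYp
    let P : C(I, E) →L[𝕜] C(I, E) := primitive
    have h3a : HasFDerivAt (fun p => N (φ p)) (N'.comp (fderiv 𝕜 φ p)) p :=
      HasFDerivAt.comp (g := N) p h1 hφp.hasFDerivAt
    have h3b : HasFDerivAt (fun p => P (N (φ p))) (P.comp (N'.comp (fderiv 𝕜 φ p))) p :=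
      P.hasFDerivAt.comp p h3a
    have h3 : HasFDerivAt φ (κ + P.comp (N'.comp (fderiv 𝕜 φ p))) p :=
      (κ.hasFDerivAt.add h3b).congr_of_eventuallyEq hp
    obtain ⟨V, hV1, hV2, hV3⟩ := exists_hasDerivAt_of_eq_primitive (𝕜 := 𝕜) (u := fderiv 𝕜 φ p v)
      (w := N' (fderiv 𝕜 φ p v)) (p := v) fun t => by
        conv_lhs => rw [h3.fderiv]
        change κ v t + _ = _
        rw [hκ]
        rfl
    refine ⟨V, hV1, hV2, fun t => ?_⟩
    have := hV3 t
    rwa [h2, ← hV2] at this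

end Flow

end LogSymplectic

/-! ### Cartan's formula and Moser's argument -/

namespace LogSymplectic

section Moser

open unitInterval

variable {𝕜 : Type*} [RCLike 𝕜] {m : ℕ}

/-- The 2-form `w`, given by its coefficients, is differentiable at `q` and `dw = 0` there. -/
structure IsClosedAt (w : Fin m → Fin m → (Fin m → 𝕜) → 𝕜) (q : Fin m → 𝕜) : Prop where
  differentiableAt : ∀ a b, DifferentiableAt 𝕜 (w a b) q
  antisymm : ∀ a b, w a b q = -w b a q
  closed : ∀ a b d, fderiv 𝕜 (w a b) q (Pi.single d 1) =
    fderiv 𝕜 (w d b) q (Pi.single a 1) - fderiv 𝕜 (w d a) q (Pi.single b 1)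

/-- Cartan's formula `L_X w = d(ι_X w)` for a closed 2-form `w`. -/
theorem cartan_formula {w : Fin m → Fin m → (Fin m → 𝕜) → 𝕜} {X : (Fin m → 𝕜) → (Fin m → 𝕜)}
    {θ : Fin m → (Fin m → 𝕜) → 𝕜} {q : Fin m → 𝕜} (hw : IsClosedAt w q) (hX : DifferentiableAt 𝕜 X q)
    (hθ : ∀ b, θ b =ᶠ[𝓝 q] fun y => ∑ c, X y c * w c b y) (a b : Fin m) :
    ∑ c, (X q c * fderiv 𝕜 (w a b) q (Pi.single c 1)
        + fderiv 𝕜 X q (Pi.single a 1) c * w c b q + fderiv 𝕜 X q (Pi.single b 1) c * w a c q) =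
      fderiv 𝕜 (θ b) q (Pi.single a 1) - fderiv 𝕜 (θ a) q (Pi.single b 1) := by
  have hXc : ∀ c, HasFDerivAt (fun y => X y c)
      ((ContinuousLinearMap.proj c).comp (fderiv 𝕜 X q)) q := fun c =>
    hasFDerivAt_pi'.mp hX.hasFDerivAt c
  have h1 : ∀ a b, fderiv 𝕜 (θ b) q (Pi.single a 1) =
      ∑ c, (X q c * fderiv 𝕜 (w c b) q (Pi.single a 1)
        + w c b q * fderiv 𝕜 X q (Pi.single a 1) c) := by
    intro a b
    have h2 : HasFDerivAt (fun y => ∑ c, X y c * w c b y) _ q :=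
      HasFDerivAt.fun_sum fun c (_ : c ∈ Finset.univ) => (hXc c).mul (hw.differentiableAt c b).hasFDerivAt
    rw [(hθ b).fderiv_eq, h2.fderiv, ContinuousLinearMap.sum_apply]
    rfl
  rw [h1, h1, ← Finset.sum_sub_distrib]
  refine Finset.sum_congr rfl fun c _ => ?_
  rw [hw.closed a b c, hw.antisymm a c]
  ring

/-- Moser's argument: the pull-back of `ω - t τ` under the flow of `X_t` is constant. -/
theorem moser_constant {ω τ : Fin m → Fin m → (Fin m → 𝕜) → 𝕜} {θ : Fin m → (Fin m → 𝕜) → 𝕜}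
    {X : ℝ → (Fin m → 𝕜) → (Fin m → 𝕜)} {c V W : ℝ → (Fin m → 𝕜)}
    (hω : ∀ t : I, IsClosedAt ω (c t)) (hτ : ∀ t : I, IsClosedAt τ (c t))
    (hX : ∀ t : I, DifferentiableAt 𝕜 (X t) (c t))
    (hθ : ∀ t : I, ∀ b, θ b =ᶠ[𝓝 (c t)] fun y =>
      ∑ d, X t y d * (ω d b y - ((t : ℝ) : 𝕜) * τ d b y))
    (hθτ : ∀ t : I, ∀ a b, fderiv 𝕜 (θ b) (c t) (Pi.single a 1)
      - fderiv 𝕜 (θ a) (c t) (Pi.single b 1) = τ a b (c t))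
    (hc : ∀ t : I, HasDerivAt c (X t (c t)) t)
    (hV : ∀ t : I, HasDerivAt V (fderiv 𝕜 (X t) (c t) (V t)) t)
    (hW : ∀ t : I, HasDerivAt W (fderiv 𝕜 (X t) (c t) (W t)) t) :
    ∑ a, ∑ b, ω a b (c 0) * (V 0 a * W 0 b) =
      ∑ a, ∑ b, (ω a b (c 1) - τ a b (c 1)) * (V 1 a * W 1 b) := by
  let M : ℝ → 𝕜 := fun t => ∑ a, ∑ b, (ω a b (c t) - (t : 𝕜) * τ a b (c t)) * (V t a * W t b)
  have hM : ∀ t : I, HasDerivAt M 0 t := by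
    intro t
    have hcomp : ∀ f : (Fin m → 𝕜) → 𝕜, DifferentiableAt 𝕜 f (c t) →
        HasDerivAt (fun s => f (c s)) (fderiv 𝕜 f (c t) (X t (c t))) (t : ℝ) := fun f hf =>
      (hf.hasFDerivAt.restrictScalars ℝ).comp_hasDerivAt (t : ℝ) (hc t)
    have hid : HasDerivAt (fun s : ℝ => (s : 𝕜)) 1 (t : ℝ) := by
      simpa using (RCLike.ofRealCLM (K := 𝕜)).hasDerivAt (x := (t : ℝ))
    have hderiv : HasDerivAt M _ (t : ℝ) :=
      HasDerivAt.fun_sum fun a (_ : a ∈ Finset.univ) =>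
        HasDerivAt.fun_sum fun b (_ : b ∈ Finset.univ) =>
          ((hcomp _ ((hω t).differentiableAt a b)).sub (hid.mul (hcomp _ ((hτ t).differentiableAt a b)))).mul
            ((hasDerivAt_pi.mp (hV t) a).mul (hasDerivAt_pi.mp (hW t) b))
    refine hderiv.congr_deriv ?_
    let w : Fin m → Fin m → (Fin m → 𝕜) → 𝕜 := fun a b q => ω a b q - ((t : ℝ) : 𝕜) * τ a b q
    have hw : ∀ a b, HasFDerivAt (w a b)
        (fderiv 𝕜 (ω a b) (c t) - ((t : ℝ) : 𝕜) • fderiv 𝕜 (τ a b) (c t)) (c t) := fun a b =>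
      ((hω t).differentiableAt a b).hasFDerivAt.sub (((hτ t).differentiableAt a b).hasFDerivAt.const_mul _)
    -- For `w = ω - t τ` the Lie derivative along `X t` is `dθ = τ`, which cancels the explicit time
    -- derivative `-τ`.
    have key := cartan_formula (w := w) (θ := θ) ⟨fun a b => (hw a b).differentiableAt,
      fun a b => by simp only [w]; rw [(hω t).antisymm a b, (hτ t).antisymm a b]; ring,
      fun a b d => by
        simp only [(hw _ _).fderiv, ContinuousLinearMap.sub_apply, ContinuousLinearMap.smul_apply,
          (hω t).closed a b d, (hτ t).closed a b d, smul_eq_mul]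
        ring⟩ (hX t) (hθ t)
    have hx : ∀ (f : (Fin m → 𝕜) → 𝕜), fderiv 𝕜 f (c t) (X t (c t)) =
        ∑ d, X t (c t) d * fderiv 𝕜 f (c t) (Pi.single d 1) := fun f => fderiv_eq_sum f _ _
    have hXv : ∀ (v : Fin m → 𝕜) (a : Fin m), fderiv 𝕜 (X t) (c t) v a =
        ∑ d, v d * fderiv 𝕜 (X t) (c t) (Pi.single d 1) a := fun v a => by
      conv_lhs => rw [pi_eq_sum_univ' v, map_sum]
      simp [Finset.sum_apply]
    have e1 : ∀ a b, (∑ d, (X t (c t) d * fderiv 𝕜 (w a b) (c t) (Pi.single d 1)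
        + fderiv 𝕜 (X t) (c t) (Pi.single a 1) d * w d b (c t)
        + fderiv 𝕜 (X t) (c t) (Pi.single b 1) d * w a d (c t))) * (V t a * W t b)
        - τ a b (c t) * (V t a * W t b) = 0 := fun a b => by
      rw [key, hθτ t a b, sub_self]
    have e2 : ∑ a, ∑ b, ((∑ d, (X t (c t) d * fderiv 𝕜 (w a b) (c t) (Pi.single d 1)
        + fderiv 𝕜 (X t) (c t) (Pi.single a 1) d * w d b (c t)
        + fderiv 𝕜 (X t) (c t) (Pi.single b 1) d * w a d (c t))) * (V t a * W t b)
        - τ a b (c t) * (V t a * W t b)) = 0 := by simp only [e1, Finset.sum_const_zero]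
    -- In `e3` and `e4` the terms of the Lie derivative with derivatives of `X` become the
    -- derivatives of `V` and `W` along the curve.
    have e3 : ∑ a, ∑ b, ∑ d, fderiv 𝕜 (X t) (c t) (Pi.single a 1) d * w d b (c t) * (V t a * W t b) =
        ∑ a, ∑ b, w a b (c t) * (fderiv 𝕜 (X t) (c t) (V t) a * W t b) := by
      simp only [hXv (V t), Finset.sum_mul, Finset.mul_sum]
      rw [Finset.sum_comm]
      conv_rhs => rw [Finset.sum_comm]
      refine Finset.sum_congr rfl fun b _ => ?_
      rw [Finset.sum_comm]
      exact Finset.sum_congr rfl fun _ _ => Finset.sum_congr rfl fun _ _ => by ring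
    have e4 : ∑ a, ∑ b, ∑ d, fderiv 𝕜 (X t) (c t) (Pi.single b 1) d * w a d (c t) * (V t a * W t b) =
        ∑ a, ∑ b, w a b (c t) * (V t a * fderiv 𝕜 (X t) (c t) (W t) b) := by
      simp only [hXv (W t), Finset.mul_sum]
      refine Finset.sum_congr rfl fun a _ => ?_
      rw [Finset.sum_comm]
      exact Finset.sum_congr rfl fun _ _ => Finset.sum_congr rfl fun _ _ => by ring
    simp only [Finset.sum_add_distrib, add_mul, Finset.sum_sub_distrib, Finset.sum_mul] at e2
    have e5 : ∀ a b, ∑ d, X t (c t) d * fderiv 𝕜 (w a b) (c t) (Pi.single d 1) * (V t a * W t b) =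
        fderiv 𝕜 (w a b) (c t) (X t (c t)) * (V t a * W t b) := fun a b => by
      rw [hx, Finset.sum_mul]
    rw [e3, e4] at e2
    simp only [e5] at e2
    rw [← e2]
    simp only [(hw _ _).fderiv, ContinuousLinearMap.sub_apply, ContinuousLinearMap.smul_apply,
      smul_eq_mul, one_mul, w, Pi.sub_apply, Pi.mul_apply]
    simp only [← Finset.sum_add_distrib, ← Finset.sum_sub_distrib]
    exact Finset.sum_congr rfl fun a _ => Finset.sum_congr rfl fun b _ => by ring
  have h1 : ∀ t ∈ Set.Icc (0 : ℝ) 1, M t = M 0 :=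
    constant_of_has_deriv_right_zero (fun t ht => (hM ⟨t, ht⟩).continuousAt.continuousWithinAt)
      fun t ht => (hM ⟨t, ht.1, ht.2.le⟩).hasDerivWithinAt
  have h2 := h1 1 ⟨zero_le_one, le_rfl⟩
  simp only [M, RCLike.ofReal_zero, RCLike.ofReal_one, zero_mul, sub_zero, one_mul] at h2
  exact h2.symm

end Moser

end LogSymplectic

namespace LogSymplectic

section

variable {𝕜 : Type*} [RCLike 𝕜] {m : ℕ} {q : Fin m → 𝕜}

namespace IsClosedAt

variable {w w' : Fin m → Fin m → (Fin m → 𝕜) → 𝕜}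

theorem add (h : IsClosedAt w q) (h' : IsClosedAt w' q) :
    IsClosedAt (fun a b y => w a b y + w' a b y) q where
  differentiableAt a b := (h.differentiableAt a b).add (h'.differentiableAt a b)
  antisymm a b := by rw [h.antisymm, h'.antisymm]; ring
  closed a b d := by
    simp only [fderiv_fun_add (h.differentiableAt _ _) (h'.differentiableAt _ _),
      ContinuousLinearMap.add_apply, h.closed a b d, h'.closed a b d]
    ring

theorem sum {ι : Type*} {s : Finset ι} {w : ι → Fin m → Fin m → (Fin m → 𝕜) → 𝕜}
    (h : ∀ i ∈ s, IsClosedAt (w i) q) : IsClosedAt (fun a b y => ∑ i ∈ s, w i a b y) q where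
  differentiableAt a b := DifferentiableAt.fun_sum fun i hi => (h i hi).differentiableAt a b
  antisymm a b := by
    rw [← Finset.sum_neg_distrib]
    exact Finset.sum_congr rfl fun i hi => (h i hi).antisymm a b
  closed a b d := by
    simp only [fderiv_fun_sum fun i hi => (h i hi).differentiableAt _ _,
      ContinuousLinearMap.sum_apply]
    rw [← Finset.sum_sub_distrib]
    exact Finset.sum_congr rfl fun i hi => (h i hi).closed a b d

/-- The form `g(f) df ∧ dl` is closed. -/
theorem mul_wedge {r : WithTop ℕ∞} [IsSmoothOrAnalytic r] {f l : (Fin m → 𝕜) → 𝕜} {g : 𝕜 → 𝕜}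
    (hf : ContDiffNear (𝕜 := 𝕜) r f q) (hl : ContDiffNear (𝕜 := 𝕜) r l q)
    (hg : DifferentiableAt 𝕜 g (f q)) :
    IsClosedAt (fun a b y => g (f y) *
      (fderiv 𝕜 f y (Pi.single a 1) * fderiv 𝕜 l y (Pi.single b 1)
        - fderiv 𝕜 f y (Pi.single b 1) * fderiv 𝕜 l y (Pi.single a 1))) q := by
  have hF := fun a => (hf.partial (Pi.single a 1)).hasFDerivAt
  have hL := fun a => (hl.partial (Pi.single a 1)).hasFDerivAt
  have hgf := hg.hasDerivAt.comp_hasFDerivAt q hf.hasFDerivAt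
  have key := fun a b => hgf.mul (((hF a).mul (hL b)).sub ((hF b).mul (hL a)))
  refine ⟨fun a b => (key a b).differentiableAt, fun a b => by ring, fun a b d => ?_⟩
  have key' := fun a b => (key a b).fderiv
  simp only [Function.comp_def] at key'
  have e : ∀ a b, fderiv 𝕜 (fun y => g (f y) *
      (fderiv 𝕜 f y (Pi.single a 1) * fderiv 𝕜 l y (Pi.single b 1)
        - fderiv 𝕜 f y (Pi.single b 1) * fderiv 𝕜 l y (Pi.single a 1))) q = _ := key'
  simp only [e, ContinuousLinearMap.add_apply, ContinuousLinearMap.smul_apply,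
    ContinuousLinearMap.sub_apply, smul_eq_mul, Pi.sub_apply, Pi.mul_apply]
  rw [hf.fderiv_comm (Pi.single a 1) (Pi.single d 1), hf.fderiv_comm (Pi.single b 1) (Pi.single d 1),
    hf.fderiv_comm (Pi.single a 1) (Pi.single b 1), hl.fderiv_comm (Pi.single a 1) (Pi.single d 1),
    hl.fderiv_comm (Pi.single b 1) (Pi.single d 1), hl.fderiv_comm (Pi.single a 1) (Pi.single b 1)]
  ring

end IsClosedAt

/-- The coefficients of a canonical form. -/
theorem isClosedAt_canonicalForm {r : WithTop ℕ∞} [IsSmoothOrAnalytic r] {n k : ℕ}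
    {u : Coord n k → (Fin m → 𝕜) → 𝕜} (hu : ∀ c, ContDiffNear (𝕜 := 𝕜) r (u c) q)
    (h0 : ∀ i, u (cx i) q ≠ 0) :
    IsClosedAt (fun a b y => canonicalForm (fun c => u c y)
      (fun c => (fderiv 𝕜 (u c) y : (Fin m → 𝕜) →ₗ[𝕜] 𝕜)) ![Pi.single a 1, Pi.single b 1]) q := by
  simp only [canonicalForm_apply, ContinuousLinearMap.coe_coe]
  refine IsClosedAt.add (.sum fun i _ => .mul_wedge (g := fun x => x⁻¹) (hu _) (hu _)
    (differentiableAt_inv (h0 i))) (.sum fun j _ => ?_)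
  simpa using IsClosedAt.mul_wedge (g := fun _ => 1) (hu (cz j)) (hu (cz' j))
    (differentiableAt_const _)

/-- The exterior derivative of a 1-form is closed. -/
theorem isClosedAt_of_primitive {r : WithTop ℕ∞} [IsSmoothOrAnalytic r]
    {θ : Fin m → (Fin m → 𝕜) → 𝕜} {τ : Fin m → Fin m → (Fin m → 𝕜) → 𝕜}
    (hθ : ∀ b, ContDiffNear (𝕜 := 𝕜) r (θ b) q)
    (h : ∀ a b, τ a b =ᶠ[𝓝 q] fun y => fderiv 𝕜 (θ b) y (Pi.single a 1)
      - fderiv 𝕜 (θ a) y (Pi.single b 1)) : IsClosedAt τ q := by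
  have key := fun a b => (((hθ b).partial (Pi.single a 1)).hasFDerivAt.sub
    ((hθ a).partial (Pi.single b 1)).hasFDerivAt).congr_of_eventuallyEq (h a b)
  refine ⟨fun a b => (key a b).differentiableAt, fun a b => ?_, fun a b d => ?_⟩
  · rw [(h a b).self_of_nhds, (h b a).self_of_nhds]; ring
  · simp only [(key _ _).fderiv, ContinuousLinearMap.sub_apply]
    rw [(hθ b).fderiv_comm (Pi.single a 1) (Pi.single d 1),
      (hθ a).fderiv_comm (Pi.single b 1) (Pi.single d 1),
      (hθ d).fderiv_comm (Pi.single a 1) (Pi.single b 1)]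
    ring

end

end LogSymplectic

/-! ### Solving Moser's equation in logarithmic fields -/

namespace LogSymplectic

section MoserField

open unitInterval

universe u

variable {𝕜 : Type u} [RCLike 𝕜] {m n k : ℕ}

/-- The conormal factors `Λ`: the log-vector fields are spanned by `Λ_c ∂_c`. -/
def logFactor (u : Coord n k → 𝕜) : Coord n k → 𝕜 :=
  Sum.elim (Sum.elim (fun i => u (cx i)) fun _ => 1) fun _ => 1

variable (𝕜 n k) in
/-- The contraction of vectors, in the basis `Λ_c ∂_c`, with the canonical form. -/
noncomputable def canonicalContract : (Coord n k → 𝕜) →L[𝕜] (Coord n k → 𝕜) :=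
  ContinuousLinearMap.pi (Sum.elim
    (Sum.elim (fun i => -ContinuousLinearMap.proj (cy i)) fun i => ContinuousLinearMap.proj (cx i))
    (Sum.elim (fun j => -ContinuousLinearMap.proj (cz' j)) fun j => ContinuousLinearMap.proj (cz j)))

theorem canonicalContract_apply (ξ : Coord n k → 𝕜) : canonicalContract 𝕜 n k ξ =
    Sum.elim (Sum.elim (fun i => -ξ (cy i)) fun i => ξ (cx i))
      (Sum.elim (fun j => -ξ (cz' j)) fun j => ξ (cz j)) := by
  funext c
  rcases c with (i | i) | (j | j) <;> rfl

/-- The canonical contraction squares to `-1`. Its coefficients in the basis `Λ_c ∂_c` are constant,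
so that it remains invertible on the divisor. -/
theorem isUnit_canonicalContract : IsUnit (canonicalContract 𝕜 n k) := by
  refine ⟨⟨canonicalContract 𝕜 n k, -canonicalContract 𝕜 n k, ?_, ?_⟩, rfl⟩ <;>
  · ext ξ c
    rw [ContinuousLinearMap.mul_apply, ContinuousLinearMap.neg_apply, canonicalContract_apply,
      canonicalContract_apply]
    rcases c with (i | i) | (j | j) <;> simp

/-- The contraction of vectors, in the basis `Λ_c ∂_c`, with the 2-form with coefficients `T`. -/
noncomputable def formContract (Λ : Coord n k → 𝕜) (T : Coord n k → Coord n k → 𝕜) :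
    (Coord n k → 𝕜) →L[𝕜] (Coord n k → 𝕜) :=
  ∑ c, ∑ d, (Λ c * Λ d * T c d) •
    (ContinuousLinearMap.single 𝕜 (fun _ : Coord n k => 𝕜) d).comp (ContinuousLinearMap.proj c)

theorem formContract_apply (Λ : Coord n k → 𝕜) (T : Coord n k → Coord n k → 𝕜) (ξ : Coord n k → 𝕜)
    (d : Coord n k) : formContract Λ T ξ d = ∑ c, Λ c * Λ d * T c d * ξ c := by
  simp [formContract, Finset.sum_apply, Pi.single_apply,
    -Fintype.sum_sum_type]

theorem frame_apply {du : Coord n k → (Fin m → 𝕜) →L[𝕜] 𝕜} {E : Fin m → Coord n k → 𝕜}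
    (hE : ∀ c d, ∑ a, du c (Pi.single a 1) * E a d = if c = d then 1 else 0) (η : Coord n k → 𝕜)
    (c : Coord n k) : du c (fun a => ∑ d, η d * E a d) = η c := by
  rw [pi_eq_sum_univ' fun a => ∑ d, η d * E a d, map_sum]
  simp only [map_smul, smul_eq_mul, Finset.sum_mul]
  rw [Finset.sum_comm]
  calc _ = ∑ d, η d * ∑ a, du c (Pi.single a 1) * E a d :=
        Finset.sum_congr rfl fun d _ => by
          rw [Finset.mul_sum]; exact Finset.sum_congr rfl fun a _ => by ring
    _ = _ := by simp [hE]

/-- Moser's equation `ι_X (ω₀ + s τ) = θ`, solved in the basis `Λ_c ∂_c`. -/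
theorem moser_equation {u : Coord n k → 𝕜} {du : Coord n k → (Fin m → 𝕜) →L[𝕜] 𝕜}
    {E : Fin m → Coord n k → 𝕜}
    (hE : ∀ c d, ∑ a, du c (Pi.single a 1) * E a d = if c = d then 1 else 0)
    (hE' : ∀ a b, ∑ c, E a c * du c (Pi.single b 1) = if a = b then 1 else 0)
    (hu : ∀ i, u (cx i) ≠ 0) {τ : Fin m → Fin m → 𝕜} {θ : Fin m → 𝕜} {s : 𝕜} {ξ : Coord n k → 𝕜}
    (hξ : ∀ d, (canonicalContract 𝕜 n k
        + s • formContract (logFactor u) fun c d => ∑ a, ∑ b, τ a b * E a c * E b d) ξ d =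
      logFactor u d * ∑ b, θ b * E b d) (b : Fin m) :
    θ b = ∑ a, (∑ c, ξ c * logFactor u c * E a c) *
      (canonicalForm u (fun c => (du c : (Fin m → 𝕜) →ₗ[𝕜] 𝕜)) ![Pi.single a 1, Pi.single b 1]
        + s * τ a b) := by
  set Λ := logFactor u with hΛ
  set X : Fin m → 𝕜 := fun a => ∑ c, ξ c * Λ c * E a c with hX
  set κ := canonicalForm u (fun c => (du c : (Fin m → 𝕜) →ₗ[𝕜] 𝕜)) with hκ
  have hduX : ∀ c, du c X = ξ c * Λ c := frame_apply hE fun c => ξ c * Λ c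
  have hduE : ∀ c d, du c (fun a => E a d) = if c = d then 1 else 0 := by
    intro c d
    rw [← hE, pi_eq_sum_univ' (fun a => E a d), map_sum]
    exact Finset.sum_congr rfl fun a _ => by rw [map_smul, smul_eq_mul, mul_comm]
  have hΛ0 : ∀ d, Λ d ≠ 0 := by
    rintro ((i | i) | j)
    · exact hu i
    · exact one_ne_zero
    · exact one_ne_zero
  -- The factor `x_i⁻¹` of the form cancels against the factor `Λ` of the frame vector or of the
  -- coefficient of `X`; no pole is left.
  have hκE : ∀ d, Λ d * κ ![X, fun a => E a d] = canonicalContract 𝕜 n k ξ d := by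
    intro d
    rw [hκ, canonicalForm_apply, canonicalContract_apply]
    simp only [ContinuousLinearMap.coe_coe, hduX, hduE]
    rcases d with (i | i) | (j | j) <;>
      simp [hΛ, logFactor, mul_ite, hu]
    rw [mul_comm (ξ _), inv_mul_cancel_left₀ (hu i)]
  have hτE : ∀ d, Λ d * ∑ b, (∑ a, X a * τ a b) * E b d =
      formContract Λ (fun c d => ∑ a, ∑ b, τ a b * E a c * E b d) ξ d := by
    intro d
    rw [formContract_apply]
    simp only [hX, Finset.mul_sum, Finset.sum_mul]
    have e1 : ∀ x y z, Λ d * (ξ z * Λ z * E y z * τ y x * E x d) =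
        Λ z * Λ d * (τ y x * E y z * E x d) * ξ z := fun x y z => by ring
    simp only [e1]
    rw [Finset.sum_comm, Finset.sum_congr rfl fun a _ => Finset.sum_comm, Finset.sum_comm]
  have hρ : ∀ d, ∑ b, (∑ a, X a * (κ ![Pi.single a 1, Pi.single b 1] + s * τ a b)) * E b d =
      ∑ b, θ b * E b d := by
    intro d
    refine mul_left_cancel₀ (hΛ0 d) ?_
    rw [← hξ d, ContinuousLinearMap.add_apply, Pi.add_apply, ← hκE, ContinuousLinearMap.smul_apply,
      Pi.smul_apply, ← hτE, form_sum_apply κ, Finset.sum_comm, smul_eq_mul]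
    simp only [mul_add, Finset.sum_add_distrib, Finset.mul_sum, Finset.sum_mul, add_mul]
    congr 1 <;>
      exact Finset.sum_congr rfl fun _ _ => Finset.sum_congr rfl fun _ _ => by ring
  -- A covector is determined by its values on the frame, so it is enough to have compared the two
  -- sides there in `hρ`.
  have hexp : ∀ ρ : Fin m → 𝕜, ρ b = ∑ c, (∑ a, ρ a * E a c) * du c (Pi.single b 1) := by
    intro ρ
    simp only [Finset.sum_mul]
    rw [Finset.sum_comm]
    simp only [mul_assoc, ← Finset.mul_sum, hE']
    simp
  rw [hexp θ]
  simp only [← hρ]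
  exact (hexp fun b => ∑ a, X a * (κ ![Pi.single a 1, Pi.single b 1] + s * τ a b)).symm

end MoserField

end LogSymplectic

namespace LogSymplectic

section MoserFlow

open unitInterval

universe u

variable {𝕜 : Type u} [RCLike 𝕜] {m n k : ℕ} {r : WithTop ℕ∞} [IsSmoothOrAnalytic r]

/-- Solutions of `f' = g f` vanish everywhere or nowhere. -/
theorem eq_zero_iff_of_linear_ode {f : ℝ → 𝕜} (g : C(I, 𝕜))
    (h : ∀ t : I, HasDerivAt f (g t * f t) t) (t : I) : f t = 0 ↔ f 0 = 0 := by
  let G : ℝ → 𝕜 := fun t => ∫ s in (0 : ℝ)..t, extendCurve g s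
  have hG : ∀ t : I, HasDerivAt G (g t) t := fun t => by
    have h1 := intervalIntegral.integral_hasDerivAt_right
      ((continuous_extendCurve g).intervalIntegrable 0 t)
      ((continuous_extendCurve g).stronglyMeasurableAtFilter _ _)
      (continuous_extendCurve g).continuousAt
    rwa [extendCurve_coe] at h1
  -- The exponential of `-∫ g` is an integrating factor.
  have hM : ∀ t : I, HasDerivAt (fun t => f t * NormedSpace.exp (-G t)) 0 t := fun t => by
    have h1 := ((hasDerivAt_exp (x := -G t)).hasFDerivAt.restrictScalars ℝ).comp_hasDerivAt
      (t : ℝ) (hG t).neg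
    refine ((h t).mul h1).congr_deriv ?_
    simp
    ring
  have h1 : ∀ t ∈ Set.Icc (0 : ℝ) 1, f t * NormedSpace.exp (-G t) = f 0 * NormedSpace.exp (-G 0) :=
    constant_of_has_deriv_right_zero (fun t ht => (hM ⟨t, ht⟩).continuousAt.continuousWithinAt)
      fun t ht => (hM ⟨t, ht.1, ht.2.le⟩).hasDerivWithinAt
  have h2 := h1 t t.2
  have h3 : ∀ z : 𝕜, NormedSpace.exp z ≠ 0 := fun z => (NormedSpace.isUnit_exp z).ne_zero
  constructor
  · intro h0
    rw [h0, zero_mul] at h2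
    exact (mul_eq_zero.mp h2.symm).resolve_right (h3 _)
  · intro h0
    rw [h0, zero_mul] at h2
    exact (mul_eq_zero.mp h2).resolve_right (h3 _)

theorem eventually_forall_apply {E E' : Type*} [NormedAddCommGroup E] [NormedAddCommGroup E']
    {φ : E → C(I, E')} (hφ : ContinuousAt φ 0) (h0 : φ 0 = 0) {p : E' → Prop}
    (hp : ∀ᶠ y in 𝓝 0, p y) : ∀ᶠ q in 𝓝 0, ∀ t, p (φ q t) := by
  obtain ⟨B, hBp, hB, hB0⟩ := eventually_nhds_iff.mp hp
  have h1 : {u : C(I, E') | ∀ t, u t ∈ B} ∈ 𝓝 (φ 0) :=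
    (isOpen_range_subset hB).mem_nhds fun t => by simpa [h0] using hB0
  filter_upwards [hφ h1] with q hq t using hBp _ (hq t)

theorem eventually_forall_smul {E A : Type*} [NormedAddCommGroup E] [NormedAddCommGroup A]
    [NormedSpace 𝕜 A] {S : E → A} (hS : ContinuousAt S 0) (hS0 : S 0 = 0) {p : A × E → Prop}
    (hp : ∀ᶠ y in 𝓝 0, p y) :
    ∀ᶠ q in 𝓝 0, ∀ t : I, p (((1 - (t : ℝ) : ℝ) : 𝕜) • S q, q) := by
  obtain ⟨ε, hε, h⟩ := Metric.eventually_nhds_iff.mp hp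
  have h1 : ∀ᶠ q in 𝓝 0, dist (S q) (S 0) < ε := Metric.tendsto_nhds.mp hS ε hε
  filter_upwards [h1, Metric.ball_mem_nhds (0 : E) hε] with q hq hq' t
  refine h ?_
  rw [dist_zero_right, Prod.norm_mk, max_lt_iff]
  rw [hS0, dist_zero_right] at hq
  refine ⟨lt_of_le_of_lt ?_ hq, by simpa using hq'⟩
  rw [norm_smul]
  refine mul_le_of_le_one_left (norm_nonneg _) ?_
  rw [RCLike.norm_ofReal, abs_of_nonneg (sub_nonneg.mpr t.2.2)]
  linarith [t.2.1]

theorem contDiffNear_ringInverse {A : Type*} [NormedRing A] [NormedAlgebra 𝕜 A] [CompleteSpace A]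
    {a : A} (ha : IsUnit a) : ContDiffNear (𝕜 := 𝕜) r Ring.inverse a := by
  filter_upwards [Units.isOpen.mem_nhds ha]
  rintro _ ⟨y, rfl⟩
  exact contDiffAt_ringInverse 𝕜 y

theorem contDiffNear_logFactor {F : Type*} [NormedAddCommGroup F] [NormedSpace 𝕜 F]
    {u : Coord n k → F → 𝕜} {q : F} (hu : ∀ c, ContDiffNear (𝕜 := 𝕜) r (u c) q) (c : Coord n k) :
    ContDiffNear (𝕜 := 𝕜) r (fun y => logFactor (fun c => u c y) c) q := by
  rcases c with (i | i) | j
  · exact hu _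
  · exact .const 1
  · exact .const 1

/-- Differentiability at a zero of second order. -/
theorem hasFDerivAt_zero_mul {F : Type*} [NormedAddCommGroup F] [NormedSpace 𝕜 F]
    {f g : F → 𝕜} {q : F} (hf : HasFDerivAt f (0 : F →L[𝕜] 𝕜) q) (hf0 : f q = 0)
    (hg : DifferentiableAt 𝕜 g q) : HasFDerivAt (fun y => f y * g y) (0 : F →L[𝕜] 𝕜) q := by
  refine (hf.mul hg.hasFDerivAt).congr_fderiv ?_
  ext v
  simp [hf0]

end MoserFlow

end LogSymplectic

/-! ### Moser's theorem for logarithmic forms -/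

namespace LogSymplectic

section MoserTheorem

open unitInterval

universe u

variable {𝕜 : Type u} [RCLike 𝕜] {m n k : ℕ} {r : WithTop ℕ∞} [IsSmoothOrAnalytic r]

/-- The coefficients of a 2-form in a frame `E`. -/
def frameCoeff (τ : Fin m → Fin m → 𝕜) (E : Fin m → Coord n k → 𝕜) (c d : Coord n k) : 𝕜 :=
  ∑ a, ∑ b, τ a b * E a c * E b d

/-- The solution `ξ` of Moser's equation. -/
noncomputable def moserSolution (B : (Coord n k → 𝕜) →L[𝕜] (Coord n k → 𝕜)) (Λ : Coord n k → 𝕜)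
    (θ : Fin m → 𝕜) (E : Fin m → Coord n k → 𝕜) : Coord n k → 𝕜 :=
  Ring.inverse (canonicalContract 𝕜 n k + B) fun d => Λ d * ∑ b, θ b * E b d

variable {u : Coord n k → (Fin m → 𝕜) → 𝕜} {E : Fin m → Coord n k → (Fin m → 𝕜) → 𝕜}
  {τ : Fin m → Fin m → (Fin m → 𝕜) → 𝕜} {θ : Fin m → (Fin m → 𝕜) → 𝕜} {q : Fin m → 𝕜}

theorem contDiffNear_formContract (hu : ∀ c, ContDiffNear (𝕜 := 𝕜) r (u c) q)
    (hE : ∀ a c, ContDiffNear (𝕜 := 𝕜) r (E a c) q)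
    (hτ : ∀ a b, ContDiffNear (𝕜 := 𝕜) r (τ a b) q) :
    ContDiffNear (𝕜 := 𝕜) r (fun y => formContract (logFactor fun c => u c y)
      (frameCoeff (fun a b => τ a b y) fun a c => E a c y)) q :=
  .sum fun c _ => .sum fun d _ => .smul
    (((contDiffNear_logFactor hu c).mul (contDiffNear_logFactor hu d)).mul
      (.sum fun a _ => .sum fun b _ => ((hτ a b).mul (hE a c)).mul (hE b d))) (.const _)

theorem contDiffNear_moserSolution {B : (Coord n k → 𝕜) →L[𝕜] (Coord n k → 𝕜)}
    (hB : IsUnit (canonicalContract 𝕜 n k + B)) (hu : ∀ c, ContDiffNear (𝕜 := 𝕜) r (u c) q)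
    (hE : ∀ a c, ContDiffNear (𝕜 := 𝕜) r (E a c) q) (hθ : ∀ b, ContDiffNear (𝕜 := 𝕜) r (θ b) q) :
    ContDiffNear (𝕜 := 𝕜) r
      (fun y : ((Coord n k → 𝕜) →L[𝕜] (Coord n k → 𝕜)) × (Fin m → 𝕜) =>
        moserSolution y.1 (logFactor fun c => u c y.2) (fun b => θ b y.2) fun a c => E a c y.2)
      (B, q) := by
  have h2 : ContDiffNear (𝕜 := 𝕜) r
    (fun y : ((Coord n k → 𝕜) →L[𝕜] (Coord n k → 𝕜)) × (Fin m → 𝕜) => y.2) (B, q) :=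
    .of_contDiff contDiff_snd
  refine .clm_apply (.comp (g := Ring.inverse) (contDiffNear_ringInverse hB)
    ((ContDiffNear.const _).add (.of_contDiff contDiff_fst))) (.pi fun d => ?_)
  exact (ContDiffNear.comp (contDiffNear_logFactor hu d) h2).mul
    (.sum fun b _ => (ContDiffNear.comp (hθ b) h2).mul (.comp (hE b d) h2))

/-- The solution is linear in `θ`, which vanishes to second order. This supplies the hypothesis of
`exists_flow` that the derivative of the field is zero. -/
theorem hasFDerivAt_moserSolution (hu : ∀ c, ContDiffNear (𝕜 := 𝕜) r (u c) 0)
    (hE : ∀ a c, ContDiffNear (𝕜 := 𝕜) r (E a c) 0)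
    (hθ : ∀ b, HasFDerivAt (θ b) (0 : (Fin m → 𝕜) →L[𝕜] 𝕜) 0) (hθ0 : ∀ b, θ b 0 = 0) :
    HasFDerivAt (fun y : ((Coord n k → 𝕜) →L[𝕜] (Coord n k → 𝕜)) × (Fin m → 𝕜) =>
        moserSolution y.1 (logFactor fun c => u c y.2) (fun b => θ b y.2) fun a c => E a c y.2)
      (0 : ((Coord n k → 𝕜) →L[𝕜] (Coord n k → 𝕜)) × (Fin m → 𝕜) →L[𝕜] (Coord n k → 𝕜)) 0 := by
  have h1 : HasFDerivAt (fun (q : Fin m → 𝕜) (d : Coord n k) =>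
      logFactor (fun c => u c q) d * ∑ b, θ b q * E b d q)
      (0 : (Fin m → 𝕜) →L[𝕜] (Coord n k → 𝕜)) 0 := by
    refine hasFDerivAt_pi'.mpr fun d => ?_
    have h2 : HasFDerivAt (fun q => ∑ b, θ b q * E b d q) _ 0 :=
      HasFDerivAt.fun_sum fun b (_ : b ∈ Finset.univ) =>
        hasFDerivAt_zero_mul (hθ b) (hθ0 b) (hE b d).differentiableAt
    rw [Finset.sum_const_zero] at h2
    have h3 := hasFDerivAt_zero_mul h2 (by simp [hθ0])
      (contDiffNear_logFactor hu d).differentiableAt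
    simpa only [mul_comm, ContinuousLinearMap.comp_zero] using h3
  have h2 : DifferentiableAt 𝕜
      (fun y : ((Coord n k → 𝕜) →L[𝕜] (Coord n k → 𝕜)) × (Fin m → 𝕜) =>
        Ring.inverse (canonicalContract 𝕜 n k + y.1)) 0 := by
    have : ContDiffNear (𝕜 := 𝕜) r (fun y : ((Coord n k → 𝕜) →L[𝕜] (Coord n k → 𝕜)) ×
        (Fin m → 𝕜) => Ring.inverse (canonicalContract 𝕜 n k + y.1)) 0 :=
      .comp (g := Ring.inverse) (contDiffNear_ringInverse (by
        simpa using isUnit_canonicalContract))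
        ((ContDiffNear.const _).add (.of_contDiff contDiff_fst))
    exact this.differentiableAt
  have h3 := h2.hasFDerivAt.clm_apply (h1.comp
    (0 : ((Coord n k → 𝕜) →L[𝕜] (Coord n k → 𝕜)) × (Fin m → 𝕜)) hasFDerivAt_snd)
  have h4 : ((fun (q : Fin m → 𝕜) (d : Coord n k) =>
      logFactor (fun c => u c q) d * ∑ b, θ b q * E b d q) ∘ Prod.snd)
      (0 : ((Coord n k → 𝕜) →L[𝕜] (Coord n k → 𝕜)) × (Fin m → 𝕜)) = 0 := by
    funext d
    simp [hθ0]
  rwa [h4, ContinuousLinearMap.zero_comp, ContinuousLinearMap.comp_zero, map_zero, add_zero] at h3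

/-- Moser's theorem: a second-order perturbation `dθ` of a canonical form is removed by a
diffeomorphism which preserves the components of the divisor. -/
theorem exists_moser (hu : ∀ c, ContDiffNear (𝕜 := 𝕜) r (u c) 0)
    (hE : ∀ a c, ContDiffNear (𝕜 := 𝕜) r (E a c) 0)
    (hτ : ∀ a b, ContDiffNear (𝕜 := 𝕜) r (τ a b) 0) (hτ0 : ∀ a b, τ a b 0 = 0)
    (hθ : ∀ b, ContDiffNear (𝕜 := 𝕜) r (θ b) 0) (hθ0 : ∀ b, θ b 0 = 0)
    (hθ' : ∀ b, fderiv 𝕜 (θ b) 0 = 0)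
    (hdθ : ∀ a b, τ a b =ᶠ[𝓝 0] fun y => fderiv 𝕜 (θ b) y (Pi.single a 1)
      - fderiv 𝕜 (θ a) y (Pi.single b 1))
    (hF : ∀ᶠ q in 𝓝 0, ∀ c d, ∑ a, fderiv 𝕜 (u c) q (Pi.single a 1) * E a d q =
      if c = d then 1 else 0)
    (hF' : ∀ᶠ q in 𝓝 0, ∀ a b, ∑ c, E a c q * fderiv 𝕜 (u c) q (Pi.single b 1) =
      if a = b then 1 else 0) :
    ∃ φ : (Fin m → 𝕜) → (Fin m → 𝕜), ContDiffNear (𝕜 := 𝕜) r φ 0 ∧ φ 0 = 0 ∧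
      HasFDerivAt φ (ContinuousLinearMap.id 𝕜 _) 0 ∧ ∀ᶠ p in 𝓝 0,
        (∀ i, u (cx i) (φ p) = 0 ↔ u (cx i) p = 0) ∧ ((∀ i, u (cx i) p ≠ 0) → ∀ v w,
          ∑ a, ∑ b, (canonicalForm (fun c => u c p)
            (fun c => (fderiv 𝕜 (u c) p : (Fin m → 𝕜) →ₗ[𝕜] 𝕜)) ![Pi.single a 1, Pi.single b 1]
              + τ a b p) * (v a * w b) =
          canonicalForm (fun c => u c (φ p))
            (fun c => (fderiv 𝕜 (u c) (φ p) : (Fin m → 𝕜) →ₗ[𝕜] 𝕜))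
              ![fderiv 𝕜 φ p v, fderiv 𝕜 φ p w]) := by
  let κ : Fin m → Fin m → (Fin m → 𝕜) → 𝕜 := fun a b q => canonicalForm (fun c => u c q)
    (fun c => (fderiv 𝕜 (u c) q : (Fin m → 𝕜) →ₗ[𝕜] 𝕜)) ![Pi.single a 1, Pi.single b 1]
  let S : (Fin m → 𝕜) → ((Coord n k → 𝕜) →L[𝕜] (Coord n k → 𝕜)) := fun y =>
    formContract (logFactor fun c => u c y) (frameCoeff (fun a b => τ a b y) fun a c => E a c y)
  let ξ : ((Coord n k → 𝕜) →L[𝕜] (Coord n k → 𝕜)) × (Fin m → 𝕜) → (Coord n k → 𝕜) := fun y =>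
    moserSolution y.1 (logFactor fun c => u c y.2) (fun b => θ b y.2) fun a c => E a c y.2
  -- The field `X_t(q) = Y((1 - t) S(q), q)` solves `ι_X (κ + (1 - t) τ) = θ`. The coefficient `Λ_c`
  -- in front of `∂_c` makes it tangent to the divisor.
  let Y : ((Coord n k → 𝕜) →L[𝕜] (Coord n k → 𝕜)) × (Fin m → 𝕜) → (Fin m → 𝕜) := fun y a =>
    ∑ c, ξ y c * logFactor (fun c => u c y.2) c * E a c y.2
  have hS := contDiffNear_formContract hu hE hτ
  have hS0 : S 0 = 0 := by
    refine ContinuousLinearMap.ext fun η => funext fun d => ?_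
    simp only [S, formContract_apply, frameCoeff, hτ0, zero_mul, Finset.sum_const_zero, mul_zero]
    rfl
  have hYq : ∀ B q, IsUnit (canonicalContract 𝕜 n k + B) →
      (∀ c, ContDiffNear (𝕜 := 𝕜) r (u c) q) → (∀ a c, ContDiffNear (𝕜 := 𝕜) r (E a c) q) →
      (∀ b, ContDiffNear (𝕜 := 𝕜) r (θ b) q) → ContDiffNear (𝕜 := 𝕜) r Y (B, q) := by
    intro B q hB hu hE hθ
    have h2 : ContDiffNear (𝕜 := 𝕜) r
      (fun y : ((Coord n k → 𝕜) →L[𝕜] (Coord n k → 𝕜)) × (Fin m → 𝕜) => y.2) (B, q) :=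
      .of_contDiff contDiff_snd
    exact .pi fun a => .sum fun c _ => ((ContDiffNear.comp (.clm (ContinuousLinearMap.proj c))
      (contDiffNear_moserSolution hB hu hE hθ)).mul
        (.comp (contDiffNear_logFactor hu c) h2)).mul (.comp (hE a c) h2)
  have hY0 : Y 0 = 0 := by
    funext a
    simp [Y, ξ, moserSolution, hθ0, ← Pi.zero_def]
  have hY' : HasFDerivAt (𝕜 := 𝕜) Y 0 0 := by
    refine hasFDerivAt_pi'.mpr fun a => ?_
    have hξ := hasFDerivAt_pi'.mp (hasFDerivAt_moserSolution (n := n) (k := k) (u := u) (E := E)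
      hu hE (fun b => hθ' b ▸ (hθ b).hasFDerivAt) hθ0)
    have hξ0 : ∀ c, ξ 0 c = 0 := fun c => by simp [ξ, moserSolution, hθ0, ← Pi.zero_def]
    have hsnd : ∀ g : (Fin m → 𝕜) → 𝕜, ContDiffNear (𝕜 := 𝕜) r g 0 → DifferentiableAt 𝕜
        (fun y : ((Coord n k → 𝕜) →L[𝕜] (Coord n k → 𝕜)) × (Fin m → 𝕜) => g y.2) 0 := fun g hg =>
      (show DifferentiableAt 𝕜 g (Prod.snd (0 : ((Coord n k → 𝕜) →L[𝕜] (Coord n k → 𝕜)) ×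
        (Fin m → 𝕜))) from hg.differentiableAt).comp 0 differentiableAt_snd
    have h3 : HasFDerivAt (fun y => Y y a) _ 0 :=
      HasFDerivAt.fun_sum fun c (_ : c ∈ Finset.univ) => hasFDerivAt_zero_mul
        (hasFDerivAt_zero_mul (f := fun y => ξ y c)
          ((hξ c).congr_fderiv (ContinuousLinearMap.comp_zero _)) (hξ0 c)
          (hsnd _ (contDiffNear_logFactor hu c)))
        (by rw [hξ0, zero_mul]) (hsnd _ (hE a c))
    rw [Finset.sum_const_zero] at h3
    rwa [ContinuousLinearMap.comp_zero]
  obtain ⟨φ, hφ, hφ0, hφ', hφp⟩ := exists_flow hS hS0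
    (hYq 0 0 (by simpa using isUnit_canonicalContract) hu hE hθ) hY0 hY'
  let ev₁ : C(I, Fin m → 𝕜) →L[𝕜] (Fin m → 𝕜) := ContinuousMap.evalCLM 𝕜 (1 : I)
  have hev : HasFDerivAt (fun p => φ p 1)
      (ev₁.comp (segment (ContinuousLinearMap.id 𝕜 (Fin m → 𝕜)) 0)) 0 :=
    ev₁.hasFDerivAt.comp 0 hφ'
  refine ⟨fun p => φ p 1, .comp (.clm ev₁) hφ, by simp [hφ0],
    hev.congr_fderiv ?_, ?_⟩
  · ext v a
    simp [segment_apply, ev₁]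
  have hG : ∀ᶠ q in 𝓝 0, ((∀ c, ContDiffNear (𝕜 := 𝕜) r (u c) q) ∧
      (∀ a c, ContDiffNear (𝕜 := 𝕜) r (E a c) q) ∧ (∀ a b, ContDiffNear (𝕜 := 𝕜) r (τ a b) q) ∧
      ∀ b, ContDiffNear (𝕜 := 𝕜) r (θ b) q) ∧ (∀ a b, τ a b =ᶠ[𝓝 q] fun y =>
        fderiv 𝕜 (θ b) y (Pi.single a 1) - fderiv 𝕜 (θ a) y (Pi.single b 1)) ∧
      (∀ᶠ q in 𝓝 q, ∀ c d, ∑ a, fderiv 𝕜 (u c) q (Pi.single a 1) * E a d q =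
        if c = d then 1 else 0) ∧
      ∀ᶠ q in 𝓝 q, ∀ a b, ∑ c, E a c q * fderiv 𝕜 (u c) q (Pi.single b 1) =
        if a = b then 1 else 0 :=
    (((Filter.eventually_all.mpr fun c => (hu c).eventually).and
      ((Filter.eventually_all.mpr fun a => Filter.eventually_all.mpr fun c => (hE a c).eventually).and
      ((Filter.eventually_all.mpr fun a => Filter.eventually_all.mpr fun c => (hτ a c).eventually).and
      (Filter.eventually_all.mpr fun b => (hθ b).eventually)))).and
      ((Filter.eventually_all.mpr fun a => Filter.eventually_all.mpr fun b =>
        (hdθ a b).eventuallyEq_nhds).and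
      ((eventually_eventually_nhds.mpr hF).and (eventually_eventually_nhds.mpr hF'))))
  have hU : ∀ᶠ q in 𝓝 0, ∀ t : I,
      IsUnit (canonicalContract 𝕜 n k + ((1 - (t : ℝ) : ℝ) : 𝕜) • S q) := by
    refine eventually_forall_smul (p := fun y : ((Coord n k → 𝕜) →L[𝕜] (Coord n k → 𝕜)) ×
      (Fin m → 𝕜) => IsUnit (canonicalContract 𝕜 n k + y.1)) hS.continuousAt hS0 ?_
    refine (continuous_const.add continuous_fst).continuousAt
      (Units.isOpen.mem_nhds (?_ : IsUnit _))
    simpa using isUnit_canonicalContract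
  filter_upwards [hφp, eventually_forall_apply hφ.continuousAt hφ0 (hG.and hU), hφ.eventually]
    with p ⟨⟨c, hc0, hcφ, hc⟩, hV⟩ hgood hφp
  have hSq : ∀ t, ContDiffNear (𝕜 := 𝕜) r S (φ p t) := fun t =>
    contDiffNear_formContract (hgood t).1.1.1 (hgood t).1.1.2.1 (hgood t).1.1.2.2.1
  let X : ℝ → (Fin m → 𝕜) → (Fin m → 𝕜) := fun t y => Y (((1 - t : ℝ) : 𝕜) • S y, y)
  have hfd : ∀ v, fderiv 𝕜 (fun p => φ p 1) p v = fderiv 𝕜 φ p v 1 := fun v => by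
    have : HasFDerivAt (fun p => φ p 1) (ev₁.comp (fderiv 𝕜 φ p)) p :=
      ev₁.hasFDerivAt.comp p hφp.hasFDerivAt
    rw [this.fderiv]
    rfl
  have hsS : ∀ t : I, ContDiffNear (𝕜 := 𝕜) r (fun y => ((1 - (t : ℝ) : ℝ) : 𝕜) • S y) (φ p t) :=
    fun t => .smul (.const _) (hSq t)
  have hcφ1 : c 1 = φ p 1 := by rw [← hcφ 1]; simp
  -- Along an integral curve `x_i` has derivative `dx_i(X) = ξ x_i`. This is a linear equation, so
  -- `x_i` vanishes throughout or nowhere.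
  have hxi : ∀ i, ∀ t : I, u (cx i) (c t) = 0 ↔ u (cx i) (c 0) = 0 := by
    intro i
    refine eq_zero_iff_of_linear_ode (f := fun t => u (cx i) (c t))
      ⟨fun t : I => ξ (((1 - (t : ℝ) : ℝ) : 𝕜) • S (φ p t), φ p t) (cx i), ?_⟩ fun t => ?_
    · refine continuous_iff_continuousAt.mpr fun t => ?_
      have h1 := contDiffNear_moserSolution ((hgood t).2 t) (hgood t).1.1.1 (hgood t).1.1.2.1
        (hgood t).1.1.2.2.2
      refine ContinuousAt.comp (g := fun y => ξ y (cx i)) (f := fun s : I =>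
        (((1 - (s : ℝ) : ℝ) : 𝕜) • S (φ p s), φ p s))
        ((continuous_apply (cx i)).continuousAt.comp h1.continuousAt) ?_
      have h2 : ContinuousAt (fun s : I => ((1 - (s : ℝ) : ℝ) : 𝕜)) t :=
        (RCLike.continuous_ofReal.comp (by fun_prop)).continuousAt
      exact (h2.smul (ContinuousAt.comp (g := S) (hSq t).continuousAt
        (φ p).continuous.continuousAt)).prodMk (φ p).continuous.continuousAt
    · have h1 := (((hgood t).1.1.1 (cx i)).hasFDerivAt.restrictScalars ℝ)
      rw [← hcφ t] at h1
      refine (h1.comp_hasDerivAt (t : ℝ) (hc t)).congr_deriv ?_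
      have h2 := (hgood t).1.2.2.1.self_of_nhds
      have h3 := frame_apply h2 (fun d => ξ (((1 - (t : ℝ) : ℝ) : 𝕜) • S (φ p t), φ p t) d *
        logFactor (fun c => u c (φ p t)) d) (cx i)
      rw [hcφ t]
      exact h3
  refine ⟨fun i => by rw [← hcφ1, ← hc0]; simpa using hxi i 1, fun hx v w => ?_⟩
  have hne : ∀ (t : I) i, u (cx i) (φ p t) ≠ 0 := fun t i h0 =>
    hx i (by rw [← hc0]; exact (hxi i t).mp (by rw [hcφ]; exact h0))
  obtain ⟨V, hV0, hVφ, hV'⟩ := hV v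
  obtain ⟨W, hW0, hWφ, hW'⟩ := hV w
  have hτc : ∀ t : I, IsClosedAt τ (φ p t) := fun t =>
    isClosedAt_of_primitive (hgood t).1.1.2.2.2 (hgood t).1.2.1
  -- The path of forms is `κ + (1 - t) τ`, which runs from `κ + τ` to `κ`. Off the divisor the whole
  -- integral curve stays off the divisor, where `κ` is regular and closed.
  have key := moser_constant (ω := fun a b y => κ a b y + τ a b y) (τ := τ) (θ := θ) (X := X)
    (c := c) (V := V) (W := W)
    (fun t => hcφ t ▸ (isClosedAt_canonicalForm (hgood t).1.1.1 (hne t)).add (hτc t))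
    (fun t => hcφ t ▸ hτc t) (fun t => ?_) (fun t b => ?_)
    (fun t a b => by rw [hcφ t]; exact ((hgood t).1.2.1 a b).self_of_nhds.symm) hc
    (fun t => hcφ t ▸ hV' t) (fun t => hcφ t ▸ hW' t)
  · simp only [add_sub_cancel_right] at key
    rw [hc0, hV0, hW0] at key
    refine key.trans ?_
    have hV1 : V 1 = fderiv 𝕜 φ p v 1 := by rw [← hVφ 1]; simp
    have hW1 : W 1 = fderiv 𝕜 φ p w 1 := by rw [← hWφ 1]; simp
    rw [hfd, hfd, form_sum_apply, hcφ1, hV1, hW1]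
    exact Finset.sum_congr rfl fun _ _ => Finset.sum_congr rfl fun _ _ => by
      rw [mul_assoc]
  · rw [hcφ t]
    exact DifferentiableAt.comp (g := Y) (φ p t)
      (hYq _ _ ((hgood t).2 t) (hgood t).1.1.1 (hgood t).1.1.2.1
        (hgood t).1.1.2.2.2).differentiableAt
      ((hsS t).differentiableAt.prodMk differentiableAt_fun_id)
  · rw [hcφ t]
    have h1 : ∀ᶠ y in 𝓝 (φ p t), IsUnit (canonicalContract 𝕜 n k + ((1 - (t : ℝ) : ℝ) : 𝕜) • S y) :=
      ((ContDiffNear.const (canonicalContract 𝕜 n k)).add (hsS t)).continuousAt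
        (Units.isOpen.mem_nhds ((hgood t).2 t))
    have h2 : ∀ᶠ y in 𝓝 (φ p t), ∀ i, u (cx i) y ≠ 0 := Filter.eventually_all.mpr fun i =>
      ((hgood t).1.1.1 (cx i)).continuousAt.eventually_ne (hne t i)
    filter_upwards [h1, h2, (hgood t).1.2.2.1, (hgood t).1.2.2.2] with y hy hy0 hyE hyE'
    have h3 := moser_equation (du := fun c => fderiv 𝕜 (u c) y) hyE hyE' hy0
      (τ := fun a b => τ a b y) (θ := fun b => θ b y) (s := ((1 - (t : ℝ) : ℝ) : 𝕜))
      (ξ := ξ (((1 - (t : ℝ) : ℝ) : 𝕜) • S y, y)) (fun d => by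
        have h4 := congrArg (fun A => A fun d => logFactor (fun c => u c y) d *
          ∑ b, θ b y * E b d y) (Ring.mul_inverse_cancel _ hy)
        exact congrFun h4 d) b
    rw [h3]
    refine Finset.sum_congr rfl fun d _ => ?_
    rw [RCLike.ofReal_sub, RCLike.ofReal_one]
    simp only [X, Y, κ]
    rw [RCLike.ofReal_sub, RCLike.ofReal_one]
    ring

end MoserTheorem

end LogSymplectic

/-! ### From log-symplectic forms to germs -/

namespace LogSymplectic

section FiniteDimensional

variable {𝕜 E : Type*} [RCLike 𝕜] [NormedAddCommGroup E] [NormedSpace 𝕜 E]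
  [FiniteDimensional 𝕜 E]

instance : FiniteDimensional 𝕜 (E [⋀^Fin 2]→L[𝕜] 𝕜) := by
  let f : (E [⋀^Fin 2]→L[𝕜] 𝕜) →ₗ[𝕜] MultilinearMap 𝕜 (fun _ : Fin 2 => E) 𝕜 :=
    { toFun := fun η => η.toMultilinearMap
      map_add' := fun _ _ => rfl
      map_smul' := fun _ _ => rfl }
  refine Module.Finite.of_injective f fun η η' h => ?_
  ext v
  exact congrArg (fun g => g v) h

/-- In finite dimension, every 2-form is continuous. -/
theorem exists_toAlternatingMap_eq (η : E [⋀^Fin 2]→ₗ[𝕜] 𝕜) :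
    ∃ η' : E [⋀^Fin 2]→L[𝕜] 𝕜, η'.toAlternatingMap = η := by
  let A : E →ₗ[𝕜] (E →L[𝕜] 𝕜) :=
    { toFun := fun v => LinearMap.toContinuousLinearMap (contract η v)
      map_add' := fun v v' => by
        ext w
        simp only [contract, map_add, ContinuousLinearMap.add_apply,
          LinearMap.coe_toContinuousLinearMap']
        rfl
      map_smul' := fun c v => by
        ext w
        simp only [contract, map_smul, ContinuousLinearMap.smul_apply,
          LinearMap.coe_toContinuousLinearMap', RingHom.id_apply]
        rfl }
  have hA : ∀ v : Fin 2 → E, η v = LinearMap.toContinuousLinearMap A (v 0) (v 1) := fun v => by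
    refine (congrArg η ?_).trans (contract_apply η (v 0) (v 1)).symm
    funext i
    fin_cases i <;> rfl
  refine ⟨{ η with cont := ?_ }, rfl⟩
  change Continuous fun v => η v
  simp only [hA]
  exact ((LinearMap.toContinuousLinearMap A).continuous.comp (continuous_apply 0)).clm_apply
    (continuous_apply 1)

/-- A vector-valued function is of class `C^r` if its components with respect to a separating
family of functionals are. -/
theorem contDiffAt_of_separating {F G J : Type*} [NormedAddCommGroup F] [NormedSpace 𝕜 F]
    [NormedAddCommGroup G] [NormedSpace 𝕜 G] [FiniteDimensional 𝕜 G] [Fintype J]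
    {r : WithTop ℕ∞} (l : J → G →L[𝕜] 𝕜) (hl : ∀ g, (∀ j, l j g = 0) → g = 0) {f : F → G} {x : F}
    (h : ∀ j, ContDiffAt 𝕜 r (fun y => l j (f y)) x) : ContDiffAt 𝕜 r f x := by
  let L : G →ₗ[𝕜] (J → 𝕜) := LinearMap.pi fun j => (l j : G →ₗ[𝕜] 𝕜)
  obtain ⟨g, hg⟩ := L.exists_leftInverse_of_injective
    ((LinearMap.ker_eq_bot').mpr fun y hy => hl y fun j => congrFun hy j)
  have h1 : f = fun y => LinearMap.toContinuousLinearMap g (fun j => l j (f y)) :=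
    funext fun y => (LinearMap.congr_fun hg (f y)).symm
  rw [h1]
  exact (LinearMap.toContinuousLinearMap g).contDiff.contDiffAt.comp x (contDiffAt_pi.mpr h)

end FiniteDimensional

end LogSymplectic

namespace LogSymplectic

namespace Represents

variable {𝕜 : Type*} [RCLike 𝕜] {r : WithTop ℕ∞} {ι : Type*} [Fintype ι] {x : ι → 𝕜}

theorem intCast (a : ℤ) : Represents (fun _ => (a : 𝕜)) (a : GermRing 𝕜 r x) := by
  have := const (r := r) (x := x) (a : 𝕜)
  rwa [map_intCast] at this

theorem aeval {σ : Type*} {f : σ → (ι → 𝕜) → 𝕜} {a : σ → GermRing 𝕜 r x}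
    (h : ∀ s, Represents (f s) (a s)) (P : MvPolynomial σ ℤ) :
    Represents (fun y => MvPolynomial.aeval (fun s => f s y) P) (MvPolynomial.aeval a P) := by
  induction P using MvPolynomial.induction_on with
  | C c => simpa using intCast c
  | add p q hp hq => simpa using hp.add hq
  | mul_X p s hp => simpa using hp.mul (h s)

theorem det {m : ℕ} {f : Fin m → Fin m → (ι → 𝕜) → 𝕜} {a : Fin m → Fin m → GermRing 𝕜 r x}
    (h : ∀ i j, Represents (f i j) (a i j)) :
    Represents (fun y => Matrix.det (Matrix.of fun i j => f i j y)) (Matrix.det (Matrix.of a)) := by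
  simp only [Matrix.det_apply']
  exact .sum fun σ _ => (intCast _).mul (.prod fun i _ => h _ _)

end Represents

namespace IsSimpleLogSymplectic

universe u

variable {𝕜 : Type u} [RCLike 𝕜] {r : WithTop ℕ∞} [IsSmoothOrAnalytic r] {n k : ℕ}
  {U : Set (Space 𝕜 (2 * n))} {h : Fin k → Space 𝕜 (2 * n) → 𝕜}
  {ω : Space 𝕜 (2 * n) → (Space 𝕜 (2 * n)) [⋀^Fin 2]→L[𝕜] 𝕜}

theorem eventually_notMem_divisor (H : IsSimpleLogSymplectic r n k U h ω) {p : Space 𝕜 (2 * n)}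
    (hp : p ∈ U \ divisor h) : ∀ᶠ q in 𝓝 p, q ∈ U \ divisor h := by
  have h1 : ∀ᶠ q in 𝓝 p, ∀ i, h i q ≠ 0 := Filter.eventually_all.mpr fun i =>
    ((H.contDiffOn i).continuousOn.continuousAt (H.isOpen.mem_nhds hp.1)).eventually_ne
      fun h0 => hp.2 ⟨i, h0⟩
  filter_upwards [h1, H.isOpen.mem_nhds hp.1] with q hq hqU
  exact ⟨hqU, fun ⟨i, hi⟩ => hq i hi⟩

/-- The coefficients of the regular form `h₁ ⋯ h_k ω`. -/
theorem exists_coefficients (H : IsSimpleLogSymplectic r n k U h ω) :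
    ∃ (h' : Fin k → GermRing 𝕜 r (0 : Space 𝕜 (2 * n)))
      (β : Fin k → Fin (2 * n) → GermRing 𝕜 r (0 : Space 𝕜 (2 * n)))
      (γ : Fin (2 * n) → Fin (2 * n) → GermRing 𝕜 r (0 : Space 𝕜 (2 * n)))
      (Ω : Fin (2 * n) → Fin (2 * n) → Space 𝕜 (2 * n) → 𝕜),
      (∀ i, Represents (h i) (h' i)) ∧ (∀ a b, γ a b = -γ b a) ∧
      (∀ a b, Represents (Ω a b) ((germCalculus 𝕜 r (2 * n)).logForm h' β γ a b)) ∧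
      (∀ a b, ContDiffOn 𝕜 r (Ω a b) U) ∧
      ∀ p ∈ U \ divisor h, ∀ a b,
        (∏ i, h i p) * ω p ![Pi.single a 1, Pi.single b 1] = Ω a b p := by
  obtain ⟨β, γ, hβ, hγ, hω⟩ := H.exists_eq
  have e0 := fun i => (ContDiffNear.of_contDiffOn (H.contDiffOn i) H.isOpen H.zero_mem).exists_germ
  have hβ' : ∀ i a, ContDiffOn 𝕜 r (fun p => β i p (Pi.single a 1)) U := fun i a =>
    (hβ i).clm_apply contDiffOn_const
  have hγ' : ∀ a b, ContDiffOn 𝕜 r (fun p => γ p ![Pi.single a 1, Pi.single b 1]) U := fun a b =>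
    (ContinuousAlternatingMap.apply 𝕜 (Space 𝕜 (2 * n)) 𝕜
      ![Pi.single a 1, Pi.single b 1]).contDiff.comp_contDiffOn hγ
  have e1 := fun i a => (ContDiffNear.of_contDiffOn (hβ' i a) H.isOpen H.zero_mem).exists_germ
  have e2 := fun a b => (ContDiffNear.of_contDiffOn (hγ' a b) H.isOpen H.zero_mem).exists_germ
  choose h' hh using e0
  choose β' hβ'' using e1
  choose γ' hγ'' using e2
  have hd : ∀ i (a : Fin (2 * n)), ContDiffOn 𝕜 r (fun p => fderiv 𝕜 (h i) p (Pi.single a 1)) U :=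
    fun i a => ((H.contDiffOn i).fderiv_of_isOpen H.isOpen
      (IsSmoothOrAnalytic.add_one_le r)).clm_apply contDiffOn_const
  refine ⟨h', β', γ', fun a b p => ∑ i, (∏ j ∈ Finset.univ.erase i, h j p) *
    (fderiv 𝕜 (h i) p (Pi.single a 1) * β i p (Pi.single b 1)
      - fderiv 𝕜 (h i) p (Pi.single b 1) * β i p (Pi.single a 1))
    + (∏ j, h j p) * γ p ![Pi.single a 1, Pi.single b 1], hh, fun a b => ?_, fun a b => ?_,
    fun a b => ?_, fun p hp a b => ?_⟩
  · refine ((hγ'' a b).eq_iff (hγ'' b a).neg).mpr (.of_forall fun p => ?_)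
    exact form_swap (γ p).toAlternatingMap _ _
  · exact (Represents.sum fun i _ => (Represents.prod fun j _ => hh j).mul
      ((((hh i).germDeriv a).mul (hβ'' i b)).sub (((hh i).germDeriv b).mul (hβ'' i a)))).add
      ((Represents.prod fun j _ => hh j).mul (hγ'' a b))
  · exact (ContDiffOn.sum fun i _ => (contDiffOn_prod fun j _ => H.contDiffOn j).mul
      (((hd i a).mul (hβ' i b)).sub ((hd i b).mul (hβ' i a)))).add
      ((contDiffOn_prod fun j _ => H.contDiffOn j).mul (hγ' a b))
  · have h1 := congrArg (fun η => η ![Pi.single a 1, Pi.single b 1]) (hω p hp)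
    simp only [AlternatingMap.add_apply, alternatingMap_sum_apply, AlternatingMap.smul_apply,
      wedge₁_apply, smul_eq_mul] at h1
    have h2 : ω p ![Pi.single a 1, Pi.single b 1] = _ := h1
    rw [h2, mul_add, Finset.mul_sum]
    congr 1
    refine Finset.sum_congr rfl fun i _ => ?_
    rw [← Finset.prod_erase_mul _ _ (Finset.mem_univ i), mul_assoc,
      mul_inv_cancel_left₀ fun h0 => hp.2 ⟨i, h0⟩]
    rfl

/-- The condition `dω = 0`, in terms of coefficients. -/
theorem closed_coefficients (H : IsSimpleLogSymplectic r n k U h ω)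
    {Ω : Fin (2 * n) → Fin (2 * n) → Space 𝕜 (2 * n) → 𝕜} (hΩd : ∀ a b, ContDiffOn 𝕜 r (Ω a b) U)
    (hΩ : ∀ p ∈ U \ divisor h, ∀ a b,
      (∏ i, h i p) * ω p ![Pi.single a 1, Pi.single b 1] = Ω a b p) {p : Space 𝕜 (2 * n)}
    (hp : p ∈ U \ divisor h) (a b c : Fin (2 * n)) :
    (∏ i, h i p) * (fderiv 𝕜 (Ω b c) p (Pi.single a 1) + fderiv 𝕜 (Ω c a) p (Pi.single b 1)
        + fderiv 𝕜 (Ω a b) p (Pi.single c 1)) =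
      fderiv 𝕜 (fun q => ∏ i, h i q) p (Pi.single a 1) * Ω b c p
        + fderiv 𝕜 (fun q => ∏ i, h i q) p (Pi.single b 1) * Ω c a p
        + fderiv 𝕜 (fun q => ∏ i, h i q) p (Pi.single c 1) * Ω a b p := by
  have hne : ∀ q ∈ U \ divisor h, ∏ i, h i q ≠ 0 := fun q hq =>
    Finset.prod_ne_zero_iff.mpr fun i _ h0 => hq.2 ⟨i, h0⟩
  have hU := H.isOpen.mem_nhds hp.1
  have hHd : DifferentiableAt 𝕜 (fun q => ∏ i, h i q) p :=
    ((contDiffOn_prod fun j _ => H.contDiffOn j).contDiffAt hU).differentiableAt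
      (IsSmoothOrAnalytic.ne_zero r)
  have hΩp : ∀ a b, DifferentiableAt 𝕜 (Ω a b) p := fun a b =>
    ((hΩd a b).contDiffAt hU).differentiableAt (IsSmoothOrAnalytic.ne_zero r)
  have hω : ∀ a b, (fun q => ω q ![Pi.single a 1, Pi.single b 1]) =ᶠ[𝓝 p]
      fun q => Ω a b q * (∏ i, h i q)⁻¹ := fun a b => by
    filter_upwards [H.eventually_notMem_divisor hp] with q hq
    rw [← hΩ q hq, mul_comm (∏ i, h i q), mul_inv_cancel_right₀ (hne q hq)]
  -- Off the divisor the coefficients of `ω` are `Ω / h`. Differentiability of `ω` is deduced from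
  -- them, since without it `extDeriv` would have no expression in partial derivatives.
  have hωd : DifferentiableAt 𝕜 ω p := by
    refine (contDiffAt_of_separating (r := 1) (J := Fin (2 * n) × Fin (2 * n))
      (fun j => ContinuousAlternatingMap.apply 𝕜 (Space 𝕜 (2 * n)) 𝕜
        ![Pi.single j.1 1, Pi.single j.2 1]) (fun η hη => ?_) fun j => ?_).differentiableAt one_ne_zero
    · have : η.toAlternatingMap = 0 := form_ext fun a b => hη (a, b)
      ext v
      exact congrArg (fun g => g v) this
    · refine ContDiffAt.congr_of_eventuallyEq ?_ (hω j.1 j.2)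
      have h1 := IsSmoothOrAnalytic.one_le r
      exact (((hΩd _ _).contDiffAt hU).of_le h1).mul
        ((((contDiffOn_prod fun j _ => H.contDiffOn j).contDiffAt hU).of_le h1).inv (hne p hp))
  have hfd : ∀ a b d, fderiv 𝕜 (fun q => ω q ![Pi.single a 1, Pi.single b 1]) p (Pi.single d 1) *
      (∏ i, h i p) ^ 2 = (∏ i, h i p) * fderiv 𝕜 (Ω a b) p (Pi.single d 1)
        - fderiv 𝕜 (fun q => ∏ i, h i q) p (Pi.single d 1) * Ω a b p := by
    intro a b d
    have h1 := (hΩp a b).hasFDerivAt.mul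
      ((hasDerivAt_inv (hne p hp)).comp_hasFDerivAt p hHd.hasFDerivAt)
    rw [(hω a b).fderiv_eq]
    have h2 : fderiv 𝕜 (fun q => Ω a b q * (∏ i, h i q)⁻¹) p = _ := h1.fderiv
    rw [h2]
    have h3 := hne p hp
    simp only [ContinuousLinearMap.add_apply, ContinuousLinearMap.smul_apply, smul_eq_mul,
      Function.comp_apply]
    field_simp
    ring
  have hcl := extDeriv_apply hωd ![Pi.single a 1, Pi.single b 1, Pi.single c 1]
  have r0 : (0 : Fin 3).removeNth ![(Pi.single a 1 : Space 𝕜 (2 * n)), Pi.single b 1, Pi.single c 1] =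
      ![Pi.single b 1, Pi.single c 1] := by
    funext i; fin_cases i <;> rfl
  have r1 : (1 : Fin 3).removeNth ![(Pi.single a 1 : Space 𝕜 (2 * n)), Pi.single b 1, Pi.single c 1] =
      ![Pi.single a 1, Pi.single c 1] := by
    funext i; fin_cases i <;> rfl
  have r2 : (2 : Fin 3).removeNth ![(Pi.single a 1 : Space 𝕜 (2 * n)), Pi.single b 1, Pi.single c 1] =
      ![Pi.single a 1, Pi.single b 1] := by
    funext i; fin_cases i <;> rfl
  have hswap : (fun q => ω q ![Pi.single c 1, Pi.single a 1]) =
      fun q => -ω q ![Pi.single a 1, Pi.single c 1] :=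
    funext fun q => form_swap (ω q).toAlternatingMap _ _
  have h1 := hfd c a b
  rw [hswap, fderiv_fun_neg, ContinuousLinearMap.neg_apply] at h1
  rw [H.closed p hp, Fin.sum_univ_three, r0, r1, r2] at hcl
  have hcl' : (0 : 𝕜) = (-1) ^ 0 •
      fderiv 𝕜 (fun q => ω q ![Pi.single b 1, Pi.single c 1]) p (Pi.single a 1)
      + (-1) ^ 1 • fderiv 𝕜 (fun q => ω q ![Pi.single a 1, Pi.single c 1]) p (Pi.single b 1)
      + (-1) ^ 2 • fderiv 𝕜 (fun q => ω q ![Pi.single a 1, Pi.single b 1]) p (Pi.single c 1) := hcl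
  norm_num at hcl'
  linear_combination -(hfd b c a) - h1 - hfd a b c - (∏ i, h i p) ^ 2 * hcl'

/-- The conclusion of the algebraic part of the proof, for representatives of the germs. -/
theorem exists_normal_form (H : IsSimpleLogSymplectic r n k U h ω) :
    k ≤ n ∧ ∃ (u : Coord n k → Space 𝕜 (2 * n) → 𝕜)
      (E : Fin (2 * n) → Coord n k → Space 𝕜 (2 * n) → 𝕜)
      (τ : Fin (2 * n) → Fin (2 * n) → Space 𝕜 (2 * n) → 𝕜)
      (θ : Fin (2 * n) → Space 𝕜 (2 * n) → 𝕜),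
      (∀ c, ContDiffNear (𝕜 := 𝕜) r (u c) 0) ∧ (∀ c, u c 0 = 0) ∧
      (∀ a c, ContDiffNear (𝕜 := 𝕜) r (E a c) 0) ∧
      (∀ a b, ContDiffNear (𝕜 := 𝕜) r (τ a b) 0) ∧ (∀ a b, τ a b 0 = 0) ∧
      (∀ b, ContDiffNear (𝕜 := 𝕜) r (θ b) 0) ∧ (∀ b, θ b 0 = 0) ∧ (∀ b, fderiv 𝕜 (θ b) 0 = 0) ∧
      (∀ a b, τ a b =ᶠ[𝓝 0] fun y => fderiv 𝕜 (θ b) y (Pi.single a 1)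
        - fderiv 𝕜 (θ a) y (Pi.single b 1)) ∧
      (∀ᶠ q in 𝓝 0, ∀ c d, ∑ a, fderiv 𝕜 (u c) q (Pi.single a 1) * E a d q =
        if c = d then 1 else 0) ∧
      (∀ᶠ q in 𝓝 0, ∀ a b, ∑ c, E a c q * fderiv 𝕜 (u c) q (Pi.single b 1) =
        if a = b then 1 else 0) ∧
      (∀ᶠ q in 𝓝 0, ∀ i, u (cx i) q = 0 ↔ h i q = 0) ∧
      ∀ᶠ q in 𝓝 0, q ∉ divisor h → ∀ a b, ω q ![Pi.single a 1, Pi.single b 1] =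
        canonicalForm (fun c => u c q) (fun c => (fderiv 𝕜 (u c) q : Space 𝕜 (2 * n) →ₗ[𝕜] 𝕜))
          ![Pi.single a 1, Pi.single b 1] + τ a b q := by
  set L := germCalculus 𝕜 r (2 * n) with hL
  obtain ⟨h', β, γ, Ω, hh, hγ, hΩ, hΩd, hΩω⟩ := H.exists_coefficients
  have hH : Represents (fun q => ∏ i, h i q) (∏ i, h' i) := .prod fun i _ => hh i
  have hUn : ∀ᶠ q in 𝓝 0, q ∈ U := H.isOpen.mem_nhds H.zero_mem
  have hdiff : ∀ {f : Space 𝕜 (2 * n) → 𝕜} {a : GermRing 𝕜 r (0 : Space 𝕜 (2 * n))},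
      Represents f a → (fderiv 𝕜 f 0 : Space 𝕜 (2 * n) →ₗ[𝕜] 𝕜) = L.diff₀ a := by
    intro f a hf
    refine LinearMap.ext fun v => ?_
    rw [LocalCalculus.diff₀, covector_apply]
    refine (fderiv_eq_sum f 0 v).trans (Finset.sum_congr rfl fun b _ => ?_)
    rw [← (hf.germDeriv b).germEval, mul_comm]
    rfl
  have hind : LinearIndependent 𝕜 fun i => L.diff₀ (h' i) := by
    have := linearIndependent_of_wedgeFamily_ne_zero H.wedge_ne_zero
    simpa only [hdiff (hh _)] using this
  have hnzd : ∀ g, (∏ i, h' i) * g = 0 → g = 0 :=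
    L.prod_nzd Finset.univ h' fun i _ _ => hind.ne_zero i
  -- Regular functions that agree off the divisor have equal germs: multiplied by `h`, their
  -- difference vanishes near the origin, and the germ of `h` is not a zero divisor.
  have heq : ∀ {f g : Space 𝕜 (2 * n) → 𝕜} {a b : GermRing 𝕜 r (0 : Space 𝕜 (2 * n))},
      Represents f a → Represents g b → (∀ᶠ q in 𝓝 0, q ∈ U \ divisor h → f q = g q) →
      a = b := by
    intro f g a b hf hg hfg
    refine sub_eq_zero.mp (hnzd _ (((hH.mul (hf.sub hg)).eq_iff .zero).mpr ?_))
    filter_upwards [hfg, hUn] with q hq hqU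
    by_cases h0 : q ∈ divisor h
    · obtain ⟨i, hi⟩ := h0
      rw [Finset.prod_eq_zero (Finset.mem_univ i) hi, zero_mul]
    · rw [hq ⟨hqU, h0⟩, sub_self, mul_zero]
  have hcl : ∀ a b c, (∏ j, h' j) * L.d2 (L.logForm h' β γ) a b c =
      w12 (L.grad (∏ j, h' j)) (L.logForm h' β γ) a b c := fun a b c =>
    heq (hH.mul ((((hΩ b c).germDeriv a).add ((hΩ c a).germDeriv b)).add ((hΩ a b).germDeriv c)))
      ((((hH.germDeriv a).mul (hΩ b c)).add ((hH.germDeriv b).mul (hΩ c a))).add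
        ((hH.germDeriv c).mul (hΩ a b)))
      (.of_forall fun q hq => H.closed_coefficients hΩd hΩω hq a b c)
  obtain ⟨f, hf, hf0, hvol⟩ := H.volume
  obtain ⟨f', hff⟩ := (ContDiffNear.of_contDiffOn hf H.isOpen H.zero_mem).exists_germ
  have hvol' : ∀ G B : Fin (2 * n) → Fin (2 * n) → GermRing 𝕜 r (0 : Space 𝕜 (2 * n)),
      (∀ c d, (∏ j, h' j) * B c d = ∑ a, ∑ b, L.logForm h' β γ a b * G a c * G b d) →
      (∏ j, h' j) * MvPolynomial.aeval (fun c : Fin (2 * n) × Fin (2 * n) => B c.1 c.2)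
        (wedgePowPoly n id) = f' * Matrix.det (Matrix.of G) := by
    intro G B hGB
    choose G' hG' using fun a b => exists_represents (G a b)
    choose B' hB' using fun a b => exists_represents (B a b)
    have h0 := Represents.aeval (f := fun c : Fin (2 * n) × Fin (2 * n) => B' c.1 c.2)
      (a := fun c => B c.1 c.2) (fun c => hB' c.1 c.2) (wedgePowPoly n id)
    have h1 := Represents.det hG'
    refine heq (hH.mul h0) (hff.mul h1) ?_
    have h1 : ∀ᶠ q in 𝓝 0, ∀ c d, (∏ j, h j q) * B' c d q =
        ∑ a, ∑ b, Ω a b q * G' a c q * G' b d q :=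
      Filter.eventually_all.mpr fun c => Filter.eventually_all.mpr fun d =>
        ((hH.mul (hB' c d)).eq_iff (.sum fun a _ => .sum fun b _ =>
          ((hΩ a b).mul (hG' a c)).mul (hG' b d))).mp (hGB c d)
    filter_upwards [h1] with q hq hqU
    exact volume_coefficients (φ := RingHom.id 𝕜) Function.injective_id
      (Finset.prod_ne_zero_iff.mpr fun i _ h0 => hqU.2 ⟨i, h0⟩) (hvol q hqU)
      (fun a b => hΩω q hqU a b) (fun a b => G' a b q) (fun a b => B' a b q) hq
  obtain ⟨hkn, u', ε, ε', τ', hux, hε, hu0, hker, hτneg, hτcl, hτ0, hform⟩ :=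
    L.normal_form h' β γ hγ (fun i => ((hh i).germEval).trans (H.map_zero i)) hind
      (L.closed_of_logForm h' β γ hnzd hcl) ⟨f', by rw [← hff.germEval] at hf0; exact hf0, hvol'⟩
  let e : Fin (2 * n) ≃ Coord n k := (Fintype.equivFinOfCardEq (card_coord hkn)).symm
  obtain ⟨E', hE1, hE2, -⟩ := L.exists_frame e u' hker
  choose u hu using fun c => exists_represents (u' c)
  choose E hE using fun a c => exists_represents (E' a c)
  choose τ hτ using fun a b => exists_represents (τ' a b)
  choose θ hθ using fun b => exists_represents (L.prim τ' b)
  choose η hη using fun i => exists_represents (ε i)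
  choose η' hη' using fun i => exists_represents (ε' i)
  refine ⟨hkn, u, E, τ, θ, fun c => (hu c).contDiffNear, fun c => by rw [← (hu c).germEval]; exact hu0 c,
    fun a c => (hE a c).contDiffNear, fun a b => (hτ a b).contDiffNear,
    fun a b => by rw [← (hτ a b).germEval]; exact hτ0 a b, fun b => (hθ b).contDiffNear,
    fun b => by rw [← (hθ b).germEval]; exact L.ev_prim τ' b, fun b => ?_, fun a b => ?_, ?_, ?_,
    ?_, ?_⟩
  · ext v
    rw [fderiv_eq_sum]
    refine Finset.sum_eq_zero fun a _ => ?_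
    rw [← ((hθ b).germDeriv a).germEval]
    exact mul_eq_zero_of_right _ (L.ev_D_prim τ' hτ0 a b)
  · refine ((hτ a b).eq_iff (((hθ b).germDeriv a).sub ((hθ a).germDeriv b))).mp ?_
    exact (L.dd_prim τ' hτneg hτcl a b).symm
  · refine Filter.eventually_all.mpr fun c => Filter.eventually_all.mpr fun d => ?_
    have h1 := Represents.sum (s := Finset.univ) fun a _ => ((hu c).germDeriv a).mul (hE a d)
    have h2 := hE1 c d
    split_ifs at h2 ⊢
    · exact (h1.eq_iff .one).mp h2
    · exact (h1.eq_iff .zero).mp h2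
  · refine Filter.eventually_all.mpr fun a => Filter.eventually_all.mpr fun b => ?_
    have h1 := Represents.sum (s := Finset.univ) fun c _ => (hE a c).mul ((hu c).germDeriv b)
    have h2 := hE2 a b
    split_ifs at h2 ⊢
    · exact (h1.eq_iff .one).mp h2
    · exact (h1.eq_iff .zero).mp h2
  · refine Filter.eventually_all.mpr fun i => ?_
    filter_upwards [((hu (cx i)).eq_iff ((hh i).mul (hη i))).mp (hux i),
      (((hη i).mul (hη' i)).eq_iff .one).mp (hε i)] with q h1 h2
    rw [h1, mul_eq_zero, or_iff_left fun h0 => by rw [h0, zero_mul] at h2; exact zero_ne_one h2]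
  · have h1 : ∀ᶠ q in 𝓝 0, ∀ i, u (cx i) q = h i q * η i q ∧ η i q * η' i q = 1 :=
      Filter.eventually_all.mpr fun i =>
        (((hu (cx i)).eq_iff ((hh i).mul (hη i))).mp (hux i)).and
          ((((hη i).mul (hη' i)).eq_iff .one).mp (hε i))
    have h2 : ∀ᶠ q in 𝓝 0, ∀ a b, Ω a b q = ∑ i, (∏ j ∈ Finset.univ.erase i, h j q) *
        (η' i q * (fderiv 𝕜 (u (cx i)) q (Pi.single a 1) * fderiv 𝕜 (u (cy i)) q (Pi.single b 1)
          - fderiv 𝕜 (u (cx i)) q (Pi.single b 1) * fderiv 𝕜 (u (cy i)) q (Pi.single a 1)))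
        + (∏ j, h j q) * (∑ j, (fderiv 𝕜 (u (cz j)) q (Pi.single a 1) *
          fderiv 𝕜 (u (cz' j)) q (Pi.single b 1) - fderiv 𝕜 (u (cz j)) q (Pi.single b 1) *
            fderiv 𝕜 (u (cz' j)) q (Pi.single a 1)) + τ a b q) := by
      refine Filter.eventually_all.mpr fun a => Filter.eventually_all.mpr fun b =>
        ((hΩ a b).eq_iff ?_).mp (hform a b)
      exact (Represents.sum fun i _ => (Represents.prod fun j _ => hh j).mul ((hη' i).mul
        ((((hu _).germDeriv a).mul ((hu _).germDeriv b)).sub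
          (((hu _).germDeriv b).mul ((hu _).germDeriv a))))).add (hH.mul
        ((Represents.sum fun j _ => (((hu _).germDeriv a).mul ((hu _).germDeriv b)).sub
          (((hu _).germDeriv b).mul ((hu _).germDeriv a))).add (hτ a b)))
    filter_upwards [h1, h2, hUn] with q h1 h2 hqU hqh a b
    have hne : ∀ i, h i q ≠ 0 := fun i h0 => hqh ⟨i, h0⟩
    refine mul_left_cancel₀ (Finset.prod_ne_zero_iff.mpr fun i (_ : i ∈ Finset.univ) => hne i) ?_
    rw [hΩω q ⟨hqU, hqh⟩, h2, canonicalForm_apply]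
    simp only [mul_add, Finset.mul_sum, add_assoc, ContinuousLinearMap.coe_coe]
    congr 1
    refine Finset.sum_congr rfl fun i _ => ?_
    obtain ⟨h3, h4⟩ := h1 i
    rw [← Finset.prod_erase_mul _ _ (Finset.mem_univ i), h3, mul_inv,
      eq_inv_of_mul_eq_one_right h4, mul_assoc, mul_assoc, mul_inv_cancel_left₀ (hne i)]

end IsSimpleLogSymplectic

end LogSymplectic

/-! ### Canonical coordinates in the smooth and analytic cases -/

namespace LogSymplectic

universe u

variable {𝕜 : Type u} [RCLike 𝕜] {r : WithTop ℕ∞} [IsSmoothOrAnalytic r] {n k : ℕ}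

/-- The geometric case of the theorem, without the statements on the Poisson structure. -/
theorem IsSimpleLogSymplectic.exists_canonical_coordinates {U : Set (Space 𝕜 (2 * n))}
    {h : Fin k → Space 𝕜 (2 * n) → 𝕜}
    {ω : Space 𝕜 (2 * n) → (Space 𝕜 (2 * n)) [⋀^Fin 2]→L[𝕜] 𝕜}
    (H : IsSimpleLogSymplectic r n k U h ω) :
    k ≤ n ∧ ∃ Φ : OpenPartialHomeomorph (Space 𝕜 (2 * n)) (Coord n k → 𝕜),
      IsCoordinateSystem r Φ ∧ Φ.source ⊆ U ∧
      (∀ p ∈ Φ.source, p ∈ divisor h ↔ ∃ i, Φ p (cx i) = 0) ∧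
      ∀ p ∈ Φ.source \ divisor h, (ω p).toAlternatingMap =
        canonicalForm (Φ p) (fun c => (coordDiff Φ c p : Space 𝕜 (2 * n) →ₗ[𝕜] 𝕜)) := by
  obtain ⟨hkn, u, E, τ, θ, hu, hu0, hE, hτ, hτ0, hθ, hθ0, hθ', hdθ, hF, hF', huh, hω⟩ :=
    H.exists_normal_form
  obtain ⟨φ, hφ, hφ0, hφ', hφp⟩ := exists_moser hu hE hτ hτ0 hθ hθ0 hθ' hdθ hF hF'
  refine ⟨hkn, ?_⟩
  -- The canonical coordinates are the `u c` composed with the Moser map. The latter is tangent to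
  -- the identity, so the differentials at the origin are still those of the `u c` and independent.
  have hψ : ContDiffNear (𝕜 := 𝕜) r (fun p c => u c (φ p)) 0 :=
    .pi fun c => .comp (by rw [hφ0]; exact hu c) hφ
  have hψ' : HasFDerivAt (fun p c => u c (φ p))
      (ContinuousLinearMap.pi fun c => fderiv 𝕜 (u c) 0) 0 := by
    refine hasFDerivAt_pi.mpr fun c => ?_
    have h1 : HasFDerivAt (u c) (fderiv 𝕜 (u c) 0) (φ 0) := by
      rw [hφ0]; exact (hu c).hasFDerivAt
    exact h1.comp 0 hφ'
  obtain ⟨e, he⟩ := exists_equiv_of_injective (by simp [card_coord hkn])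
    (ContinuousLinearMap.pi fun c => fderiv 𝕜 (u c) 0) fun v hv => by
      funext a
      calc v a = ∑ b, v b * (if a = b then 1 else 0) := by simp
        _ = ∑ c, E a c 0 * fderiv 𝕜 (u c) 0 v := by
          simp only [← hF'.self_of_nhds, fderiv_eq_sum _ _ v, Finset.mul_sum]
          rw [Finset.sum_comm]
          exact Finset.sum_congr rfl fun _ _ => Finset.sum_congr rfl fun _ _ => by ring
        _ = 0 := Finset.sum_eq_zero fun c _ => by
          rw [show fderiv 𝕜 (u c) 0 v = 0 from congrFun hv c, mul_zero]
  have hV : ∀ᶠ p in 𝓝 0, p ∈ U ∧ (∀ i, u (cx i) (φ p) = 0 ↔ h i p = 0) ∧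
      (p ∉ divisor h → ∀ a b, ω p ![Pi.single a 1, Pi.single b 1] =
        canonicalForm (fun c => u c (φ p)) (fun c => (fderiv 𝕜 (fun q => u c (φ q)) p :
          Space 𝕜 (2 * n) →ₗ[𝕜] 𝕜)) ![Pi.single a 1, Pi.single b 1]) := by
    have h1 : ∀ᶠ p in 𝓝 0, ∀ c, ContDiffNear (𝕜 := 𝕜) r (u c) (φ p) :=
      Filter.eventually_all.mpr fun c =>
        hφ.continuousAt (by rw [hφ0]; exact (hu c).eventually)
    filter_upwards [hφp, huh, hω, h1, hφ.eventually, H.isOpen.mem_nhds H.zero_mem]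
      with p ⟨h2, h3⟩ h4 h5 h6 h7 h8
    refine ⟨h8, fun i => (h2 i).trans (h4 i), fun hp a b => ?_⟩
    have h9 := h3 (fun i h0 => hp ⟨i, (h4 i).mp h0⟩) (Pi.single a 1) (Pi.single b 1)
    have h10 : ∀ c, fderiv 𝕜 (fun q => u c (φ q)) p =
        (fderiv 𝕜 (u c) (φ p)).comp (fderiv 𝕜 φ p) := fun c =>
      ((h6 c).hasFDerivAt.comp p h7.hasFDerivAt).fderiv
    rw [canonicalForm_apply] at h9 ⊢
    simp only [h10]
    refine Eq.trans ?_ h9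
    rw [h5 hp]
    simp [Pi.single_apply]
  rw [← he] at hψ'
  obtain ⟨Φ, hΦ, h0, hsub, hd, hd'⟩ := hψ.exists_openPartialHomeomorph hψ' hV
  have hiff : ∀ p ∈ Φ.source, p ∈ divisor h ↔ ∃ i, Φ p (cx i) = 0 := fun p hp => by
    rw [hΦ]
    exact exists_congr fun i => ((hsub hp).2.1 i).symm
  refine ⟨Φ, ⟨h0, ?_, ?_, fun z hz => (hd' z hz).contDiffWithinAt⟩, fun p hp => (hsub hp).1, hiff,
    fun p hp => form_ext fun a b => ?_⟩
  · rw [hΦ]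
    funext c
    simp [hφ0, hu0]
  · rw [hΦ]
    exact fun z hz => (hd z hz).contDiffWithinAt
  · have := (hsub hp.1).2.2 hp.2 a b
    simp only [coordDiff, hΦ]
    exact this

section Coordinates

variable {Φ : OpenPartialHomeomorph (Space 𝕜 (2 * n)) (Coord n k → 𝕜)} {p : Space 𝕜 (2 * n)}

namespace IsCoordinateSystem

theorem contDiffNear (hΦ : IsCoordinateSystem r Φ) (hp : p ∈ Φ.source) :
    ContDiffNear (𝕜 := 𝕜) r Φ p := .of_contDiffOn hΦ.contDiffOn Φ.open_source hp

theorem contDiffNear_symm (hΦ : IsCoordinateSystem r Φ) (hp : p ∈ Φ.source) :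
    ContDiffNear (𝕜 := 𝕜) r Φ.symm (Φ p) :=
  .of_contDiffOn hΦ.contDiffOn_symm Φ.open_target (Φ.map_source hp)

theorem fderiv_comp_symm (hΦ : IsCoordinateSystem r Φ) (hp : p ∈ Φ.source) :
    (fderiv 𝕜 Φ p).comp (fderiv 𝕜 Φ.symm (Φ p)) = ContinuousLinearMap.id 𝕜 _ := by
  have h1 : HasFDerivAt Φ (fderiv 𝕜 Φ p) (Φ.symm (Φ p)) := by
    rw [Φ.left_inv hp]; exact (hΦ.contDiffNear hp).hasFDerivAt
  have h2 := h1.comp (Φ p) (hΦ.contDiffNear_symm hp).hasFDerivAt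
  refine h2.unique ((hasFDerivAt_id (Φ p)).congr_of_eventuallyEq ?_)
  filter_upwards [Φ.open_target.mem_nhds (Φ.map_source hp)] with y hy using Φ.right_inv hy

theorem fderiv_symm_comp (hΦ : IsCoordinateSystem r Φ) (hp : p ∈ Φ.source) :
    (fderiv 𝕜 Φ.symm (Φ p)).comp (fderiv 𝕜 Φ p) = ContinuousLinearMap.id 𝕜 _ := by
  have h2 := (hΦ.contDiffNear_symm hp).hasFDerivAt.comp p (hΦ.contDiffNear hp).hasFDerivAt
  refine h2.unique ((hasFDerivAt_id p).congr_of_eventuallyEq ?_)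
  filter_upwards [Φ.open_source.mem_nhds hp] with y hy using Φ.left_inv hy

theorem coordDiff_apply (hΦ : IsCoordinateSystem r Φ) (hp : p ∈ Φ.source) (c : Coord n k)
    (v : Space 𝕜 (2 * n)) : coordDiff Φ c p v = fderiv 𝕜 Φ p v c := by
  have h1 := hasFDerivAt_pi'.mp (hΦ.contDiffNear hp).hasFDerivAt c
  rw [coordDiff, h1.fderiv]
  rfl

theorem isDualBivector (hΦ : IsCoordinateSystem r Φ) (hp : p ∈ Φ.source)
    (hx : ∀ i, Φ p (cx i) ≠ 0) :
    IsDualBivector (canonicalBivector (Φ p) fun c => coordVec Φ c p)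
      (canonicalForm (Φ p) fun c => (coordDiff Φ c p : Space 𝕜 (2 * n) →ₗ[𝕜] 𝕜)) := by
  refine isDualBivector_canonical _ _ _ (fun c d => ?_) (fun v hv => ?_) hx
  · have h1 := congrArg (fun A => A (Pi.single d 1) c) (hΦ.fderiv_comp_symm hp)
    refine (hΦ.coordDiff_apply hp c _).trans (h1.trans ?_)
    simp [Pi.single_apply]
  · have h1 : fderiv 𝕜 Φ p v = 0 := funext fun c => (hΦ.coordDiff_apply hp c v).symm.trans (hv c)
    have h2 := congrArg (fun A => A v) (hΦ.fderiv_symm_comp hp)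
    refine h2.symm.trans ?_
    rw [ContinuousLinearMap.comp_apply, h1]
    exact ContinuousLinearMap.map_zero _

theorem contDiffNear_coordVec (hΦ : IsCoordinateSystem r Φ) (hp : p ∈ Φ.source) (c : Coord n k) :
    ContDiffNear (𝕜 := 𝕜) r (coordVec Φ c) p :=
  ContDiffNear.comp (g := fun y => fderiv 𝕜 Φ.symm y (Pi.single c 1))
    ((hΦ.contDiffNear_symm hp).fderiv.clm_apply (.const _)) (hΦ.contDiffNear hp)

end IsCoordinateSystem

end Coordinates

end LogSymplectic

/-! ### The Poisson structure in the smooth and analytic cases -/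

namespace LogSymplectic

universe u

variable {𝕜 : Type u} [RCLike 𝕜] {r : WithTop ℕ∞} [IsSmoothOrAnalytic r] {n k : ℕ}

/-- The canonical bracket of functions of the canonical coordinates. -/
noncomputable def canonicalBracket (F G : (Coord n k → 𝕜) → 𝕜) (y : Coord n k → 𝕜) : 𝕜 :=
  ∑ i, y (cx i) * (fderiv 𝕜 F y (Pi.single (cx i) 1) * fderiv 𝕜 G y (Pi.single (cy i) 1)
      - fderiv 𝕜 G y (Pi.single (cx i) 1) * fderiv 𝕜 F y (Pi.single (cy i) 1))
    + ∑ j, (fderiv 𝕜 F y (Pi.single (cz j) 1) * fderiv 𝕜 G y (Pi.single (cz' j) 1)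
      - fderiv 𝕜 G y (Pi.single (cz j) 1) * fderiv 𝕜 F y (Pi.single (cz' j) 1))

theorem exists_germ_apply (y : Coord n k → 𝕜) (c : Coord n k) :
    ∃ a : GermRing 𝕜 r y, Represents (fun z => z c) a ∧
      ∀ d, germDeriv 𝕜 r y d a = if d = c then 1 else 0 := by
  let pr : (Coord n k → 𝕜) →L[𝕜] 𝕜 := ContinuousLinearMap.proj c
  obtain ⟨a, ha⟩ := (ContDiffNear.clm (r := r) (x := y) pr).exists_germ
  refine ⟨a, ha, fun d => ?_⟩
  have h1 : ∀ z, fderiv 𝕜 pr z (Pi.single d 1) = if d = c then 1 else 0 := fun z => by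
    rw [pr.fderiv]
    simp [pr, Pi.single_apply, eq_comm]
  split_ifs with h
  · exact ((ha.germDeriv d).eq_iff .one).mpr (.of_forall fun z => (h1 z).trans (if_pos h))
  · exact ((ha.germDeriv d).eq_iff .zero).mpr (.of_forall fun z => (h1 z).trans (if_neg h))

theorem contDiffNear_canonicalBracket {F G : (Coord n k → 𝕜) → 𝕜} {y : Coord n k → 𝕜}
    (hF : ContDiffNear (𝕜 := 𝕜) r F y) (hG : ContDiffNear (𝕜 := 𝕜) r G y) :
    ContDiffNear (𝕜 := 𝕜) r (canonicalBracket F G) y := by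
  have hD := fun c => hF.partial (Pi.single c 1)
  have hD' := fun c => hG.partial (Pi.single c 1)
  exact ContDiffNear.add (.sum fun i _ => (ContDiffNear.clm (ContinuousLinearMap.proj (cx i))).mul
    (((hD _).mul (hD' _)).sub ((hD' _).mul (hD _)))) (.sum fun j _ =>
      ((hD _).mul (hD' _)).sub ((hD' _).mul (hD _)))

/-- The Jacobi identity for the canonical bracket of functions. -/
theorem canonicalBracket_jacobi {F : Fin 3 → (Coord n k → 𝕜) → 𝕜} {y : Coord n k → 𝕜}
    (hF : ∀ s, ContDiffNear (𝕜 := 𝕜) r (F s) y) :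
    canonicalBracket (F 0) (canonicalBracket (F 1) (F 2)) y
      + canonicalBracket (F 1) (canonicalBracket (F 2) (F 0)) y
      + canonicalBracket (F 2) (canonicalBracket (F 0) (F 1)) y = 0 := by
  choose X hX hDX using fun c : Coord n k => exists_germ_apply (r := r) y c
  let D := germDeriv 𝕜 r y
  have hD : ∀ c d f, D c (D d f) = D d (D c f) := germDeriv_comm
  let br : GermRing 𝕜 r y → GermRing 𝕜 r y → GermRing 𝕜 r y := fun f g =>
    ∑ i, X (cx i) * (D (cx i) f * D (cy i) g - D (cx i) g * D (cy i) f)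
      + ∑ j, (D (cz j) f * D (cz' j) g - D (cz j) g * D (cz' j) f)
  have hbr : ∀ {f g : (Coord n k → 𝕜) → 𝕜} {a b : GermRing 𝕜 r y}, Represents f a →
      Represents g b → Represents (canonicalBracket f g) (br a b) := fun hf hg =>
    (Represents.sum fun i _ => (hX (cx i)).mul (((hf.germDeriv _).mul (hg.germDeriv _)).sub
      ((hg.germDeriv _).mul (hf.germDeriv _)))).add
      (.sum fun j _ => ((hf.germDeriv _).mul (hg.germDeriv _)).sub
        ((hg.germDeriv _).mul (hf.germDeriv _)))
  choose f hf using fun s => (hF s).exists_germ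
  -- The identity is proved in the ring of germs at `y`, for the commuting derivations `x_i
  -- ∂_{x_i}`, `∂_{y_i}`, `∂_{z_j}`, `∂_{z'_j}`, and then evaluated at `y`.
  have key := jacobi_of_commuting (germEval 𝕜 r y : GermRing 𝕜 r y →+* 𝕜)
    (Sum.elim (fun i : Fin k => X (cx i) • D (cx i)) fun j : Fin (n - k) => D (cz j))
    (Sum.elim (fun i => D (cy i)) fun j => D (cz' j)) ?_ ?_ ?_ f br ?_
  · have h1 := fun a b c => (hbr (hf a) (hbr (hf b) (hf c))).germEval
    rw [← h1, ← h1, ← h1]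
    exact key
  · rintro (i | j) (i' | j') g <;>
      simp only [Sum.elim_inl, Sum.elim_inr, Derivation.smul_apply, smul_eq_mul,
        Derivation.leibniz, D, hDX]
    · by_cases h : i = i'
      · subst h; ring
      · rw [if_neg (by simpa using h), if_neg (by simpa using Ne.symm h), germDeriv_comm (cx i)]
        ring
    · rw [if_neg (by simp), germDeriv_comm (cx i)]; ring
    · rw [if_neg (by simp), germDeriv_comm (cz j)]; ring
    · exact germDeriv_comm _ _ _
  · rintro (i | j) (i' | j') g <;>
      simp only [Sum.elim_inl, Sum.elim_inr, Derivation.smul_apply, smul_eq_mul,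
        Derivation.leibniz, D, hDX]
    · rw [if_neg (by simp), germDeriv_comm (cx i)]; ring
    · rw [if_neg (by simp), germDeriv_comm (cx i)]; ring
    · exact germDeriv_comm _ _ _
    · exact germDeriv_comm _ _ _
  · rintro (i | j) (i' | j') g <;> exact germDeriv_comm _ _ _
  · intro g l
    rw [Fintype.sum_sum_type]
    simp only [br, Sum.elim_inl, Sum.elim_inr, Derivation.smul_apply, smul_eq_mul]
    congr 1
    exact Finset.sum_congr rfl fun _ _ => by ring

section Coordinates

variable {Φ : OpenPartialHomeomorph (Space 𝕜 (2 * n)) (Coord n k → 𝕜)}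

/-- The bivector `∑ x_i ∂_{x_i} ∧ ∂_{y_i} + ∑ ∂_{z_j} ∧ ∂_{z_{j+n-k}}` of a coordinate system is a
Poisson structure. -/
theorem IsCoordinateSystem.exists_isPoisson (hΦ : IsCoordinateSystem r Φ) :
    ∃ P : Space 𝕜 (2 * n) → (Space 𝕜 (2 * n) →L[𝕜] 𝕜) [⋀^Fin 2]→L[𝕜] 𝕜,
      IsPoisson r Φ.source P ∧
      ∀ p, toDualBivector (P p) = canonicalBivector (Φ p) fun c => coordVec Φ c p := by
  choose P hP using fun p => exists_toAlternatingMap_eq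
    ((canonicalBivector (Φ p) fun c => coordVec Φ c p).compLinearMap
      (ContinuousLinearMap.coeLM 𝕜 : (Space 𝕜 (2 * n) →L[𝕜] 𝕜) →ₗ[𝕜] _))
  have hPa : ∀ p (f g : Space 𝕜 (2 * n) →L[𝕜] 𝕜), P p ![f, g] =
      ∑ i, Φ p (cx i) * (f (coordVec Φ (cx i) p) * g (coordVec Φ (cy i) p)
          - g (coordVec Φ (cx i) p) * f (coordVec Φ (cy i) p))
        + ∑ j, (f (coordVec Φ (cz j) p) * g (coordVec Φ (cz' j) p)
          - g (coordVec Φ (cz j) p) * f (coordVec Φ (cz' j) p)) := fun p f g => by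
    have h1 : P p ![f, g] = canonicalBivector (Φ p) (fun c => coordVec Φ c p)
        fun i => ContinuousLinearMap.coeLM 𝕜 (![f, g] i) := congrArg (fun η => η ![f, g]) (hP p)
    have h2 : (fun i => ContinuousLinearMap.coeLM 𝕜 (![f, g] i)) =
        ![(f : Space 𝕜 (2 * n) →ₗ[𝕜] 𝕜), (g : Space 𝕜 (2 * n) →ₗ[𝕜] 𝕜)] := by
      funext i
      fin_cases i <;> rfl
    rw [h1, h2, canonicalBivector_apply]
    rfl
  have hPd : ∀ p ∈ Φ.source, ∀ f g : Space 𝕜 (2 * n) →L[𝕜] 𝕜,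
      ContDiffNear (𝕜 := 𝕜) r (fun q => P q ![f, g]) p := fun p hp f g => by
    simp only [hPa]
    have hf : ∀ (f : Space 𝕜 (2 * n) →L[𝕜] 𝕜) c,
        ContDiffNear (𝕜 := 𝕜) r (fun q => f (coordVec Φ c q)) p := fun f c =>
      .comp (.clm f) (hΦ.contDiffNear_coordVec hp c)
    refine .add (.sum fun i _ => .mul ?_ (((hf f _).mul (hf g _)).sub ((hf g _).mul (hf f _))))
      (.sum fun j _ => ((hf f _).mul (hf g _)).sub ((hf g _).mul (hf f _)))
    exact .comp (.clm (ContinuousLinearMap.proj (cx i))) (hΦ.contDiffNear hp)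
  refine ⟨P, ⟨fun p hp => ContDiffAt.contDiffWithinAt ?_, fun p hp f g l => ?_⟩, fun p => ?_⟩
  · let b := Module.finBasis 𝕜 (Space 𝕜 (2 * n) →L[𝕜] 𝕜)
    refine contDiffAt_of_separating (fun j : Fin _ × Fin _ => ContinuousAlternatingMap.apply 𝕜
      (Space 𝕜 (2 * n) →L[𝕜] 𝕜) 𝕜 ![b j.1, b j.2]) (fun η hη => ?_)
      fun j => (hPd p hp _ _).contDiffAt
    have h1 : η.toAlternatingMap = 0 := b.ext_alternating fun v _ => by
      have : (fun i => b (v i)) = ![b (v 0), b (v 1)] := by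
        funext i
        fin_cases i <;> rfl
      rw [this]
      exact hη (v 0, v 1)
    ext v
    exact congrArg (fun g => g v) h1
  -- The bracket of ambient linear functions is read in the chart, where the coordinate fields are
  -- constant and the bracket is the canonical one. The inner bracket must be identified on a
  -- neighbourhood of `p`, as it is differentiated.
  · have hs : ∀ q ∈ Φ.source, ∀ f : Space 𝕜 (2 * n) →L[𝕜] 𝕜, ∀ c,
        f (coordVec Φ c q) = fderiv 𝕜 (fun y => f (Φ.symm y)) (Φ q) (Pi.single c 1) :=
      fun q hq f c => by
        have : HasFDerivAt (fun y => f (Φ.symm y)) _ (Φ q) :=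
          f.hasFDerivAt.comp (Φ q) (hΦ.contDiffNear_symm hq).hasFDerivAt
        rw [this.fderiv]
        rfl
    have hbr : ∀ q ∈ Φ.source, ∀ f g : Space 𝕜 (2 * n) →L[𝕜] 𝕜, P q ![f, g] =
        canonicalBracket (fun y => f (Φ.symm y)) (fun y => g (Φ.symm y)) (Φ q) := fun q hq f g => by
      simp only [hPa, canonicalBracket, hs q hq]
    have hfs : ∀ f : Space 𝕜 (2 * n) →L[𝕜] 𝕜,
        ContDiffNear (𝕜 := 𝕜) r (fun y => f (Φ.symm y)) (Φ p) := fun f =>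
      .comp (.clm f) (hΦ.contDiffNear_symm hp)
    have hD : ∀ (g l : Space 𝕜 (2 * n) →L[𝕜] 𝕜) c,
        fderiv 𝕜 (fun q => P q ![g, l]) p (coordVec Φ c p) =
        fderiv 𝕜 (canonicalBracket (fun y => g (Φ.symm y)) fun y => l (Φ.symm y)) (Φ p)
          (Pi.single c 1) := fun g l c => by
      have h1 : (fun q => P q ![g, l]) =ᶠ[𝓝 p] fun q =>
          canonicalBracket (fun y => g (Φ.symm y)) (fun y => l (Φ.symm y)) (Φ q) := by
        filter_upwards [Φ.open_source.mem_nhds hp] with q hq using hbr q hq g l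
      have h2 : HasFDerivAt (fun q =>
          canonicalBracket (fun y => g (Φ.symm y)) (fun y => l (Φ.symm y)) (Φ q)) _ p :=
        (contDiffNear_canonicalBracket (hfs g) (hfs l)).hasFDerivAt.comp p
          (hΦ.contDiffNear hp).hasFDerivAt
      rw [h1.fderiv_eq, h2.fderiv, ContinuousLinearMap.comp_apply]
      congr 1
      exact congrArg (fun A => A (Pi.single c 1)) (hΦ.fderiv_comp_symm hp)
    have hJ : ∀ f g l : Space 𝕜 (2 * n) →L[𝕜] 𝕜, P p ![f, fderiv 𝕜 (fun q => P q ![g, l]) p] =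
        canonicalBracket (fun y => f (Φ.symm y))
          (canonicalBracket (fun y => g (Φ.symm y)) fun y => l (Φ.symm y)) (Φ p) := fun f g l => by
      rw [hPa, canonicalBracket]
      simp only [hD, hs p hp f]
    rw [hJ, hJ, hJ]
    exact canonicalBracket_jacobi (F := ![fun y => f (Φ.symm y), fun y => g (Φ.symm y),
      fun y => l (Φ.symm y)]) (r := r) fun s => by fin_cases s <;> exact hfs _
  · rw [toDualBivector, hP]
    ext v
    rfl

end Coordinates

end LogSymplectic

theorem mainTheorem4 {𝕜 : Type*} [RCLike 𝕜] (n k : ℕ) :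
    (∀ r : WithTop ℕ∞, (r = ((⊤ : ℕ∞) : WithTop ℕ∞) ∨ r = (⊤ : WithTop ℕ∞)) →
      ∀ (U : Set (Space 𝕜 (2 * n))) (h : Fin k → Space 𝕜 (2 * n) → 𝕜)
        (ω : Space 𝕜 (2 * n) → (Space 𝕜 (2 * n)) [⋀^Fin 2]→L[𝕜] 𝕜),
        IsSimpleLogSymplectic r n k U h ω →
        k ≤ n ∧
        ∃ Φ : OpenPartialHomeomorph (Space 𝕜 (2 * n)) (Coord n k → 𝕜),
          IsCoordinateSystem r Φ ∧ Φ.source ⊆ U ∧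
          (∀ p ∈ Φ.source, p ∈ divisor h ↔ ∃ i, Φ p (cx i) = 0) ∧
          (∀ p ∈ Φ.source \ divisor h, (ω p).toAlternatingMap =
            canonicalForm (Φ p) (fun c => (coordDiff Φ c p : Space 𝕜 (2 * n) →ₗ[𝕜] 𝕜))) ∧
          ∃ P : Space 𝕜 (2 * n) → (Space 𝕜 (2 * n) →L[𝕜] 𝕜) [⋀^Fin 2]→L[𝕜] 𝕜,
            IsPoisson r Φ.source P ∧
            (∀ p ∈ Φ.source \ divisor h,
              IsDualBivector (toDualBivector (P p)) (ω p).toAlternatingMap) ∧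
            ∀ p ∈ Φ.source, toDualBivector (P p) =
              canonicalBivector (Φ p) (fun c => coordVec Φ c p)) ∧
    (∀ (h : Fin k → FFun 𝕜 (2 * n))
        (ω : (FVec 𝕜 (2 * n)) [⋀^Fin 2]→ₗ[FMer 𝕜 (2 * n)] FMer 𝕜 (2 * n)),
        IsFormalSimpleLogSymplectic n k h ω →
        k ≤ n ∧
        ∃ u : Coord n k → FFun 𝕜 (2 * n),
          IsFormalCoordinateSystem u ∧
          ω = canonicalForm (fun c => toMer (u c)) (fun c => merDiff (toMer (u c))) ∧
          ∃ (P : (Module.Dual (FMer 𝕜 (2 * n)) (FVec 𝕜 (2 * n))) [⋀^Fin 2]→ₗ[FMer 𝕜 (2 * n)]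
              FMer 𝕜 (2 * n)) (X : Coord n k → FVec 𝕜 (2 * n)),
            IsFormalPoisson P ∧ IsDualBivector P ω ∧ IsFormalCoordVec u X ∧
            P = canonicalBivector (fun c => toMer (u c)) X) := by
  refine ⟨fun r hr U h ω H => ?_, fun h ω H => Formal.exists_canonical_coordinates H⟩
  haveI : IsSmoothOrAnalytic r := ⟨hr⟩
  obtain ⟨hkn, Φ, hΦ, hU, hdiv, hω⟩ := H.exists_canonical_coordinates
  obtain ⟨P, hP, hPeq⟩ := hΦ.exists_isPoisson
  refine ⟨hkn, Φ, hΦ, hU, hdiv, hω, P, hP, fun p hp => ?_, fun p _ => hPeq p⟩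
  rw [hPeq, hω p hp]
  exact hΦ.isDualBivector hp.1 fun i h0 => hp.2 ((hdiv p hp.1).mpr ⟨i, h0⟩)
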